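/- **Setting.** Let $d,\alpha\ge 1$ be integers, $\gamma>0$, let $\mathbb A$ be a Borel space with a probability measure $\Theta$, and for $j=1,\dots,\alpha$ let $\varphi_j:(\mathbb R^d\times\mathbb A)^{j+1}\to[0,1]$ be measurable, symmetric and invariant under simultaneous translation of all $\mathbb R^d$-components. Let $\mathbb M=\prod_{j=1}^{\alpha}[0,1]^{(\mathbb N_0^2)^j}$ with the product $\mathbb Q$ of uniform distributions, and let $\Psi$ be a Poisson process on $\mathbb R^d\times\mathbb A\times[0,1]\times\mathbb M$ with intensity measure $\gamma\lambda_d\otimes\Theta\otimes\mathcal U([0,1])\otimes\mathbb Q$. Fix an enumeration $z_0=\mathbf 0,z_1,z_2,\dots$ of $\mathbb Z^d$ and put $Q_k=[0,1)^d+z_k$. For a locally finite point configuration $\psi$ in $\mathbb R^d\times\mathbb A\times[0,1]\times\mathbb M$, the coordinates of a point $(x,a,t,u)$ of $\psi$ are $(k,i)$, where $x\in Q_k$ and the point has the $i$-th smallest $t$-component among the points of $\psi$ over $Q_k$. For points $(x_0,a_0,t_0,u^{(0)}),\dots,(x_j,a_j,t_j,u^{(j)})$ of $\psi$ with $t_0<\dots<t_j$,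 $1\le j\le\alpha$, and $\rho=\{(x_0,a_0),\dots,(x_j,a_j)\}$, let $u(\rho)$ be the entry of the $j$-th component of $u^{(j)}$ indexed by the coordinates of the first $j$ points. The simplicial complex $T(\psi)$ has as simplices the nonempty sets $\sigma$ of at most $\alpha+1$ points $(x,a)$ of the projection of $\psi$ to $\mathbb R^d\times\mathbb A$ such that $u(\rho)\le\varphi_{|\rho|-1}(\rho)$ for all $\rho\subseteq\sigma$ with $|\rho|\ge2$. For $W\subseteq\mathbb R^d$ let $T(\psi)_W$ be its restriction to simplices with vertices in $W\times\mathbb A$. Put $\Delta=T(\Psi)$ (the marked random connection simplicial complex) and $\Delta_W=T(\Psi)_W$. Let $V\sim\Theta$ and $U\sim\mathbb Q$ be random elements such that $V,U,\Psi$ are independent. For a real function $f$ of finite simplicial complexes with vertices in $\mathbb R^d\times\mathbb A$ put $$\Lambda f(\Delta_W)=f\big(T(\Psi+\delta_{(\mathbf 0,V,1,U)})_W\big)-f\big(T(\Psi+\delta_{(\mathbf 0,V,1,U)})_{W\setminus\{\mathbf 0\}}\big).$$ A sequence of half-open cubes $W_n$ tends to $\mathbb R^d$ ($W_n\to\mathbb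 R^d$) if every bounded set is contained in $W_n$ for all large $n$. The function $f$ is *weakly stabilizing* if it is invariant under translations of complexes and there is a real random variable $Z$ (associated to $f$) such that $\Lambda f(\Delta_{W_n})\to Z$ in probability for every sequence of cubes $W_n\to\mathbb R^d$. It satisfies the *moment condition* if $\sup_W\mathbb E\,|\Lambda f(\Delta_W)|^{2+\varepsilon}<\infty$ for some $\varepsilon>0$, the supremum being over all half-open cubes $W\ni\mathbf 0$. For $p\ge0$ let $\beta_p(K)=\dim\ker\partial_p-\dim\operatorname{im}\partial_{p+1}$ be the $p$-th Betti number over $\mathbb Z_2$ of a finite simplicial complex $K$, with $\partial_0=0$ (unreduced homology). Let $$\pi(a)=\gamma\int_{\mathbb R^d}\int_{\mathbb A}\varphi_1\big((\mathbf 0,a),(y,b)\big)\,\Theta(\mathrm db)\,\mathrm dy .$$ **Statement.** Let $p\in\mathbb N_0$ with $\mathbb E[\pi(V)^{3(p+1)}]<\infty$. Then $\beta_p$ is weakly stabilizing and satisfies the moment condition. Hence the central limit theorem applies to $\beta_p$: the variable $\beta_p(\Delta_W)$ is square integrable for every half-open cube $W$, and there is $\sigma^2\in[0,\infty)$ such that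 for every sequence of cubes $W_n\to\mathbb R^d$, as $n\to\infty$, $$\frac{\operatorname{Var}\beta_p(\Delta_{W_n})}{\lambda_d(W_n)}\to\sigma^2\qquad\text{and}\qquad\frac{\beta_p(\Delta_{W_n})-\mathbb E\beta_p(\Delta_{W_n})}{\sqrt{\lambda_d(W_n)}}\xrightarrow{\;d\;}N(0,\sigma^2);$$ moreover $\sigma^2>0$ if $\mathbb P(Z\ne0)>0$ for the random variable $Z$ associated to $\beta_p$. -/

import Mathlib

open MeasureTheory ProbabilityTheory Filter Topology Set
open scoped NNReal ENNReal

noncomputable section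

namespace RCM

/-! ### Simplicial complexes and Betti numbers over the field with two elements -/

section Complexes

variable {X : Type*}

/-- The `p`-th chain group: the span of the `p`-simplices of `K` (the faces with `p + 1` vertices)
in the free `ZMod 2`-module on all finite sets of vertices. -/
def chains (K : PreAbstractSimplicialComplex X) (p : ℕ) : Submodule (ZMod 2) (Finset X →₀ ZMod 2) :=
  Finsupp.supported (ZMod 2) (ZMod 2) {σ | σ ∈ K.faces ∧ σ.card = p + 1}

open Classical in
/-- The linear extension of `σ ↦ ∑ v ∈ σ, σ \ {v}`. -/
def faceSum (X : Type*) : (Finset X →₀ ZMod 2) →ₗ[ZMod 2] (Finset X →₀ ZMod 2) :=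
  Finsupp.linearCombination (ZMod 2) fun σ : Finset X ↦ ∑ v ∈ σ, Finsupp.single (σ.erase v) 1

/-- The boundary operator `∂_p`, with `∂_0 = 0`. -/
def boundary (X : Type*) : ℕ → ((Finset X →₀ ZMod 2) →ₗ[ZMod 2] (Finset X →₀ ZMod 2))
  | 0 => 0
  | _ + 1 => faceSum X

/-- `Z_p(K)`, the kernel of `∂_p : C_p(K) → C_{p-1}(K)`. -/
def cycles (K : PreAbstractSimplicialComplex X) (p : ℕ) : Submodule (ZMod 2) (Finset X →₀ ZMod 2) :=
  chains K p ⊓ LinearMap.ker (boundary X p)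

/-- `B_p(K)`, the image of `∂_{p+1} : C_{p+1}(K) → C_p(K)`. -/
def boundaries (K : PreAbstractSimplicialComplex X) (p : ℕ) :
    Submodule (ZMod 2) (Finset X →₀ ZMod 2) :=
  (chains K (p + 1)).map (boundary X (p + 1))

/-- The `p`-th Betti number `dim Z_p(K) - dim B_p(K)` of a finite simplicial complex. -/
def betti (p : ℕ) (K : PreAbstractSimplicialComplex X) : ℝ :=
  (Module.finrank (ZMod 2) (cycles K p) : ℝ) - Module.finrank (ZMod 2) (boundaries K p)

/-- The restriction of a complex to the simplices with all vertices in `S`. -/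
def restrict (K : PreAbstractSimplicialComplex X) (S : Set X) : PreAbstractSimplicialComplex X where
  faces := {σ | σ ∈ K.faces ∧ (σ : Set X) ⊆ S}
  isRelLowerSet_faces := by
    rintro σ ⟨hσ, hS⟩
    refine ⟨(K.isRelLowerSet_faces hσ).1, fun τ hτσ hτ ↦
      ⟨(K.isRelLowerSet_faces hσ).2 hτσ hτ, ?_⟩⟩
    exact fun x hx ↦ hS (hτσ hx)

end Complexes

/-! ### Poisson processes -/

section Poisson

/-- Locally finite counting measures on `ℝ^d × B`. -/
def IsLocallyFiniteCounting {d : ℕ} {B : Type*} [MeasurableSpace B]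
    (η : Measure ((Fin d → ℝ) × B)) : Prop :=
  (∀ s, MeasurableSet s → ∃ n : ℕ∞, η s = n) ∧
    ∀ s : Set (Fin d → ℝ), MeasurableSet s → Bornology.IsBounded s → η (s ×ˢ univ) < ∞

/-- `Ψ` is a Poisson process on `ℝ^d × B` with intensity measure `μ`: a random locally finite
counting measure (for the `σ`-algebra generated by the evaluations) with Poisson distributed counts
which are independent on disjoint sets. A Poisson variable with parameter `∞` is almost surely
infinite. -/
structure IsPoissonProcess {d : ℕ} {B Ω : Type*} [MeasurableSpace B] [MeasurableSpace Ω]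
    (Ψ : Ω → Measure ((Fin d → ℝ) × B)) (μ : Measure ((Fin d → ℝ) × B)) (P : Measure Ω) :
    Prop where
  measurable : Measurable Ψ
  counting : ∀ ω, IsLocallyFiniteCounting (Ψ ω)
  poisson : ∀ s, MeasurableSet s → μ s ≠ ∞ →
    P.map (fun ω ↦ Ψ ω s) = (poissonMeasure (μ s).toNNReal).map (fun n : ℕ ↦ (n : ℝ≥0∞))
  infinite : ∀ s, MeasurableSet s → μ s = ∞ → ∀ᵐ ω ∂P, Ψ ω s = ∞
  indep : ∀ (m : ℕ) (s : Fin m → Set ((Fin d → ℝ) × B)), (∀ i, MeasurableSet (s i)) →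
    Pairwise (fun i j ↦ Disjoint (s i) (s j)) → iIndepFun (fun i ω ↦ Ψ ω (s i)) P

end Poisson

/-! ### The marked random connection complex -/

section Model

/-- `∏_{j = 1}^α [0,1]^{(ℕ × ℕ)^j}`: the component `j` decides about the `j`-simplices. -/
abbrev Marks (α : ℕ) : Type := (j : Icc 1 α) → (Fin (j : ℕ) → ℕ × ℕ) → unitInterval

/-- The product of uniform distributions on `Marks α`. -/
def marksLaw (α : ℕ) : Measure (Marks α) :=
  Measure.pi fun _ ↦ Measure.infinitePi fun _ ↦ (volume : Measure unitInterval)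

/-- Points `(x, a, t, u)` of `ℝ^d × A × [0,1] × Marks α`. -/
abbrev Point (d : ℕ) (A : Type*) (α : ℕ) : Type _ := (Fin d → ℝ) × A × unitInterval × Marks α

/-- The intensity measure `γ λ_d ⊗ Θ ⊗ U([0,1]) ⊗ marksLaw`. -/
def intensity (d : ℕ) {A : Type*} [MeasurableSpace A] (α : ℕ) (γ : ℝ≥0) (Θ : Measure A) :
    Measure (Point d A α) :=
  (γ • (volume : Measure (Fin d → ℝ))).prod
    (Θ.prod ((volume : Measure unitInterval).prod (marksLaw α)))

variable {d : ℕ} {A : Type*} {α : ℕ}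

/-- The projection of a point to `ℝ^d × A`. -/
def loc (q : Point d A α) : (Fin d → ℝ) × A := (q.1, q.2.1)

/-- The component of a point in `[0,1]`, used for ordering the points. -/
def time (q : Point d A α) : unitInterval := q.2.2.1

/-- The component of a point in `Marks α`. -/
def mark (q : Point d A α) : Marks α := q.2.2.2

/-- The connection functions: `φ j`, for `1 ≤ j ≤ α`, is a measurable, symmetric and
translation-invariant function on `(ℝ^d × A)^{j+1}` with values in `[0,1]`. The values of `φ` at
other `j` are never used. -/
structure IsConnection [MeasurableSpace A] (α : ℕ)
    (φ : (j : ℕ) → (Fin (j + 1) → (Fin d → ℝ) × A) → unitInterval) : Prop where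
  measurable : ∀ j ∈ Icc 1 α, Measurable (φ j)
  symmetric : ∀ j ∈ Icc 1 α, ∀ (π : Equiv.Perm (Fin (j + 1))) (x : Fin (j + 1) → (Fin d → ℝ) × A),
    φ j (x ∘ π) = φ j x
  translation : ∀ j ∈ Icc 1 α, ∀ (t : Fin d → ℝ) (x : Fin (j + 1) → (Fin d → ℝ) × A),
    φ j (fun i ↦ ((x i).1 + t, (x i).2)) = φ j x

variable [MeasurableSpace A]

/-- The points (atoms) of a counting measure. -/
def points (ψ : Measure (Point d A α)) : Set (Point d A α) := {q | ψ {q} ≠ 0}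

/-- The number `k` of the cube `[0,1)^d + e k` that contains `x`. -/
def cubeIndex (e : ℕ ≃ (Fin d → ℤ)) (x : Fin d → ℝ) : ℕ := e.symm fun i ↦ ⌊x i⌋

/-- The coordinates `(k, i)` of `q` inside `ψ`: `q` lies in the `k`-th cube and is the `i`-th
smallest point of `ψ` over this cube with respect to the order given by `time`. -/
def coords (e : ℕ ≃ (Fin d → ℤ)) (ψ : Measure (Point d A α)) (q : Point d A α) : ℕ × ℕ :=
  (cubeIndex e q.1,
    {q' | q' ∈ points ψ ∧ cubeIndex e q'.1 = cubeIndex e q.1 ∧ time q' ≤ time q}.ncard)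

/-- The rule for a finite set `S` of points of `ψ` to span a simplex: it has at most `α + 1`
elements and every subset `{z_0, …, z_j}` with `j ≥ 1` and `time z_0 < ⋯ < time z_j` is accepted,
i.e. the component of `mark z_j` at the coordinates of `z_0, …, z_{j-1}` is at most
`φ_j(z_0, …, z_j)`. -/
def Spans (φ : (j : ℕ) → (Fin (j + 1) → (Fin d → ℝ) × A) → unitInterval) (e : ℕ ≃ (Fin d → ℤ))
    (ψ : Measure (Point d A α)) (S : Finset (Point d A α)) : Prop :=
  S.Nonempty ∧ (S : Set (Point d A α)) ⊆ points ψ ∧ S.card ≤ α + 1 ∧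
    ∀ (j : Icc 1 α) (z : Fin ((j : ℕ) + 1) → Point d A α), (∀ i, z i ∈ S) →
      StrictMono (fun i ↦ time (z i)) →
      mark (z (Fin.last j)) j (fun i ↦ coords e ψ (z i.castSucc)) ≤ φ j (fun i ↦ loc (z i))

open Classical in
/-- The simplicial complex `T(ψ)` with vertices in `ℝ^d × A` constructed from `ψ`. -/
def complex (φ : (j : ℕ) → (Fin (j + 1) → (Fin d → ℝ) × A) → unitInterval) (e : ℕ ≃ (Fin d → ℤ))
    (ψ : Measure (Point d A α)) : PreAbstractSimplicialComplex ((Fin d → ℝ) × A) :=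
  PreAbstractSimplicialComplex.map
    { faces := {S | Spans φ e ψ S}
      isRelLowerSet_faces := by
        rintro S ⟨hS, hp, hc, hu⟩
        exact ⟨hS, fun R hR hne ↦ ⟨hne, fun q hq ↦ hp (hR hq),
          (Finset.card_le_card hR).trans hc, fun j z hz ↦ hu j z fun i ↦ hR (hz i)⟩⟩ } loc

/-- `T(ψ)_W`, the restriction of `T(ψ)` to the simplices with vertices in `W × A`. -/
def complexIn (φ : (j : ℕ) → (Fin (j + 1) → (Fin d → ℝ) × A) → unitInterval) (e : ℕ ≃ (Fin d → ℤ))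
    (ψ : Measure (Point d A α)) (W : Set (Fin d → ℝ)) :
    PreAbstractSimplicialComplex ((Fin d → ℝ) × A) :=
  restrict (complex φ e ψ) (W ×ˢ univ)

/-- The difference operator `Λ_q f (T(ψ)_W) = f (T(ψ + δ_q)_W) - f (T(ψ + δ_q)_{W \ {x}})`,
where `x` is the position of `q`. -/
def diffOp (φ : (j : ℕ) → (Fin (j + 1) → (Fin d → ℝ) × A) → unitInterval) (e : ℕ ≃ (Fin d → ℤ))
    (f : PreAbstractSimplicialComplex ((Fin d → ℝ) × A) → ℝ) (q : Point d A α)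
    (ψ : Measure (Point d A α)) (W : Set (Fin d → ℝ)) : ℝ :=
  f (complexIn φ e (ψ + Measure.dirac q) W) - f (complexIn φ e (ψ + Measure.dirac q) (W \ {q.1}))

/-- The mixing parameter `π(a) = γ ∫ ∫ φ_1((0, a), (y, b)) Θ(db) dy`. -/
def mixing (γ : ℝ≥0) (Θ : Measure A) (φ : (j : ℕ) → (Fin (j + 1) → (Fin d → ℝ) × A) → unitInterval)
    (a : A) : ℝ≥0∞ :=
  γ * ∫⁻ y : Fin d → ℝ, ∫⁻ b, ENNReal.ofReal (φ 1 ![(0, a), (y, b)]) ∂Θ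

end Model

/-! ### Weakly stabilizing functionals -/

section Functionals

/-- Half-open cubes in `ℝ^d`. -/
def IsCube {d : ℕ} (W : Set (Fin d → ℝ)) : Prop :=
  ∃ (c : Fin d → ℝ) (s : ℝ), 0 < s ∧ W = {x | ∀ i, c i ≤ x i ∧ x i < c i + s}

/-- `W` is a sequence of cubes tending to `ℝ^d`. -/
def CubesTendTo {d : ℕ} (W : ℕ → Set (Fin d → ℝ)) : Prop :=
  (∀ n, IsCube (W n)) ∧
    ∀ B : Set (Fin d → ℝ), Bornology.IsBounded B → ∃ N, ∀ n ≥ N, B ⊆ W n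

open Classical in
/-- Invariance of `f` under translating all vertices of a finite simplicial complex. -/
def TranslationInvariant {d : ℕ} {A : Type*}
    (f : PreAbstractSimplicialComplex ((Fin d → ℝ) × A) → ℝ) : Prop :=
  ∀ (K : PreAbstractSimplicialComplex ((Fin d → ℝ) × A)), K.faces.Finite → ∀ t : Fin d → ℝ,
    f (K.map fun v ↦ (v.1 + t, v.2)) = f K

variable {d : ℕ} {A Ω : Type*} {α : ℕ} [MeasurableSpace A] [MeasurableSpace Ω]

/-- The quantity `Λ_{(0, V, 1, U)} f (Δ_W)`, where `Δ = T(Ψ)`. -/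
def originDiff (φ : (j : ℕ) → (Fin (j + 1) → (Fin d → ℝ) × A) → unitInterval) (e : ℕ ≃ (Fin d → ℤ))
    (Ψ : Ω → Measure (Point d A α)) (V : Ω → A) (U : Ω → Marks α)
    (f : PreAbstractSimplicialComplex ((Fin d → ℝ) × A) → ℝ) (W : Set (Fin d → ℝ)) (ω : Ω) : ℝ :=
  diffOp φ e f (0, V ω, 1, U ω) (Ψ ω) W

/-- `Z` is a random variable associated to `f`: the quantities `Λ_{(0, V, 1, U)} f (Δ_{W_n})` are
random variables that converge to `Z` in probability for all sequences of cubes `W_n → ℝ^d`. -/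
def IsAssociated (φ : (j : ℕ) → (Fin (j + 1) → (Fin d → ℝ) × A) → unitInterval) (e : ℕ ≃ (Fin d → ℤ))
    (Ψ : Ω → Measure (Point d A α)) (V : Ω → A) (U : Ω → Marks α) (P : Measure Ω)
    (f : PreAbstractSimplicialComplex ((Fin d → ℝ) × A) → ℝ) (Z : Ω → ℝ) : Prop :=
  Measurable Z ∧ ∀ W : ℕ → Set (Fin d → ℝ), CubesTendTo W →
    (∀ n, AEMeasurable (originDiff φ e Ψ V U f (W n)) P) ∧
    TendstoInMeasure P (fun n ↦ originDiff φ e Ψ V U f (W n)) atTop Z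

/-- Weakly stabilizing functionals. -/
def WeaklyStabilizing (φ : (j : ℕ) → (Fin (j + 1) → (Fin d → ℝ) × A) → unitInterval) (e : ℕ ≃ (Fin d → ℤ))
    (Ψ : Ω → Measure (Point d A α)) (V : Ω → A) (U : Ω → Marks α) (P : Measure Ω)
    (f : PreAbstractSimplicialComplex ((Fin d → ℝ) × A) → ℝ) : Prop :=
  TranslationInvariant f ∧ ∃ Z : Ω → ℝ, IsAssociated φ e Ψ V U P f Z

/-- The moment condition: for some `ε > 0`, the moments of order `2 + ε` of
`Λ_{(0, V, 1, U)} f (Δ_W)` are bounded uniformly over all cubes `W` that contain the origin. -/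
def MomentCondition (φ : (j : ℕ) → (Fin (j + 1) → (Fin d → ℝ) × A) → unitInterval) (e : ℕ ≃ (Fin d → ℤ))
    (Ψ : Ω → Measure (Point d A α)) (V : Ω → A) (U : Ω → Marks α) (P : Measure Ω)
    (f : PreAbstractSimplicialComplex ((Fin d → ℝ) × A) → ℝ) : Prop :=
  ∃ ε : ℝ, 0 < ε ∧
    (∀ W, IsCube W → 0 ∈ W → AEMeasurable (originDiff φ e Ψ V U f W) P) ∧
    ⨆ (W : Set (Fin d → ℝ)) (_ : IsCube W) (_ : 0 ∈ W),
      ∫⁻ ω, ‖originDiff φ e Ψ V U f W ω‖ₑ ^ (2 + ε) ∂P < ∞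

/-- The central limit theorem for `f (Δ_W)`: these are square integrable random variables, and there
is an asymptotic variance `σ²` (written `v`) such that, for every sequence of cubes `W_n → ℝ^d`, the
variances divided by the volume `|W_n|` converge to `σ²`, and `f (Δ_{W_n})`, centered and divided by
`√|W_n|`, converges in distribution to a centered normal variable with variance `σ²`. If the random
variable associated to `f` is not almost surely zero, then `σ² > 0`. -/
def SatisfiesCLT (φ : (j : ℕ) → (Fin (j + 1) → (Fin d → ℝ) × A) → unitInterval) (e : ℕ ≃ (Fin d → ℤ))
    (Ψ : Ω → Measure (Point d A α)) (V : Ω → A) (U : Ω → Marks α) (P : Measure Ω)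
    [IsProbabilityMeasure P]
    (f : PreAbstractSimplicialComplex ((Fin d → ℝ) × A) → ℝ) : Prop :=
  (∀ W, IsCube W → MemLp (fun ω ↦ f (complexIn φ e (Ψ ω) W)) 2 P) ∧
  ∃ v : ℝ≥0,
    (∀ W : ℕ → Set (Fin d → ℝ), CubesTendTo W →
      Tendsto (fun n ↦ variance (fun ω ↦ f (complexIn φ e (Ψ ω) (W n))) P / volume.real (W n))
        atTop (𝓝 (v : ℝ)) ∧
      TendstoInDistribution
        (fun n ω ↦ (f (complexIn φ e (Ψ ω) (W n)) - ∫ ω', f (complexIn φ e (Ψ ω') (W n)) ∂P) /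
          √(volume.real (W n)))
        atTop (id : ℝ → ℝ) (fun _ ↦ P) (gaussianReal 0 v)) ∧
    ∀ Z : Ω → ℝ, IsAssociated φ e Ψ V U P f Z → 0 < P {ω | Z ω ≠ 0} → 0 < v

end Functionals

end RCM

end

open RCM

/-! Deterministic part. By rank-nullity, `β_p = z_p + z_{p+1} - f_{p+1}`, where `z_q` is the
dimension of the space of `q`-cycles and `f_q` the number of `q`-simplices (`betti_eq`). When a
vertex `v` is added to a vertex set `S`, the increments of `z_q` and `f_q` lie between `0` and
`deg(v)^q`, and they do not decrease when `S` grows: two cycle spaces meet in the cycle space of the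
intersection, so `z_q` is supermodular. Bounded monotone integers are eventually constant. Hence, if
`v` has finite degree in the infinite complex, its effect on `β_p` is the same for all large windows
(`exists_bettiDiff_stable`), and it is at most `(1 + deg(v))^(p+1)` (`abs_bettiDiff_le`). Given its
mark, the added point has a Poisson degree with mean `π(V)`, so moments of `π(V)` of order `3(p+1)`
give third moments of the effect. This yields weak stabilization and the moment condition with `ε =
1`.

Central limit theorem. It is proved in a model with independent identically distributed coordinates:
a Poisson number of points for each unit cell, and for each finite set of labels a datum that holds
a position and mark (used at singletons) and a uniform decision variable (used at larger sets). An
Efron-Stein inequality (`variance_le_of_dependsOn`) bounds the variance of the difference between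
the Betti number of a window and the sum of the Betti numbers of the blocks inside it by the effects
of erasing the points of single cells. Erasing a cell is compared with adding one point at the
origin, by a relabelling that plays the role of the Mecke formula (`lintegral_diffIn_next`). For
cells deep inside a block the effects on the window and on the block nearly agree by stabilization;
the other cells are a small proportion. So the Betti number of a large window is close in mean
square to a sum of independent copies, and the limit theorem follows by characteristic functions
(`exists_clt_of_approx`).

Positivity. The effect of a point is an integer, so if its limit is not almost surely zero, then its
second moment on the event of a suitable number of points near the origin stays away from zero.
Testing the Betti number against centred functions of the numbers of points in the central cells of
blocks and applying the Cauchy-Schwarz inequality gives a variance at least proportional to the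
volume (`pos_of_integral_sq_diffIn_ge`).

Transfer. The complex of the Poisson process takes its decision variables from the marks of its
points, indexed by coordinates. The configurations of the model are therefore extended by times and
marks. Each decision variable is replaced by the uniform variable that the rule of the complex
selects. The selection is injective and depends only on variables that are independent of those
selected, so the new configuration has the old law (`measurePreserving_code`). On configurations
with distinct times and positions its complex is that of the point process (`betti_complexIn`,
`diffOp_cloud`). For the added point all positions are shifted by its relative position, which puts
it at the origin. Measurability on the space of counting measures is tested along a Borel surjection
from the extended configurations (`measurable_of_comp_cloudPoint`). -/

noncomputable section

namespace RCM

/-! ### Betti numbers of finite complexes -/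

section Topology

variable {X Y : Type*}

lemma chains_mono {K K' : PreAbstractSimplicialComplex X} (h : K.faces ⊆ K'.faces) (q : ℕ) :
    chains K q ≤ chains K' q :=
  Finsupp.supported_mono fun _ hσ ↦ ⟨h hσ.1, hσ.2⟩

/-- The set of `q`-simplices. -/
def qfaces (K : PreAbstractSimplicialComplex X) (q : ℕ) : Set (Finset X) :=
  {σ | σ ∈ K.faces ∧ σ.card = q + 1}

lemma qfaces_finite {K : PreAbstractSimplicialComplex X} (h : K.faces.Finite) (q : ℕ) :
    (qfaces K q).Finite := h.subset fun _ hσ ↦ hσ.1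

lemma finrank_chains (K : PreAbstractSimplicialComplex X) (q : ℕ) :
    Module.finrank (ZMod 2) (chains K q) = (qfaces K q).ncard := by
  have e := Finsupp.supportedEquivFinsupp (M := ZMod 2) (R := ZMod 2) (qfaces K q)
  rw [show chains K q = Finsupp.supported (ZMod 2) (ZMod 2) (qfaces K q) from rfl,
    e.finrank_eq, ← Nat.card_coe_set_eq]
  rw [Module.finrank, rank_finsupp_self]
  simp [Nat.card]

lemma finite_chains {K : PreAbstractSimplicialComplex X} (h : K.faces.Finite) (q : ℕ) :
    Module.Finite (ZMod 2) (chains K q) := by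
  have e := Finsupp.supportedEquivFinsupp (M := ZMod 2) (R := ZMod 2) (qfaces K q)
  have := (qfaces_finite h q).to_subtype
  exact Module.Finite.equiv e.symm

/-- The dimension of the space of cycles. -/
def zdim (q : ℕ) (K : PreAbstractSimplicialComplex X) : ℕ := Module.finrank (ZMod 2) (cycles K q)

lemma finite_cycles {K : PreAbstractSimplicialComplex X} (h : K.faces.Finite) (q : ℕ) :
    Module.Finite (ZMod 2) (cycles K q) :=
  have := finite_chains h q
  Submodule.finiteDimensional_of_le (S₂ := chains K q) inf_le_left

/-- Rank-nullity for the boundary operator restricted to the chains, where its kernel is the space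
of cycles. -/
lemma finrank_boundaries {K : PreAbstractSimplicialComplex X} (h : K.faces.Finite) (p : ℕ) :
    Module.finrank (ZMod 2) (boundaries K p) + zdim (p + 1) K = (qfaces K (p + 1)).ncard := by
  have := finite_chains h (p + 1)
  rw [← finrank_chains, zdim, cycles, boundaries]
  set f := boundary X (p + 1)
  have h1 := LinearMap.finrank_range_add_finrank_ker (K := ZMod 2) (V := chains K (p + 1))
    (f.domRestrict (chains K (p + 1)))
  rw [LinearMap.range_domRestrict, LinearMap.ker_domRestrict] at h1
  rw [← h1, ← LinearEquiv.finrank_eq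
    (Submodule.comap_equiv_self_of_inj_of_le (f := (chains K (p + 1)).subtype)
      (p := chains K (p + 1) ⊓ LinearMap.ker f) (Submodule.injective_subtype _) (by simp))]
  rw [Submodule.comap_inf, Submodule.comap_subtype_self, top_inf_eq]

/-- Eliminates the boundaries. The three remaining quantities each have increments that are monotone
in the vertex set. -/
lemma betti_eq {K : PreAbstractSimplicialComplex X} (h : K.faces.Finite) (p : ℕ) :
    betti p K = zdim p K + zdim (p + 1) K - (qfaces K (p + 1)).ncard := by
  have := finrank_boundaries h p
  rw [betti, ← this, zdim]
  push_cast
  ring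

lemma zdim_le {K : PreAbstractSimplicialComplex X} (h : K.faces.Finite) (q : ℕ) :
    zdim q K ≤ (qfaces K q).ncard := by
  have := finite_chains h q
  rw [← finrank_chains]
  exact Submodule.finrank_mono inf_le_left

/-- A crude bound, sufficient to see that the Betti numbers of an empty complex vanish. -/
lemma abs_betti_le {K : PreAbstractSimplicialComplex X} (h : K.faces.Finite) (p : ℕ) :
    |betti p K| ≤ K.faces.ncard := by
  have h1 := finrank_boundaries h p
  have h2 := zdim_le h p
  have h3 : (qfaces K p).ncard ≤ K.faces.ncard := ncard_le_ncard (fun _ h ↦ h.1) h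
  have h4 : (qfaces K (p + 1)).ncard ≤ K.faces.ncard := ncard_le_ncard (fun _ h ↦ h.1) h
  rw [betti, abs_le]
  rw [zdim] at h2
  constructor
  · have : (Module.finrank (ZMod 2) (boundaries K p) : ℝ) ≤ K.faces.ncard := by
      exact_mod_cast (by omega)
    have h0 : (0 : ℝ) ≤ Module.finrank (ZMod 2) (cycles K p) := by positivity
    linarith
  · have : (Module.finrank (ZMod 2) (cycles K p) : ℝ) ≤ K.faces.ncard := by
      exact_mod_cast (by omega)
    have h0 : (0 : ℝ) ≤ Module.finrank (ZMod 2) (boundaries K p) := by positivity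
    linarith

lemma chains_inf {K K' L : PreAbstractSimplicialComplex X} (h : K.faces ∩ K'.faces = L.faces)
    (q : ℕ) : chains K q ⊓ chains K' q = chains L q := by
  rw [chains, chains, ← Finsupp.supported_inter, chains, ← h]
  congr 1
  ext σ
  simp only [mem_inter_iff, mem_ofPred_eq]
  tauto

lemma cycles_mono {K K' : PreAbstractSimplicialComplex X} (h : K.faces ⊆ K'.faces) (q : ℕ) :
    cycles K q ≤ cycles K' q := inf_le_inf_right _ (chains_mono h q)

/-- Supermodularity of the dimension of the space of cycles. -/
lemma zdim_supermodular {K K' L M : PreAbstractSimplicialComplex X} (hM : M.faces.Finite)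
    (hK : K.faces ⊆ M.faces) (hK' : K'.faces ⊆ M.faces) (h : K.faces ∩ K'.faces = L.faces) (q : ℕ) :
    zdim q K + zdim q K' ≤ zdim q M + zdim q L := by
  have := finite_cycles hM q
  have := finite_cycles (hM.subset hK) q
  have := finite_cycles (hM.subset hK') q
  -- Dimension formula for sum and intersection. The intersection is exactly the cycle space of `L`,
  -- while the sum is merely contained in the cycles of `M`; this is why only an inequality results.
  have h1 := Submodule.finrank_sup_add_finrank_inf_eq (cycles K q) (cycles K' q)
  have h2 : cycles K q ⊓ cycles K' q = cycles L q := by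
    rw [cycles, cycles, cycles, ← chains_inf h]
    exact inf_inf_distrib_right _ _ _ |>.symm
  rw [h2] at h1
  have h3 : Module.finrank (ZMod 2) ↥(cycles K q ⊔ cycles K' q) ≤ zdim q M :=
    Submodule.finrank_mono (sup_le (cycles_mono hK q) (cycles_mono hK' q))
  simp only [zdim] at *
  omega

/-- The cycles of `K` are the cycles of `M` that are chains of `K`. So passing from `K` to `M`
creates at most as many dimensions of cycles as simplices. -/
lemma zdim_add_qfaces_le {K M : PreAbstractSimplicialComplex X} (hM : M.faces.Finite)
    (hK : K.faces ⊆ M.faces) (q : ℕ) :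
    zdim q M + (qfaces K q).ncard ≤ (qfaces M q).ncard + zdim q K := by
  have := finite_chains hM q
  have := finite_cycles hM q
  have := finite_chains (hM.subset hK) q
  have h1 := Submodule.finrank_sup_add_finrank_inf_eq (cycles M q) (chains K q)
  have h2 : cycles M q ⊓ chains K q = cycles K q := by
    rw [cycles, cycles, inf_right_comm, inf_eq_right.2 (chains_mono hK q)]
  have h3 : Module.finrank (ZMod 2) ↥(cycles M q ⊔ chains K q) ≤
      Module.finrank (ZMod 2) (chains M q) :=
    Submodule.finrank_mono (sup_le inf_le_left (chains_mono hK q))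
  rw [h2, finrank_chains] at h1
  rw [finrank_chains] at h3
  simp only [zdim] at *
  omega

/-! ### Betti numbers and maps of vertices -/

open Classical in
lemma faceSum_single (σ : Finset X) (r : ZMod 2) :
    faceSum X (Finsupp.single σ r) = ∑ v ∈ σ, Finsupp.single (σ.erase v) r := by
  simp [faceSum, Finset.smul_sum]

open Classical in
/-- The map of chains induced by a map of vertices. -/
def chainMap (f : X → Y) : (Finset X →₀ ZMod 2) →ₗ[ZMod 2] (Finset Y →₀ ZMod 2) :=
  Finsupp.lmapDomain (ZMod 2) (ZMod 2) (Finset.image f)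

variable {f : X → Y} {K : PreAbstractSimplicialComplex X} {V : Set X}

open Classical in
lemma chains_map (hf : InjOn f V) (hV : ∀ σ ∈ K.faces, (σ : Set X) ⊆ V) (q : ℕ) :
    chains (K.map f) q = (chains K q).map (chainMap f) := by
  rw [chains, chains, chainMap, Finsupp.lmapDomain_supported]
  congr 1
  ext τ
  constructor
  · rintro ⟨⟨σ, hσ, rfl⟩, hc⟩
    exact ⟨σ, ⟨hσ, by rwa [Finset.card_image_of_injOn (hf.mono (hV σ hσ))] at hc⟩, rfl⟩
  · rintro ⟨σ, ⟨hσ, hc⟩, rfl⟩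
    exact ⟨⟨σ, hσ, rfl⟩, by rwa [Finset.card_image_of_injOn (hf.mono (hV σ hσ))]⟩

open Classical in
-- Naturality is checked on single simplices, where injectivity on the vertices makes erasing a
-- vertex commute with taking images.
lemma chainMap_boundary (hf : InjOn f V) (hV : ∀ σ ∈ K.faces, (σ : Set X) ⊆ V) (q : ℕ)
    {c : Finset X →₀ ZMod 2} (hc : c ∈ chains K q) :
    boundary Y q (chainMap f c) = chainMap f (boundary X q c) := by
  cases q with
  | zero => simp [boundary]
  | succ q =>
    simp only [boundary]
    rw [chains, Finsupp.supported_eq_span_single] at hc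
    induction hc using Submodule.span_induction with
    | zero => simp
    | add x y _ _ hx hy => simp [hx, hy]
    | smul r x _ hx => simp [hx]
    | mem x hx =>
      obtain ⟨σ, hσ, rfl⟩ := hx
      have hi := hf.mono (hV σ hσ.1)
      simp only [chainMap, Finsupp.lmapDomain_apply, Finsupp.mapDomain_single, faceSum_single,
        Finsupp.mapDomain_finsetSum]
      rw [Finset.sum_image hi]
      refine Finset.sum_congr rfl fun v hv ↦ ?_
      congr 1
      ext w
      simp only [Finset.mem_erase, Finset.mem_image]
      constructor
      · rintro ⟨hw, u, hu, rfl⟩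
        exact ⟨u, ⟨fun h ↦ hw (by rw [h]), hu⟩, rfl⟩
      · rintro ⟨u, ⟨hu, hu'⟩, rfl⟩
        exact ⟨fun h ↦ hu (hi hu' hv h), u, hu', rfl⟩

open Classical in
lemma chainMap_injOn (hf : InjOn f V)
    (S : Set (Finset X)) (hS : ∀ σ ∈ S, (σ : Set X) ⊆ V) :
    ∀ c ∈ Finsupp.supported (ZMod 2) (ZMod 2) S, chainMap f c = 0 → c = 0 := by
  intro c hc h0
  have : InjOn (Finset.image f) S := by
    intro σ hσ τ hτ h
    have h' : f '' (σ : Set X) = f '' (τ : Set X) := by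
      rw [← Finset.coe_image, ← Finset.coe_image, h]
    exact Finset.coe_injective ((hf.image_eq_image_iff (hS _ hσ) (hS _ hτ)).1 h')
  exact Finsupp.mapDomain_injOn S this hc (by simp : (0 : Finset X →₀ ZMod 2) ∈ {w | _}) 
    (by simpa [chainMap] using h0)

lemma finrank_map_of_ker {M N : Type*} [AddCommGroup M] [Module (ZMod 2) M] [AddCommGroup N]
    [Module (ZMod 2) N] (g : M →ₗ[ZMod 2] N) (S : Submodule (ZMod 2) M)
    (h : ∀ c ∈ S, g c = 0 → c = 0) :
    Module.finrank (ZMod 2) (S.map g) = Module.finrank (ZMod 2) S := by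
  have hi : Function.Injective (g.domRestrict S) := by
    rw [← LinearMap.ker_eq_bot, LinearMap.ker_eq_bot']
    rintro ⟨c, hc⟩ h0
    exact Subtype.ext (h c hc h0)
  rw [← LinearMap.range_domRestrict]
  exact (LinearEquiv.ofInjective _ hi).finrank_eq.symm

open Classical in
/-- Betti numbers are invariant under maps that are injective on the vertices. -/
lemma betti_map (hf : InjOn f V) (hV : ∀ σ ∈ K.faces, (σ : Set X) ⊆ V) (p : ℕ) :
    betti p (K.map f) = betti p K := by
  set S : Set (Finset X) := {σ | (σ : Set X) ⊆ V}
  have hinj := chainMap_injOn hf S fun _ h ↦ h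
  have hch (q : ℕ) : chains K q ≤ Finsupp.supported (ZMod 2) (ZMod 2) S :=
    Finsupp.supported_mono fun σ hσ ↦ hV σ hσ.1
  -- It is enough that boundaries are supported on subsets of `V`, since the chain map is injective
  -- on all such chains.
  have hbd (q : ℕ) (c) (hc : c ∈ chains K q) :
      boundary X q c ∈ Finsupp.supported (ZMod 2) (ZMod 2) S := by
    cases q with
    | zero => simp [boundary]
    | succ q =>
      simp only [boundary]
      rw [chains, Finsupp.supported_eq_span_single] at hc
      induction hc using Submodule.span_induction with
      | zero => simp
      | add x y _ _ hx hy => rw [map_add]; exact add_mem hx hy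
      | smul r x _ hx => rw [map_smul]; exact Submodule.smul_mem _ _ hx
      | mem x hx =>
        obtain ⟨σ, hσ, rfl⟩ := hx
        simp only [faceSum_single]
        refine sum_mem fun v hv ↦ Finsupp.single_mem_supported _ _ ?_
        exact (Finset.coe_subset.2 (Finset.erase_subset _ _)).trans (hV σ hσ.1)
  have h1 : cycles (K.map f) p = (cycles K p).map (chainMap f) := by
    ext c
    simp only [cycles, chains_map hf hV, Submodule.mem_inf, Submodule.mem_map, LinearMap.mem_ker]
    constructor
    · rintro ⟨⟨c, hc, rfl⟩, h0⟩
      refine ⟨c, ⟨hc, hinj _ (hbd p c hc) ?_⟩, rfl⟩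
      rwa [← chainMap_boundary hf hV p hc]
    · rintro ⟨c, ⟨hc, h0⟩, rfl⟩
      exact ⟨⟨c, hc, rfl⟩, by rw [chainMap_boundary hf hV p hc, h0, map_zero]⟩
  have h2 : boundaries (K.map f) p = (boundaries K p).map (chainMap f) := by
    ext c
    simp only [boundaries, chains_map hf hV, Submodule.mem_map, exists_exists_and_eq_and]
    constructor
    · rintro ⟨a, ha, rfl⟩
      exact ⟨a, ha, (chainMap_boundary hf hV _ ha).symm⟩
    · rintro ⟨a, ha, rfl⟩
      exact ⟨a, ha, chainMap_boundary hf hV _ ha⟩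
  rw [betti, betti, h1, h2, finrank_map_of_ker, finrank_map_of_ker]
  · rintro c ⟨a, ha, rfl⟩
    exact hinj _ (hbd _ a ha)
  · exact fun c hc ↦ hinj c (hch p hc.1)

end Topology

/-! ### Adding a vertex to a complex -/

section AddOne

variable {X : Type*} (K : PreAbstractSimplicialComplex X)

/-- The change of the Betti number when the vertex `v` is added to the vertex set `S`. -/
def bettiDiff (p : ℕ) (S : Set X) (v : X) : ℝ :=
  betti p (restrict K (insert v S)) - betti p (restrict K S)

open Classical in
/-- The neighbours of `v` in `S`. -/
def nbrs (S : Set X) (v : X) : Set X := {w | w ∈ S ∧ w ≠ v ∧ {v, w} ∈ K.faces}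

variable {K} {S S' : Set X} {v : X}

lemma restrict_faces_mono (h : S ⊆ S') : (restrict K S).faces ⊆ (restrict K S').faces :=
  fun _ hσ ↦ ⟨hσ.1, hσ.2.trans h⟩

lemma restrict_faces_finite (h : S.Finite) : (restrict K S).faces.Finite :=
  h.toFinset.powerset.finite_toSet.subset fun σ hσ ↦ by
    simpa [Finset.subset_iff, Set.subset_def] using hσ.2

lemma nbrs_finite (h : (restrict K (insert v S)).faces.Finite) : (nbrs K S v).Finite := by
  classical
  refine Finite.of_finite_image (f := fun w ↦ ({v, w} : Finset X)) (h.subset ?_) ?_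
  · rintro _ ⟨w, hw, rfl⟩
    refine ⟨hw.2.2, ?_⟩
    simp only [Finset.coe_insert, Finset.coe_singleton]
    exact insert_subset_insert (by simpa using hw.1)
  · intro w hw w' hw' hww
    have : w ∈ ({v, w'} : Finset X) := by
      rw [← show ({v, w} : Finset X) = {v, w'} from hww]; simp
    simpa [hw.2.1] using this

/-- A new `q`-simplex contains `v`, and erasing `v` leaves `q` of the neighbours of `v`. With `n`
neighbours there are at most `n.choose q ≤ n ^ q` such sets. -/
lemma ncard_star_le (h : (restrict K (insert v S)).faces.Finite) (q : ℕ) :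
    (qfaces (restrict K (insert v S)) q).ncard ≤
      (qfaces (restrict K S) q).ncard + (nbrs K S v).ncard ^ q := by
  classical
  have hsub : qfaces (restrict K S) q ⊆ qfaces (restrict K (insert v S)) q :=
    fun σ hσ ↦ ⟨restrict_faces_mono (subset_insert _ _) hσ.1, hσ.2⟩
  rw [← ncard_sdiff_add_ncard_of_subset hsub (qfaces_finite h q), add_comm]
  refine Nat.add_le_add_left ?_ _
  have hn := nbrs_finite h
  have hmem : ∀ σ ∈ qfaces (restrict K (insert v S)) q \ qfaces (restrict K S) q, v ∈ σ := by
    rintro σ ⟨⟨⟨h1, h2⟩, h3⟩, h4⟩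
    by_contra hvσ
    refine h4 ⟨⟨h1, fun w hw ↦ ?_⟩, h3⟩
    exact (h2 hw).resolve_left fun h ↦ hvσ (h ▸ hw)
  calc (qfaces (restrict K (insert v S)) q \ qfaces (restrict K S) q).ncard
      ≤ ((hn.toFinset.powersetCard q : Finset (Finset X)) : Set (Finset X)).ncard := by
        refine ncard_le_ncard_of_injOn (fun σ ↦ σ.erase v) ?_ ?_ (Finset.finite_toSet _)
        · rintro σ hσ
          have hvσ := hmem σ hσ
          obtain ⟨⟨⟨h1, h2⟩, h3⟩, h4⟩ := hσ
          simp only [Finset.mem_coe, Finset.mem_powersetCard]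
          refine ⟨fun w hw ↦ ?_, by rw [Finset.card_erase_of_mem hvσ, h3]; rfl⟩
          rw [Finset.mem_erase] at hw
          simp only [Finite.mem_toFinset]
          refine ⟨(h2 hw.2).resolve_left hw.1, hw.1, (K.isRelLowerSet_faces h1).2 ?_ ⟨v, by simp⟩⟩
          simp [Finset.insert_subset_iff, hvσ, hw.2]
        · intro σ hσ τ hτ hστ
          rw [← Finset.insert_erase (hmem σ hσ), ← Finset.insert_erase (hmem τ hτ)]
          exact congrArg (insert v) hστ
    _ = (nbrs K S v).ncard.choose q := by
        rw [ncard_coe_finset, Finset.card_powersetCard, ncard_eq_toFinset_card _ hn]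
    _ ≤ _ := Nat.choose_le_pow _ _

/-- Supermodularity for the complexes on `insert v S` and on `S'`, which meet in the complex on `S`.
Thus the increment caused by `v` grows with the vertex set. -/
lemma zdim_insert_mono (hv : v ∉ S') (hS : S ⊆ S')
    (h : (restrict K (insert v S')).faces.Finite) (q : ℕ) :
    zdim q (restrict K (insert v S)) + zdim q (restrict K S') ≤
      zdim q (restrict K (insert v S')) + zdim q (restrict K S) := by
  refine zdim_supermodular h (restrict_faces_mono (insert_subset_insert hS))
    (restrict_faces_mono (subset_insert _ _)) ?_ q
  ext σ
  constructor
  · rintro ⟨⟨h1, h2⟩, -, h4⟩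
    exact ⟨h1, fun w hw ↦ (h2 hw).resolve_left fun h ↦ hv (h ▸ h4 hw)⟩
  · rintro ⟨h1, h2⟩
    exact ⟨⟨h1, h2.trans (subset_insert _ _)⟩, h1, h2.trans hS⟩

/-- The same monotonicity for numbers of simplices, by inclusion-exclusion for the same pair of
complexes. -/
lemma qfaces_insert_mono (hv : v ∉ S') (hS : S ⊆ S')
    (h : (restrict K (insert v S')).faces.Finite) (q : ℕ) :
    (qfaces (restrict K (insert v S)) q).ncard + (qfaces (restrict K S') q).ncard ≤
      (qfaces (restrict K (insert v S')) q).ncard + (qfaces (restrict K S) q).ncard := by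
  have hf := qfaces_finite h q
  set F := qfaces (restrict K (insert v S')) q
  have h1 : qfaces (restrict K (insert v S)) q ⊆ F :=
    fun σ hσ ↦ ⟨restrict_faces_mono (insert_subset_insert hS) hσ.1, hσ.2⟩
  have h2 : qfaces (restrict K S') q ⊆ F :=
    fun σ hσ ↦ ⟨restrict_faces_mono (subset_insert _ _) hσ.1, hσ.2⟩
  have h3 : qfaces (restrict K (insert v S)) q ∩ qfaces (restrict K S') q =
      qfaces (restrict K S) q := by
    ext σ
    constructor
    · rintro ⟨⟨⟨h1, h2⟩, h3⟩, ⟨-, h4⟩, -⟩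
      exact ⟨⟨h1, fun w hw ↦ (h2 hw).resolve_left fun h ↦ hv (h ▸ h4 hw)⟩, h3⟩
    · rintro ⟨⟨h1, h2⟩, h3⟩
      exact ⟨⟨⟨h1, h2.trans (subset_insert _ _)⟩, h3⟩, ⟨h1, h2.trans hS⟩, h3⟩
  rw [← ncard_union_add_ncard_inter _ _ (hf.subset h1) (hf.subset h2), h3]
  exact Nat.add_le_add_right (ncard_le_ncard (union_subset h1 h2) hf) _

lemma bettiDiff_eq (h : (restrict K (insert v S)).faces.Finite) (p : ℕ) :
    bettiDiff K p S v =
      (zdim p (restrict K (insert v S)) - zdim p (restrict K S)) +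
      (zdim (p + 1) (restrict K (insert v S)) - zdim (p + 1) (restrict K S)) -
      ((qfaces (restrict K (insert v S)) (p + 1)).ncard -
        (qfaces (restrict K S) (p + 1)).ncard) := by
  rw [bettiDiff, betti_eq h, betti_eq (h.subset (restrict_faces_mono (subset_insert _ _)))]
  ring

lemma zdim_restrict_le (h : (restrict K (insert v S)).faces.Finite) (q : ℕ) :
    zdim q (restrict K S) ≤ zdim q (restrict K (insert v S)) := by
  have := finite_cycles h q
  exact Submodule.finrank_mono (cycles_mono (restrict_faces_mono (subset_insert _ _)) q)

lemma zdim_insert_le (h : (restrict K (insert v S)).faces.Finite) (q : ℕ) :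
    zdim q (restrict K (insert v S)) ≤ zdim q (restrict K S) + (nbrs K S v).ncard ^ q := by
  have h1 := ncard_star_le h q
  have h2 := zdim_add_qfaces_le h (restrict_faces_mono (subset_insert v S)) q
  omega

/-- With `n` the degree of `v`, the `p`-cycles contribute between `0` and `n ^ p`, and the terms of
degree `p + 1` together between `-n ^ (p + 1)` and `0`. The signs are opposite, so no constant in
front is needed. -/
lemma abs_bettiDiff_le (h : (restrict K (insert v S)).faces.Finite) (p : ℕ) :
    |bettiDiff K p S v| ≤ (1 + (nbrs K S v).ncard : ℝ) ^ (p + 1) := by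
  have a1 := zdim_restrict_le h p
  have a2 := zdim_insert_le h p
  have b1 := zdim_restrict_le h (p + 1)
  have b2 := zdim_add_qfaces_le h (restrict_faces_mono (subset_insert v S)) (p + 1)
  have c := ncard_star_le h (p + 1)
  rw [bettiDiff_eq h]
  set n := (nbrs K S v).ncard
  have e1 : (n : ℝ) ^ p ≤ (1 + n : ℝ) ^ (p + 1) :=
    calc (n : ℝ) ^ p ≤ (1 + n : ℝ) ^ p := by gcongr; simp
      _ ≤ _ := pow_le_pow_right₀ (by simp) (by simp)
  have e2 : (n : ℝ) ^ (p + 1) ≤ (1 + n : ℝ) ^ (p + 1) := by gcongr; simp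
  rify at a1 a2 b1 b2 c
  rw [abs_le]
  constructor <;> linarith

/-- A bounded function with natural values attains its supremum; by monotonicity it is constant
above a set where it does. -/
lemma exists_stable {ι : Type*} {C : Set (Set ι)} (hC : C.Nonempty)
    (g : Set ι → ℕ)
    (hg : ∀ S ∈ C, ∀ T ∈ C, S ⊆ T → g S ≤ g T) (N : ℕ) (hN : ∀ S ∈ C, g S ≤ N) :
    ∃ S₀ ∈ C, ∀ S ∈ C, S₀ ⊆ S → g S = g S₀ := by
  have hb : BddAbove (g '' C) := ⟨N, by rintro _ ⟨S, hS, rfl⟩; exact hN S hS⟩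
  obtain ⟨S₀, hS₀, h⟩ := Nat.sSup_mem (hC.image g) hb
  refine ⟨S₀, hS₀, fun S hS hle ↦ le_antisymm ?_ (hg _ hS₀ _ hS hle)⟩
  rw [h]
  exact le_csSup hb ⟨S, hS, rfl⟩

/-- If the degree of `v` is bounded, then `bettiDiff` is eventually constant along a directed family
of vertex sets. -/
lemma exists_bettiDiff_stable {C : Set (Set X)} (hC : C.Nonempty)
    (hU : ∀ S ∈ C, ∀ T ∈ C, S ∪ T ∈ C) (hv : ∀ S ∈ C, v ∉ S)
    (hf : ∀ S ∈ C, (restrict K (insert v S)).faces.Finite) (N : ℕ)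
    (hN : ∀ S ∈ C, (nbrs K S v).ncard ≤ N) (p : ℕ) :
    ∃ S₀ ∈ C, ∀ S ∈ C, S₀ ⊆ S → bettiDiff K p S v = bettiDiff K p S₀ v := by
  -- These subtractions in `ℕ` are not truncated, because adding a vertex never decreases the
  -- dimension of cycles.
  have key (q : ℕ) : ∃ S₀ ∈ C, ∀ S ∈ C, S₀ ⊆ S →
      zdim q (restrict K (insert v S)) - zdim q (restrict K S) =
        zdim q (restrict K (insert v S₀)) - zdim q (restrict K S₀) := by
    refine exists_stable hC
      (fun S ↦ zdim q (restrict K (insert v S)) - zdim q (restrict K S)) ?_ (N ^ q) ?_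
    · intro S hS T hT hST
      have := zdim_insert_mono (hv T hT) hST (hf T hT) q
      have := zdim_restrict_le (hf S hS) q
      have := zdim_restrict_le (hf T hT) q
      omega
    · intro S hS
      have := zdim_insert_le (hf S hS) q
      have := Nat.pow_le_pow_left (hN S hS) q
      omega
  have hq (q : ℕ) {S : Set X} (hS : S ∈ C) :
      (qfaces (restrict K S) q).ncard ≤ (qfaces (restrict K (insert v S)) q).ncard :=
    ncard_le_ncard (fun σ hσ ↦ ⟨restrict_faces_mono (subset_insert _ _) hσ.1, hσ.2⟩)
      (qfaces_finite (hf S hS) q)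
  have key' (q : ℕ) : ∃ S₀ ∈ C, ∀ S ∈ C, S₀ ⊆ S →
      (qfaces (restrict K (insert v S)) q).ncard - (qfaces (restrict K S) q).ncard =
        (qfaces (restrict K (insert v S₀)) q).ncard - (qfaces (restrict K S₀) q).ncard := by
    refine exists_stable hC
      (fun S ↦ (qfaces (restrict K (insert v S)) q).ncard - (qfaces (restrict K S) q).ncard)
      ?_ (N ^ q) ?_
    · intro S hS T hT hST
      have := qfaces_insert_mono (hv T hT) hST (hf T hT) q
      have := hq q hS
      have := hq q hT
      omega
    · intro S hS
      have := ncard_star_le (hf S hS) q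
      have := Nat.pow_le_pow_left (hN S hS) q
      omega
  obtain ⟨S₁, h₁, e₁⟩ := key p
  obtain ⟨S₂, h₂, e₂⟩ := key (p + 1)
  obtain ⟨S₃, h₃, e₃⟩ := key' (p + 1)
  -- The three increments stabilize separately; beyond the union of the three sets all of them are
  -- constant.
  have h₀ := hU _ (hU _ h₁ _ h₂) _ h₃
  refine ⟨_, h₀, fun S hS hle ↦ ?_⟩
  have a₁ : S₁ ⊆ S₁ ∪ S₂ ∪ S₃ := fun x hx ↦ Or.inl (Or.inl hx)
  have a₂ : S₂ ⊆ S₁ ∪ S₂ ∪ S₃ := fun x hx ↦ Or.inl (Or.inr hx)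
  have a₃ : S₃ ⊆ S₁ ∪ S₂ ∪ S₃ := fun x hx ↦ Or.inr hx
  have f₁ := (e₁ S hS (a₁.trans hle)).trans (e₁ _ h₀ a₁).symm
  have f₂ := (e₂ S hS (a₂.trans hle)).trans (e₂ _ h₀ a₂).symm
  have f₃ := (e₃ S hS (a₃.trans hle)).trans (e₃ _ h₀ a₃).symm
  rw [bettiDiff_eq (hf S hS), bettiDiff_eq (hf _ h₀)]
  rw [← Nat.cast_sub (zdim_restrict_le (hf S hS) p), ← Nat.cast_sub (zdim_restrict_le (hf S hS) _),
    ← Nat.cast_sub (hq _ hS), ← Nat.cast_sub (zdim_restrict_le (hf _ h₀) p),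
    ← Nat.cast_sub (zdim_restrict_le (hf _ h₀) _), ← Nat.cast_sub (hq _ h₀), f₁, f₂, f₃]

end AddOne

/-! ### Infinite product measures -/

section Products

variable {ι κ : Type*}

lemma prod_map_sumElim_infinitePi {Z : Type*} [MeasurableSpace Z] (μ : ι ⊕ κ → Measure Z)
    [∀ i, IsProbabilityMeasure (μ i)] :
    ((Measure.infinitePi fun i ↦ μ (.inl i)).prod (Measure.infinitePi fun i ↦ μ (.inr i))).map
      (fun p i ↦ Sum.elim p.1 p.2 i) = Measure.infinitePi μ := by
  have hm : Measurable fun p : (ι → Z) × (κ → Z) ↦ (fun i ↦ Sum.elim p.1 p.2 i) := by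
    refine measurable_pi_lambda _ fun i ↦ ?_
    cases i <;> simp only [Sum.elim_inl, Sum.elim_inr] <;> fun_prop
  refine Measure.eq_infinitePi _ fun s t ht ↦ ?_
  rw [Measure.map_apply hm (.pi s.countable_toSet fun i _ ↦ ht i)]
  have : (fun p : (ι → Z) × (κ → Z) ↦ (fun i ↦ Sum.elim p.1 p.2 i)) ⁻¹' (Set.pi s t) =
      (Set.pi s.toLeft fun i ↦ t (.inl i)) ×ˢ (Set.pi s.toRight fun i ↦ t (.inr i)) := by
    ext p
    simp [Set.mem_pi]
  rw [this, Measure.prod_prod, Measure.infinitePi_pi _ fun i _ ↦ ht _,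
    Measure.infinitePi_pi _ fun i _ ↦ ht _]
  conv_rhs => rw [← Finset.toLeft_disjSum_toRight (u := s), Finset.prod_disjSum]

lemma infinitePi_map_sumSplit {Z : Type*} [MeasurableSpace Z] (μ : ι ⊕ κ → Measure Z)
    [∀ i, IsProbabilityMeasure (μ i)] :
    (Measure.infinitePi μ).map (fun ω ↦ (fun i ↦ ω (.inl i), fun i ↦ ω (.inr i))) =
      (Measure.infinitePi fun i ↦ μ (.inl i)).prod (Measure.infinitePi fun i ↦ μ (.inr i)) := by
  have hm : Measurable fun p : (ι → Z) × (κ → Z) ↦ (fun i ↦ Sum.elim p.1 p.2 i) := by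
    refine measurable_pi_lambda _ fun i ↦ ?_
    cases i <;> simp only [Sum.elim_inl, Sum.elim_inr] <;> fun_prop
  rw [← prod_map_sumElim_infinitePi, Measure.map_map (by fun_prop) hm]
  exact Measure.map_id

lemma boxes_generate {Z : ι → Type*} [∀ i, MeasurableSpace (Z i)] :
    MeasurableSpace.generateFrom (squareCylinders fun i ↦ {s : Set (Z i) | MeasurableSet s}) =
      MeasurableSpace.pi := generateFrom_squareCylinders

lemma isPiSystem_boxes (W : ι → Type*) [∀ i, MeasurableSpace (W i)] :
    IsPiSystem (squareCylinders fun i ↦ {s : Set (W i) | MeasurableSet s}) :=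
  isPiSystem_squareCylinders (fun _ ↦ MeasurableSpace.isPiSystem_measurableSet) fun _ ↦ .univ

/-- The whole space is a box. -/
def boxesSpanning (W : ι → Type*) [∀ i, MeasurableSpace (W i)] (μ : Measure (∀ i, W i))
    [IsProbabilityMeasure μ] : μ.FiniteSpanningSetsIn
      (squareCylinders fun i ↦ {s : Set (W i) | MeasurableSet s}) where
  set := fun _ ↦ univ
  set_mem := fun _ ↦ ⟨∅, fun _ ↦ univ, fun _ _ ↦ MeasurableSet.univ, by simp⟩
  finite := fun _ ↦ by simp
  spanning := by simp [iUnion_const]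

/-- Boxes over finitely many coordinates generate both factors, and on boxes both sides are finite
products. -/
lemma infinitePi_map_prodSplit {X Y : ι → Type*} [∀ i, MeasurableSpace (X i)]
    [∀ i, MeasurableSpace (Y i)] (μ : ∀ i, Measure (X i)) (ν : ∀ i, Measure (Y i))
    [∀ i, IsProbabilityMeasure (μ i)] [∀ i, IsProbabilityMeasure (ν i)] :
    (Measure.infinitePi fun i ↦ (μ i).prod (ν i)).map (fun ω ↦ (fun i ↦ (ω i).1, fun i ↦ (ω i).2)) =
      (Measure.infinitePi μ).prod (Measure.infinitePi ν) := by
  classical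
  symm
  refine Measure.prod_eq_generateFrom boxes_generate boxes_generate (isPiSystem_boxes X)
    (isPiSystem_boxes Y) (boxesSpanning X _) (boxesSpanning Y _) ?_
  rintro _ ⟨s, a, ha, rfl⟩ _ ⟨t, b, hb, rfl⟩
  have ha' : ∀ i, MeasurableSet (a i) := fun i ↦ ha i (mem_univ i)
  have hb' : ∀ i, MeasurableSet (b i) := fun i ↦ hb i (mem_univ i)
  rw [Measure.map_apply (by fun_prop)
    ((MeasurableSet.pi s.countable_toSet fun i _ ↦ ha' i).prod
      (MeasurableSet.pi t.countable_toSet fun i _ ↦ hb' i))]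
  have : (fun ω : (i : ι) → X i × Y i ↦ (fun i ↦ (ω i).1, fun i ↦ (ω i).2)) ⁻¹'
      ((s : Set ι).pi a ×ˢ (t : Set ι).pi b) =
      Set.pi ((s ∪ t : Finset ι) : Set ι) fun i ↦
        (if i ∈ s then a i else univ) ×ˢ (if i ∈ t then b i else univ) := by
    ext ω
    simp only [mem_preimage, mem_prod, Set.mem_pi, Finset.coe_union, mem_union, Finset.mem_coe]
    constructor
    · rintro ⟨h1, h2⟩ i hi
      constructor
      · split_ifs with h
        exacts [h1 i h, trivial]
      · split_ifs with h
        exacts [h2 i h, trivial]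
    · intro h
      exact ⟨fun i hi ↦ by simpa [hi] using (h i (Or.inl hi)).1,
        fun i hi ↦ by simpa [hi] using (h i (Or.inr hi)).2⟩
  have hms (i) : MeasurableSet (if i ∈ s then a i else univ) := by
    split_ifs
    exacts [ha' i, .univ]
  have hmt (i) : MeasurableSet (if i ∈ t then b i else univ) := by
    split_ifs
    exacts [hb' i, .univ]
  rw [this, Measure.infinitePi_pi _ fun i _ ↦ (hms i).prod (hmt i)]
  simp only [Measure.prod_prod, Finset.prod_mul_distrib]
  rw [Measure.infinitePi_pi _ fun i _ ↦ ha' i, Measure.infinitePi_pi _ fun i _ ↦ hb' i]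
  congr 1
  · rw [← Finset.prod_subset (Finset.subset_union_left (s₁ := s) (s₂ := t))]
    · exact Finset.prod_congr rfl fun i hi ↦ by rw [if_pos hi]
    · intro i _ hi; rw [if_neg hi, measure_univ]
  · rw [← Finset.prod_subset (Finset.subset_union_right (s₁ := s) (s₂ := t))]
    · exact Finset.prod_congr rfl fun i hi ↦ by rw [if_pos hi]
    · intro i _ hi; rw [if_neg hi, measure_univ]

variable {Z : Type*} [MeasurableSpace Z] (ζ : Measure Z) [IsProbabilityMeasure ζ]

/-- Resampling one coordinate preserves a product measure. -/
lemma measurePreserving_update [DecidableEq ι] (i : ι) :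
    MeasurePreserving (fun p : (ι → Z) × Z ↦ Function.update p.1 i p.2)
      ((Measure.infinitePi fun _ : ι ↦ ζ).prod ζ) (Measure.infinitePi fun _ : ι ↦ ζ) := by
  have hm : Measurable (fun p : (ι → Z) × Z ↦ Function.update p.1 i p.2) := measurable_update'
  refine ⟨hm, Measure.eq_infinitePi _ fun s t ht ↦ ?_⟩
  rw [Measure.map_apply hm (.pi s.countable_toSet fun i _ ↦ ht i)]
  have : (fun p : (ι → Z) × Z ↦ Function.update p.1 i p.2) ⁻¹' (Set.pi s t) =
      (Set.pi (s.erase i : Finset ι) t) ×ˢ (if i ∈ s then t i else univ) := by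
    ext p
    simp only [mem_preimage, Set.mem_pi, Finset.mem_coe, mem_prod, Finset.mem_erase]
    constructor
    · intro h
      refine ⟨fun j hj ↦ by simpa [hj.1] using h j hj.2, ?_⟩
      split_ifs with hi
      · simpa using h i hi
      · trivial
    · rintro ⟨h1, h2⟩ j hj
      obtain rfl | hne := eq_or_ne j i
      · simpa [hj] using h2
      · simpa [hne] using h1 j ⟨hne, hj⟩
  rw [this, Measure.prod_prod, Measure.infinitePi_pi _ fun i _ ↦ ht _]
  split_ifs with hi
  · rw [Finset.prod_erase_mul _ _ hi]
  · rw [measure_univ, mul_one, Finset.erase_eq_of_notMem hi]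

lemma lintegral_eq_update [DecidableEq ι] {F : (ι → Z) → ℝ≥0∞} (hF : Measurable F) (i : ι) :
    ∫⁻ ω, F ω ∂(Measure.infinitePi fun _ : ι ↦ ζ) =
      ∫⁻ ω, ∫⁻ z, F (Function.update ω i z) ∂ζ ∂(Measure.infinitePi fun _ : ι ↦ ζ) := by
  rw [← (measurePreserving_update ζ i).lintegral_comp hF, lintegral_prod]
  exact (hF.comp (measurePreserving_update ζ i).measurable).aemeasurable

lemma update_of_dependsOn [DecidableEq ι] {β Z : Type*} {X : (ι → Z) → β} {i : ι} (hX : DependsOn X {i}ᶜ)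
    (ω : ι → Z) (z : Z) : X (Function.update ω i z) = X ω :=
  hX fun _ hj ↦ Function.update_of_ne hj _ _

/-- Independence of a coordinate and a function that ignores it, in the form of a product formula.
It follows by resampling this coordinate. -/
lemma lintegral_mul_of_dependsOn {X : (ι → Z) → ℝ≥0∞} (hX : Measurable X) {i : ι}
    (hXi : DependsOn X {i}ᶜ) {a : Z → ℝ≥0∞} (ha : Measurable a) :
    ∫⁻ ω, a (ω i) * X ω ∂(Measure.infinitePi fun _ : ι ↦ ζ) =
      (∫⁻ z, a z ∂ζ) * ∫⁻ ω, X ω ∂(Measure.infinitePi fun _ : ι ↦ ζ) := by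
  classical
  rw [lintegral_eq_update ζ (by fun_prop) i]
  simp only [Function.update_self, update_of_dependsOn hXi]
  simp_rw [lintegral_mul_const _ ha]
  rw [lintegral_const_mul _ hX]

lemma integral_mul_of_dependsOn {X : (ι → Z) → ℝ} {i : ι}
    (hX : AEStronglyMeasurable X (Measure.infinitePi fun _ : ι ↦ ζ))
    (hXi : DependsOn X {i}ᶜ) {a : Z → ℝ} (ha : Measurable a) :
    ∫ ω, a (ω i) * X ω ∂(Measure.infinitePi fun _ : ι ↦ ζ) =
      (∫ z, a z ∂ζ) * ∫ ω, X ω ∂(Measure.infinitePi fun _ : ι ↦ ζ) := by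
  classical
  have hmp := measurePreserving_update ζ i
  have hsm : AEStronglyMeasurable (fun ω ↦ a (ω i) * X ω) (Measure.infinitePi fun _ : ι ↦ ζ) :=
    (ha.comp (measurable_pi_apply i)).aestronglyMeasurable.mul hX
  calc _ = ∫ p : (ι → Z) × Z, a p.2 * X p.1 ∂((Measure.infinitePi fun _ : ι ↦ ζ).prod ζ) := by
        conv_lhs => rw [← hmp.map_eq]
        rw [integral_map hmp.measurable.aemeasurable (by rwa [hmp.map_eq])]
        simp only [Function.update_self, update_of_dependsOn hXi]
    _ = ∫ p : (ι → Z) × Z, X p.1 * a p.2 ∂((Measure.infinitePi fun _ : ι ↦ ζ).prod ζ) := by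
        simp_rw [mul_comm]
    _ = _ := by rw [integral_prod_mul, mul_comm]

/-! ### The Efron-Stein inequality -/

lemma integrable_mul_of_memLp_two {Ω : Type*} [MeasurableSpace Ω] {μ : Measure Ω} {f g : Ω → ℝ}
    (hf : MemLp f 2 μ) (hg : MemLp g 2 μ) : Integrable (fun x ↦ f x * g x) μ := hf.integrable_mul hg

open Classical in
/-- Selects the second components for the coordinates in `s` and the first ones otherwise. -/
def sel {Z : Type*} (s : Set ι) (w : ι → Z × Z) (i : ι) : Z := if i ∈ s then (w i).2 else (w i).1

open Classical in
lemma measurePreserving_sel (s : Set ι) :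
    MeasurePreserving (sel s) (Measure.infinitePi fun _ : ι ↦ ζ.prod ζ)
      (Measure.infinitePi fun _ : ι ↦ ζ) := by
  have hf (i : ι) : Measurable fun z : Z × Z ↦ if i ∈ s then z.2 else z.1 := by
    split_ifs <;> fun_prop
  have h := Measure.infinitePi_map_pi (fun _ : ι ↦ ζ.prod ζ) hf
  refine ⟨measurable_pi_lambda _ fun i ↦ (hf i).comp (measurable_pi_apply i), ?_⟩
  refine h.trans ?_
  congr 1
  ext1 i
  split_ifs
  · exact measurePreserving_snd.map_eq
  · exact measurePreserving_fst.map_eq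

open Classical in
/-- Exchanges the components for the coordinates in `s`. -/
def swapOn {Z : Type*} (s : Set ι) (w : ι → Z × Z) (i : ι) : Z × Z := if i ∈ s then (w i).swap else w i

open Classical in
lemma measurePreserving_swapOn (s : Set ι) :
    MeasurePreserving (swapOn s) (Measure.infinitePi fun _ : ι ↦ ζ.prod ζ)
      (Measure.infinitePi fun _ : ι ↦ ζ.prod ζ) := by
  have hf (i : ι) : Measurable fun z : Z × Z ↦ if i ∈ s then z.swap else z := by
    split_ifs <;> fun_prop
  have h := Measure.infinitePi_map_pi (fun _ : ι ↦ ζ.prod ζ) hf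
  refine ⟨measurable_pi_lambda _ fun i ↦ (hf i).comp (measurable_pi_apply i), ?_⟩
  refine h.trans ?_
  congr 1
  ext1 i
  split_ifs
  · exact Measure.prod_swap
  · exact Measure.map_id

lemma sel_swapOn {Z : Type*} (s t : Set ι) (w : ι → Z × Z) : sel s (swapOn t w) = sel (symmDiff s t) w := by
  ext i
  have h := Set.mem_symmDiff (a := i) (s := s) (t := t)
  by_cases h1 : i ∈ s <;> by_cases h2 : i ∈ t <;> simp [sel, swapOn, h, h1, h2]

/-- `sel ∅` and `sel univ` are the first and the second components of all pairs, hence independent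
copies of each other. -/
lemma integral_sel_empty_mul_sel_univ (f : (ι → Z) → ℝ) 
    (hf : AEStronglyMeasurable f (Measure.infinitePi fun _ : ι ↦ ζ)) :
    ∫ w, f (sel ∅ w) * f (sel univ w) ∂(Measure.infinitePi fun _ : ι ↦ ζ.prod ζ) =
      (∫ ω, f ω ∂(Measure.infinitePi fun _ : ι ↦ ζ)) ^ 2 := by
  have h := infinitePi_map_prodSplit (fun _ : ι ↦ ζ) (fun _ : ι ↦ ζ)
  have e1 : (fun w : ι → Z × Z ↦ f (sel ∅ w) * f (sel univ w)) =
      fun w ↦ (fun p : (ι → Z) × (ι → Z) ↦ f p.1 * f p.2) (fun i ↦ (w i).1, fun i ↦ (w i).2) := by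
    ext w
    have h1 : sel ∅ w = fun i ↦ (w i).1 := by ext i; simp [sel]
    have h2 : sel univ w = fun i ↦ (w i).2 := by ext i; simp [sel]
    rw [h1, h2]
  rw [e1, ← integral_map (φ := fun w : ι → Z × Z ↦ (fun i ↦ (w i).1, fun i ↦ (w i).2))
    (f := fun p : (ι → Z) × (ι → Z) ↦ f p.1 * f p.2) (by fun_prop), h, integral_prod_mul, sq]
  rw [h]
  exact (hf.comp_fst).mul hf.comp_snd

/-- A form of the Efron-Stein inequality for coordinates that are grouped by `g`. With an
independent copy `ω'` of `ω`, the variance is the mean of `f ω * (f ω - f ω')`, which telescopes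
when the groups are exchanged one at a time. The comparison function `h k` may be any
square-integrable function that ignores the group `k`. Therefore groups can later be erased instead
of resampled; the price is the factor `2`. -/
lemma variance_le_of_dependsOn {G : Type*} (g : ι → G) (F : Finset G) {f : (ι → Z) → ℝ}
    (hf : MemLp f 2 (Measure.infinitePi fun _ : ι ↦ ζ)) (hfd : DependsOn f {i | g i ∈ F})
    {h : G → (ι → Z) → ℝ} (hh : ∀ k ∈ F, MemLp (h k) 2 (Measure.infinitePi fun _ : ι ↦ ζ))
    (hhd : ∀ k ∈ F, DependsOn (h k) {i | g i ≠ k}) :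
    variance f (Measure.infinitePi fun _ : ι ↦ ζ) ≤
      2 * ∑ k ∈ F, ∫ ω, (f ω - h k ω) ^ 2 ∂(Measure.infinitePi fun _ : ι ↦ ζ) := by
  classical
  set μ := Measure.infinitePi fun _ : ι ↦ ζ
  set μ₁ := Measure.infinitePi fun _ : ι ↦ ζ.prod ζ
  have hsel (s : Set ι) : MemLp (fun w ↦ f (sel s w)) 2 μ₁ :=
    hf.comp_measurePreserving (measurePreserving_sel ζ s)
  have key (T : Finset G) (hT : T ⊆ F) :
      ∫ w, f (sel ∅ w) * (f (sel ∅ w) - f (sel {i | g i ∈ T} w)) ∂μ₁ ≤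
        2 * ∑ k ∈ T, ∫ ω, (f ω - h k ω) ^ 2 ∂μ := by
    induction T using Finset.induction_on with
    | empty => simp
    | insert k T hk ih =>
      have hkF : k ∈ F := hT (Finset.mem_insert_self _ _)
      specialize ih ((Finset.subset_insert _ _).trans hT)
      rw [Finset.sum_insert hk, mul_add]
      set A := {i | g i ∈ T}
      set A' := {i | g i ∈ insert k T}
      set B := {i | g i = k}
      have hAB : symmDiff A B = A' := by
        ext i
        simp only [A, B, A', Set.mem_symmDiff, mem_ofPred_eq, Finset.mem_insert]
        constructor
        · rintro (h | h)
          exacts [Or.inr h.1, Or.inl h.1]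
        · rintro (h | h)
          · exact Or.inr ⟨h, fun h' ↦ hk (h ▸ h')⟩
          · exact Or.inl ⟨h, fun h' ↦ hk (h' ▸ h)⟩
      have hAB' : symmDiff A' B = A := by rw [← hAB, symmDiff_symmDiff_cancel_right]
      set I := ∫ w, f (sel ∅ w) * (f (sel A w) - f (sel A' w)) ∂μ₁ with hI
      have hi1 (s t u : Set ι) : Integrable (fun w ↦ f (sel s w) * (f (sel t w) - f (sel u w))) μ₁ :=
        integrable_mul_of_memLp_two (hsel s) ((hsel t).sub (hsel u))
      -- Swapping the two components of the group `k` preserves the law. Averaging the two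
      -- expressions for `I` gives a product of two increments that come from the group `k` alone.
      have hI1 : I = ∫ w, f (sel B w) * (f (sel A' w) - f (sel A w)) ∂μ₁ := by
        have hmp := measurePreserving_swapOn ζ B
        rw [hI]
        conv_lhs => rw [show μ₁ = μ₁.map (swapOn B) from hmp.map_eq.symm]
        rw [integral_map hmp.measurable.aemeasurable
          (by rw [hmp.map_eq]; exact (hi1 _ _ _).aestronglyMeasurable)]
        simp only [sel_swapOn, hAB, hAB', ← Set.bot_eq_empty, bot_symmDiff]
      have hI2 : 2 * I = ∫ w, (f (sel ∅ w) - f (sel B w)) * (f (sel A w) - f (sel A' w)) ∂μ₁ := by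
        rw [two_mul]
        nth_rw 2 [hI1]
        rw [hI, ← integral_add (hi1 _ _ _) (hi1 _ _ _)]
        exact integral_congr_ae (.of_forall fun w ↦ by ring)
      have hd2 (s : Set ι) : MemLp (fun w ↦ f (sel s w) - h k (sel s w)) 2 μ₁ :=
        (hf.sub (hh k hkF)).comp_measurePreserving (measurePreserving_sel ζ s)
      have hd (s : Set ι) : Integrable (fun w ↦ (f (sel s w) - h k (sel s w)) ^ 2) μ₁ :=
        (hd2 s).integrable_sq
      have hde (s : Set ι) : ∫ w, (f (sel s w) - h k (sel s w)) ^ 2 ∂μ₁ =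
          ∫ ω, (f ω - h k ω) ^ 2 ∂μ := by
        have hmp := measurePreserving_sel ζ s
        conv_rhs => rw [show μ = μ₁.map (sel s) from hmp.map_eq.symm]
        rw [integral_map hmp.measurable.aemeasurable]
        rw [hmp.map_eq]
        exact ((hf.sub (hh k hkF)).integrable_sq).aestronglyMeasurable
      -- Exchanging the group `k` does not change `h k`, so `h k` can be subtracted in both
      -- increments.
      have hB : ∀ w, h k (sel B w) = h k (sel ∅ w) := fun w ↦ hhd k hkF fun i hi ↦ by
        have : i ∉ B := hi
        simp [sel, this]
      have hA : ∀ w, h k (sel A' w) = h k (sel A w) := fun w ↦ hhd k hkF fun i hi ↦ by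
        have : i ∈ A' ↔ i ∈ A := by
          simp only [A, A', mem_ofPred_eq, Finset.mem_insert]
          exact or_iff_right hi
        simp [sel, this]
      have hd4' (s t : Set ι) : Integrable (fun w ↦ (f (sel s w) - h k (sel s w)) ^ 2 +
          (f (sel t w) - h k (sel t w)) ^ 2) μ₁ := (hd s).add (hd t)
      have hd4 (s t u v : Set ι) : Integrable (fun w ↦ (f (sel s w) - h k (sel s w)) ^ 2 +
          (f (sel t w) - h k (sel t w)) ^ 2 + ((f (sel u w) - h k (sel u w)) ^ 2 +
          (f (sel v w) - h k (sel v w)) ^ 2)) μ₁ := (hd4' s t).add (hd4' u v)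
      have hle : 2 * I ≤ ∫ w, ((f (sel ∅ w) - h k (sel ∅ w)) ^ 2 + (f (sel B w) - h k (sel B w)) ^ 2 +
          ((f (sel A w) - h k (sel A w)) ^ 2 + (f (sel A' w) - h k (sel A' w)) ^ 2)) ∂μ₁ := by
        rw [hI2]
        refine integral_mono (integrable_mul_of_memLp_two ((hsel _).sub (hsel _)) ((hsel _).sub (hsel _)))
          (hd4 _ _ _ _) fun w ↦ ?_
        dsimp only
        rw [hB, hA]
        set x := f (sel ∅ w) - h k (sel ∅ w)
        set y := f (sel B w) - h k (sel ∅ w)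
        set z := f (sel A w) - h k (sel A w)
        set u := f (sel A' w) - h k (sel A w)
        have : (f (sel ∅ w) - f (sel B w)) * (f (sel A w) - f (sel A' w)) = (x - y) * (z - u) := by
          simp only [x, y, z, u]; ring
        rw [this]
        nlinarith [sq_nonneg (x - y - (z - u)), sq_nonneg (x + y), sq_nonneg (z + u)]
      rw [integral_add (hd4' _ _) (hd4' _ _), integral_add (hd _) (hd _),
        integral_add (hd _) (hd _), hde, hde, hde, hde] at hle
      have hsplit : ∫ w, f (sel ∅ w) * (f (sel ∅ w) - f (sel A' w)) ∂μ₁ =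
          ∫ w, f (sel ∅ w) * (f (sel ∅ w) - f (sel A w)) ∂μ₁ + I := by
        rw [hI, ← integral_add (hi1 _ _ _) (hi1 _ _ _)]
        exact integral_congr_ae (.of_forall fun w ↦ by ring)
      rw [hsplit]
      linarith
  refine le_trans (le_of_eq ?_) (key F subset_rfl)
  have h1 : ∀ w, f (sel {i | g i ∈ F} w) = f (sel univ w) := fun w ↦ hfd fun i hi ↦ by
    have : g i ∈ F := hi
    simp [sel, this]
  have h2 : ∫ w, f (sel ∅ w) * f (sel ∅ w) ∂μ₁ = ∫ ω, f ω ^ 2 ∂μ := by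
    have hmp := measurePreserving_sel ζ (∅ : Set ι)
    conv_rhs => rw [show μ = μ₁.map (sel ∅) from hmp.map_eq.symm]
    rw [integral_map hmp.measurable.aemeasurable]
    · simp_rw [sq]
    · rw [hmp.map_eq]; exact hf.integrable_sq.aestronglyMeasurable
  simp only [h1, mul_sub]
  rw [integral_sub (integrable_mul_of_memLp_two (hsel _) (hsel _))
    (integrable_mul_of_memLp_two (hsel _) (hsel _)), h2,
    integral_sel_empty_mul_sel_univ ζ f hf.aestronglyMeasurable, variance_eq_sub hf]
  rfl

/-! ### A lower bound for the variance -/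

/-- The Cauchy-Schwarz inequality for `f` and the test function `∑ i ∈ T, a (ω i) * Y i ω`. The
summands are centred and pairwise orthogonal, because `a` has mean zero and no `Y i` depends on a
coordinate in `T`. -/
lemma sq_sum_integral_le_variance_mul (T : Finset ι) {f : (ι → Z) → ℝ}
    (hf : MemLp f 2 (Measure.infinitePi fun _ : ι ↦ ζ)) {Y : ι → (ι → Z) → ℝ}
    (hY : ∀ i ∈ T, MemLp (Y i) 2 (Measure.infinitePi fun _ : ι ↦ ζ))
    (hYd : ∀ i ∈ T, DependsOn (Y i) (T : Set ι)ᶜ) {a : Z → ℝ} (ha : Measurable a) {M : ℝ}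
    (haM : ∀ z, |a z| ≤ M) (ha0 : ∫ z, a z ∂ζ = 0) :
    (∑ i ∈ T, ∫ ω, a (ω i) * Y i ω * f ω ∂(Measure.infinitePi fun _ : ι ↦ ζ)) ^ 2 ≤
      variance f (Measure.infinitePi fun _ : ι ↦ ζ) *
        (M ^ 2 * ∑ i ∈ T, ∫ ω, Y i ω ^ 2 ∂(Measure.infinitePi fun _ : ι ↦ ζ)) := by
  classical
  set μ := Measure.infinitePi fun _ : ι ↦ ζ
  have haY (i) (hi : i ∈ T) : MemLp (fun ω ↦ a (ω i) * Y i ω) 2 μ := by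
    refine MemLp.mono ((hY i hi).const_mul M) ?_ (.of_forall fun ω ↦ ?_)
    · exact (ha.comp (measurable_pi_apply i)).aestronglyMeasurable.mul (hY i hi).aestronglyMeasurable
    · rw [norm_mul, norm_mul]
      gcongr
      rw [Real.norm_eq_abs, Real.norm_eq_abs]
      exact (haM _).trans (le_abs_self _)
  have hd1 (i) (hi : i ∈ T) : DependsOn (Y i) {i}ᶜ := fun x y hxy ↦ hYd i hi fun j hj ↦ hxy j
    (by rintro rfl; exact hj hi)
  set g : (ι → Z) → ℝ := fun ω ↦ ∑ i ∈ T, a (ω i) * Y i ω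
  have hg : MemLp g 2 μ := memLp_finsetSum T haY
  have hg0 : ∫ ω, g ω ∂μ = 0 := by
    rw [integral_finsetSum _ fun i hi ↦ (haY i hi).integrable one_le_two]
    refine Finset.sum_eq_zero fun i hi ↦ ?_
    rw [integral_mul_of_dependsOn ζ (hY i hi).aestronglyMeasurable (hd1 i hi) ha, ha0, zero_mul]
  have hgf : ∫ ω, g ω * (f ω - ∫ ω', f ω' ∂μ) ∂μ = ∑ i ∈ T, ∫ ω, a (ω i) * Y i ω * f ω ∂μ := by
    simp only [mul_sub]
    rw [integral_sub (integrable_mul_of_memLp_two hg hf) ((hg.integrable one_le_two).mul_const _),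
      integral_mul_const, hg0, zero_mul, sub_zero]
    simp only [g, Finset.sum_mul]
    exact integral_finsetSum _ fun i hi ↦ integrable_mul_of_memLp_two (haY i hi) hf
  have hg2 : ∫ ω, g ω ^ 2 ∂μ ≤ M ^ 2 * ∑ i ∈ T, ∫ ω, Y i ω ^ 2 ∂μ := by
    have e1 : ∀ ω, g ω ^ 2 = ∑ i ∈ T, ∑ j ∈ T, (a (ω i) * Y i ω) * (a (ω j) * Y j ω) := by
      intro ω
      rw [sq, Finset.sum_mul_sum]
    simp only [e1]
    rw [integral_finsetSum _ fun i hi ↦ integrable_finsetSum _ fun j hj ↦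
      integrable_mul_of_memLp_two (haY i hi) (haY j hj), Finset.mul_sum]
    refine Finset.sum_le_sum fun i hi ↦ ?_
    rw [integral_finsetSum _ fun j hj ↦ integrable_mul_of_memLp_two (haY i hi) (haY j hj),
      Finset.sum_eq_single i]
    · rw [← integral_const_mul]
      refine integral_mono (integrable_mul_of_memLp_two (haY i hi) (haY i hi))
        ((hY i hi).integrable_sq.const_mul _) fun ω ↦ ?_
      have : a (ω i) ^ 2 ≤ M ^ 2 := sq_le_sq' (neg_le_of_abs_le (haM _)) (le_of_abs_le (haM _))
      dsimp only
      nlinarith [sq_nonneg (Y i ω)]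
    · intro j hj hji
      have e2 : ∀ ω, (a (ω i) * Y i ω) * (a (ω j) * Y j ω) = a (ω i) * (Y i ω * (a (ω j) * Y j ω)) :=
        fun ω ↦ by ring
      simp only [e2]
      rw [integral_mul_of_dependsOn ζ _ _ ha, ha0, zero_mul]
      · exact ((hY i hi).integrable_mul (haY j hj)).aestronglyMeasurable
      · intro x y hxy
        have h1 := hd1 i hi hxy
        have h2 : Y j x = Y j y := hYd j hj fun k hk ↦ hxy k (by rintro rfl; exact hk hi)
        dsimp only
        rw [h1, h2, hxy j hji]
    · exact fun h ↦ absurd hi h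
  have hfc : MemLp (fun ω ↦ f ω - ∫ ω', f ω' ∂μ) 2 μ := hf.sub (memLp_const _)
  rw [← hgf, variance_eq_integral hf.aestronglyMeasurable.aemeasurable]
  have hV : 0 ≤ ∫ ω, (f ω - ∫ ω', f ω' ∂μ) ^ 2 ∂μ := integral_nonneg fun _ ↦ sq_nonneg _
  refine le_trans ?_ (mul_le_mul_of_nonneg_left hg2 hV)
  -- The Cauchy-Schwarz inequality is the nonpositivity of the discriminant of this quadratic
  -- polynomial.
  have hquad (t : ℝ) : 0 ≤ (∫ ω, g ω ^ 2 ∂μ) * (t * t) +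
      (2 * ∫ ω, g ω * (f ω - ∫ ω', f ω' ∂μ) ∂μ) * t + ∫ ω, (f ω - ∫ ω', f ω' ∂μ) ^ 2 ∂μ := by
    have : (∫ ω, g ω ^ 2 ∂μ) * (t * t) + (2 * ∫ ω, g ω * (f ω - ∫ ω', f ω' ∂μ) ∂μ) * t +
        ∫ ω, (f ω - ∫ ω', f ω' ∂μ) ^ 2 ∂μ = ∫ ω, (t * g ω + (f ω - ∫ ω', f ω' ∂μ)) ^ 2 ∂μ := by
      have i1 := hg.integrable_sq.mul_const (t * t)
      have i2 := ((integrable_mul_of_memLp_two hg hfc).const_mul 2).mul_const t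
      have i3 : Integrable (fun x ↦ g x ^ 2 * (t * t) +
        2 * (g x * (f x - ∫ (ω' : ι → Z), f ω' ∂μ)) * t) μ := i1.add i2
      rw [← integral_mul_const, ← integral_const_mul, ← integral_mul_const, ← integral_add i1 i2,
        ← integral_add i3 hfc.integrable_sq]
      exact integral_congr_ae (.of_forall fun ω ↦ by ring)
    rw [this]
    exact integral_nonneg fun _ ↦ sq_nonneg _
  have := discrim_le_zero hquad
  rw [discrim] at this
  nlinarith

end Products

/-! ### Complexes built from a field of marks on finite sets -/

section MarkComplex

variable {L L' : Type*} {d : ℕ} {A : Type*}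

open Classical in
/-- The complex on labels `L` with locations `y` in which a set of at most `α + 1` labels is a
simplex if `u ρ ≤ φ (ρ)` for all its subsets `ρ` with at least two elements. -/
def markComplex (α : ℕ) (φ : (j : ℕ) → (Fin (j + 1) → (Fin d → ℝ) × A) → unitInterval)
    (y : L → (Fin d → ℝ) × A) (u : Finset L → unitInterval) : PreAbstractSimplicialComplex L where
  faces := {σ | σ.Nonempty ∧ σ.card ≤ α + 1 ∧ ∀ j ∈ Icc 1 α, ∀ z : Fin (j + 1) → L,
    Function.Injective z → (∀ i, z i ∈ σ) → u (Finset.univ.image z) ≤ φ j fun i ↦ y (z i)}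
  isRelLowerSet_faces := by
    rintro S ⟨hS, hc, hu⟩
    exact ⟨hS, fun R hR hne ↦ ⟨hne, (Finset.card_le_card hR).trans hc,
      fun j hj z hz hi ↦ hu j hj z hz fun i ↦ hR (hi i)⟩⟩

variable {α : ℕ} {φ : (j : ℕ) → (Fin (j + 1) → (Fin d → ℝ) × A) → unitInterval}
  {y : L → (Fin d → ℝ) × A} {u : Finset L → unitInterval}
  {y' : L' → (Fin d → ℝ) × A} {u' : Finset L' → unitInterval} {S : Set L'} {e : L' → L}

open Classical in
-- The restricted complex sees the positions only up to a common translation, and the decision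
-- variables only of sets with at least two labels inside `S`. Relabelling, translation and locality
-- of the model are all instances of this.
lemma restrict_markComplex_map [MeasurableSpace A] (hφ : IsConnection α φ) (he : InjOn e S)
    (t : Fin d → ℝ)
    (hy : ∀ l ∈ S, y' l = ((y (e l)).1 + t, (y (e l)).2))
    (hu : ∀ ρ : Finset L', (ρ : Set L') ⊆ S → 2 ≤ ρ.card → u' ρ = u (ρ.image e)) :
    (restrict (markComplex α φ y' u') S).map e = restrict (markComplex α φ y u) (e '' S) := by
  have hloc (j) (hj : j ∈ Icc 1 α) (z : Fin (j + 1) → L') (hz : ∀ i, z i ∈ S) :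
      φ j (fun i ↦ y' (z i)) = φ j fun i ↦ y (e (z i)) := by
    rw [← hφ.translation j hj t fun i ↦ y (e (z i))]
    congr 1
    ext1 i
    exact hy _ (hz i)
  have himg (j : ℕ) (hj : j ∈ Icc 1 α) (z : Fin (j + 1) → L') (hz : Function.Injective z)
      (hzS : ∀ i, z i ∈ S) :
      u' (Finset.univ.image z) = u (Finset.univ.image fun i ↦ e (z i)) := by
    rw [hu, Finset.image_image]
    · rfl
    · intro l hl
      simp only [Finset.coe_image, Finset.coe_univ, image_univ, mem_range] at hl
      obtain ⟨i, rfl⟩ := hl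
      exact hzS i
    · rw [Finset.card_image_of_injective _ hz, Finset.card_univ, Fintype.card_fin]
      have := hj.1
      omega
  apply PreAbstractSimplicialComplex.ext
  ext τ
  constructor
  · rintro ⟨σ, ⟨⟨hne, hc, h⟩, hS⟩, rfl⟩
    refine ⟨⟨hne.image _, ?_, fun j hj z hz hi ↦ ?_⟩, ?_⟩
    · rwa [Finset.card_image_of_injOn (he.mono hS)]
    · have : ∀ i, ∃ l ∈ σ, e l = z i := fun i ↦ by simpa using hi i
      choose w hw hwz using this
      have hwS (i) : w i ∈ S := hS (hw i)
      have hwi : Function.Injective w := fun a b hab ↦ hz (by rw [← hwz, ← hwz, hab])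
      have := h j hj w hwi hw
      rw [hloc j hj w hwS, himg j hj w hwi hwS] at this
      simpa only [hwz] using this
    · rw [Finset.coe_image]
      exact image_mono hS
  · rintro ⟨⟨hne, hc, h⟩, hS⟩
    obtain ⟨σ, hσ, rfl⟩ := Finset.subset_set_image_iff.1 hS
    refine ⟨σ, ⟨⟨Finset.image_nonempty.1 hne, ?_, fun j hj z hz hi ↦ ?_⟩, hσ⟩, rfl⟩
    · rwa [Finset.card_image_of_injOn (he.mono hσ)] at hc
    · have hzS (i) : z i ∈ S := hσ (hi i)
      rw [hloc j hj z hzS, himg j hj z hz hzS]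
      exact h j hj (fun i ↦ e (z i)) (fun a b hab ↦ hz (he (hzS a) (hzS b) hab))
        fun i ↦ Finset.mem_image_of_mem _ (hi i)

lemma betti_markComplex_map [MeasurableSpace A] (hφ : IsConnection α φ) (he : InjOn e S)
    (t : Fin d → ℝ) (p : ℕ)
    (hy : ∀ l ∈ S, y' l = ((y (e l)).1 + t, (y (e l)).2))
    (hu : ∀ ρ : Finset L', (ρ : Set L') ⊆ S → 2 ≤ ρ.card →
      open Classical in u' ρ = u (ρ.image e)) :
    betti p (restrict (markComplex α φ y' u') S) =
      betti p (restrict (markComplex α φ y u) (e '' S)) := by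
  classical
  rw [← restrict_markComplex_map hφ he t hy hu]
  exact (betti_map (K := restrict (markComplex α φ y' u') S) he (fun σ hσ ↦ hσ.2) p).symm

end MarkComplex

/-! ### Measurability of functions of random finite complexes -/

section Measurability

variable {Ω L β : Type*} [MeasurableSpace Ω] [Countable L] [MeasurableSpace β]

/-- Every function of a random finite complex with countably many vertices is measurable. -/
lemma measurable_of_faces {K : Ω → PreAbstractSimplicialComplex L}
    (hK : ∀ σ, MeasurableSet {ω | σ ∈ (K ω).faces}) (hf : ∀ ω, (K ω).faces.Finite)
    (F : PreAbstractSimplicialComplex L → β) : Measurable fun ω ↦ F (K ω) := by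
  classical
  -- A finite complex with countably many possible vertices has only countably many values, each
  -- taken on a measurable event.
  let code : Ω → Finset (Finset L) := fun ω ↦ (hf ω).toFinset
  have hcode : ∀ s : Finset (Finset L), MeasurableSet (code ⁻¹' {s}) := by
    intro s
    have : code ⁻¹' {s} = ⋂ σ : Finset L, {ω | σ ∈ (K ω).faces ↔ σ ∈ s} := by
      ext ω
      simp [code, Finset.ext_iff]
    rw [this]
    refine MeasurableSet.iInter fun σ ↦ ?_
    by_cases h : σ ∈ s
    · simpa [h] using hK σ
    · simp only [h, iff_false]
      exact (hK σ).compl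
  have hinj : ∀ ω ω', code ω = code ω' → K ω = K ω' := by
    intro ω ω' h
    apply PreAbstractSimplicialComplex.ext
    ext σ
    have : σ ∈ code ω ↔ σ ∈ code ω' := by rw [h]
    simpa [code] using this
  intro B _
  have : (fun ω ↦ F (K ω)) ⁻¹' B =
      ⋃ s : {s : Finset (Finset L) // ∃ ω, code ω = s ∧ F (K ω) ∈ B}, code ⁻¹' {s.1} := by
    ext ω
    simp only [mem_preimage, mem_iUnion, mem_singleton_iff, Subtype.exists, exists_prop]
    constructor
    · exact fun h ↦ ⟨_, ⟨ω, rfl, h⟩, rfl⟩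
    · rintro ⟨s, ⟨ω', h1, h2⟩, h3⟩
      rwa [hinj ω ω' (h3.trans h1.symm)]
  rw [this]
  exact MeasurableSet.iUnion fun s ↦ hcode s

open Classical in
lemma measurableSet_mem_markComplex {d : ℕ} {A : Type*} [MeasurableSpace A] {α : ℕ}
    {φ : (j : ℕ) → (Fin (j + 1) → (Fin d → ℝ) × A) → unitInterval} (hφ : IsConnection α φ)
    {y : Ω → L → (Fin d → ℝ) × A} {u : Ω → Finset L → unitInterval}
    (hy : ∀ l, Measurable fun ω ↦ y ω l) (hu : ∀ ρ, Measurable fun ω ↦ u ω ρ) (σ : Finset L) :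
    MeasurableSet {ω | σ ∈ (markComplex α φ (y ω) (u ω)).faces} := by
  have : {ω | σ ∈ (markComplex α φ (y ω) (u ω)).faces} = {_ω | σ.Nonempty ∧ σ.card ≤ α + 1} ∩
      ⋂ j : Icc 1 α, ⋂ z : {z : Fin ((j : ℕ) + 1) → L // Function.Injective z ∧ ∀ i, z i ∈ σ},
        {ω | u ω (Finset.univ.image z.1) ≤ φ j fun i ↦ y ω (z.1 i)} := by
    ext ω
    simp only [markComplex, mem_inter_iff, mem_ofPred_eq, mem_iInter, Subtype.forall, and_assoc,
      and_imp]
  rw [this]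
  refine (MeasurableSet.const _).inter (.iInter fun j ↦ .iInter fun z ↦ ?_)
  exact measurableSet_le (hu _)
    ((hφ.measurable j j.2).comp (measurable_pi_lambda _ fun i ↦ hy (z.1 i)))

end Measurability

/-! ### The combinatorial model -/

section Model

/-- The unit cubes, indexed by their lower corners. -/
abbrev Cell (d : ℕ) : Type := Fin d → ℤ

/-- Labels: `some (c, j)` is the `j`-th point in the cell `c`, and `none` is an additional point. -/
abbrev Label (d : ℕ) : Type := Option (Cell d × ℕ)

/-- The relative position and the mark of a point together with the variable that decides about a
simplex. -/
abbrev Datum (d : ℕ) (A : Type*) : Type _ := ((Fin d → unitInterval) × A) × unitInterval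

/-- Points (at singletons) and decision variables (at larger sets). -/
abbrev Field (d : ℕ) (A : Type*) : Type _ := Finset (Label d) → Datum d A

/-- Coordinates of the model: a number of points for each cell and a datum for each set of labels. -/
abbrev Idx (d : ℕ) : Type := Cell d ⊕ Finset (Label d)

/-- Configurations of the model. -/
abbrev Config (d : ℕ) (A : Type*) : Type _ := Idx d → ℕ × Datum d A

/-- Sets of pairs of cells and relative positions. -/
abbrev Region (d : ℕ) : Type := Set (Cell d × (Fin d → unitInterval))

variable {d : ℕ} {A : Type*}

/-- The law of one coordinate. -/
def siteLaw (d : ℕ) [MeasurableSpace A] (γ : ℝ≥0) (Θ : Measure A) : Measure (ℕ × Datum d A) :=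
  (poissonMeasure γ).prod
    (((volume : Measure (Fin d → unitInterval)).prod Θ).prod (volume : Measure unitInterval))

instance [MeasurableSpace A] (γ : ℝ≥0) (Θ : Measure A) [IsProbabilityMeasure Θ] :
    IsProbabilityMeasure (siteLaw d γ Θ) := by
  unfold siteLaw; infer_instance

/-- The law of a configuration. -/
def configLaw (d : ℕ) [MeasurableSpace A] (γ : ℝ≥0) (Θ : Measure A) [IsProbabilityMeasure Θ] :
    Measure (Config d A) := Measure.infinitePi fun _ ↦ siteLaw d γ Θ

instance [MeasurableSpace A] (γ : ℝ≥0) (Θ : Measure A) [IsProbabilityMeasure Θ] :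
    IsProbabilityMeasure (configLaw d γ Θ) := by
  unfold configLaw; infer_instance

/-- The numbers of points. -/
def cnt (ω : Config d A) (c : Cell d) : ℕ := (ω (.inl c)).1

/-- The data. -/
def field (ω : Config d A) : Field d A := fun ρ ↦ (ω (.inr ρ)).2

/-- The cell of a label. -/
def cellOf : Label d → Cell d
  | none => 0
  | some p => p.1

/-- The relative position of a label. -/
def rel (q : Field d A) (l : Label d) : Fin d → unitInterval := (q {l}).1.1

/-- The vertex that belongs to a label. -/
def vtx (q : Field d A) (l : Label d) : (Fin d → ℝ) × A :=
  (fun i ↦ (cellOf l i : ℝ) + rel q l i, (q {l}).1.2)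

/-- The complex on all labels. -/
def labelComplex (α : ℕ) (φ : (j : ℕ) → (Fin (j + 1) → (Fin d → ℝ) × A) → unitInterval)
    (q : Field d A) : PreAbstractSimplicialComplex (Label d) :=
  markComplex α φ (vtx q) fun ρ ↦ (q ρ).2

/-- The labels of the points in the region `E`. -/
def verts (E : Region d) (N : Cell d → ℕ) (q : Field d A) : Set (Label d) :=
  {l | ∃ c j, l = some (c, j) ∧ j < N c ∧ (c, rel q l) ∈ E}

/-- The Betti number of the complex in the region `E`. -/
def bettiIn (α : ℕ) (φ : (j : ℕ) → (Fin (j + 1) → (Fin d → ℝ) × A) → unitInterval) (p : ℕ)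
    (E : Region d) (N : Cell d → ℕ) (q : Field d A) : ℝ :=
  betti p (restrict (labelComplex α φ q) (verts E N q))

open Classical in
/-- The change of the Betti number in the region `E` when the label `l` is added. -/
def diffIn (α : ℕ) (φ : (j : ℕ) → (Fin (j + 1) → (Fin d → ℝ) × A) → unitInterval) (p : ℕ)
    (E : Region d) (l : Label d) (N : Cell d → ℕ) (q : Field d A) : ℝ :=
  if (cellOf l, rel q l) ∈ E then bettiDiff (labelComplex α φ q) p (verts E N q) l else 0

/-- The degree of `l` in the region `E`. -/
def degIn (α : ℕ) (φ : (j : ℕ) → (Fin (j + 1) → (Fin d → ℝ) × A) → unitInterval)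
    (E : Region d) (l : Label d) (N : Cell d → ℕ) (q : Field d A) : ℕ :=
  (nbrs (labelComplex α φ q) (verts E N q) l).ncard

/-- The cells of a region. -/
def cells (E : Region d) : Set (Cell d) := Prod.fst '' E

/-- The translation of a region. -/
def shiftRegion (k : Cell d) (E : Region d) : Region d := {x | (x.1 + k, x.2) ∈ E}

variable {α : ℕ} {φ : (j : ℕ) → (Fin (j + 1) → (Fin d → ℝ) × A) → unitInterval}
  {E E' : Region d} {N N' : Cell d → ℕ} {q q' : Field d A} {l : Label d} {p : ℕ}

lemma none_notMem_verts : none ∉ verts E N q := by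
  rintro ⟨c, j, h, -⟩
  cases h

lemma some_mem_verts {c : Cell d} {j : ℕ} :
    some (c, j) ∈ verts E N q ↔ j < N c ∧ (c, rel q (some (c, j))) ∈ E := by
  constructor
  · rintro ⟨c, j, h, h'⟩
    cases h
    exact h'
  · exact fun h ↦ ⟨c, j, rfl, h⟩

lemma verts_mono (h : E ⊆ E') : verts E N q ⊆ verts E' N q := by
  rintro _ ⟨c, j, rfl, h1, h2⟩
  exact ⟨c, j, rfl, h1, h h2⟩

lemma verts_finite (hE : (cells E).Finite) : (verts E N q).Finite := by
  have h : (⋃ c ∈ cells E, (fun j ↦ some (c, j)) '' {j | j < N c} : Set (Label d)).Finite :=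
    hE.biUnion fun c _ ↦ (finite_lt_nat (N c)).image _
  refine h.subset ?_
  rintro _ ⟨c, j, rfl, h1, h2⟩
  exact mem_biUnion (mem_image_of_mem _ h2) ⟨j, h1, rfl⟩

/-- Adding one point to the cell `k`. -/
lemma bettiIn_update_succ (k : Cell d) (i : ℕ) :
    bettiIn α φ p E (Function.update N k (i + 1)) q - bettiIn α φ p E (Function.update N k i) q =
      diffIn α φ p E (some (k, i)) (Function.update N k i) q := by
  classical
  have hv : verts E (Function.update N k (i + 1)) q =
      if (k, rel q (some (k, i))) ∈ E then insert (some (k, i)) (verts E (Function.update N k i) q)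
      else verts E (Function.update N k i) q := by
    ext l
    rcases l with _ | ⟨c, j⟩
    · split_ifs <;> simp [none_notMem_verts]
    · split_ifs with h
      · rw [mem_insert_iff, some_mem_verts, some_mem_verts]
        obtain rfl | hc := eq_or_ne c k
        · simp only [Function.update_self, Option.some.injEq, Prod.mk.injEq, true_and]
          constructor
          · rintro ⟨h1, h2⟩
            rcases Nat.lt_succ_iff_lt_or_eq.1 h1 with h1 | h1
            exacts [Or.inr ⟨h1, h2⟩, Or.inl h1]
          · rintro (rfl | ⟨h1, h2⟩)
            exacts [⟨Nat.lt_succ_self _, h⟩, ⟨h1.trans (Nat.lt_succ_self _), h2⟩]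
        · simp [hc]
      · rw [some_mem_verts, some_mem_verts]
        obtain rfl | hc := eq_or_ne c k
        · simp only [Function.update_self]
          constructor
          · rintro ⟨h1, h2⟩
            rcases Nat.lt_succ_iff_lt_or_eq.1 h1 with h1 | rfl
            exacts [⟨h1, h2⟩, absurd h2 h]
          · rintro ⟨h1, h2⟩
            exact ⟨h1.trans (Nat.lt_succ_self _), h2⟩
        · simp [hc]
  rw [bettiIn, bettiIn, diffIn, bettiDiff, hv]
  by_cases h : (k, rel q (some (k, i))) ∈ E <;> simp [h, cellOf]

end Model

/-! ### Measurability, locality and relabelling in the model. -/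

section Model

variable {d : ℕ} {A : Type*} [MeasurableSpace A] {α : ℕ}
  {φ : (j : ℕ) → (Fin (j + 1) → (Fin d → ℝ) × A) → unitInterval}
  {E E' : Region d} {N N' : Cell d → ℕ} {q q' : Field d A} {l : Label d} {p : ℕ}

/-! ### Measurability -/

section Measurable

variable {Ω : Type*} [MeasurableSpace Ω] {M : Ω → Cell d → ℕ} {r : Ω → Field d A}

@[fun_prop]
lemma measurable_cnt : Measurable (cnt : Config d A → Cell d → ℕ) := by
  unfold cnt; fun_prop

@[fun_prop]
lemma measurable_field : Measurable (field : Config d A → Field d A) := by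
  unfold field; fun_prop

@[fun_prop]
lemma measurable_rel (l : Label d) : Measurable fun q : Field d A ↦ rel q l := by
  unfold rel; fun_prop

@[fun_prop]
lemma measurable_vtx (l : Label d) : Measurable fun q : Field d A ↦ vtx q l := by
  unfold vtx
  refine Measurable.prodMk (measurable_pi_lambda _ fun i ↦ ?_) (by fun_prop)
  exact measurable_const.add (measurable_subtype_coe.comp (by unfold rel; fun_prop))

lemma measurableSet_mem_labelComplex (hφ : IsConnection α φ) (hr : Measurable r)
    (σ : Finset (Label d)) : MeasurableSet {x | σ ∈ (labelComplex α φ (r x)).faces} :=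
  measurableSet_mem_markComplex hφ (fun l ↦ (measurable_vtx l).comp hr)
    (fun ρ ↦ by fun_prop) σ

lemma measurableSet_mem_verts (hE : MeasurableSet E) (hM : Measurable M) (hr : Measurable r)
    (l : Label d) : MeasurableSet {x | l ∈ verts E (M x) (r x)} := by
  rcases l with _ | ⟨c, j⟩
  · simp [none_notMem_verts]
  · simp only [some_mem_verts]
    refine MeasurableSet.inter (s₁ := {x | j < M x c}) ?_ ?_
    · exact measurableSet_lt measurable_const ((measurable_pi_apply c).comp hM)
    · exact hE.preimage (by fun_prop)

lemma measurableSet_mem_restrict {L : Type*} {K : Ω → PreAbstractSimplicialComplex L}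
    {S : Ω → Set L} {σ : Finset L} (hK : MeasurableSet {x | σ ∈ (K x).faces})
    (hS : ∀ l, MeasurableSet {x | l ∈ S x}) :
    MeasurableSet {x | σ ∈ (restrict (K x) (S x)).faces} := by
  have : {x | σ ∈ (restrict (K x) (S x)).faces} =
      {x | σ ∈ (K x).faces} ∩ ⋂ l ∈ σ, {x | l ∈ S x} := by
    ext x
    simp [restrict, Set.subset_def]
  rw [this]
  exact hK.inter (Finset.measurableSet_biInter _ fun l _ ↦ hS l)

lemma measurableSet_mem_insert {L : Type*} {S : Ω → Set L} (hS : ∀ l, MeasurableSet {x | l ∈ S x})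
    (v l : L) : MeasurableSet {x | l ∈ insert v (S x)} := by
  simp only [mem_insert_iff]
  exact (MeasurableSet.const _).union (hS l)

lemma measurable_bettiIn (hφ : IsConnection α φ) (hE : MeasurableSet E) (hEc : (cells E).Finite)
    (hM : Measurable M) (hr : Measurable r) :
    Measurable fun x ↦ bettiIn α φ p E (M x) (r x) :=
  measurable_of_faces (fun σ ↦ measurableSet_mem_restrict (measurableSet_mem_labelComplex hφ hr σ)
    (measurableSet_mem_verts hE hM hr)) (fun _ ↦ restrict_faces_finite (verts_finite hEc)) _

lemma measurable_diffIn (hφ : IsConnection α φ) (hE : MeasurableSet E) (hEc : (cells E).Finite)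
    (hM : Measurable M) (hr : Measurable r) (l : Label d) :
    Measurable fun x ↦ diffIn α φ p E l (M x) (r x) := by
  classical
  refine Measurable.ite (hE.preimage (by fun_prop)) ?_ measurable_const
  refine Measurable.sub ?_ (measurable_bettiIn hφ hE hEc hM hr)
  exact measurable_of_faces (fun σ ↦ measurableSet_mem_restrict
    (measurableSet_mem_labelComplex hφ hr σ)
    (measurableSet_mem_insert (measurableSet_mem_verts hE hM hr) l))
    (fun _ ↦ restrict_faces_finite ((verts_finite hEc).insert _)) _

end Measurable

/-! ### Dependence on the coordinates -/

/-- The set of the coordinates for the cells in `T`. -/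
def coordsOf (T : Set (Cell d)) : Set (Idx d) :=
  {i | (∃ c ∈ T, i = .inl c) ∨
    ∃ ρ : Finset (Label d), ρ.Nonempty ∧ (∀ l ∈ ρ, ∃ c ∈ T, ∃ j, l = some (c, j)) ∧ i = .inr ρ}

omit [MeasurableSpace A] in
lemma verts_congr {T : Set (Cell d)} (hE : cells E ⊆ T) (hN : ∀ c ∈ T, N c = N' c)
    (hq : ∀ c ∈ T, ∀ j, q {some (c, j)} = q' {some (c, j)}) : verts E N q = verts E N' q' := by
  ext l
  rcases l with _ | ⟨c, j⟩
  · simp [none_notMem_verts]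
  · rw [some_mem_verts, some_mem_verts]
    by_cases hc : c ∈ T
    · rw [hN c hc, rel, rel, hq c hc]
    · have h0 (x) : (c, x) ∉ E := fun h ↦ hc (hE (mem_image_of_mem Prod.fst h))
      simp [h0]

lemma restrict_labelComplex_congr {S : Set (Label d)} (hφ : IsConnection α φ)
    (h : ∀ ρ : Finset (Label d), ρ.Nonempty → (ρ : Set (Label d)) ⊆ S → q ρ = q' ρ) :
    restrict (labelComplex α φ q) S = restrict (labelComplex α φ q') S := by
  classical
  have h1 := restrict_markComplex_map (S := S) (e := id) hφ (injOn_id _) 0 (y := vtx q')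
    (u := fun ρ ↦ (q' ρ).2) (y' := vtx q) (u' := fun ρ ↦ (q ρ).2) ?_ ?_
  · rw [image_id] at h1
    rw [labelComplex, labelComplex, ← h1]
    apply PreAbstractSimplicialComplex.ext
    ext σ
    simp [PreAbstractSimplicialComplex.map]
  · intro l hl
    have := h {l} (by simp) (by simpa using hl)
    simp [vtx, rel, this]
  · intro ρ hρ hc
    rw [h ρ (Finset.card_pos.1 (by omega)) hρ]
    simp

lemma bettiIn_congr (hφ : IsConnection α φ) {T : Set (Cell d)} (hE : cells E ⊆ T)
    (hN : ∀ c ∈ T, N c = N' c)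
    (hq : ∀ ρ : Finset (Label d), ρ.Nonempty → (∀ l ∈ ρ, ∃ c ∈ T, ∃ j, l = some (c, j)) →
      q ρ = q' ρ) : bettiIn α φ p E N q = bettiIn α φ p E N' q' := by
  have hv : verts E N q = verts E N' q' := verts_congr hE hN
    fun c hc j ↦ hq _ (by simp) (fun l hl ↦ ⟨c, hc, j, Finset.mem_singleton.1 hl⟩)
  rw [bettiIn, bettiIn, ← hv]
  congr 1
  refine restrict_labelComplex_congr hφ fun ρ hne hρ ↦ hq ρ hne fun l hl ↦ ?_
  obtain ⟨c, j, rfl, -, h⟩ := hρ hl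
  exact ⟨c, hE (mem_image_of_mem Prod.fst h), j, rfl⟩

lemma diffIn_congr (hφ : IsConnection α φ) {T : Set (Cell d)} (hE : cells E ⊆ T)
    (hN : ∀ c ∈ T, N c = N' c) {k : Cell d} (hk : k ∈ T) (i : ℕ)
    (hq : ∀ ρ : Finset (Label d), ρ.Nonempty → (∀ l ∈ ρ, ∃ c ∈ T, ∃ j, l = some (c, j)) →
      q ρ = q' ρ) :
    diffIn α φ p E (some (k, i)) N q = diffIn α φ p E (some (k, i)) N' q' := by
  have hv : verts E N q = verts E N' q' := verts_congr hE hN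
    fun c hc j ↦ hq _ (by simp) (fun l hl ↦ ⟨c, hc, j, Finset.mem_singleton.1 hl⟩)
  have hsub : ∀ l ∈ verts E N q, ∃ c ∈ T, ∃ j, l = some (c, j) := by
    rintro _ ⟨c, j, rfl, -, h⟩
    exact ⟨c, hE (mem_image_of_mem Prod.fst h), j, rfl⟩
  have hrel : rel q (some (k, i)) = rel q' (some (k, i)) := by
    rw [rel, rel, hq _ (by simp) (fun l hl ↦ ⟨k, hk, i, Finset.mem_singleton.1 hl⟩)]
  rw [diffIn, diffIn, bettiDiff, bettiDiff, ← hv, hrel]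
  rw [restrict_labelComplex_congr (q := q) (q' := q') hφ fun ρ hne hρ ↦ hq ρ hne fun l hl ↦ ?_,
    restrict_labelComplex_congr (q := q) (q' := q') hφ fun ρ hne hρ ↦ hq ρ hne fun l hl ↦ ?_]
  · exact hsub l (hρ hl)
  · rcases hρ hl with rfl | h
    exacts [⟨k, hk, i, rfl⟩, hsub l h]

/-- Betti numbers of regions over disjoint families of cells thus use disjoint sets of coordinates
and are independent. -/
lemma dependsOn_bettiIn (hφ : IsConnection α φ) {T : Set (Cell d)} (hE : cells E ⊆ T) :
    DependsOn (fun ω : Config d A ↦ bettiIn α φ p E (cnt ω) (field ω)) (coordsOf T) :=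
  fun ω ω' h ↦ bettiIn_congr hφ hE
    (fun c hc ↦ by rw [cnt, cnt, h (.inl c) (Or.inl ⟨c, hc, rfl⟩)])
    fun ρ h1 h2 ↦ by rw [field, field, h (.inr ρ) (Or.inr ⟨ρ, h1, h2, rfl⟩)]

/-- The region without the cell `k`. -/
def eraseCell (k : Cell d) (E : Region d) : Region d := {x | x ∈ E ∧ x.1 ≠ k}

omit [MeasurableSpace A] in
lemma bettiIn_update_zero (k : Cell d) :
    bettiIn α φ p E (Function.update N k 0) q = bettiIn α φ p (eraseCell k E) N q := by
  have : verts E (Function.update N k 0) q = verts (eraseCell k E) N q := by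
    ext l
    rcases l with _ | ⟨c, j⟩
    · simp [none_notMem_verts]
    · rw [some_mem_verts, some_mem_verts]
      obtain rfl | hc := eq_or_ne c k
      · simp [eraseCell]
      · simp [hc, eraseCell]
  rw [bettiIn, bettiIn, this]

/-! ### Relabelling -/

/-- Moves the additional point to the label `(k, i)` and shifts all other labels by `k`. -/
def relabel (k : Cell d) (i : ℕ) : Label d → Label d
  | none => some (k, i)
  | some (c, j) => if c = 0 ∧ j = i then none else some (c + k, j)

omit [MeasurableSpace A] in
-- The label `(0, i)` is the only one whose shift collides with `(k, i)`, the image of the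
-- additional point. It is sent to `none` instead.
lemma relabel_injective (k : Cell d) (i : ℕ) : Function.Injective (relabel k i) := by
  rintro (_ | ⟨c, j⟩) (_ | ⟨c', j'⟩) h
  · rfl
  · simp only [relabel] at h
    split_ifs at h with h1
    simp only [Option.some.injEq, Prod.mk.injEq] at h
    exact absurd ⟨by simpa using h.1.symm, h.2.symm⟩ h1
  · simp only [relabel] at h
    split_ifs at h with h1
    simp only [Option.some.injEq, Prod.mk.injEq] at h
    exact absurd ⟨by simpa using h.1, h.2⟩ h1
  · simp only [relabel] at h
    split_ifs at h with h1 h2 h2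
    · rw [h1.1, h1.2, h2.1, h2.2]
    · simpa using h

/-- The map of coordinates that belongs to `relabel`. -/
def relabelIdx (k : Cell d) (i : ℕ) : Idx d → Idx d
  | .inl c => .inl (c + k)
  | .inr ρ => .inr (ρ.map ⟨relabel k i, relabel_injective k i⟩)

lemma relabelIdx_injective (k : Cell d) (i : ℕ) : Function.Injective (relabelIdx k i) := by
  rintro (c | ρ) (c' | ρ') h <;> simp only [relabelIdx, Sum.inl.injEq, Sum.inr.injEq] at h
  · simpa using h
  · cases h
  · cases h
  · rw [Finset.map_injective _ h]

/-- The relabelled configuration. -/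
def relabelled (k : Cell d) (i : ℕ) (ω : Config d A) : Config d A := fun x ↦ ω (relabelIdx k i x)

lemma measurePreserving_relabelled (γ : ℝ≥0) (Θ : Measure A) [IsProbabilityMeasure Θ]
    (k : Cell d) (i : ℕ) :
    MeasurePreserving (relabelled k i) (configLaw d γ Θ) (configLaw d γ Θ) := by
  refine ⟨by unfold relabelled; fun_prop, ?_⟩
  exact Measure.map_infinitePi_infinitePi_of_inj (P := fun _ ↦ siteLaw d γ Θ)
    (relabelIdx_injective k i)

omit [MeasurableSpace A] in
-- Labels in a cell are smaller than the number of its points. If `k` holds exactly `i` points, then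
-- `(0, i)` is not in use after the shift, and the exceptional value of `relabel` does not occur.
lemma image_verts_relabelled {ω : Config d A} {k : Cell d} {i : ℕ} (h : cnt ω k = i) :
    relabel k i '' verts (shiftRegion k E) (cnt (relabelled k i ω)) (field (relabelled k i ω)) =
      verts E (cnt ω) (field ω) := by
  have hval (c j) (hj : j < cnt ω (c + k)) : relabel k i (some (c, j)) = some (c + k, j) := by
    rw [relabel, if_neg]
    rintro ⟨rfl, rfl⟩
    rw [zero_add, h] at hj
    exact lt_irrefl _ hj
  have hrel (l) : rel (field (relabelled k i ω)) l = rel (field ω) (relabel k i l) := by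
    simp [rel, field, relabelled, relabelIdx]
  ext l
  constructor
  · rintro ⟨_, ⟨c, j, rfl, h1, h2⟩, rfl⟩
    replace h1 : j < cnt ω (c + k) := h1
    rw [hrel, hval c j h1] at h2
    rw [hval c j h1]
    exact ⟨_, _, rfl, h1, h2⟩
  · rintro ⟨c, j, rfl, h1, h2⟩
    have e := hval (c - k) j (by simpa using h1)
    rw [sub_add_cancel] at e
    refine ⟨some (c - k, j), ⟨_, _, rfl, ?_, ?_⟩, e⟩
    · change j < cnt ω (c - k + k)
      simpa using h1
    · rw [hrel, e]
      simpa [shiftRegion] using h2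

/-- Seen from the cell `k`, its next point plays the role of an additional point in the cell `0`.
Together with `measurePreserving_relabelled` this takes the place of the Mecke formula. -/
lemma diffIn_relabelled (hφ : IsConnection α φ) {ω : Config d A} {k : Cell d} {i : ℕ}
    (h : cnt ω k = i) :
    diffIn α φ p (shiftRegion k E) none (cnt (relabelled k i ω)) (field (relabelled k i ω)) =
      diffIn α φ p E (some (k, i)) (cnt ω) (field ω) := by
  classical
  have hrel (l) : rel (field (relabelled k i ω)) l = rel (field ω) (relabel k i l) := by
    simp [rel, field, relabelled, relabelIdx]
  have key (S : Set (Label d)) (hS : ∀ c j, some (c, j) ∈ S → j < cnt ω (c + k)) :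
      betti p (restrict (labelComplex α φ (field (relabelled k i ω))) S) =
        betti p (restrict (labelComplex α φ (field ω)) (relabel k i '' S)) := by
    refine betti_markComplex_map hφ (relabel_injective k i).injOn (fun x ↦ - (k x : ℝ)) p ?_ ?_
    · rintro (_ | ⟨c, j⟩) hl
      · simp [vtx, cellOf, relabel, rel, field, relabelled, relabelIdx]
        ext x
        simp
      · have hj := hS c j hl
        have e : relabel k i (some (c, j)) = some (c + k, j) := by
          rw [relabel, if_neg]
          rintro ⟨rfl, rfl⟩
          rw [zero_add, h] at hj
          exact lt_irrefl _ hj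
        simp [vtx, hrel, e, cellOf, field, relabelled, relabelIdx]
        ext x
        simp
        ring
    · intro ρ _ _
      simp only [field, relabelled, relabelIdx, Finset.map_eq_image, Function.Embedding.coeFn_mk]
      congr!
  rw [diffIn, diffIn, hrel]
  have hcond : ((cellOf (none : Label d), rel (field ω) (relabel k i none)) ∈ shiftRegion k E) ↔
      (cellOf (some (k, i)), rel (field ω) (some (k, i))) ∈ E := by
    simp [shiftRegion, cellOf, relabel]
  simp only [hcond]
  congr 1
  rw [bettiDiff, bettiDiff, key, key, image_insert_eq, image_verts_relabelled h]
  · rfl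
  · rintro c j ⟨c', j', h1, h2, -⟩
    cases h1
    exact h2
  · intro c j hcj
    rcases hcj with hcj | ⟨c', j', h1, h2, -⟩
    · cases hcj
    · cases h1
      exact h2

end Model

/-! ### Poisson variables -/

section Poisson

/-- Write `n = m + i + 1`. Then `n / n! = 1 / (m + i)! ≤ 1 / (m! * i!)`, and summation over `m`
gives the factor `exp γ`; the remaining power of `γ` is the factor in front. -/
lemma lintegral_poisson_tail_le (γ : ℝ≥0) (i : ℕ) :
    ∫⁻ n, (if i < n then (n : ℝ≥0∞) else 0) ∂poissonMeasure γ ≤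
      ENNReal.ofReal (γ * Real.exp γ) * poissonMeasure γ {i} := by
  rw [lintegral_countable']
  have hinj : Function.Injective fun m : ℕ ↦ m + (i + 1) := add_left_injective _
  rw [← hinj.tsum_eq]
  · have hs := (NormedSpace.expSeries_div_hasSum_exp (𝔸 := ℝ) (γ : ℝ))
    rw [← Real.exp_eq_exp_ℝ] at hs
    calc ∑' m : ℕ, (if i < m + (i + 1) then ((m + (i + 1) : ℕ) : ℝ≥0∞) else 0) *
          poissonMeasure γ {m + (i + 1)}
        ≤ ∑' m : ℕ, ENNReal.ofReal (γ * (Real.exp (-γ) * γ ^ i / i.factorial) *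
            ((γ : ℝ) ^ m / m.factorial)) := by
          refine ENNReal.tsum_le_tsum fun m ↦ ?_
          rw [if_pos (by omega), poissonMeasure_singleton, ← ENNReal.ofReal_natCast,
            ← ENNReal.ofReal_mul (by positivity)]
          refine ENNReal.ofReal_le_ofReal ?_
          have h1 : ((m.factorial * i.factorial : ℕ) : ℝ) ≤ ((m + i).factorial : ℕ) := by
            exact_mod_cast Nat.le_of_dvd (Nat.factorial_pos _)
              (Nat.factorial_mul_factorial_dvd_factorial_add m i)
          have h2 : (((m + (i + 1)).factorial : ℕ) : ℝ) = (m + i + 1) * (m + i).factorial := by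
            rw [← add_assoc, Nat.factorial_succ]; push_cast; ring
          have h3 : (0 : ℝ) < m.factorial * i.factorial := by positivity
          push_cast at h1
          rw [h2]
          push_cast
          calc (m + (i + 1) : ℝ) * (Real.exp (-γ) * γ ^ (m + (i + 1)) /
                ((m + i + 1) * (m + i).factorial))
              = Real.exp (-γ) * γ ^ (m + (i + 1)) / (m + i).factorial := by
                field_simp
                ring
            _ ≤ Real.exp (-γ) * γ ^ (m + (i + 1)) / (m.factorial * i.factorial) := by
                gcongr
            _ = _ := by
                field_simp
                ring
      _ = ENNReal.ofReal (γ * (Real.exp (-γ) * γ ^ i / i.factorial) * Real.exp γ) := by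
          rw [← ENNReal.ofReal_tsum_of_nonneg (fun m ↦ by positivity) (hs.summable.mul_left _),
            tsum_mul_left, hs.tsum_eq]
      _ = _ := by
          rw [poissonMeasure_singleton, ← ENNReal.ofReal_mul (by positivity)]
          congr 1
          ring
  · intro n hn
    by_cases h : i < n
    · exact ⟨n - (i + 1), by simp only; omega⟩
    · simp [h] at hn

lemma lintegral_nat_partition {Ω : Type*} [MeasurableSpace Ω] {μ : Measure Ω} {X : Ω → ℕ}
    (hX : Measurable X) {g : ℕ → Ω → ℝ≥0∞} (hg : ∀ i, Measurable (g i)) :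
    ∫⁻ ω, g (X ω) ω ∂μ = ∑' i, ∫⁻ ω, (if X ω = i then g i ω else 0) ∂μ := by
  have hm (i : ℕ) : Measurable fun ω ↦ if X ω = i then g i ω else 0 :=
    Measurable.ite (hX (measurableSet_singleton i)) (hg i) measurable_const
  rw [← lintegral_tsum fun i ↦ (hm i).aemeasurable]
  refine lintegral_congr fun ω ↦ ?_
  rw [tsum_eq_single (X ω) fun i hi ↦ if_neg (Ne.symm hi), if_pos rfl]

end Poisson

/-! ### Mecke-type relations between the points of a cell and an additional point. -/

section Model

variable {d : ℕ} {A : Type*} [MeasurableSpace A] {α : ℕ}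
  {φ : (j : ℕ) → (Fin (j + 1) → (Fin d → ℝ) × A) → unitInterval}
  {E E' : Region d} {N N' : Cell d → ℕ} {q q' : Field d A} {l : Label d} {p : ℕ}
  (γ : ℝ≥0) (Θ : Measure A) [IsProbabilityMeasure Θ]

lemma lintegral_siteLaw_fst {f : ℕ → ℝ≥0∞} :
    ∫⁻ z, f z.1 ∂siteLaw d γ Θ = ∫⁻ n, f n ∂poissonMeasure γ := by
  rw [siteLaw]
  exact (measurePreserving_fst.lintegral_comp (measurable_of_countable f))

/-- The sum over the points in a cell of functions that do not depend on their number, compared with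
an additional point. -/
lemma lintegral_cnt_mul_sum_le (k : Cell d) {H : ℕ → Config d A → ℝ≥0∞}
    (hH : ∀ i, Measurable (H i)) (hHd : ∀ i, DependsOn (H i) {Sum.inl k}ᶜ) :
    ∫⁻ ω, cnt ω k * ∑ i ∈ Finset.range (cnt ω k), H i ω ∂configLaw d γ Θ ≤
      ENNReal.ofReal (γ * Real.exp γ) * ∫⁻ ω, H (cnt ω k) ω ∂configLaw d γ Θ := by
  have hm (f : ℕ → ℝ≥0∞) : Measurable fun z : ℕ × Datum d A ↦ f z.1 :=
    (measurable_of_countable f).comp measurable_fst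
  have e1 : ∀ ω : Config d A, cnt ω k * ∑ i ∈ Finset.range (cnt ω k), H i ω =
      ∑' i, (if i < (ω (.inl k)).1 then ((ω (.inl k)).1 : ℝ≥0∞) else 0) * H i ω := by
    intro ω
    rw [Finset.mul_sum, tsum_eq_sum (s := Finset.range (cnt ω k))]
    · refine Finset.sum_congr rfl fun i hi ↦ ?_
      rw [Finset.mem_range] at hi
      rw [if_pos (show i < (ω (.inl k)).1 from hi)]
      rfl
    · intro i hi
      rw [Finset.mem_range] at hi
      rw [if_neg (show ¬ i < (ω (.inl k)).1 from hi), zero_mul]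
  simp only [e1]
  have hm' (i : ℕ) : Measurable fun ω : Config d A ↦
      (if i < (ω (.inl k)).1 then ((ω (.inl k)).1 : ℝ≥0∞) else 0) :=
    (hm fun n ↦ if i < n then (n : ℝ≥0∞) else 0).comp (measurable_pi_apply _)
  have hm2 (i : ℕ) : Measurable fun ω : Config d A ↦
      (if i < (ω (.inl k)).1 then ((ω (.inl k)).1 : ℝ≥0∞) else 0) * H i ω := (hm' i).mul (hH i)
  rw [lintegral_tsum fun i ↦ (hm2 i).aemeasurable,
    lintegral_nat_partition (X := fun ω ↦ cnt ω k) (by fun_prop) hH, ← ENNReal.tsum_mul_left]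
  refine ENNReal.tsum_le_tsum fun i ↦ ?_
  -- The weight is a function of the number of points in `k`, which `H i` ignores. By
  -- `lintegral_poisson_tail_le` its mean is at most a constant times the probability of exactly `i`
  -- points.
  rw [configLaw, lintegral_mul_of_dependsOn (siteLaw d γ Θ) (hH i) (hHd i)
    (hm fun n ↦ if i < n then (n : ℝ≥0∞) else 0),
    lintegral_siteLaw_fst γ Θ (f := fun n ↦ if i < n then (n : ℝ≥0∞) else 0)]
  have e2 : ∀ ω : Config d A, (if cnt ω k = i then H i ω else 0) =
      (if (ω (.inl k)).1 = i then 1 else 0) * H i ω := by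
    intro ω
    rw [show cnt ω k = (ω (.inl k)).1 from rfl]
    split_ifs <;> simp
  simp only [e2]
  rw [lintegral_mul_of_dependsOn (siteLaw d γ Θ) (hH i) (hHd i)
    (hm fun n ↦ if n = i then 1 else 0),
    lintegral_siteLaw_fst γ Θ (f := fun n ↦ if n = i then 1 else 0), ← mul_assoc]
  gcongr
  refine (lintegral_poisson_tail_le γ i).trans (le_of_eq ?_)
  congr 1
  rw [← lintegral_indicator_one (measurableSet_singleton i)]
  refine lintegral_congr fun n ↦ ?_
  simp [indicator_apply]

/-- The next point in the cell `k` has the same effect as the additional point after a shift. -/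
lemma lintegral_diffIn_next (hφ : IsConnection α φ) (hE : MeasurableSet E) (hEc : (cells E).Finite)
    (hE' : MeasurableSet E') (hEc' : (cells E').Finite) (k : Cell d)
    {F : ℕ → ℝ → ℝ → ℝ≥0∞} (hF : ∀ i, Measurable fun x : ℝ × ℝ ↦ F i x.1 x.2) :
    ∫⁻ ω, F (cnt ω k) (diffIn α φ p E (some (k, cnt ω k)) (cnt ω) (field ω))
        (diffIn α φ p E' (some (k, cnt ω k)) (cnt ω) (field ω)) ∂configLaw d γ Θ =
      ∫⁻ ω, F (cnt ω 0) (diffIn α φ p (shiftRegion k E) none (cnt ω) (field ω))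
        (diffIn α φ p (shiftRegion k E') none (cnt ω) (field ω)) ∂configLaw d γ Θ := by
  have hsm {E : Region d} (hE : MeasurableSet E) : MeasurableSet (shiftRegion k E) :=
    hE.preimage (by fun_prop)
  have hsc {E : Region d} (hEc : (cells E).Finite) : (cells (shiftRegion k E)).Finite := by
    refine (hEc.image fun c ↦ c - k).subset ?_
    rintro _ ⟨⟨c, x⟩, hx, rfl⟩
    exact ⟨c + k, ⟨_, hx, rfl⟩, by simp⟩
  have hd {E : Region d} (hE : MeasurableSet E) (hEc : (cells E).Finite) (l : Label d) :
      Measurable fun ω : Config d A ↦ diffIn α φ p E l (cnt ω) (field ω) :=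
    measurable_diffIn hφ hE hEc measurable_cnt measurable_field l
  have hX (k : Cell d) : Measurable fun ω : Config d A ↦ cnt ω k := by fun_prop
  -- The relabelling involves the number `i` of points in the cell, so the integral is split
  -- according to this number.
  rw [lintegral_nat_partition (hX k)
    (g := fun i ω ↦ F i (diffIn α φ p E (some (k, i)) (cnt ω) (field ω))
        (diffIn α φ p E' (some (k, i)) (cnt ω) (field ω)))
    fun i ↦ (hF i).comp ((hd hE hEc _).prodMk (hd hE' hEc' _)),
    lintegral_nat_partition (hX 0)
    (g := fun i ω ↦ F i (diffIn α φ p (shiftRegion k E) none (cnt ω) (field ω))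
        (diffIn α φ p (shiftRegion k E') none (cnt ω) (field ω)))
    fun i ↦ (hF i).comp ((hd (hsm hE) (hsc hEc) _).prodMk (hd (hsm hE') (hsc hEc') _))]
  congr 1
  ext i
  rw [← (measurePreserving_relabelled γ Θ k i).lintegral_comp (f := fun ω ↦
    if cnt ω 0 = i then F i (diffIn α φ p (shiftRegion k E) none (cnt ω) (field ω))
        (diffIn α φ p (shiftRegion k E') none (cnt ω) (field ω)) else 0)]
  · refine lintegral_congr fun ω ↦ ?_
    have : cnt (relabelled k i ω) 0 = cnt ω k := by
      simp [cnt, relabelled, relabelIdx]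
    rw [this]
    split_ifs with h
    · rw [diffIn_relabelled hφ h, diffIn_relabelled hφ h]
    · rfl
  · exact Measurable.ite (hX 0 (measurableSet_singleton i))
      ((hF i).comp ((hd (hsm hE) (hsc hEc) _).prodMk (hd (hsm hE') (hsc hEc') _))) measurable_const

end Model

/-! ### Decomposition of space into unit cubes -/

section Cubes

variable {d : ℕ}

lemma map_coe_volume_unitCube :
    (volume : Measure (Fin d → unitInterval)).map (fun ξ i ↦ (ξ i : ℝ)) =
      volume.restrict (univ.pi fun _ : Fin d ↦ Ico (0 : ℝ) 1) := by
  have h1 : (volume : Measure unitInterval).map ((↑) : unitInterval → ℝ) =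
      volume.restrict (Icc 0 1) := map_comap_subtype_coe measurableSet_Icc _
  rw [volume_pi, volume_pi, Measure.restrict_pi_pi]
  have : SigmaFinite ((volume : Measure unitInterval).map ((↑) : unitInterval → ℝ)) := by
    rw [h1]; infer_instance
  rw [Measure.pi_map_pi (f := fun _ ↦ ((↑) : unitInterval → ℝ))
    fun _ ↦ measurable_subtype_coe.aemeasurable]
  congr 1
  ext1 i
  rw [h1]
  exact Measure.restrict_congr_set Ico_ae_eq_Icc.symm

lemma lintegral_eq_tsum_cells {f : (Fin d → ℝ) → ℝ≥0∞} (hf : Measurable f) :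
    ∫⁻ y, f y = ∑' k : Cell d, ∫⁻ ξ : Fin d → unitInterval, f fun i ↦ (k i : ℝ) + ξ i := by
  have hmeas (k : Cell d) : MeasurableSet {y : Fin d → ℝ | (fun i ↦ ⌊y i⌋) = k} := by
    have : Measurable fun y : Fin d → ℝ ↦ fun i ↦ ⌊y i⌋ := by fun_prop
    exact this (measurableSet_singleton k)
  have hU : ⋃ k : Cell d, {y : Fin d → ℝ | (fun i ↦ ⌊y i⌋) = k} = univ := by
    ext y; simp
  rw [← setLIntegral_univ, ← hU, lintegral_iUnion hmeas]
  · congr 1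
    ext k
    have e1 : ∫⁻ ξ : Fin d → unitInterval, f (fun i ↦ (k i : ℝ) + ξ i) =
        ∫⁻ y in univ.pi fun _ : Fin d ↦ Ico (0 : ℝ) 1, f ((fun i ↦ (k i : ℝ)) + y) := by
      rw [← map_coe_volume_unitCube, lintegral_map (by fun_prop)]
      · rfl
      · exact measurable_pi_lambda _ fun i ↦ measurable_subtype_coe.comp (measurable_pi_apply i)
    rw [e1, ← lintegral_indicator (hmeas k), ← lintegral_indicator
      (MeasurableSet.univ_pi fun _ ↦ measurableSet_Ico),
      ← lintegral_add_left_eq_self _ (fun i ↦ (k i : ℝ))]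
    congr 1
    ext y
    have : (fun i ↦ (k i : ℝ)) + y ∈ {y : Fin d → ℝ | (fun i ↦ ⌊y i⌋) = k} ↔
        y ∈ univ.pi fun _ : Fin d ↦ Ico (0 : ℝ) 1 := by
      simp only [mem_ofPred_eq, funext_iff, Pi.add_apply, Int.floor_intCast_add, mem_univ_pi,
        mem_Ico]
      exact forall_congr' fun i ↦ by rw [add_eq_left, Int.floor_eq_zero_iff, mem_Ico]
    by_cases h : y ∈ univ.pi fun _ : Fin d ↦ Ico (0 : ℝ) 1
    · rw [indicator_of_mem h, indicator_of_mem (this.2 h)]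
    · rw [indicator_of_notMem h, indicator_of_notMem fun h' ↦ h (this.1 h')]
  · intro k k' hkk
    rw [Function.onFun, Set.disjoint_left]
    rintro y rfl h
    exact hkk h

/-- The sum over the cells is an integral over all of `ℝ^d`, and translation invariance removes the
dependence on `x`. -/
lemma tsum_lintegral_cells {A : Type*} [MeasurableSpace A] {α : ℕ}
    {φ : (j : ℕ) → (Fin (j + 1) → (Fin d → ℝ) × A) → unitInterval} (hφ : IsConnection α φ)
    (hα : 1 ≤ α) (γ : ℝ≥0) (Θ : Measure A) [IsProbabilityMeasure Θ] (x : Fin d → ℝ) (a : A) :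
    γ * ∑' k : Cell d, ∫⁻ ξ : Fin d → unitInterval, ∫⁻ b,
      ENNReal.ofReal (φ 1 ![(x, a), (fun i ↦ (k i : ℝ) + ξ i, b)]) ∂Θ = mixing γ Θ φ a := by
  have hm : Measurable fun z : (Fin d → ℝ) × A ↦ ENNReal.ofReal (φ 1 ![(x, a), z]) := by
    refine ENNReal.measurable_ofReal.comp (measurable_subtype_coe.comp
      ((hφ.measurable 1 ⟨le_rfl, hα⟩).comp (measurable_pi_lambda _ fun i ↦ ?_)))
    fin_cases i
    · exact measurable_const
    · exact measurable_id
  rw [mixing, ← lintegral_eq_tsum_cells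
    (f := fun y ↦ ∫⁻ b, ENNReal.ofReal (φ 1 ![(x, a), (y, b)]) ∂Θ)
    (Measurable.lintegral_prod_right' (f := fun z : (Fin d → ℝ) × A ↦
      ENNReal.ofReal (φ 1 ![(x, a), z])) hm),
    ← lintegral_add_right_eq_self _ x]
  congr 1
  refine lintegral_congr fun y ↦ lintegral_congr fun b ↦ ?_
  rw [← hφ.translation 1 ⟨le_rfl, hα⟩ x ![(0, a), (y, b)]]
  congr 3
  ext1 i
  fin_cases i <;> simp

end Cubes

/-! ### Moments of the degree of the additional point -/

section Degree

variable {d : ℕ} {A : Type*} [MeasurableSpace A] {α : ℕ}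
  {φ : (j : ℕ) → (Fin (j + 1) → (Fin d → ℝ) × A) → unitInterval}
  {E E' : Region d} {N N' : Cell d → ℕ} {q q' : Field d A} {l : Label d} {p : ℕ}

open Classical in
/-- Indicates that the label `(k, i)` is joined to the additional point. -/
def joined (φ : (j : ℕ) → (Fin (j + 1) → (Fin d → ℝ) × A) → unitInterval) (k : Cell d) (i : ℕ)
    (q : Field d A) : ℕ :=
  if (q {none, some (k, i)}).2 ≤ φ 1 ![vtx q none, vtx q (some (k, i))] then 1 else 0

/-- The number of labels in the cells `T` that are joined to the additional point. -/
def joinedCount (φ : (j : ℕ) → (Fin (j + 1) → (Fin d → ℝ) × A) → unitInterval)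
    (T : Finset (Cell d)) (N : Cell d → ℕ) (q : Field d A) : ℕ :=
  ∑ k ∈ T, ∑ i ∈ Finset.range (N k), joined φ k i q

omit [MeasurableSpace A] in
lemma joined_le_one (k : Cell d) (i : ℕ) : joined φ k i q ≤ 1 := by
  unfold joined; split_ifs <;> simp

omit [MeasurableSpace A] in
-- Every neighbour passes the test for edges. The count on the right ignores which part of its cells
-- `E` covers, hence only an inequality.
lemma degIn_le_joinedCount (hα : 1 ≤ α) {T : Finset (Cell d)} (hE : cells E ⊆ T) :
    degIn α φ E none N q ≤ joinedCount φ T N q := by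
  classical
  set s := (T.sigma fun k ↦ Finset.range (N k)).filter fun x ↦ joined φ x.1 x.2 q = 1 with hs
  have h1 : joinedCount φ T N q = s.card := by
    rw [joinedCount, Finset.sum_sigma', hs, Finset.card_filter]
    refine Finset.sum_congr rfl fun x _ ↦ ?_
    unfold joined
    split_ifs <;> simp_all
  rw [h1, degIn, ← ncard_coe_finset]
  refine (ncard_le_ncard (t := (fun x : (_ : Cell d) × ℕ ↦ some (x.1, x.2)) '' (s : Set _)) ?_
    (s.finite_toSet.image _)).trans (ncard_image_le s.finite_toSet)
  rintro _ ⟨⟨c, j, rfl, hj, hc⟩, h2, h3⟩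
  refine ⟨⟨c, j⟩, ?_, rfl⟩
  simp only [hs, Finset.coe_filter, Finset.mem_sigma, Finset.mem_range, mem_ofPred_eq]
  refine ⟨⟨hE (mem_image_of_mem Prod.fst hc), hj⟩, ?_⟩
  rw [joined, if_pos]
  have h4 := h3.2.2 1 ⟨le_rfl, hα⟩ ![none, some (c, j)] ?_ ?_
  · have e1 : Finset.univ.image ![(none : Label d), some (c, j)] = {none, some (c, j)} := by
      ext x
      simp [Fin.exists_fin_two, eq_comm]
    have e2 : (fun i ↦ vtx q (![(none : Label d), some (c, j)] i)) =
        ![vtx q none, vtx q (some (c, j))] := by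
      ext1 i
      fin_cases i <;> rfl
    rw [e2] at h4
    convert h4
    convert e1.symm
  · intro a b hab
    fin_cases a <;> fin_cases b <;> simp_all
  · intro i
    fin_cases i <;> simp

lemma measurable_joined (hφ : IsConnection α φ) (hα : 1 ≤ α) (k : Cell d) (i : ℕ) :
    Measurable fun q : Field d A ↦ joined φ k i q := by
  classical
  refine Measurable.ite (measurableSet_le (by fun_prop) ?_) measurable_const measurable_const
  refine (hφ.measurable 1 ⟨le_rfl, hα⟩).comp (measurable_pi_lambda _ fun j ↦ ?_)
  fin_cases j
  · exact measurable_vtx none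
  · exact measurable_vtx (some (k, i))

lemma measurable_joinedCount (hφ : IsConnection α φ) (hα : 1 ≤ α) (T : Finset (Cell d)) :
    Measurable fun ω : Config d A ↦ joinedCount φ T (cnt ω) (field ω) := by
  refine Finset.measurable_sum _ fun k _ ↦ ?_
  have h1 : Measurable fun x : ℕ × Field d A ↦ ∑ i ∈ Finset.range x.1, joined φ k i x.2 :=
    measurable_from_prod_countable_right fun n ↦
      Finset.measurable_sum (Finset.range n) fun i _ ↦ measurable_joined hφ hα k i
  exact h1.comp (Measurable.prodMk (f := fun ω : Config d A ↦ cnt ω k) (by fun_prop) (by fun_prop))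

/-- The probability that a uniform point in the cell `k` is joined to `v`. -/
def joinProb (Θ : Measure A) (φ : (j : ℕ) → (Fin (j + 1) → (Fin d → ℝ) × A) → unitInterval)
    (k : Cell d) (v : (Fin d → ℝ) × A) : ℝ≥0∞ :=
  ∫⁻ ξ : Fin d → unitInterval, ∫⁻ b, ENNReal.ofReal (φ 1 ![v, (fun i ↦ (k i : ℝ) + ξ i, b)]) ∂Θ

variable (γ : ℝ≥0) (Θ : Measure A) [IsProbabilityMeasure Θ]

lemma measurable_phi_one (hφ : IsConnection α φ) (hα : 1 ≤ α) :
    Measurable fun z : ((Fin d → ℝ) × A) × ((Fin d → ℝ) × A) ↦ φ 1 ![z.1, z.2] := by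
  refine (hφ.measurable 1 ⟨le_rfl, hα⟩).comp (measurable_pi_lambda _ fun j ↦ ?_)
  fin_cases j
  · exact measurable_fst
  · exact measurable_snd

lemma measurable_cellPoint (k : Cell d) :
    Measurable fun x : (Fin d → unitInterval) × A ↦
      ((fun i ↦ (k i : ℝ) + x.1 i, x.2) : (Fin d → ℝ) × A) := by
  refine Measurable.prodMk (measurable_pi_lambda _ fun i ↦ ?_) measurable_snd
  exact measurable_const.add (measurable_subtype_coe.comp (by fun_prop))

lemma joinProb_eq (hφ : IsConnection α φ) (hα : 1 ≤ α) (k : Cell d) (v : (Fin d → ℝ) × A) :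
    joinProb Θ φ k v = ∫⁻ x : (Fin d → unitInterval) × A,
      ENNReal.ofReal (φ 1 ![v, (fun i ↦ (k i : ℝ) + x.1 i, x.2)]) ∂(volume.prod Θ) := by
  rw [joinProb, lintegral_prod]
  refine (ENNReal.measurable_ofReal.comp (measurable_subtype_coe.comp
    ((measurable_phi_one hφ hα).comp
      (measurable_const.prodMk (measurable_cellPoint k))))).aemeasurable

lemma measurable_joinProb (hφ : IsConnection α φ) (hα : 1 ≤ α) (k : Cell d) :
    Measurable fun v ↦ joinProb Θ φ k v := by
  simp only [joinProb_eq Θ hφ hα]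
  refine Measurable.lintegral_prod_right' (f := fun z : ((Fin d → ℝ) × A) × ((Fin d → unitInterval) × A) ↦
    ENNReal.ofReal (φ 1 ![z.1, (fun i ↦ (k i : ℝ) + z.2.1 i, z.2.2)])) ?_
  exact ENNReal.measurable_ofReal.comp (measurable_subtype_coe.comp
    ((measurable_phi_one hφ hα).comp
      (measurable_fst.prodMk ((measurable_cellPoint k).comp measurable_snd))))

lemma lintegral_siteLaw_snd {f : Datum d A → ℝ≥0∞} (hf : Measurable f) :
    ∫⁻ z, f z.2 ∂siteLaw d γ Θ =
      ∫⁻ x, ∫⁻ u, f (x, u) ∂(volume : Measure unitInterval) ∂(volume.prod Θ) := by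
  rw [siteLaw, measurePreserving_snd.lintegral_comp hf, lintegral_prod _ hf.aemeasurable]

lemma lintegral_ite_le (t : unitInterval) :
    ∫⁻ u : unitInterval, (if u ≤ t then 1 else 0 : ℝ≥0∞) = ENNReal.ofReal t := by
  have h : ∀ u, (if u ≤ t then 1 else 0 : ℝ≥0∞) = (Iic t).indicator 1 u := fun u ↦ by
    simp [indicator_apply]
  simp only [h]
  rw [lintegral_indicator_one measurableSet_Iic, unitInterval.volume_Iic]

open Classical in
-- Integrates out the decision variable of the pair first and the point `(k, i)` afterwards; what
-- remains depends only on the additional point.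
lemma lintegral_mul_joined (hφ : IsConnection α φ) (hα : 1 ≤ α) (k : Cell d) (i : ℕ)
    {X : Config d A → ℝ≥0∞} (hX : Measurable X)
    (hX1 : DependsOn X {Sum.inr {none, some (k, i)}}ᶜ) (hX2 : DependsOn X {Sum.inr {some (k, i)}}ᶜ) :
    ∫⁻ ω, X ω * joined φ k i (field ω) ∂configLaw d γ Θ =
      ∫⁻ ω, X ω * joinProb Θ φ k (vtx (field ω) none) ∂configLaw d γ Θ := by
  have hj : Measurable fun ω : Config d A ↦ (joined φ k i (field ω) : ℝ≥0∞) :=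
    (measurable_of_countable (fun n : ℕ ↦ (n : ℝ≥0∞))).comp
      ((measurable_joined hφ hα k i).comp measurable_field)
  have hphi : Measurable fun ω : Config d A ↦
      ENNReal.ofReal (φ 1 ![vtx (field ω) none, vtx (field ω) (some (k, i))]) :=
    ENNReal.measurable_ofReal.comp (measurable_subtype_coe.comp ((measurable_phi_one hφ hα).comp
      (((measurable_vtx none).comp measurable_field).prodMk
        ((measurable_vtx (some (k, i))).comp measurable_field))))
  have n1 : ({none, some (k, i)} : Finset (Label d)) ≠ {none} := fun h ↦ by
    have : some (k, i) ∈ ({none} : Finset (Label d)) := h ▸ by simp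
    simp at this
  have n2 : ({none, some (k, i)} : Finset (Label d)) ≠ {some (k, i)} := fun h ↦ by
    have : none ∈ ({some (k, i)} : Finset (Label d)) := h ▸ by simp
    simp at this
  have n3 : ({some (k, i)} : Finset (Label d)) ≠ {none} := fun h ↦ by
    have : some (k, i) ∈ ({none} : Finset (Label d)) := h ▸ by simp
    simp at this
  rw [configLaw, lintegral_eq_update (siteLaw d γ Θ) (F := fun ω ↦ X ω * joined φ k i (field ω))
    (hX.mul hj) (Sum.inr {none, some (k, i)})]
  have s1 : ∀ ω : Config d A, ∫⁻ z, X (Function.update ω (Sum.inr {none, some (k, i)}) z) *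
      joined φ k i (field (Function.update ω (Sum.inr {none, some (k, i)}) z)) ∂siteLaw d γ Θ =
      X ω * ENNReal.ofReal (φ 1 ![vtx (field ω) none, vtx (field ω) (some (k, i))]) := by
    intro ω
    simp only [update_of_dependsOn hX1]
    have e : ∀ z : ℕ × Datum d A,
        (joined φ k i (field (Function.update ω (Sum.inr {none, some (k, i)}) z)) : ℝ≥0∞) =
        (if z.2.2 ≤ φ 1 ![vtx (field ω) none, vtx (field ω) (some (k, i))] then 1 else 0) := by
      intro z
      have v1 : vtx (field (Function.update ω (Sum.inr {none, some (k, i)}) z)) none =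
          vtx (field ω) none := by
        simp [vtx, rel, field, Function.update_of_ne, n1.symm]
      have v2 : vtx (field (Function.update ω (Sum.inr {none, some (k, i)}) z)) (some (k, i)) =
          vtx (field ω) (some (k, i)) := by
        simp [vtx, rel, field, Function.update_of_ne, n2.symm]
      rw [joined, v1, v2]
      simp [field]
    simp only [e]
    have hm : Measurable fun z : Datum d A ↦
        (if z.2 ≤ φ 1 ![vtx (field ω) none, vtx (field ω) (some (k, i))] then 1 else 0 : ℝ≥0∞) :=
      Measurable.ite (measurableSet_le measurable_snd measurable_const) measurable_const
        measurable_const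
    rw [lintegral_const_mul (μ := siteLaw d γ Θ) (X ω) (f := fun z ↦
      if z.2.2 ≤ φ 1 ![vtx (field ω) none, vtx (field ω) (some (k, i))] then 1 else 0)
      (hm.comp measurable_snd), lintegral_siteLaw_snd γ Θ hm]
    simp only [lintegral_ite_le, lintegral_const, measure_univ, mul_one]
  simp only [s1]
  rw [lintegral_eq_update (siteLaw d γ Θ) (F := fun ω ↦ X ω *
    ENNReal.ofReal (φ 1 ![vtx (field ω) none, vtx (field ω) (some (k, i))]))
    (hX.mul hphi) (Sum.inr {some (k, i)})]
  refine lintegral_congr fun ω ↦ ?_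
  simp only [update_of_dependsOn hX2]
  have v1 (z) : vtx (field (Function.update ω (Sum.inr {some (k, i)}) z)) none =
      vtx (field ω) none := by
    simp [vtx, rel, field, Function.update_of_ne, n3.symm]
  have v2 (z) : vtx (field (Function.update ω (Sum.inr {some (k, i)}) z)) (some (k, i)) =
      (fun x ↦ (k x : ℝ) + z.2.1.1 x, z.2.1.2) := by
    simp [vtx, rel, field, cellOf]
  simp only [v1, v2]
  have hm : Measurable fun z : Datum d A ↦
      ENNReal.ofReal (φ 1 ![vtx (field ω) none, (fun x ↦ (k x : ℝ) + z.1.1 x, z.1.2)]) :=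
    ENNReal.measurable_ofReal.comp (measurable_subtype_coe.comp ((measurable_phi_one hφ hα).comp
      (measurable_const.prodMk ((measurable_cellPoint k).comp measurable_fst))))
  rw [lintegral_const_mul (μ := siteLaw d γ Θ) (X ω) (f := fun z ↦ ENNReal.ofReal
    (φ 1 ![vtx (field ω) none, (fun x ↦ (k x : ℝ) + z.2.1.1 x, z.2.1.2)]))
    (hm.comp measurable_snd), lintegral_siteLaw_snd γ Θ hm, joinProb_eq Θ hφ hα]
  simp

omit [MeasurableSpace A] in
lemma field_congr_joined {ω ω' : Config d A} {k : Cell d} {j : ℕ} (s : Set (Idx d))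
    (h : ∀ x ∈ s, ω x = ω' x)
    (h1 : Sum.inr {none} ∈ s) (h2 : Sum.inr {some (k, j)} ∈ s)
    (h3 : open Classical in Sum.inr {none, some (k, j)} ∈ s) :
    joined φ k j (field ω) = joined φ k j (field ω') := by
  classical
  have e1 := h _ h1
  have e2 := h _ h2
  have e3 := h _ h3
  have v1 : vtx (field ω) none = vtx (field ω') none := by simp [vtx, rel, field, e1]
  have v2 : vtx (field ω) (some (k, j)) = vtx (field ω') (some (k, j)) := by
    simp [vtx, rel, field, e2]
  rw [joined, joined, v1, v2]
  congr 2
  simp only [field]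
  exact congrArg (fun z : ℕ × Datum d A ↦ z.2.2) e3

/-- The increment of a power when one candidate `b` is counted. It carries the factor `b` and a
power of lower order, which is the form needed for an induction on the order of the moment. -/
lemma pow_succ_add_le (m : ℕ) (a : ℕ) {b : ℕ} (hb : b ≤ 1) :
    (1 + (a + b)) ^ (m + 1) ≤ (1 + a) ^ (m + 1) + b * ((m + 1) * 2 ^ m * (1 + a) ^ m) := by
  interval_cases b
  · simp
  · have h : ∀ m : ℕ, (1 + (a + 1)) ^ (m + 1) ≤ (1 + a) ^ (m + 1) + (m + 1) * (1 + (a + 1)) ^ m := by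
      intro m
      induction m with
      | zero => simp; omega
      | succ m ih =>
        calc (1 + (a + 1)) ^ (m + 2) = (1 + (a + 1)) ^ (m + 1) * (1 + a) + (1 + (a + 1)) ^ (m + 1) := by
              ring
          _ ≤ ((1 + a) ^ (m + 1) + (m + 1) * (1 + (a + 1)) ^ m) * (1 + a) +
              (1 + (a + 1)) ^ (m + 1) := by gcongr
          _ ≤ (1 + a) ^ (m + 2) + (m + 1) * ((1 + (a + 1)) ^ m * (1 + (a + 1))) +
              (1 + (a + 1)) ^ (m + 1) := by
              have : (1 + (a + 1)) ^ m * (1 + a) ≤ (1 + (a + 1)) ^ m * (1 + (a + 1)) := by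
                gcongr; omega
              have := Nat.mul_le_mul_left (m + 1) this
              rw [add_mul, ← pow_succ, mul_assoc]
              exact Nat.add_le_add_right (Nat.add_le_add_left this _) _
          _ = _ := by ring
    refine (h m).trans ?_
    have : (1 + (a + 1)) ^ m ≤ 2 ^ m * (1 + a) ^ m := by
      rw [← mul_pow]; gcongr; omega
    rw [one_mul, mul_assoc]
    gcongr

/-- Moments of the degree of the additional point given its position and mark. -/
lemma lintegral_joinedCount_pow_le (hφ : IsConnection α φ) (hα : 1 ≤ α) (m : ℕ) :
    ∃ C : ℝ≥0, ∀ (w : (Fin d → ℝ) × A → ℝ≥0∞), Measurable w → ∀ T : Finset (Cell d),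
      ∫⁻ ω, w (vtx (field ω) none) * (1 + joinedCount φ T (cnt ω) (field ω) : ℕ) ^ m
        ∂configLaw d γ Θ ≤
      C * ∫⁻ ω, w (vtx (field ω) none) * (1 + mixing γ Θ φ (vtx (field ω) none).2) ^ m
        ∂configLaw d γ Θ := by
  classical
  induction m with
  | zero => exact ⟨1, fun w hw T ↦ by simp⟩
  | succ m ih =>
    obtain ⟨C, hC⟩ := ih
    set K : ℝ≥0∞ := ENNReal.ofReal (γ * Real.exp γ) with hK
    set c : ℕ := (m + 1) * 2 ^ m with hc
    have hvm : Measurable fun ω : Config d A ↦ vtx (field ω) none :=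
      (measurable_vtx none).comp measurable_field
    have hmix (a : A) (x : Fin d → ℝ) : γ * ∑' k : Cell d, joinProb Θ φ k (x, a) = mixing γ Θ φ a :=
      tsum_lintegral_cells hφ hα γ Θ x a
    have hmixm : Measurable fun v : (Fin d → ℝ) × A ↦ mixing γ Θ φ v.2 := by
      have : (fun v : (Fin d → ℝ) × A ↦ mixing γ Θ φ v.2) =
          fun v ↦ γ * ∑' k : Cell d, joinProb Θ φ k v := by
        ext v; exact (hmix v.2 v.1).symm
      rw [this]
      exact (Measurable.tsum fun k ↦ measurable_joinProb Θ hφ hα k).const_mul _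
    -- Cells are added one at a time. The increment of the power `m + 1` is a sum over the points of
    -- the new cell of edge indicators times powers of order `m`. Integrating an edge indicator
    -- produces the weight `joinProb`, to which the bound for order `m` applies; this is why a
    -- general weight `w` is carried along.
    have step (w : (Fin d → ℝ) × A → ℝ≥0∞) (hw : Measurable w) (T : Finset (Cell d)) :
        ∫⁻ ω, w (vtx (field ω) none) * (1 + joinedCount φ T (cnt ω) (field ω) : ℕ) ^ (m + 1)
          ∂configLaw d γ Θ ≤ ∫⁻ ω, w (vtx (field ω) none) ∂configLaw d γ Θ +
          ∑ k ∈ T, K * (c * (C * ∫⁻ ω, w (vtx (field ω) none) * joinProb Θ φ k (vtx (field ω) none) *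
            (1 + mixing γ Θ φ (vtx (field ω) none).2) ^ m ∂configLaw d γ Θ)) := by
      induction T using Finset.induction_on with
      | empty => simp [joinedCount]
      | insert k T hk ih2 =>
        rw [Finset.sum_insert hk]
        set D : Config d A → ℕ → ℕ := fun ω i ↦ joinedCount φ T (cnt ω) (field ω) +
          ∑ j ∈ Finset.range i, joined φ k j (field ω) with hD
        have hDm (i : ℕ) : Measurable fun ω ↦ D ω i :=
          (measurable_joinedCount hφ hα T).add (Finset.measurable_sum _ fun j _ ↦
            (measurable_joined hφ hα k j).comp measurable_field)
        have hDi (ω) : joinedCount φ (insert k T) (cnt ω) (field ω) = D ω (cnt ω k) := by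
          rw [joinedCount, Finset.sum_insert hk, add_comm]; rfl
        set B : ℕ → Config d A → ℝ≥0∞ := fun i ω ↦
          w (vtx (field ω) none) * (c * (1 + D ω i : ℕ) ^ m) with hB
        set H : ℕ → Config d A → ℝ≥0∞ := fun i ω ↦ B i ω * joined φ k i (field ω) with hH
        have hBm (i) : Measurable (B i) := by
          refine (hw.comp hvm).mul (Measurable.const_mul ?_ _)
          exact (measurable_of_countable (fun n : ℕ ↦ ((1 + n : ℕ) : ℝ≥0∞) ^ m)).comp (hDm i)
        have hjm (i) : Measurable fun ω : Config d A ↦ (joined φ k i (field ω) : ℝ≥0∞) :=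
          (measurable_of_countable (fun n : ℕ ↦ (n : ℝ≥0∞))).comp
            ((measurable_joined hφ hα k i).comp measurable_field)
        have hHm (i) : Measurable (H i) := (hBm i).mul (hjm i)
        have tele (ω) : (1 + D ω (cnt ω k)) ^ (m + 1) ≤
            (1 + joinedCount φ T (cnt ω) (field ω)) ^ (m + 1) +
            ∑ i ∈ Finset.range (cnt ω k), joined φ k i (field ω) * (c * (1 + D ω i) ^ m) := by
          generalize cnt ω k = n
          induction n with
          | zero => simp [hD]
          | succ n ihn =>
            rw [Finset.sum_range_succ, ← add_assoc ((1 + joinedCount φ T (cnt ω) (field ω)) ^ (m + 1))]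
            refine le_trans ?_ (Nat.add_le_add_right ihn (joined φ k n (field ω) * (c * (1 + D ω n) ^ m)))
            have : D ω (n + 1) = D ω n + joined φ k n (field ω) := by
              simp only [hD, Finset.sum_range_succ, add_assoc]
            rw [this]
            exact pow_succ_add_le m _ (joined_le_one k n)
        have hpt (ω) : w (vtx (field ω) none) *
            (1 + joinedCount φ (insert k T) (cnt ω) (field ω) : ℕ) ^ (m + 1) ≤
            w (vtx (field ω) none) * (1 + joinedCount φ T (cnt ω) (field ω) : ℕ) ^ (m + 1) +
            cnt ω k * ∑ i ∈ Finset.range (cnt ω k), H i ω := by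
          -- The factor `cnt ω k` is at least one unless the sum is empty. It is inserted to match
          -- `lintegral_cnt_mul_sum_le`.
          have h1 : ∑ i ∈ Finset.range (cnt ω k), H i ω ≤
              cnt ω k * ∑ i ∈ Finset.range (cnt ω k), H i ω := by
            rcases Nat.eq_zero_or_pos (cnt ω k) with h | h
            · simp [h]
            · refine le_mul_of_one_le_left zero_le ?_
              exact_mod_cast h
          refine le_trans ?_ (add_le_add_right h1 _)
          have h2 : ∑ i ∈ Finset.range (cnt ω k), H i ω = w (vtx (field ω) none) *
              ((∑ i ∈ Finset.range (cnt ω k), joined φ k i (field ω) * (c * (1 + D ω i) ^ m) : ℕ) :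
                ℝ≥0∞) := by
            rw [Nat.cast_sum, Finset.mul_sum]
            refine Finset.sum_congr rfl fun i _ ↦ ?_
            simp only [hH, hB]
            push_cast
            ring
          rw [h2, ← mul_add, hDi]
          gcongr
          exact_mod_cast tele ω
        refine (lintegral_mono hpt).trans ?_
        have hbase : Measurable fun ω : Config d A ↦ w (vtx (field ω) none) *
            ((1 + joinedCount φ T (cnt ω) (field ω) : ℕ) : ℝ≥0∞) ^ (m + 1) :=
          (hw.comp hvm).mul ((measurable_of_countable (fun n : ℕ ↦
            ((1 + n : ℕ) : ℝ≥0∞) ^ (m + 1))).comp (measurable_joinedCount hφ hα T))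
        rw [lintegral_add_left hbase, add_comm]
        rw [← add_assoc, add_comm (∫⁻ ω, w (vtx (field ω) none) ∂configLaw d γ Θ), add_assoc]
        refine add_le_add ?_ ih2
        -- `B i` involves only the cells of `T` and the labels of `k` before `i`. Hence it ignores
        -- the number of points in `k`, the point `(k, i)` and the decision variable of its edge.
        have hsub (i) (s : Set (Idx d)) (hs : Sum.inr {none} ∈ s)
            (hs1 : ∀ c ∈ T, Sum.inl c ∈ s)
            (hs2 : ∀ c j, c ≠ k ∨ j < i → Sum.inr {some (c, j)} ∈ s ∧
              Sum.inr {none, some (c, j)} ∈ s) : DependsOn (B i) s := by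
          intro ω ω' h
          have v1 : vtx (field ω) none = vtx (field ω') none := by
            simp [vtx, rel, field, h _ hs]
          have hjj (c j) (hcj : c ≠ k ∨ j < i) :
              joined φ c j (field ω) = joined φ c j (field ω') :=
            field_congr_joined s h hs (hs2 c j hcj).1 (by convert (hs2 c j hcj).2)
          have hDD : D ω i = D ω' i := by
            simp only [hD, joinedCount]
            congr 1
            · refine Finset.sum_congr rfl fun c hcT ↦ ?_
              have : cnt ω c = cnt ω' c := by rw [cnt, cnt, h _ (hs1 c hcT)]
              rw [this]
              exact Finset.sum_congr rfl fun j _ ↦ hjj c j (Or.inl fun hck ↦ hk (hck ▸ hcT))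
            · exact Finset.sum_congr rfl fun j hj ↦ hjj k j (Or.inr (Finset.mem_range.1 hj))
          simp only [hB, v1, hDD]
        have hne (c j i') : ({none, some (c, j)} : Finset (Label d)) ≠ {some (k, i')} := fun h ↦ by
          have : none ∈ ({some (k, i')} : Finset (Label d)) := h ▸ by simp
          simp at this
        have hne' (c j i') : ({some (c, j)} : Finset (Label d)) ≠ {none, some (k, i')} := fun h ↦ by
          have : none ∈ ({some (c, j)} : Finset (Label d)) := h ▸ by simp
          simp at this
        have hne0 (i') : ({none} : Finset (Label d)) ≠ {none, some (k, i')} := fun h ↦ by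
          have : some (k, i') ∈ ({none} : Finset (Label d)) := h ▸ by simp
          simp at this
        have hne2 (c j i') (hcj : c ≠ k ∨ j < i') :
            ({none, some (c, j)} : Finset (Label d)) ≠ {none, some (k, i')} := fun h ↦ by
          have : some (c, j) ∈ ({none, some (k, i')} : Finset (Label d)) := h ▸ by simp
          simp at this
          rcases hcj with h1 | h1
          · exact h1 this.1
          · omega
        have hne3 (c j i') (hcj : c ≠ k ∨ j < i') :
            ({some (c, j)} : Finset (Label d)) ≠ {some (k, i')} := fun h ↦ by
          simp only [Finset.singleton_inj, Option.some.injEq, Prod.mk.injEq] at h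
          rcases hcj with h1 | h1
          · exact h1 h.1
          · omega
        have hHd (i) : DependsOn (H i) {Sum.inl k}ᶜ := by
          intro ω ω' h
          have e1 : B i ω = B i ω' := hsub i _ (by simp)
            (fun c hcT ↦ by simpa using fun hck : c = k ↦ hk (hck ▸ hcT)) (fun c j _ ↦ by simp) h
          have e2 : joined φ k i (field ω) = joined φ k i (field ω') :=
            field_congr_joined _ h (by simp) (by simp) (by simp)
          simp only [hH, e1, e2]
        refine (lintegral_cnt_mul_sum_le γ Θ k hHm hHd).trans ?_
        gcongr
        have hcm : Measurable fun ω : Config d A ↦ cnt ω k := by fun_prop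
        have e3 : ∫⁻ ω, H (cnt ω k) ω ∂configLaw d γ Θ = ∫⁻ ω, B (cnt ω k) ω *
            joinProb Θ φ k (vtx (field ω) none) ∂configLaw d γ Θ := by
          have hPm (i) : Measurable fun ω ↦ B i ω * joinProb Θ φ k (vtx (field ω) none) :=
            (hBm i).mul ((measurable_joinProb Θ hφ hα k).comp hvm)
          rw [lintegral_nat_partition hcm hHm, lintegral_nat_partition hcm (g := fun i ω ↦
            B i ω * joinProb Θ φ k (vtx (field ω) none)) hPm]
          congr 1
          ext i
          have := lintegral_mul_joined γ Θ hφ hα k i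
            (X := fun ω ↦ if cnt ω k = i then B i ω else 0)
            (Measurable.ite (hcm (measurableSet_singleton i)) (hBm i) measurable_const) ?_ ?_
          · convert this using 4 with ω ω
            · simp only [hH, ite_mul, zero_mul]
            · simp only [ite_mul, zero_mul]
          · intro ω ω' h
            have e1 : B i ω = B i ω' := hsub i _ (by simpa using hne0 i) (by simp)
              (fun c j hcj ↦ ⟨by simpa using hne' c j i, by simpa using hne2 c j i hcj⟩) h
            have e2 : cnt ω k = cnt ω' k := by rw [cnt, cnt, h _ (by simp)]
            simp only [e1, e2]
          · intro ω ω' h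
            have e1 : B i ω = B i ω' := hsub i _ (by simp) (by simp)
              (fun c j hcj ↦ ⟨by simpa using hne3 c j i hcj, by simpa using hne c j i⟩) h
            have e2 : cnt ω k = cnt ω' k := by rw [cnt, cnt, h _ (by simp)]
            simp only [e1, e2]
        rw [e3]
        -- When `i` is the number of points in `k`, the partial count is the full count over `insert
        -- k T`, so the induction hypothesis applies.
        have e4 : ∀ ω, B (cnt ω k) ω * joinProb Θ φ k (vtx (field ω) none) = c *
            ((w (vtx (field ω) none) * joinProb Θ φ k (vtx (field ω) none)) *
            ((1 + joinedCount φ (insert k T) (cnt ω) (field ω) : ℕ) : ℝ≥0∞) ^ m) := by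
          intro ω
          rw [hDi]
          simp only [hB]
          ring
        simp only [e4]
        rw [lintegral_const_mul']
        · gcongr
          exact hC (fun v ↦ w v * joinProb Θ φ k v) (hw.mul (measurable_joinProb Θ hφ hα k)) _
        · exact ENNReal.natCast_ne_top c
    -- The factor `γ` of `K` does not enter the constant: `γ` times the sum of `joinProb` over all
    -- cells is `mixing`.
    refine ⟨1 + (Real.exp γ).toNNReal * (c * C), fun w hw T ↦ (step w hw T).trans ?_⟩
    set I := ∫⁻ ω, w (vtx (field ω) none) * (1 + mixing γ Θ φ (vtx (field ω) none).2) ^ (m + 1)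
        ∂configLaw d γ Θ
    have hwm : Measurable fun ω : Config d A ↦ w (vtx (field ω) none) := hw.comp hvm
    have h1 : ∫⁻ ω, w (vtx (field ω) none) ∂configLaw d γ Θ ≤ I :=
      lintegral_mono fun ω ↦ le_mul_of_one_le_right zero_le (one_le_pow₀ (by simp))
    have h2 : γ * ∑ k ∈ T, ∫⁻ ω, w (vtx (field ω) none) * joinProb Θ φ k (vtx (field ω) none) *
            (1 + mixing γ Θ φ (vtx (field ω) none).2) ^ m ∂configLaw d γ Θ ≤ I := by
      have hmm (k : Cell d) : Measurable fun ω : Config d A ↦ w (vtx (field ω) none) *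
          joinProb Θ φ k (vtx (field ω) none) *
            (1 + mixing γ Θ φ (vtx (field ω) none).2) ^ m :=
        (hwm.mul ((measurable_joinProb Θ hφ hα k).comp hvm)).mul
          (((hmixm.comp hvm).const_add 1).pow_const m)
      rw [← lintegral_finsetSum _ fun k _ ↦ hmm k,
        ← lintegral_const_mul _ (Finset.measurable_sum _ fun k _ ↦ hmm k)]
      refine lintegral_mono fun ω ↦ ?_
      have h3 : γ * ∑ k ∈ T, joinProb Θ φ k (vtx (field ω) none) ≤
          mixing γ Θ φ (vtx (field ω) none).2 := by
        rw [← hmix _ (vtx (field ω) none).1]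
        gcongr
        exact ENNReal.sum_le_tsum _
      calc _ = w (vtx (field ω) none) * (γ * ∑ k ∈ T, joinProb Θ φ k (vtx (field ω) none)) *
            (1 + mixing γ Θ φ (vtx (field ω) none).2) ^ m := by
            simp only [Finset.mul_sum, Finset.sum_mul]
            exact Finset.sum_congr rfl fun _ _ ↦ by ring
        _ ≤ w (vtx (field ω) none) * (1 + mixing γ Θ φ (vtx (field ω) none).2) *
            (1 + mixing γ Θ φ (vtx (field ω) none).2) ^ m := by
            gcongr
            exact h3.trans le_add_self
        _ = _ := by ring
    calc _ ≤ I + (Real.exp γ).toNNReal * (c * C) * I := by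
          refine add_le_add h1 ?_
          refine le_trans (le_of_eq ?_) (mul_le_mul_right h2 _)
          have : K = γ * ((Real.exp γ).toNNReal : ℝ≥0∞) := by
            rw [hK, ENNReal.ofReal_mul (by positivity), ENNReal.ofReal_coe_nnreal]; rfl
          rw [this, ← Finset.mul_sum, ← Finset.mul_sum, ← Finset.mul_sum]
          ring
      _ = _ := by push_cast; ring

end Degree

/-! ### Square integrability and stabilization in the model -/

section Stabilization

variable {d : ℕ} {A : Type*} [MeasurableSpace A] {α : ℕ}
  {φ : (j : ℕ) → (Fin (j + 1) → (Fin d → ℝ) × A) → unitInterval}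
  {E E' : Region d} {N N' : Cell d → ℕ} {q q' : Field d A} {l : Label d} {p : ℕ}

/-- The cells with coordinates between `-n` and `n`. -/
def cellBox (d n : ℕ) : Finset (Cell d) := Finset.Icc (fun _ ↦ -(n : ℤ)) fun _ ↦ (n : ℤ)

lemma mem_cellBox {n : ℕ} {c : Cell d} : c ∈ cellBox d n ↔ ∀ i, |c i| ≤ n := by
  simp only [cellBox, Finset.mem_Icc, Pi.le_def, abs_le, forall_and]

lemma cellBox_mono : Monotone (cellBox d) := fun m n hmn c hc ↦ by
  rw [mem_cellBox] at *
  exact fun i ↦ (hc i).trans (by exact_mod_cast hmn)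

lemma exists_subset_cellBox {T : Set (Cell d)} (hT : T.Finite) : ∃ n, T ⊆ cellBox d n := by
  have h (c : Cell d) : ∃ n, c ∈ cellBox d n := by
    refine ⟨∑ i, (c i).natAbs, mem_cellBox.2 fun i ↦ ?_⟩
    have : (c i).natAbs ≤ ∑ i, (c i).natAbs :=
      Finset.single_le_sum (f := fun i ↦ (c i).natAbs) (fun _ _ ↦ zero_le) (Finset.mem_univ i)
    rw [Int.abs_eq_natAbs]
    exact_mod_cast this
  choose n hn using h
  refine ⟨hT.toFinset.sup n, fun c hc ↦ cellBox_mono (Finset.le_sup (by simpa using hc)) (hn c)⟩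

/-- The union of the cells in `cellBox d n`. -/
def boxRegion (d n : ℕ) : Region d := {x | x.1 ∈ cellBox d n}

lemma cells_boxRegion (n : ℕ) : cells (boxRegion d n) ⊆ cellBox d n := by
  rintro _ ⟨x, hx, rfl⟩
  exact hx

/-- The degree of the additional point in the infinite complex. -/
def joinedTotal (φ : (j : ℕ) → (Fin (j + 1) → (Fin d → ℝ) × A) → unitInterval)
    (N : Cell d → ℕ) (q : Field d A) : ℝ≥0∞ := ⨆ n, (joinedCount φ (cellBox d n) N q : ℝ≥0∞)

omit [MeasurableSpace A] in
lemma joinedCount_mono {T T' : Finset (Cell d)} (h : T ⊆ T') :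
    joinedCount φ T N q ≤ joinedCount φ T' N q :=
  Finset.sum_le_sum_of_subset h

omit [MeasurableSpace A] in
lemma degIn_le_joinedTotal (hα : 1 ≤ α) (hE : (cells E).Finite) :
    (degIn α φ E none N q : ℝ≥0∞) ≤ joinedTotal φ N q := by
  obtain ⟨n, hn⟩ := exists_subset_cellBox hE
  refine le_iSup_of_le n ?_
  exact_mod_cast degIn_le_joinedCount hα hn

lemma measurable_joinedTotal (hφ : IsConnection α φ) (hα : 1 ≤ α) :
    Measurable fun ω : Config d A ↦ joinedTotal φ (cnt ω) (field ω) :=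
  .iSup fun _ ↦ (measurable_of_countable (fun n : ℕ ↦ (n : ℝ≥0∞))).comp
    (measurable_joinedCount hφ hα _)

variable (γ : ℝ≥0) (Θ : Measure A) [IsProbabilityMeasure Θ]

lemma measurable_mixing (hφ : IsConnection α φ) (hα : 1 ≤ α) :
    Measurable fun a ↦ mixing γ Θ φ a := by
  have : (fun a ↦ mixing γ Θ φ a) = fun a ↦ γ * ∑' k : Cell d, joinProb Θ φ k (0, a) := by
    ext a; exact (tsum_lintegral_cells hφ hα γ Θ 0 a).symm
  rw [this]
  exact (Measurable.tsum fun k ↦ (measurable_joinProb Θ hφ hα k).comp (by fun_prop)).const_mul _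

/-- Monotone convergence over growing boxes; the constant in `lintegral_joinedCount_pow_le` is the
same for all of them. -/
lemma lintegral_joinedTotal_lt_top (hφ : IsConnection α φ) (hα : 1 ≤ α) {m : ℕ}
    (hm : ∫⁻ a, mixing γ Θ φ a ^ m ∂Θ < ∞) :
    ∫⁻ ω, (1 + joinedTotal φ (cnt ω) (field ω)) ^ m ∂configLaw d γ Θ < ∞ := by
  have e1 : ∀ ω : Config d A, (1 + joinedTotal φ (cnt ω) (field ω)) ^ m =
      ⨆ n, ((1 + joinedCount φ (cellBox d n) (cnt ω) (field ω) : ℕ) : ℝ≥0∞) ^ m := by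
    intro ω
    rw [joinedTotal, ENNReal.add_iSup, ENNReal.iSup_pow]
    simp
  simp only [e1]
  rw [lintegral_iSup]
  · obtain ⟨C, hC⟩ := lintegral_joinedCount_pow_le γ Θ hφ hα m
    have hle (n : ℕ) := hC (fun _ ↦ 1) measurable_const (cellBox d n)
    simp only [one_mul] at hle
    refine (iSup_le hle).trans_lt (ENNReal.mul_lt_top ENNReal.coe_lt_top ?_)
    have e2 : ∫⁻ ω : Config d A, (1 + mixing γ Θ φ (vtx (field ω) none).2) ^ m ∂configLaw d γ Θ =
        ∫⁻ a, (1 + mixing γ Θ φ a) ^ m ∂Θ := by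
      have h1 : MeasurePreserving (fun ω : Config d A ↦ ω (.inr {none})) (configLaw d γ Θ)
        (siteLaw d γ Θ) := measurePreserving_eval_infinitePi _ _
      have h2 : MeasurePreserving (fun z : ℕ × Datum d A ↦ z.2.1.2) (siteLaw d γ Θ) Θ := by
        unfold siteLaw
        exact measurePreserving_snd.comp (measurePreserving_fst.comp measurePreserving_snd)
      exact (h2.comp h1).lintegral_comp (f := fun a ↦ (1 + mixing γ Θ φ a) ^ m)
        (((measurable_mixing γ Θ hφ hα).const_add 1).pow_const m)
    rw [e2]
    have h3 : ∀ a, (1 + mixing γ Θ φ a) ^ m ≤ 2 ^ m * (1 + mixing γ Θ φ a ^ m) := by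
      intro a
      rcases le_total 1 (mixing γ Θ φ a) with h | h
      · calc (1 + mixing γ Θ φ a) ^ m ≤ (2 * mixing γ Θ φ a) ^ m := by
              rw [two_mul]; gcongr
          _ ≤ _ := by rw [mul_pow]; gcongr; exact le_add_self
      · calc (1 + mixing γ Θ φ a) ^ m ≤ 2 ^ m := by
              rw [← one_add_one_eq_two]; gcongr
          _ ≤ _ := le_mul_of_one_le_right zero_le (by simp)
    refine (lintegral_mono h3).trans_lt ?_
    rw [lintegral_const_mul' _ _ (by finiteness), lintegral_add_left measurable_const]
    refine ENNReal.mul_lt_top (by finiteness) (ENNReal.add_lt_top.2 ⟨by simp, hm⟩)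
  · exact fun n ↦ (measurable_of_countable (fun n : ℕ ↦ ((1 + n : ℕ) : ℝ≥0∞) ^ m)).comp
      (measurable_joinedCount hφ hα _)
  · intro m n hmn ω
    dsimp only
    gcongr
    exact joinedCount_mono (cellBox_mono hmn)

omit [MeasurableSpace A] in
lemma enorm_diffIn_le (hα : 1 ≤ α) (hE : (cells E).Finite) :
    ‖diffIn α φ p E none N q‖ₑ ≤ (1 + joinedTotal φ N q) ^ (p + 1) := by
  have h1 : ‖diffIn α φ p E none N q‖ₑ ≤ (1 + degIn α φ E none N q : ℝ≥0∞) ^ (p + 1) := by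
    rw [diffIn]
    split_ifs
    · rw [Real.enorm_eq_ofReal_abs]
      refine (ENNReal.ofReal_le_ofReal (abs_bettiDiff_le
        (restrict_faces_finite ((verts_finite hE).insert _)) p)).trans_eq ?_
      rw [ENNReal.ofReal_pow (by positivity), ENNReal.ofReal_add zero_le_one (by positivity)]
      simp [degIn]
    · simp
  refine h1.trans ?_
  gcongr
  exact degIn_le_joinedTotal hα hE

omit [MeasurableSpace A] in
/-- If the additional point has finite degree, then its effect on the Betti number in a large
region does not depend on the region. -/
lemma exists_diffIn_stable (hα : 1 ≤ α) (h : joinedTotal φ N q < ∞) (p : ℕ) :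
    ∃ R, ∀ E : Region d, (cells E).Finite → boxRegion d R ⊆ E →
      diffIn α φ p E none N q = diffIn α φ p (boxRegion d R) none N q := by
  obtain ⟨M, hM⟩ := ENNReal.exists_nat_gt h.ne
  -- The vertex sets of regions with finitely many cells are closed under unions, and the degrees of
  -- the additional point in them are bounded by its total degree.
  have hU : ∀ S ∈ {S | ∃ E : Region d, (cells E).Finite ∧ S = verts E N q},
      ∀ S' ∈ {S | ∃ E : Region d, (cells E).Finite ∧ S = verts E N q},
        S ∪ S' ∈ {S | ∃ E : Region d, (cells E).Finite ∧ S = verts E N q} := by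
    rintro _ ⟨E, hE, rfl⟩ _ ⟨E', hE', rfl⟩
    refine ⟨E ∪ E', by rw [cells, image_union]; exact hE.union hE', ?_⟩
    ext l
    rcases l with _ | ⟨c, j⟩
    · simp [none_notMem_verts]
    · simp only [mem_union, some_mem_verts, ← and_or_left]
  have hdeg : ∀ S ∈ {S | ∃ E : Region d, (cells E).Finite ∧ S = verts E N q},
      (nbrs (labelComplex α φ q) S none).ncard ≤ M := by
    rintro _ ⟨E, hE, rfl⟩
    have := (degIn_le_joinedTotal (φ := φ) (N := N) (q := q) hα hE).trans hM.le
    exact_mod_cast this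
  obtain ⟨_, ⟨E₀, hE₀, rfl⟩, hst⟩ := exists_bettiDiff_stable (K := labelComplex α φ q)
    (C := {S | ∃ E : Region d, (cells E).Finite ∧ S = verts E N q}) (v := none)
    ⟨_, ∅, by simp [cells], rfl⟩ hU (by rintro _ ⟨E, hE, rfl⟩; exact none_notMem_verts)
    (by rintro _ ⟨E, hE, rfl⟩; exact restrict_faces_finite ((verts_finite hE).insert _)) M hdeg p
  obtain ⟨R, hR⟩ := exists_subset_cellBox hE₀
  have h0 : E₀ ⊆ boxRegion d R := fun x hx ↦ hR (mem_image_of_mem _ hx)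
  have hbox : (cells (boxRegion d R)).Finite := (cellBox d R).finite_toSet.subset (cells_boxRegion R)
  have hmem : (cellOf (none : Label d), rel q none) ∈ boxRegion d R := by
    change (0 : Cell d) ∈ cellBox d R
    rw [mem_cellBox]
    simp
  refine ⟨R, fun E hE hRE ↦ ?_⟩
  rw [diffIn, diffIn, if_pos hmem, if_pos (hRE hmem), hst _ ⟨E, hE, rfl⟩ (verts_mono (h0.trans hRE)),
    hst _ ⟨_, hbox, rfl⟩ (verts_mono h0)]

lemma lintegral_sq_diffIn_le (hα : 1 ≤ α) (hE : (cells E).Finite) :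
    ∫⁻ ω, ‖diffIn α φ p E none (cnt ω) (field ω)‖ₑ ^ 2 ∂configLaw d γ Θ ≤
      ∫⁻ ω, (1 + joinedTotal φ (cnt ω) (field ω)) ^ (2 * (p + 1)) ∂configLaw d γ Θ := by
  refine lintegral_mono fun ω ↦ ?_
  dsimp only
  rw [mul_comm, pow_mul]
  gcongr
  exact enorm_diffIn_le hα hE

/-- Uniform stabilization in mean square. -/
lemma exists_lintegral_diffIn_sub_le (hφ : IsConnection α φ) (hα : 1 ≤ α)
    (hm : ∫⁻ a, mixing γ Θ φ a ^ (2 * (p + 1)) ∂Θ < ∞) {ε : ℝ≥0∞} (hε : 0 < ε) :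
    ∃ R, ∀ E E' : Region d, MeasurableSet E → MeasurableSet E' → (cells E).Finite →
      (cells E').Finite → boxRegion d R ⊆ E → boxRegion d R ⊆ E' →
      ∫⁻ ω, ‖diffIn α φ p E none (cnt ω) (field ω) - diffIn α φ p E' none (cnt ω) (field ω)‖ₑ ^ 2
        ∂configLaw d γ Θ ≤ ε := by
  -- Otherwise there are, for every `R`, two regions that contain the box of size `R` and whose
  -- effects differ by more than `ε`. Along this sequence the differences are almost surely
  -- eventually zero, and they are dominated by a power of the total degree. Dominated convergence
  -- gives a contradiction, and in this way uniformity in the regions.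
  by_contra! hcon
  choose E E' hE hE' hEc hEc' hRE hRE' hlt using hcon
  have hfin := lintegral_joinedTotal_lt_top γ Θ hφ hα hm
  have hlim := tendsto_lintegral_of_dominated_convergence (μ := configLaw d γ Θ)
    (F := fun R ω ↦ ‖diffIn α φ p (E R) none (cnt ω) (field ω) -
      diffIn α φ p (E' R) none (cnt ω) (field ω)‖ₑ ^ 2) (f := fun _ ↦ 0)
    (fun ω ↦ 2 ^ 2 * (1 + joinedTotal φ (cnt ω) (field ω)) ^ (2 * (p + 1))) ?_ ?_ ?_ ?_
  · rw [lintegral_zero] at hlim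
    obtain ⟨R, hR⟩ := (hlim.eventually (gt_mem_nhds hε)).exists
    exact absurd (hlt R) hR.le.not_gt
  · intro R
    exact ((measurable_diffIn hφ (hE R) (hEc R) measurable_cnt measurable_field _).sub
      (measurable_diffIn hφ (hE' R) (hEc' R) measurable_cnt measurable_field _)).enorm.pow_const 2
  · intro R
    refine .of_forall fun ω ↦ ?_
    dsimp only
    rw [mul_comm 2 (p + 1), pow_mul, ← mul_pow]
    gcongr
    refine (enorm_sub_le).trans ?_
    rw [two_mul]
    exact add_le_add (enorm_diffIn_le hα (hEc R)) (enorm_diffIn_le hα (hEc' R))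
  · rw [lintegral_const_mul' _ _ (by finiteness)]
    exact ENNReal.mul_ne_top (by finiteness) hfin.ne
  · have hae : ∀ᵐ ω ∂configLaw d γ Θ,
        (1 + joinedTotal φ (cnt ω) (field ω)) ^ (2 * (p + 1)) < ∞ :=
      ae_lt_top (((measurable_joinedTotal hφ hα).const_add 1).pow_const _) hfin.ne
    filter_upwards [hae] with ω hω
    have h1 : joinedTotal φ (cnt ω) (field ω) < ∞ := by
      rw [ENNReal.pow_lt_top_iff] at hω
      rcases hω with h | h
      · exact (ENNReal.add_lt_top.1 h).2
      · omega
    obtain ⟨R₀, hR₀⟩ := exists_diffIn_stable hα h1 p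
    refine tendsto_const_nhds.congr' ?_
    filter_upwards [eventually_ge_atTop R₀] with R hR
    have hsub : boxRegion d R₀ ⊆ boxRegion d R := fun x hx ↦ cellBox_mono hR hx
    rw [hR₀ _ (hEc R) (hsub.trans (hRE R)), hR₀ _ (hEc' R) (hsub.trans (hRE' R))]
    simp

lemma cells_eraseCell_subset (k : Cell d) : cells (eraseCell k E) ⊆ cells E :=
  image_mono fun _ hx ↦ hx.1

lemma measurableSet_eraseCell (k : Cell d) (hE : MeasurableSet E) :
    MeasurableSet (eraseCell k E) :=
  hE.inter (measurable_fst (MeasurableSet.of_discrete (s := {c | c ≠ k})))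

lemma enorm_sq_eq (x : ℝ) : ‖x‖ₑ ^ 2 = ENNReal.ofReal (x ^ 2) := by
  rw [Real.enorm_eq_ofReal_abs, ← ENNReal.ofReal_pow (abs_nonneg x), sq_abs]

/-- The effect of erasing the points in the cell `k` on the difference of the Betti numbers of two
regions. -/
lemma lintegral_sub_eraseCell_le (hφ : IsConnection α φ) (hE : MeasurableSet E)
    (hEc : (cells E).Finite) (hE' : MeasurableSet E') (hEc' : (cells E').Finite) (k : Cell d) :
    ∫⁻ ω, ‖(bettiIn α φ p E (cnt ω) (field ω) - bettiIn α φ p (eraseCell k E) (cnt ω) (field ω)) -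
        (bettiIn α φ p E' (cnt ω) (field ω) -
          bettiIn α φ p (eraseCell k E') (cnt ω) (field ω))‖ₑ ^ 2 ∂configLaw d γ Θ ≤
      ENNReal.ofReal (γ * Real.exp γ) *
        ∫⁻ ω, ‖diffIn α φ p (shiftRegion k E) none (cnt ω) (field ω) -
          diffIn α φ p (shiftRegion k E') none (cnt ω) (field ω)‖ₑ ^ 2 ∂configLaw d γ Θ := by
  set h : ℕ → Config d A → ℝ := fun i ω ↦
    diffIn α φ p E (some (k, i)) (Function.update (cnt ω) k i) (field ω) -
      diffIn α φ p E' (some (k, i)) (Function.update (cnt ω) k i) (field ω) with hh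
  have hup (i : ℕ) : Measurable fun ω : Config d A ↦ Function.update (cnt ω) k i :=
    (measurable_update_left (a := k) (x := i)).comp measurable_cnt
  have hm (i) : Measurable fun ω ↦ ‖h i ω‖ₑ ^ 2 :=
    ((measurable_diffIn hφ hE hEc (hup i) measurable_field _).sub
      (measurable_diffIn hφ hE' hEc' (hup i) measurable_field _)).enorm.pow_const 2
  have hd (i) : DependsOn (fun ω ↦ ‖h i ω‖ₑ ^ 2) {Sum.inl k}ᶜ := by
    intro ω ω' hω
    have e1 : field ω = field ω' := by
      ext1 ρ; rw [field, field, hω _ (by simp)]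
    have e2 : Function.update (cnt ω) k i = Function.update (cnt ω') k i := by
      ext c
      obtain rfl | hc := eq_or_ne c k
      · simp
      · rw [Function.update_of_ne hc, Function.update_of_ne hc, cnt, cnt, hω _ (by simpa using hc)]
    simp only [hh, e1, e2]
  -- The points of the cell are added one after the other, and the square of the sum of their
  -- effects costs the factor `cnt ω k`.
  have hle : ∀ ω : Config d A, ‖(bettiIn α φ p E (cnt ω) (field ω) -
      bettiIn α φ p (eraseCell k E) (cnt ω) (field ω)) - (bettiIn α φ p E' (cnt ω) (field ω) -
          bettiIn α φ p (eraseCell k E') (cnt ω) (field ω))‖ₑ ^ 2 ≤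
      cnt ω k * ∑ i ∈ Finset.range (cnt ω k), ‖h i ω‖ₑ ^ 2 := by
    intro ω
    have tele (E : Region d) : bettiIn α φ p E (cnt ω) (field ω) -
        bettiIn α φ p (eraseCell k E) (cnt ω) (field ω) = ∑ i ∈ Finset.range (cnt ω k),
          diffIn α φ p E (some (k, i)) (Function.update (cnt ω) k i) (field ω) := by
      simp only [← bettiIn_update_succ]
      rw [Finset.sum_range_sub (fun i ↦ bettiIn α φ p E (Function.update (cnt ω) k i) (field ω)),
        Function.update_eq_self, bettiIn_update_zero]
    rw [tele, tele, ← Finset.sum_sub_distrib, enorm_sq_eq]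
    simp only [enorm_sq_eq]
    rw [← ENNReal.ofReal_sum_of_nonneg fun _ _ ↦ sq_nonneg _, ← ENNReal.ofReal_natCast,
      ← ENNReal.ofReal_mul (by positivity)]
    refine ENNReal.ofReal_le_ofReal ?_
    have := sq_sum_le_card_mul_sum_sq (s := Finset.range (cnt ω k)) (f := fun i ↦ h i ω)
    rwa [Finset.card_range] at this
  refine (lintegral_mono hle).trans ((lintegral_cnt_mul_sum_le γ Θ k hm hd).trans_eq ?_)
  congr 1
  -- At `i = cnt ω k` the update of the counts does nothing, so only the effect of the next point
  -- remains.
  simp only [hh, Function.update_eq_self]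
  exact lintegral_diffIn_next γ Θ hφ hE hEc hE' hEc' k (F := fun _ x y ↦ ‖x - y‖ₑ ^ 2)
    fun i ↦ (measurable_fst.sub measurable_snd).enorm.pow_const 2

omit [MeasurableSpace A] in
lemma diffIn_empty : diffIn α φ p ∅ l N q = 0 := by
  simp [diffIn]

omit [MeasurableSpace A] in
lemma bettiIn_empty : bettiIn α φ p ∅ N q = 0 := by
  have h1 : (restrict (labelComplex α φ q) (verts ∅ N q)).faces = ∅ := by
    ext σ
    simp only [mem_empty_iff_false, iff_false]
    rintro ⟨h1, h2⟩
    obtain ⟨x, hx⟩ := ((labelComplex α φ q).isRelLowerSet_faces h1).1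
    obtain ⟨c, j, -, -, h⟩ := h2 hx
    exact h
  have h2 := abs_betti_le (K := restrict (labelComplex α φ q) (verts ∅ N q)) (by simp [h1]) p
  rw [h1] at h2
  simpa [bettiIn] using h2

lemma memLp_two_iff_lintegral {Ω : Type*} [MeasurableSpace Ω] {μ : Measure Ω} {f : Ω → ℝ}
    (hf : AEStronglyMeasurable f μ) : MemLp f 2 μ ↔ ∫⁻ ω, ‖f ω‖ₑ ^ 2 ∂μ < ∞ := by
  rw [MemLp, and_iff_right hf, eLpNorm_lt_top_iff_lintegral_rpow_enorm_lt_top (by simp) (by simp)]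
  simp

/-- Induction over the cells. By `lintegral_sub_eraseCell_le` with an empty second region, erasing
one cell changes the Betti number by a square-integrable amount. -/
lemma memLp_bettiIn (hφ : IsConnection α φ) (hα : 1 ≤ α)
    (hm : ∫⁻ a, mixing γ Θ φ a ^ (2 * (p + 1)) ∂Θ < ∞) (hE : MeasurableSet E)
    (hEc : (cells E).Finite) :
    MemLp (fun ω ↦ bettiIn α φ p E (cnt ω) (field ω)) 2 (configLaw d γ Θ) := by
  classical
  have key : ∀ T : Finset (Cell d), ∀ E : Region d, MeasurableSet E → cells E ⊆ T →
      MemLp (fun ω ↦ bettiIn α φ p E (cnt ω) (field ω)) 2 (configLaw d γ Θ) := by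
    intro T
    induction T using Finset.induction_on with
    | empty =>
      intro E _ hE
      have : E = ∅ := by
        rw [← image_eq_empty (f := Prod.fst), ← subset_empty_iff]
        exact hE.trans (by simp)
      subst this
      simp only [bettiIn_empty]
      exact memLp_const 0
    | insert k T hk ih =>
      intro E hE hET
      have hEc : (cells E).Finite := (Finset.finite_toSet _).subset hET
      have h1 := ih (eraseCell k E) (measurableSet_eraseCell k hE) (by
        rintro _ ⟨x, ⟨hx, hxk⟩, rfl⟩
        have := hET (mem_image_of_mem Prod.fst hx)
        simpa [hxk] using this)
      have h2 : MemLp (fun ω : Config d A ↦ bettiIn α φ p E (cnt ω) (field ω) -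
          bettiIn α φ p (eraseCell k E) (cnt ω) (field ω)) 2 (configLaw d γ Θ) := by
        have hmeas : Measurable fun ω : Config d A ↦ bettiIn α φ p E (cnt ω) (field ω) -
          bettiIn α φ p (eraseCell k E) (cnt ω) (field ω) :=
          (measurable_bettiIn hφ hE hEc measurable_cnt measurable_field).sub
            (measurable_bettiIn hφ (measurableSet_eraseCell k hE)
              (hEc.subset (cells_eraseCell_subset k)) measurable_cnt measurable_field)
        rw [memLp_two_iff_lintegral hmeas.aestronglyMeasurable]
        have h3 := lintegral_sub_eraseCell_le (p := p) γ Θ hφ hE hEc MeasurableSet.empty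
          (by simp [cells]) k
        have e0 : eraseCell k (∅ : Region d) = ∅ := by simp [eraseCell]
        have e1 : shiftRegion k (∅ : Region d) = ∅ := by simp [shiftRegion]
        simp only [e0, e1, diffIn_empty, sub_self, sub_zero] at h3
        refine h3.trans_lt (ENNReal.mul_lt_top ENNReal.ofReal_lt_top ?_)
        refine (lintegral_sq_diffIn_le γ Θ hα ?_).trans_lt (lintegral_joinedTotal_lt_top γ Θ hφ hα hm)
        refine (hEc.image fun c ↦ c - k).subset ?_
        rintro _ ⟨⟨c, x⟩, hx, rfl⟩
        exact ⟨c + k, ⟨_, hx, rfl⟩, by simp⟩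
      refine (memLp_congr_ae (.of_forall fun ω ↦ ?_)).1 (h1.add h2)
      simp
  exact key hEc.toFinset E hE (by simp)

end Stabilization

/-! ### A central limit theorem by approximation with sums of independent variables -/

section Approximation

variable {Ω : Type*} [MeasurableSpace Ω] {P : Measure Ω} [IsProbabilityMeasure P]

lemma abs_covariance_le {X Y : Ω → ℝ} (hX : MemLp X 2 P) (hY : MemLp Y 2 P) :
    |cov[X, Y; P]| ≤ √Var[X; P] * √Var[Y; P] := by
  have hquad (t : ℝ) : 0 ≤ Var[Y; P] * (t * t) + (2 * cov[X, Y; P]) * t + Var[X; P] := by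
    have h := variance_add hX (hY.const_smul t)
    rw [variance_smul, covariance_smul_right] at h
    have h0 := variance_nonneg (X + t • Y) P
    rw [h] at h0
    nlinarith
  have := discrim_le_zero hquad
  rw [discrim] at this
  rw [← Real.sqrt_mul (variance_nonneg _ _), ← Real.sqrt_sq_eq_abs]
  exact Real.sqrt_le_sqrt (by nlinarith)

lemma sqrt_variance_add_le {X Y : Ω → ℝ} (hX : MemLp X 2 P) (hY : MemLp Y 2 P) :
    √Var[X + Y; P] ≤ √Var[X; P] + √Var[Y; P] := by
  rw [Real.sqrt_le_iff]
  refine ⟨by positivity, ?_⟩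
  rw [variance_add hX hY]
  have h1 := (abs_le.1 (abs_covariance_le hX hY)).2
  have h2 := Real.sq_sqrt (variance_nonneg X P)
  have h3 := Real.sq_sqrt (variance_nonneg Y P)
  nlinarith

lemma abs_sqrt_variance_sub_le {X Y : Ω → ℝ} (hX : MemLp X 2 P) (hY : MemLp Y 2 P) :
    |√Var[X; P] - √Var[Y; P]| ≤ √Var[X - Y; P] := by
  have h1 := sqrt_variance_add_le hY (hX.sub hY)
  have h2 := sqrt_variance_add_le hX (hY.sub hX)
  rw [add_sub_cancel] at h1 h2
  rw [← neg_sub X Y, variance_neg] at h2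
  rw [abs_le]
  constructor <;> linarith

lemma norm_exp_sub_exp_le (x y : ℝ) :
    ‖Complex.exp (x * Complex.I) - Complex.exp (y * Complex.I)‖ ≤ |x - y| := by
  have : Complex.exp (x * Complex.I) - Complex.exp (y * Complex.I) =
      Complex.exp (y * Complex.I) * (Complex.exp (Complex.I * ((x - y : ℝ) : ℂ)) - 1) := by
    rw [mul_sub, ← Complex.exp_add, mul_one]
    congr 2
    push_cast
    ring
  rw [this, norm_mul, Complex.norm_exp_ofReal_mul_I, one_mul]
  exact Real.norm_exp_I_mul_ofReal_sub_one_le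

lemma integral_abs_le_sqrt {X : Ω → ℝ} (hX : MemLp X 2 P) : ∫ ω, |X ω| ∂P ≤ √(∫ ω, X ω ^ 2 ∂P) := by
  refine Real.le_sqrt_of_sq_le ?_
  have h := variance_eq_sub hX.abs
  have h0 := variance_nonneg |X| P
  rw [h] at h0
  simpa using h0

/-- The two arguments may differ, so the same estimate serves to replace a variable and to replace a
normalization. -/
lemma norm_charFun_sub_le {X Y : Ω → ℝ} (hX : MemLp X 2 P) (hY : MemLp Y 2 P) (s t : ℝ) :
    ‖charFun (P.map X) s - charFun (P.map Y) t‖ ≤ √(∫ ω, (s * X ω - t * Y ω) ^ 2 ∂P) := by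
  have hi {X : Ω → ℝ} (hX : MemLp X 2 P) (s : ℝ) :
      charFun (P.map X) s = ∫ ω, Complex.exp ((s * X ω : ℝ) * Complex.I) ∂P := by
    rw [charFun_apply_real, integral_map hX.aestronglyMeasurable.aemeasurable]
    · simp
    · exact Continuous.aestronglyMeasurable (by fun_prop)
  have hint {X : Ω → ℝ} (hX : MemLp X 2 P) (s : ℝ) :
      Integrable (fun ω ↦ Complex.exp ((s * X ω : ℝ) * Complex.I)) P := by
    refine Integrable.of_bound (C := 1) ?_ (.of_forall fun ω ↦ ?_)
    · exact (Continuous.aestronglyMeasurable (f := fun x : ℝ ↦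
        Complex.exp ((s * x : ℝ) * Complex.I)) (μ := P.map X) (by fun_prop)).comp_aemeasurable
          hX.aestronglyMeasurable.aemeasurable
    · rw [Complex.norm_exp_ofReal_mul_I]
  rw [hi hX, hi hY, ← integral_sub (hint hX s) (hint hY t)]
  have hXY : MemLp (fun ω ↦ s * X ω - t * Y ω) 2 P := (hX.const_mul s).sub (hY.const_mul t)
  refine (norm_integral_le_integral_norm _).trans (le_trans ?_ (integral_abs_le_sqrt hXY))
  refine integral_mono ((hint hX s).sub (hint hY t)).norm (hXY.abs.integrable one_le_two) fun ω ↦ ?_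
  exact norm_exp_sub_exp_le _ _

/-- The classical limit theorem for variance one, rescaled. A vanishing variance is treated
separately, since it forbids dividing by the standard deviation. -/
lemma tendsto_charFun_pow {μ : Measure ℝ} [IsProbabilityMeasure μ] (hμ : MemLp id 2 μ)
    (h0 : ∫ x, x ∂μ = 0) (t : ℝ) :
    Tendsto (fun n : ℕ ↦ charFun μ ((√n)⁻¹ * t) ^ n) atTop
      (𝓝 (Complex.exp (-(Var[id; μ] * t ^ 2 / 2 : ℝ)))) := by
  have hvar : Var[id; μ] = ∫ x, x ^ 2 ∂μ := by
    rw [variance_eq_integral (by fun_prop)]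
    simp [h0]
  obtain h | h := eq_or_ne Var[id; μ] 0
  · have h1 : (id : ℝ → ℝ) =ᵐ[μ] fun _ ↦ ∫ x, id x ∂μ := ae_eq_integral_of_variance_eq_zero hμ h
    have h2 (s : ℝ) : charFun μ s = 1 := by
      rw [charFun_apply_real]
      rw [integral_congr_ae (g := fun _ ↦ (1 : ℂ))]
      · simp
      · filter_upwards [h1] with x hx
        simp only [id, h0] at hx
        simp [hx]
    simp [h, h2]
  · set σ := √Var[id; μ] with hσ
    have hσ0 : σ ≠ 0 := by
      rw [hσ, Real.sqrt_ne_zero (variance_nonneg _ _)]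
      exact h
    have hσ2 : σ ^ 2 = Var[id; μ] := Real.sq_sqrt (variance_nonneg _ _)
    have := tendsto_charFun_inv_sqrt_mul_pow (P := μ) (X := fun x ↦ σ⁻¹ * x) (by fun_prop)
      (by rw [integral_const_mul, h0, mul_zero]) ?_ (σ * t)
    · have e (s : ℝ) : charFun (μ.map fun x ↦ σ⁻¹ * x) s = charFun μ (σ⁻¹ * s) := charFun_map_mul _ _
      simp only [e] at this
      convert this using 3 with n n
      · congr 1
        field_simp
      · rw [← hσ2]
        push_cast
        ring
    · have : (∫ x, ((fun x ↦ σ⁻¹ * x) ^ 2 : ℝ → ℝ) x ∂μ) = σ⁻¹ ^ 2 * ∫ x, x ^ 2 ∂μ := by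
        simp only [Pi.pow_apply, mul_pow]
        rw [integral_const_mul]
      rw [this, ← hvar, ← hσ2]
      field_simp

variable {ι : Type*} {𝓕 : Filter ι} [𝓕.NeBot]

/-- If the variables `f i` can be approximated by sums of `n i` independent copies of a random
variable, then they satisfy a central limit theorem. -/
theorem exists_clt_of_approx {f : ι → Ω → ℝ} {vol : ι → ℝ} (hvol : ∀ i, 0 < vol i)
    (hf : ∀ i, MemLp (f i) 2 P)
    (happ : ∀ η > 0, ∃ (H : ι → Ω → ℝ) (n : ι → ℕ) (κ : ℝ) (μ : Measure ℝ),
      0 ≤ κ ∧ IsProbabilityMeasure μ ∧ MemLp id 2 μ ∧ ∫ x, x ∂μ = 0 ∧ (∀ i, MemLp (H i) 2 P) ∧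
      Tendsto n 𝓕 atTop ∧ Tendsto (fun i ↦ n i / vol i) 𝓕 (𝓝 κ) ∧
      (∀ᶠ i in 𝓕, Var[f i - H i; P] ≤ η * vol i) ∧ (∀ i, Var[H i; P] = n i * Var[id; μ]) ∧
      ∀ i t, charFun (P.map fun ω ↦ H i ω - ∫ ω', H i ω' ∂P) t = charFun μ t ^ n i) :
    ∃ v : ℝ≥0, Tendsto (fun i ↦ Var[f i; P] / vol i) 𝓕 (𝓝 v) ∧
      ∀ t : ℝ, Tendsto (fun i ↦ charFun (P.map fun ω ↦ (f i ω - ∫ ω', f i ω' ∂P) / √(vol i)) t) 𝓕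
        (𝓝 (Complex.exp (-(v * t ^ 2 / 2 : ℝ)))) := by
  set D : ι → ℝ := fun i ↦ √(Var[f i; P] / vol i) with hD
  -- the approximation of the standard deviations and characteristic functions
  have key : ∀ δ > 0, ∃ a : ℝ, 0 ≤ a ∧ (∀ᶠ i in 𝓕, |D i - a| ≤ δ) ∧ ∀ t : ℝ, ∀ᶠ i in 𝓕,
      ‖charFun (P.map fun ω ↦ (f i ω - ∫ ω', f i ω' ∂P) / √(vol i)) t -
        Complex.exp (-(a ^ 2 * t ^ 2 / 2 : ℝ))‖ ≤ |t| * δ + δ := by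
    intro δ hδ
    obtain ⟨H, n, κ, μ, hκ, hμp, hμ, hμ0, hH, hn, hnκ, hvar, hvH, hch⟩ := happ ((δ / 2) ^ 2)
      (by positivity)
    set τ := Var[id; μ] with hτ
    have hτ0 : 0 ≤ τ := variance_nonneg _ _
    have hapx : ∀ᶠ i in 𝓕, √(Var[f i - H i; P] / vol i) ≤ δ / 2 := by
      filter_upwards [hvar] with i hi
      rw [Real.sqrt_le_left (by positivity), div_le_iff₀ (hvol i)]
      exact hi
    have hHlim : Tendsto (fun i ↦ √(Var[H i; P] / vol i)) 𝓕 (𝓝 √(κ * τ)) := by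
      have : Tendsto (fun i ↦ √(n i / vol i * τ)) 𝓕 (𝓝 √(κ * τ)) :=
        (Real.continuous_sqrt.tendsto _).comp (hnκ.mul_const τ)
      refine this.congr fun i ↦ ?_
      rw [hvH]
      congr 1
      ring
    refine ⟨√(κ * τ), Real.sqrt_nonneg _, ?_, fun t ↦ ?_⟩
    · have h2 : ∀ᶠ i in 𝓕, |√(Var[H i; P] / vol i) - √(κ * τ)| < δ / 2 := by
        have := Metric.tendsto_nhds.1 hHlim (δ / 2) (by positivity)
        simpa [Real.dist_eq] using this
      filter_upwards [hapx, h2] with i hi h2i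
      have h3 : |D i - √(Var[H i; P] / vol i)| ≤ √(Var[f i - H i; P] / vol i) := by
        simp only [hD]
        rw [Real.sqrt_div (variance_nonneg _ _), Real.sqrt_div (variance_nonneg _ _),
          Real.sqrt_div (variance_nonneg _ _), ← sub_div, abs_div, abs_of_nonneg (Real.sqrt_nonneg (vol i))]
        gcongr
        exact abs_sqrt_variance_sub_le (hf i) (hH i)
      calc |D i - √(κ * τ)| = |(D i - √(Var[H i; P] / vol i)) + (√(Var[H i; P] / vol i) - √(κ * τ))| := by
            congr 1; ring
        _ ≤ _ := abs_add_le _ _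
        _ ≤ δ / 2 + δ / 2 := by linarith
        _ = δ := by ring
    · -- the characteristic functions
      have hcen {X : Ω → ℝ} (hX : MemLp X 2 P) : MemLp (fun ω ↦ X ω - ∫ ω', X ω' ∂P) 2 P :=
        hX.sub (memLp_const _)
      have hcenvar {X : Ω → ℝ} (hX : MemLp X 2 P) :
          ∫ ω, (X ω - ∫ ω', X ω' ∂P) ^ 2 ∂P = Var[X; P] :=
        (variance_eq_integral hX.aestronglyMeasurable.aemeasurable).symm
      have hscale (i) : charFun (P.map fun ω ↦ (f i ω - ∫ ω', f i ω' ∂P) / √(vol i)) t =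
          charFun (P.map fun ω ↦ f i ω - ∫ ω', f i ω' ∂P) ((√(vol i))⁻¹ * t) := by
        rw [← charFun_map_mul_comp (hcen (hf i)).aestronglyMeasurable.aemeasurable]
        congr 3
        ext ω
        rw [div_eq_inv_mul]
      -- The comparison has three stages: from `f i` to `H i`, from the normalization by `vol i` to
      -- the one by `n i`, and the classical limit theorem for `n i` summands.
      have s1 (i) : ‖charFun (P.map fun ω ↦ f i ω - ∫ ω', f i ω' ∂P) ((√(vol i))⁻¹ * t) -
          charFun (P.map fun ω ↦ H i ω - ∫ ω', H i ω' ∂P) ((√(vol i))⁻¹ * t)‖ ≤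
          |t| * √(Var[f i - H i; P] / vol i) := by
        refine (norm_charFun_sub_le (hcen (hf i)) (hcen (hH i)) _ _).trans_eq ?_
        have e1 : ∀ ω, ((√(vol i))⁻¹ * t * (f i ω - ∫ ω', f i ω' ∂P) -
            (√(vol i))⁻¹ * t * (H i ω - ∫ ω', H i ω' ∂P)) ^ 2 =
            t ^ 2 * (vol i)⁻¹ * ((f i - H i) ω - ∫ ω', (f i - H i) ω' ∂P) ^ 2 := by
          intro ω
          have e2 : ∫ ω', (f i - H i) ω' ∂P = ∫ ω', f i ω' ∂P - ∫ ω', H i ω' ∂P :=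
            integral_sub ((hf i).integrable one_le_two) ((hH i).integrable one_le_two)
          have e3 : (√(vol i))⁻¹ ^ 2 = (vol i)⁻¹ := by rw [inv_pow, Real.sq_sqrt (hvol i).le]
          rw [e2, ← e3, Pi.sub_apply]
          ring
        simp only [e1]
        rw [integral_const_mul, hcenvar ((hf i).sub (hH i)), mul_assoc, Real.sqrt_mul (sq_nonneg t),
          Real.sqrt_sq_eq_abs, inv_mul_eq_div]
      have s2 (i) : ‖charFun (P.map fun ω ↦ H i ω - ∫ ω', H i ω' ∂P) ((√(vol i))⁻¹ * t) -
          charFun (P.map fun ω ↦ H i ω - ∫ ω', H i ω' ∂P) ((√(n i))⁻¹ * (√κ * t))‖ ≤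
          |t * ((√(vol i))⁻¹ - (√(n i))⁻¹ * √κ)| * √(n i * τ) := by
        refine (norm_charFun_sub_le (hcen (hH i)) (hcen (hH i)) _ _).trans_eq ?_
        have e1 : ∀ ω, ((√(vol i))⁻¹ * t * (H i ω - ∫ ω', H i ω' ∂P) -
            (√(n i))⁻¹ * (√κ * t) * (H i ω - ∫ ω', H i ω' ∂P)) ^ 2 =
            (t * ((√(vol i))⁻¹ - (√(n i))⁻¹ * √κ)) ^ 2 * (H i ω - ∫ ω', H i ω' ∂P) ^ 2 :=
          fun ω ↦ by ring
        simp only [e1]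
        rw [integral_const_mul, hcenvar (hH i), hvH, Real.sqrt_mul (sq_nonneg _),
          Real.sqrt_sq_eq_abs]
      have s2lim : Tendsto (fun i ↦ |t * ((√(vol i))⁻¹ - (√(n i))⁻¹ * √κ)| * √(n i * τ)) 𝓕 (𝓝 0) := by
        have h1 : Tendsto (fun i ↦ |t| * (|√(n i / vol i) - √κ| * √τ)) 𝓕 (𝓝 (|t| * (|√κ - √κ| * √τ))) :=
          ((((Real.continuous_sqrt.tendsto _).comp hnκ).sub_const _).abs.mul_const _).const_mul _
        rw [sub_self, abs_zero, zero_mul, mul_zero] at h1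
        refine h1.congr' ?_
        filter_upwards [hn.eventually_ge_atTop 1] with i hi
        have hn0 : (0 : ℝ) < n i := by exact_mod_cast hi
        rw [abs_mul, mul_assoc]
        congr 1
        rw [Real.sqrt_mul hn0.le, ← mul_assoc, Real.sqrt_div hn0.le]
        congr 1
        nth_rw 3 [← abs_of_nonneg (Real.sqrt_nonneg (n i : ℝ))]
        rw [← abs_mul]
        congr 1
        have := (Real.sqrt_pos.2 hn0).ne'
        field_simp
      have s3 : Tendsto (fun i ↦ charFun (P.map fun ω ↦ H i ω - ∫ ω', H i ω' ∂P)
          ((√(n i))⁻¹ * (√κ * t))) 𝓕 (𝓝 (Complex.exp (-(√(κ * τ) ^ 2 * t ^ 2 / 2 : ℝ)))) := by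
        have h1 := (tendsto_charFun_pow hμ hμ0 (√κ * t)).comp hn
        have e : τ * (√κ * t) ^ 2 = √(κ * τ) ^ 2 * t ^ 2 := by
          rw [mul_pow, Real.sq_sqrt hκ, Real.sq_sqrt (by positivity)]
          ring
        rw [← hτ, e] at h1
        refine h1.congr fun i ↦ ?_
        rw [hch]
        rfl
      have h2 : ∀ᶠ i in 𝓕, |t * ((√(vol i))⁻¹ - (√(n i))⁻¹ * √κ)| * √(n i * τ) < δ / 2 :=
        s2lim.eventually (gt_mem_nhds (by positivity))
      have h3 := Metric.tendsto_nhds.1 s3 (δ / 2) (by positivity)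
      filter_upwards [hapx, h2, h3] with i hi h2i h3i
      rw [dist_eq_norm] at h3i
      rw [hscale]
      refine (norm_sub_le_norm_sub_add_norm_sub _
        (charFun (P.map fun ω ↦ H i ω - ∫ ω', H i ω' ∂P) ((√(vol i))⁻¹ * t)) _).trans ?_
      have h4 := norm_sub_le_norm_sub_add_norm_sub
        (charFun (P.map fun ω ↦ H i ω - ∫ ω', H i ω' ∂P) ((√(vol i))⁻¹ * t))
        (charFun (P.map fun ω ↦ H i ω - ∫ ω', H i ω' ∂P) ((√(n i))⁻¹ * (√κ * t)))
        (Complex.exp (-(√(κ * τ) ^ 2 * t ^ 2 / 2 : ℝ)))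
      have h5 : |t| * √(Var[f i - H i; P] / vol i) ≤ |t| * δ := by
        gcongr; linarith
      have := s1 i
      have := s2 i
      linarith
  -- The approximating constant `a` depends on the accuracy `δ`. Completeness supplies a single
  -- limit of the normalized standard deviations.
  have hcauchy : Cauchy (map D 𝓕) := by
    rw [Metric.cauchy_iff]
    refine ⟨inferInstance, fun ε hε ↦ ?_⟩
    obtain ⟨a, -, ha, -⟩ := key (ε / 3) (by positivity)
    refine ⟨{x | |x - a| ≤ ε / 3}, ha, fun x hx y hy ↦ ?_⟩
    rw [Real.dist_eq]
    have : x - y = (x - a) - (y - a) := by ring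
    rw [this]
    have h1 := abs_sub (x - a) (y - a)
    simp only [mem_ofPred_eq] at hx hy
    linarith
  obtain ⟨D₀, hD₀⟩ := CompleteSpace.complete hcauchy
  replace hD₀ : Tendsto D 𝓕 (𝓝 D₀) := hD₀
  have hD₀0 : 0 ≤ D₀ := ge_of_tendsto' hD₀ fun i ↦ Real.sqrt_nonneg _
  have hclose {δ a : ℝ} (ha : ∀ᶠ i in 𝓕, |D i - a| ≤ δ) : |D₀ - a| ≤ δ :=
    le_of_tendsto (hD₀.sub_const a).abs ha
  refine ⟨⟨D₀ ^ 2, sq_nonneg _⟩, ?_, fun t ↦ ?_⟩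
  · refine (hD₀.pow 2).congr fun i ↦ ?_
    exact Real.sq_sqrt (div_nonneg (variance_nonneg _ _) (hvol i).le)
  · rw [Metric.tendsto_nhds]
    intro ε hε
    have hcont : Tendsto (fun a : ℝ ↦ Complex.exp (-(a ^ 2 * t ^ 2 / 2 : ℝ))) (𝓝 D₀)
        (𝓝 (Complex.exp (-(D₀ ^ 2 * t ^ 2 / 2 : ℝ)))) := by
      refine Continuous.tendsto ?_ _
      fun_prop
    obtain ⟨δ₀, hδ₀, hδ⟩ := Metric.tendsto_nhds_nhds.1 hcont (ε / 2) (by positivity)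
    -- The first bound brings `a` into the range where the Gaussian characteristic function varies
    -- by less than `ε / 2`; the second makes the error `(|t| + 1) * δ` at most `ε / 4`.
    set δ := min (δ₀ / 2) (ε / (4 * (|t| + 1))) with hδd
    have hδ0 : 0 < δ := lt_min (by positivity) (by positivity)
    obtain ⟨a, -, ha, hat⟩ := key δ hδ0
    filter_upwards [hat t] with i hi
    have h1 := hδ (x := a) (by
      rw [dist_comm, Real.dist_eq]
      exact (hclose ha).trans_lt ((min_le_left _ _).trans_lt (by linarith)))
    rw [dist_eq_norm] at h1 ⊢
    have h2 : |t| * δ + δ ≤ ε / 4 := by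
      have : δ ≤ ε / (4 * (|t| + 1)) := min_le_right _ _
      calc |t| * δ + δ = (|t| + 1) * δ := by ring
        _ ≤ (|t| + 1) * (ε / (4 * (|t| + 1))) := by gcongr
        _ = ε / 4 := by field_simp
    refine (norm_sub_le_norm_sub_add_norm_sub _ _ _).trans_lt (add_lt_add_of_le_of_lt hi h1) |>.trans_le ?_
    linarith

end Approximation

/-! ### Independence of functions of disjoint sets of coordinates -/

section Independence

variable {ι Z : Type*} [MeasurableSpace Z] (ζ : Measure Z) [IsProbabilityMeasure ζ]

/-- Selecting from two independent copies according to `S` preserves the law, and then `X` reads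
only the second copy and `Y` only the first. -/
lemma indepFun_of_dependsOn {β β' : Type*} [MeasurableSpace β] [MeasurableSpace β']
    {X : (ι → Z) → β} {Y : (ι → Z) → β'} (hX : Measurable X) (hY : Measurable Y) {S : Set ι}
    (hXS : DependsOn X S) (hYS : DependsOn Y Sᶜ) :
    IndepFun X Y (Measure.infinitePi fun _ : ι ↦ ζ) := by
  rw [indepFun_iff_map_prod_eq_prod_map_map hX.aemeasurable hY.aemeasurable]
  have h := infinitePi_map_prodSplit (fun _ : ι ↦ ζ) (fun _ : ι ↦ ζ)
  have hmp := measurePreserving_sel ζ S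
  have e1 : (fun ω ↦ (X ω, Y ω)) ∘ sel S =
      (fun p : β' × β ↦ (p.2, p.1)) ∘ Prod.map Y X ∘
        fun w : ι → Z × Z ↦ (fun i ↦ (w i).1, fun i ↦ (w i).2) := by
    ext1 w
    refine Prod.ext (hXS fun i hi ↦ ?_) (hYS fun i hi ↦ ?_)
    · simp [sel, hi]
    · have : i ∉ S := hi
      simp [sel, this]
  conv_lhs => rw [← hmp.map_eq]
  rw [Measure.map_map (by fun_prop) hmp.measurable, e1, ← Measure.map_map (by fun_prop) (by fun_prop),
    ← Measure.map_map (by fun_prop) (by fun_prop), h, ← Measure.map_prod_map _ _ hY hX]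
  exact Measure.prod_swap

end Independence

/-! ### Blocks of cells -/

section Blocks

variable {d : ℕ} {A : Type*} [MeasurableSpace A] {α : ℕ}
  {φ : (j : ℕ) → (Fin (j + 1) → (Fin d → ℝ) × A) → unitInterval}
  {E E' : Region d} {N N' : Cell d → ℕ} {q q' : Field d A} {l : Label d} {p : ℕ}

/-- The translation of labels. -/
def shiftLabel (k : Cell d) : Label d ↪ Label d :=
  Function.Embedding.optionMap ⟨fun x ↦ (x.1 + k, x.2), fun x y h ↦ by
    simp only [Prod.mk.injEq, add_left_inj] at h
    exact Prod.ext h.1 h.2⟩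

/-- The translation of coordinates. -/
def shiftIdx (k : Cell d) : Idx d → Idx d
  | .inl c => .inl (c + k)
  | .inr ρ => .inr (ρ.map (shiftLabel k))

lemma shiftIdx_injective (k : Cell d) : Function.Injective (shiftIdx k) := by
  rintro (c | ρ) (c' | ρ') h <;> simp only [shiftIdx, Sum.inl.injEq, Sum.inr.injEq] at h
  · simpa using h
  · cases h
  · cases h
  · rw [Finset.map_injective _ h]

/-- The translated configuration. -/
def shifted (k : Cell d) (ω : Config d A) : Config d A := fun x ↦ ω (shiftIdx k x)

lemma measurePreserving_shifted (γ : ℝ≥0) (Θ : Measure A) [IsProbabilityMeasure Θ] (k : Cell d) :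
    MeasurePreserving (shifted k) (configLaw d γ Θ) (configLaw d γ Θ) := by
  refine ⟨by unfold shifted; fun_prop, ?_⟩
  exact Measure.map_infinitePi_infinitePi_of_inj (P := fun _ ↦ siteLaw d γ Θ) (shiftIdx_injective k)

lemma bettiIn_shifted (hφ : IsConnection α φ) (k : Cell d) (ω : Config d A) :
    bettiIn α φ p (shiftRegion k E) (cnt (shifted k ω)) (field (shifted k ω)) =
      bettiIn α φ p E (cnt ω) (field ω) := by
  classical
  have hs (c : Cell d) (j : ℕ) : shiftLabel k (some (c, j)) = some (c + k, j) := rfl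
  have hrel (l) : rel (field (shifted k ω)) l = rel (field ω) (shiftLabel k l) := by
    simp [rel, field, shifted, shiftIdx]
  rw [bettiIn, bettiIn, labelComplex, betti_markComplex_map hφ (shiftLabel k).injective.injOn
    (fun x ↦ - (k x : ℝ)) p (y := vtx (field ω)) (u := fun ρ ↦ (field ω ρ).2)]
  · congr 2
    ext l
    constructor
    · rintro ⟨_, ⟨c, j, rfl, h1, h2⟩, rfl⟩
      rw [hrel, hs] at h2
      exact ⟨_, _, hs c j, h1, h2⟩
    · rintro ⟨c, j, rfl, h1, h2⟩
      have e : shiftLabel k (some (c - k, j)) = some (c, j) := by rw [hs, sub_add_cancel]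
      refine ⟨some (c - k, j), ⟨_, _, rfl, ?_, ?_⟩, e⟩
      · change j < cnt ω (c - k + k)
        simpa using h1
      · rw [hrel, e]
        simpa [shiftRegion] using h2
  · rintro _ ⟨c, j, rfl, -, -⟩
    simp only [vtx, hrel, hs, cellOf, Pi.add_apply, Int.cast_add]
    refine Prod.ext ?_ ?_
    · ext x
      simp
      ring
    · simp [field, shifted, shiftIdx, hs]
  · intro ρ _ _
    simp only [field, shifted, shiftIdx, Finset.map_eq_image]
    congr!

/-- The index of the block of side length `L` that contains a cell. -/
def blockOf (L : ℕ) (c : Cell d) : Cell d := fun i ↦ c i / (L : ℤ)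

/-- The region covered by a block. -/
def blockRegion (L : ℕ) (b : Cell d) : Region d := {x | blockOf L x.1 = b}

/-- The cells of a block. -/
def blockCells (L : ℕ) (b : Cell d) : Finset (Cell d) :=
  Finset.Icc (fun i ↦ L * b i) fun i ↦ L * b i + L - 1

lemma mem_blockCells {L : ℕ} (hL : 0 < L) {b c : Cell d} : c ∈ blockCells L b ↔ blockOf L c = b := by
  have hL' : (0 : ℤ) < L := by exact_mod_cast hL
  simp only [blockCells, Finset.mem_Icc, Pi.le_def, blockOf, funext_iff, ← forall_and]
  refine forall_congr' fun i ↦ ?_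
  rw [Int.ediv_eq_iff_of_pos hL']
  constructor <;> intro h <;> constructor <;> nlinarith [h.1, h.2]

lemma measurableSet_blockRegion (L : ℕ) (b : Cell d) : MeasurableSet (blockRegion L b) :=
  measurable_fst (MeasurableSet.of_discrete (s := {c | blockOf L c = b}))

lemma cells_blockRegion_subset {L : ℕ} (hL : 0 < L) (b : Cell d) :
    cells (blockRegion L b) ⊆ blockCells L b := by
  rintro _ ⟨x, hx, rfl⟩
  exact (mem_blockCells hL).2 hx

lemma finite_cells_blockRegion {L : ℕ} (hL : 0 < L) (b : Cell d) :
    (cells (blockRegion L b)).Finite :=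
  (Finset.finite_toSet _).subset (cells_blockRegion_subset hL b)

lemma shiftRegion_blockRegion {L : ℕ} (hL : 0 < L) (b : Cell d) :
    shiftRegion (fun i ↦ L * b i) (blockRegion L b) = blockRegion L 0 := by
  ext x
  simp only [shiftRegion, blockRegion, mem_ofPred_eq, blockOf, funext_iff, Pi.add_apply,
    Pi.zero_apply]
  refine forall_congr' fun i ↦ ?_
  rw [Int.add_mul_ediv_left _ _ (by exact_mod_cast hL.ne')]
  simp

variable (γ : ℝ≥0) (Θ : Measure A) [IsProbabilityMeasure Θ]

lemma map_bettiIn_blockRegion (hφ : IsConnection α φ) {L : ℕ} (hL : 0 < L) (b : Cell d) :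
    (configLaw d γ Θ).map (fun ω ↦ bettiIn α φ p (blockRegion L b) (cnt ω) (field ω)) =
      (configLaw d γ Θ).map fun ω ↦ bettiIn α φ p (blockRegion L 0) (cnt ω) (field ω) := by
  conv_rhs => rw [← (measurePreserving_shifted γ Θ (fun i ↦ L * b i)).map_eq]
  rw [Measure.map_map (measurable_bettiIn hφ (measurableSet_blockRegion L 0)
    (finite_cells_blockRegion hL 0) measurable_cnt measurable_field)
    (measurePreserving_shifted γ Θ _).measurable]
  congr 1
  ext ω
  rw [Function.comp_apply, ← shiftRegion_blockRegion hL b, bettiIn_shifted hφ]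

/-- The empty set of labels is excluded from `coordsOf`; otherwise it would belong to every family
of cells. -/
lemma disjoint_coordsOf {T T' : Set (Cell d)} (h : Disjoint T T') :
    Disjoint (coordsOf T) (coordsOf T') := by
  rw [Set.disjoint_left]
  rintro i (⟨c, hc, rfl⟩ | ⟨ρ, ⟨l, hl⟩, h2, rfl⟩) (⟨c', hc', h'⟩ | ⟨ρ', -, h2', h'⟩)
  · cases h'
    exact Set.disjoint_left.1 h hc hc'
  · cases h'
  · cases h'
  · cases h'
    obtain ⟨c, hc, j, rfl⟩ := h2 l hl
    obtain ⟨c', hc', j', h3⟩ := h2' _ hl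
    cases h3
    exact Set.disjoint_left.1 h hc hc'

lemma coordsOf_mono {T T' : Set (Cell d)} (h : T ⊆ T') : coordsOf T ⊆ coordsOf T' := by
  rintro i (⟨c, hc, rfl⟩ | ⟨ρ, h1, h2, rfl⟩)
  · exact Or.inl ⟨c, h hc, rfl⟩
  · refine Or.inr ⟨ρ, h1, fun l hl ↦ ?_, rfl⟩
    obtain ⟨c, hc, j, hj⟩ := h2 l hl
    exact ⟨c, h hc, j, hj⟩

/-- The centered Betti number of a block. -/
def blockVar (α : ℕ) (φ : (j : ℕ) → (Fin (j + 1) → (Fin d → ℝ) × A) → unitInterval) (p L : ℕ)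
    (b : Cell d) (ω : Config d A) : ℝ :=
  bettiIn α φ p (blockRegion L b) (cnt ω) (field ω) -
    ∫ ω', bettiIn α φ p (blockRegion L 0) (cnt ω') (field ω') ∂configLaw d γ Θ

section

variable {γ Θ}

lemma measurable_blockVar (hφ : IsConnection α φ) {L : ℕ} (hL : 0 < L) (b : Cell d) :
    Measurable (blockVar γ Θ α φ p L b) :=
  (measurable_bettiIn hφ (measurableSet_blockRegion L b) (finite_cells_blockRegion hL b)
    measurable_cnt measurable_field).sub_const _

lemma map_blockVar (hφ : IsConnection α φ) {L : ℕ} (hL : 0 < L) (b : Cell d) :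
    (configLaw d γ Θ).map (blockVar γ Θ α φ p L b) =
      (configLaw d γ Θ).map (blockVar γ Θ α φ p L 0) := by
  have hm (b : Cell d) := measurable_bettiIn (p := p) hφ (measurableSet_blockRegion L b)
    (finite_cells_blockRegion hL b) (measurable_cnt (A := A)) measurable_field
  have h := map_bettiIn_blockRegion (p := p) γ Θ hφ hL b
  set m := ∫ ω', bettiIn α φ p (blockRegion L 0) (cnt ω') (field ω') ∂configLaw d γ Θ with hmd
  have e (b : Cell d) : (configLaw d γ Θ).map (blockVar γ Θ α φ p L b) =
      ((configLaw d γ Θ).map (fun ω ↦ bettiIn α φ p (blockRegion L b) (cnt ω) (field ω))).map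
        (· - m) := by
    rw [Measure.map_map (by fun_prop) (hm b)]
    rfl
  rw [e, e, h]

lemma memLp_blockVar (hφ : IsConnection α φ) (hα : 1 ≤ α)
    (hm : ∫⁻ a, mixing γ Θ φ a ^ (2 * (p + 1)) ∂Θ < ∞) {L : ℕ} (hL : 0 < L) (b : Cell d) :
    MemLp (blockVar γ Θ α φ p L b) 2 (configLaw d γ Θ) :=
  (memLp_bettiIn γ Θ hφ hα hm (measurableSet_blockRegion L b) (finite_cells_blockRegion hL b)).sub
    (memLp_const _)

lemma integral_blockVar (hφ : IsConnection α φ) (hα : 1 ≤ α)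
    (hm : ∫⁻ a, mixing γ Θ φ a ^ (2 * (p + 1)) ∂Θ < ∞) {L : ℕ} (hL : 0 < L) (b : Cell d) :
    ∫ ω, blockVar γ Θ α φ p L b ω ∂configLaw d γ Θ = 0 := by
  have e (b : Cell d) : ∫ ω, blockVar γ Θ α φ p L b ω ∂configLaw d γ Θ =
      ∫ x, x ∂(configLaw d γ Θ).map (blockVar γ Θ α φ p L b) :=
    (integral_map (measurable_blockVar hφ hL b).aemeasurable
      (f := fun x ↦ x) aestronglyMeasurable_id).symm
  rw [e, map_blockVar hφ hL, ← e]
  simp only [blockVar]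
  rw [integral_sub _ (integrable_const _)]
  · simp
  · exact (memLp_bettiIn γ Θ hφ hα hm (measurableSet_blockRegion L 0)
      (finite_cells_blockRegion hL 0)).integrable one_le_two

lemma dependsOn_blockVar (hφ : IsConnection α φ) {L : ℕ} (hL : 0 < L) (b : Cell d) :
    DependsOn (blockVar γ Θ α φ p L b) (coordsOf (blockCells L b : Set (Cell d))) := by
  intro ω ω' h
  have := dependsOn_bettiIn (p := p) hφ (cells_blockRegion_subset hL b) h
  dsimp only at this
  rw [blockVar, blockVar, this]

lemma indepFun_blockVar (hφ : IsConnection α φ) {L : ℕ} (hL : 0 < L) {b : Cell d}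
    {B : Finset (Cell d)} (hb : b ∉ B) :
    IndepFun (blockVar γ Θ α φ p L b) (fun ω ↦ ∑ b' ∈ B, blockVar γ Θ α φ p L b' ω)
      (configLaw d γ Θ) := by
  refine indepFun_of_dependsOn (siteLaw d γ Θ) (measurable_blockVar hφ hL b)
    (Finset.measurable_fun_sum B fun b' _ ↦ measurable_blockVar hφ hL b')
    (dependsOn_blockVar hφ hL b) fun ω ω' h ↦ ?_
  refine Finset.sum_congr rfl fun b' hb' ↦ dependsOn_blockVar hφ hL b' fun i hi ↦ h i fun hi' ↦ ?_
  refine Set.disjoint_left.1 (disjoint_coordsOf ?_) hi hi'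
  rw [Finset.disjoint_coe, Finset.disjoint_left]
  intro c hc hc'
  rw [mem_blockCells hL] at hc hc'
  exact hb (hc' ▸ hc ▸ hb')

lemma charFun_sum_blockVar (hφ : IsConnection α φ) {L : ℕ} (hL : 0 < L) (B : Finset (Cell d))
    (t : ℝ) : charFun ((configLaw d γ Θ).map fun ω ↦ ∑ b ∈ B, blockVar γ Θ α φ p L b ω) t =
      charFun ((configLaw d γ Θ).map (blockVar γ Θ α φ p L 0)) t ^ B.card := by
  classical
  induction B using Finset.induction_on with
  | empty => simp
  | insert b B hb ih =>
    simp only [Finset.sum_insert hb]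
    rw [(indepFun_blockVar hφ hL hb).charFun_map_fun_add_eq_mul
      (measurable_blockVar hφ hL b).aemeasurable
      (Finset.measurable_fun_sum B fun b' _ ↦ measurable_blockVar hφ hL b').aemeasurable,
      Pi.mul_apply, ih, map_blockVar hφ hL, Finset.card_insert_of_notMem hb, pow_succ']

lemma memLp_sum_blockVar (hφ : IsConnection α φ) (hα : 1 ≤ α)
    (hm : ∫⁻ a, mixing γ Θ φ a ^ (2 * (p + 1)) ∂Θ < ∞) {L : ℕ} (hL : 0 < L) (B : Finset (Cell d)) :
    MemLp (fun ω ↦ ∑ b ∈ B, blockVar γ Θ α φ p L b ω) 2 (configLaw d γ Θ) :=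
  memLp_finsetSum B fun b _ ↦ memLp_blockVar hφ hα hm hL b

lemma variance_sum_blockVar (hφ : IsConnection α φ) (hα : 1 ≤ α)
    (hm : ∫⁻ a, mixing γ Θ φ a ^ (2 * (p + 1)) ∂Θ < ∞) {L : ℕ} (hL : 0 < L) (B : Finset (Cell d)) :
    Var[fun ω ↦ ∑ b ∈ B, blockVar γ Θ α φ p L b ω; configLaw d γ Θ] =
      B.card * Var[blockVar γ Θ α φ p L 0; configLaw d γ Θ] := by
  classical
  induction B using Finset.induction_on with
  | empty =>
    simp only [Finset.sum_empty, Finset.card_empty, Nat.cast_zero, zero_mul]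
    exact variance_zero _
  | insert b B hb ih =>
    have e : (fun ω ↦ ∑ b ∈ insert b B, blockVar γ Θ α φ p L b ω) =
        blockVar γ Θ α φ p L b + fun ω ↦ ∑ b ∈ B, blockVar γ Θ α φ p L b ω := by
      ext ω
      simp only [Finset.sum_insert hb, Pi.add_apply]
    have hv : Var[blockVar γ Θ α φ p L b; configLaw d γ Θ] =
        Var[blockVar γ Θ α φ p L 0; configLaw d γ Θ] := by
      rw [← variance_id_map (measurable_blockVar hφ hL b).aemeasurable,
        ← variance_id_map (measurable_blockVar hφ hL 0).aemeasurable, map_blockVar hφ hL]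
    rw [e, (indepFun_blockVar hφ hL hb).variance_add (memLp_blockVar hφ hα hm hL b)
      (memLp_sum_blockVar hφ hα hm hL B), ih, hv, Finset.card_insert_of_notMem hb]
    push_cast
    ring

end

/-! ### Comparison of a region with the blocks inside it -/

/-- The cell of a coordinate. -/
def groupOf : Idx d → Option (Cell d)
  | .inl c => some c
  | .inr ρ => open Classical in
    if h : ∃ l ∈ ρ, ∃ x : Cell d × ℕ, l = some x then some h.choose_spec.2.choose.1 else none

/-- The group of a set of labels is the cell of an arbitrarily chosen one of them. Any choice is
good, because all labels of a set in `coordsOf T` lie in cells of `T`. -/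
lemma groupOf_of_mem_coordsOf {T : Set (Cell d)} {i : Idx d} (hi : i ∈ coordsOf T) :
    ∃ c ∈ T, groupOf i = some c := by
  rcases hi with ⟨c, hc, rfl⟩ | ⟨ρ, ⟨l, hl⟩, h, rfl⟩
  · exact ⟨c, hc, rfl⟩
  · have h' : ∃ l ∈ ρ, ∃ x : Cell d × ℕ, l = some x := by
      obtain ⟨c, -, j, rfl⟩ := h l hl
      exact ⟨_, hl, _, rfl⟩
    rw [groupOf, dif_pos h']
    refine ⟨_, ?_, rfl⟩
    obtain ⟨c, hc, j, hj⟩ := h _ h'.choose_spec.1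
    rw [← Option.some.inj (hj.symm.trans h'.choose_spec.2.choose_spec)]
    exact hc

/-- The Efron-Stein inequality with coordinates grouped by cells. The comparison function for `k` is
the same difference with the points of `k` erased. Apart from the window, the erasure affects only
the block that contains `k`, and `lintegral_sub_eraseCell_le` reduces its effect to that of one
additional point. -/
lemma variance_sub_blocks_le (hφ : IsConnection α φ) (hα : 1 ≤ α)
    (hm : ∫⁻ a, mixing γ Θ φ a ^ (2 * (p + 1)) ∂Θ < ∞) {L : ℕ} (hL : 0 < L)
    (hE : MeasurableSet E) {T : Finset (Cell d)} (hET : cells E ⊆ T) {B : Finset (Cell d)}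
    (hB : ∀ b ∈ B, blockCells L b ⊆ T) {c : Cell d → ℝ≥0}
    (hc : ∀ k ∈ T, open Classical in
      ∫⁻ ω, ‖diffIn α φ p (shiftRegion k E) none (cnt ω) (field ω) -
        diffIn α φ p (shiftRegion k (if blockOf L k ∈ B then blockRegion L (blockOf L k) else ∅)) none
          (cnt ω) (field ω)‖ₑ ^ 2 ∂configLaw d γ Θ ≤ c k) :
    Var[(fun ω ↦ bettiIn α φ p E (cnt ω) (field ω)) - fun ω ↦ ∑ b ∈ B, blockVar γ Θ α φ p L b ω;
      configLaw d γ Θ] ≤ 2 * (γ * Real.exp γ) * ∑ k ∈ T, (c k : ℝ) := by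
  classical
  set b0 : ℝ := ∫ ω', bettiIn α φ p (blockRegion L 0) (cnt ω') (field ω') ∂configLaw d γ Θ
  set F : Config d A → ℝ := (fun ω ↦ bettiIn α φ p E (cnt ω) (field ω)) -
    fun ω ↦ ∑ b ∈ B, blockVar γ Θ α φ p L b ω with hF
  have hEc : (cells E).Finite := (Finset.finite_toSet T).subset hET
  have hL2 {E : Region d} (hE : MeasurableSet E) (hEc : (cells E).Finite) :
      MemLp (fun ω ↦ bettiIn α φ p E (cnt ω) (field ω)) 2 (configLaw d γ Θ) :=
    memLp_bettiIn γ Θ hφ hα hm hE hEc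
  have herase {E : Region d} (hE : MeasurableSet E) (hEc : (cells E).Finite) (k : Cell d) :
      MemLp (fun ω ↦ bettiIn α φ p (eraseCell k E) (cnt ω) (field ω)) 2 (configLaw d γ Θ) :=
    hL2 (measurableSet_eraseCell k hE) (hEc.subset (cells_eraseCell_subset k))
  -- The group `none` consists of coordinates that no region uses, so the value there is irrelevant.
  set h : Option (Cell d) → Config d A → ℝ := fun o ω ↦ o.elim 0 fun k ↦
    bettiIn α φ p (eraseCell k E) (cnt ω) (field ω) -
      ∑ b ∈ B, (bettiIn α φ p (eraseCell k (blockRegion L b)) (cnt ω) (field ω) - b0) with hh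
  have hFL : MemLp F 2 (configLaw d γ Θ) := (hL2 hE hEc).sub (memLp_sum_blockVar hφ hα hm hL B)
  have hhL (k : Cell d) : MemLp (h (some k)) 2 (configLaw d γ Θ) :=
    (herase hE hEc k).sub (memLp_finsetSum B fun b _ ↦ (herase (measurableSet_blockRegion L b)
      (finite_cells_blockRegion hL b) k).sub (memLp_const b0))
  have hmain := variance_le_of_dependsOn (siteLaw d γ Θ) (g := groupOf) (T.image some) (f := F)
    (h := h) hFL ?_ ?_ ?_
  · refine hmain.trans ?_
    rw [Finset.sum_image fun x _ y _ hxy ↦ Option.some.inj hxy, mul_assoc, Finset.mul_sum T _ ((γ : ℝ) * Real.exp γ)]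
    refine mul_le_mul_of_nonneg_left (Finset.sum_le_sum fun k hk ↦ ?_) zero_le_two
    set Bk : Region d := if blockOf L k ∈ B then blockRegion L (blockOf L k) else ∅ with hBk
    have hBm : MeasurableSet Bk := by
      rw [hBk]; split_ifs
      exacts [measurableSet_blockRegion _ _, MeasurableSet.empty]
    have hBc : (cells Bk).Finite := by
      rw [hBk]; split_ifs
      exacts [finite_cells_blockRegion hL _, by simp [cells]]
    have e1 : ∀ ω, F ω - h (some k) ω =
        (bettiIn α φ p E (cnt ω) (field ω) - bettiIn α φ p (eraseCell k E) (cnt ω) (field ω)) -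
        (bettiIn α φ p Bk (cnt ω) (field ω) - bettiIn α φ p (eraseCell k Bk) (cnt ω) (field ω)) := by
      intro ω
      have e2 : ∑ b ∈ B, blockVar γ Θ α φ p L b ω -
          ∑ b ∈ B, (bettiIn α φ p (eraseCell k (blockRegion L b)) (cnt ω) (field ω) - b0) =
          bettiIn α φ p Bk (cnt ω) (field ω) - bettiIn α φ p (eraseCell k Bk) (cnt ω) (field ω) := by
        rw [← Finset.sum_sub_distrib]
        have e3 : ∀ b ∈ B, b ≠ blockOf L k → blockVar γ Θ α φ p L b ω -
            (bettiIn α φ p (eraseCell k (blockRegion L b)) (cnt ω) (field ω) - b0) = 0 := by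
          intro b _ hb
          have : eraseCell k (blockRegion L b) = blockRegion L b := by
            ext x
            simp only [eraseCell, blockRegion, mem_ofPred_eq, and_iff_left_iff_imp]
            rintro rfl rfl
            exact hb rfl
          rw [this]
          exact sub_self _
        rw [hBk]
        split_ifs with hk
        · rw [Finset.sum_eq_single_of_mem _ hk e3, blockVar]
          ring
        · rw [Finset.sum_eq_zero fun b hb ↦ e3 b hb fun h ↦ hk (h ▸ hb)]
          have : eraseCell k (∅ : Region d) = ∅ := by simp [eraseCell]
          rw [this, sub_self]
      simp only [hF, hh, Pi.sub_apply, Option.elim_some]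
      linarith
    have e4 : ∫⁻ ω, ENNReal.ofReal ((F ω - h (some k) ω) ^ 2) ∂configLaw d γ Θ ≤
        ENNReal.ofReal (γ * Real.exp γ * c k) := by
      simp only [e1, ← enorm_sq_eq]
      refine (lintegral_sub_eraseCell_le γ Θ hφ hE hEc hBm hBc k).trans ?_
      have e5 : ENNReal.ofReal (γ * Real.exp γ * c k) = ENNReal.ofReal (γ * Real.exp γ) * c k := by
        rw [ENNReal.ofReal_mul (by positivity), ENNReal.ofReal_coe_nnreal]
      rw [e5]
      gcongr
      convert hc k hk
    change ∫ ω, (F ω - h (some k) ω) ^ 2 ∂configLaw d γ Θ ≤ _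
    have hsq : Integrable (fun ω ↦ (F ω - h (some k) ω) ^ 2) (configLaw d γ Θ) :=
      (hFL.sub (hhL k)).integrable_sq
    rw [integral_eq_lintegral_of_nonneg_ae (.of_forall fun _ ↦ sq_nonneg _)
      hsq.aestronglyMeasurable]
    exact ENNReal.toReal_le_of_le_ofReal (by positivity) e4
  · intro ω ω' hω
    have hω' : ∀ i ∈ coordsOf (T : Set (Cell d)), ω i = ω' i := fun i hi ↦ by
      obtain ⟨c, hc, hci⟩ := groupOf_of_mem_coordsOf hi
      exact hω i (by simpa [hci] using hc)
    have e1 := dependsOn_bettiIn (p := p) hφ hET hω'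
    have e2 (b) (hb : b ∈ B) : blockVar γ Θ α φ p L b ω = blockVar γ Θ α φ p L b ω' :=
      dependsOn_blockVar hφ hL b fun i hi ↦ hω' i (coordsOf_mono (Finset.coe_subset.2 (hB b hb)) hi)
    simp only [hF, Pi.sub_apply, Finset.sum_congr rfl e2]
    simpa using e1
  · intro o ho
    rcases o with _ | k
    · simp at ho
    · exact hhL k
  · intro o ho
    rcases o with _ | k
    · simp at ho
    · intro ω ω' hω
      -- A set of labels that meets several cells has just one of them as its group. The erased
      -- regions use only sets without labels in `k`, so all coordinates that matter have a group
      -- other than `k`.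
      have hω' : ∀ i ∈ coordsOf ({k}ᶜ : Set (Cell d)), ω i = ω' i := fun i hi ↦ by
        obtain ⟨c, hc, hci⟩ := groupOf_of_mem_coordsOf hi
        exact hω i (by simpa [hci] using hc)
      have e1 (E : Region d) : bettiIn α φ p (eraseCell k E) (cnt ω) (field ω) =
          bettiIn α φ p (eraseCell k E) (cnt ω') (field ω') :=
        dependsOn_bettiIn (p := p) hφ (by rintro _ ⟨x, hx, rfl⟩; exact hx.2) hω'
      simp only [hh, Option.elim_some, e1]

end Blocks

/-! ### The central limit theorem in the model -/

section Cubes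

variable {d : ℕ}

/-- The half-open cube with lower corner `x` and side length `s`. -/
def cube (x : Fin d → ℝ) (s : ℝ) : Set (Fin d → ℝ) := {y | ∀ i, x i ≤ y i ∧ y i < x i + s}

lemma measurableSet_cube (x : Fin d → ℝ) (s : ℝ) : MeasurableSet (cube x s) := by
  have : cube x s = univ.pi fun i ↦ Ico (x i) (x i + s) := by
    ext y; simp [cube]
  rw [this]
  exact MeasurableSet.univ_pi fun _ ↦ measurableSet_Ico

lemma volume_real_cube (x : Fin d → ℝ) {s : ℝ} (hs : 0 ≤ s) : volume.real (cube x s) = s ^ d := by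
  have : cube x s = univ.pi fun i ↦ Ico (x i) (x i + s) := by
    ext y; simp [cube]
  rw [this, Measure.real, volume_pi_pi]
  simp [hs, ENNReal.toReal_ofReal]

/-- The region that corresponds to a subset of `ℝ^d`. -/
def regionOf (W : Set (Fin d → ℝ)) : Region d := {z | (fun i ↦ (z.1 i : ℝ) + z.2 i) ∈ W}

lemma measurable_regionPoint :
    Measurable fun z : Cell d × (Fin d → unitInterval) ↦ fun i ↦ (z.1 i : ℝ) + z.2 i := by
  refine measurable_pi_lambda _ fun i ↦ ?_
  have h1 : Measurable fun z : Cell d × (Fin d → unitInterval) ↦ (z.1 i : ℝ) :=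
    (measurable_of_countable fun c : Cell d ↦ (c i : ℝ)).comp measurable_fst
  exact h1.add (measurable_subtype_coe.comp (by fun_prop))

lemma measurableSet_regionOf {W : Set (Fin d → ℝ)} (hW : MeasurableSet W) :
    MeasurableSet (regionOf W) := measurable_regionPoint hW

/-- The cells that can meet a cube. -/
def outerCells (x : Fin d → ℝ) (s : ℝ) : Finset (Cell d) :=
  Finset.Icc (fun i ↦ ⌈x i⌉ - 1) fun i ↦ ⌊x i + s⌋

/-- Relative positions range over a closed interval, so for a corner with an integral coordinate the
cell just below it has to be included. -/
lemma cells_regionOf_cube (x : Fin d → ℝ) (s : ℝ) : cells (regionOf (cube x s)) ⊆ outerCells x s := by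
  rintro _ ⟨z, hz, rfl⟩
  simp only [outerCells, Finset.coe_Icc, mem_Icc, Pi.le_def, ← forall_and]
  intro i
  have h := hz i
  have h0 := (z.2 i).2.1
  have h1 := (z.2 i).2.2
  constructor
  · have : ⌈x i⌉ ≤ z.1 i + 1 := Int.ceil_le.2 (by push_cast; linarith)
    omega
  · exact Int.le_floor.2 (by linarith)

lemma card_outerCells_le (x : Fin d → ℝ) {s : ℝ} (hs : 0 ≤ s) :
    ((outerCells x s).card : ℝ) ≤ (s + 2) ^ d := by
  rw [outerCells, Pi.card_Icc, Nat.cast_prod]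
  refine (Finset.prod_le_prod (fun _ _ ↦ by positivity) fun i _ ↦ ?_).trans_eq
    ((Finset.prod_const (s + 2)).trans (by simp))
  rw [Int.card_Icc]
  have h1 := Int.floor_le (x i + s)
  have h2 := Int.le_ceil (x i)
  rcases le_total 0 (⌊x i + s⌋ + 1 - (⌈x i⌉ - 1)) with h | h
  · have : (((⌊x i + s⌋ + 1 - (⌈x i⌉ - 1)).toNat : ℤ) : ℝ) =
        ((⌊x i + s⌋ + 1 - (⌈x i⌉ - 1) : ℤ) : ℝ) := by rw [Int.toNat_of_nonneg h]
    rw [Int.cast_natCast] at this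
    rw [this]
    push_cast
    linarith
  · rw [Int.toNat_of_nonpos h]
    simp only [Nat.cast_zero]
    linarith

/-- The blocks inside a cube. -/
def innerBlocks (L : ℕ) (x : Fin d → ℝ) (s : ℝ) : Finset (Cell d) :=
  Finset.Icc (fun i ↦ ⌈x i / L⌉) fun i ↦ ⌈(x i + s) / L⌉ - 2

/-- The relative position `1` is allowed and the upper faces of the cube are excluded; the bound
`⌈·⌉ - 2` in `innerBlocks` makes the upper inequality strict. -/
lemma blockRegion_subset_regionOf {L : ℕ} (hL : 0 < L) {x : Fin d → ℝ} {s : ℝ} {b : Cell d}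
    (hb : b ∈ innerBlocks L x s) : blockRegion L b ⊆ regionOf (cube x s) := by
  intro z hz i
  have hL' : (0 : ℝ) < L := by exact_mod_cast hL
  simp only [innerBlocks, Finset.mem_Icc, Pi.le_def] at hb
  have h1 := hb.1 i
  have h2 := hb.2 i
  have h3 : z.1 ∈ blockCells L b := (mem_blockCells hL).2 hz
  simp only [blockCells, Finset.mem_Icc, Pi.le_def] at h3
  have h4 := h3.1 i
  have h5 := h3.2 i
  have h6 := (z.2 i).2.1
  have h7 := (z.2 i).2.2
  have h8 : x i / L ≤ b i := Int.ceil_le.1 h1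
  rw [div_le_iff₀ hL'] at h8
  have h9 : ((b i + 1 : ℤ) : ℝ) < (x i + s) / L := Int.lt_ceil.1 (by omega)
  rw [lt_div_iff₀ hL'] at h9
  rify at h4 h5
  push_cast at h9
  constructor <;> nlinarith

lemma blockCells_subset_outerCells {L : ℕ} (hL : 0 < L) {x : Fin d → ℝ} {s : ℝ} {b : Cell d}
    (hb : b ∈ innerBlocks L x s) : blockCells L b ⊆ outerCells x s := by
  intro c hc
  refine cells_regionOf_cube x s ⟨(c, 0), blockRegion_subset_regionOf hL hb ?_, rfl⟩
  exact (mem_blockCells hL).1 hc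

lemma card_innerBlocks_le {L : ℕ} (hL : 0 < L) (x : Fin d → ℝ) {s : ℝ} (hs : 0 ≤ s) :
    ((innerBlocks L x s).card : ℝ) ≤ (s / L) ^ d := by
  rw [innerBlocks, Pi.card_Icc, Nat.cast_prod]
  refine (Finset.prod_le_prod (fun _ _ ↦ by positivity) fun i _ ↦ ?_).trans_eq
    ((Finset.prod_const (s / (L : ℝ))).trans (by simp))
  rw [Int.card_Icc]
  have h1 := Int.ceil_lt_add_one ((x i + s) / L)
  have h2 := Int.le_ceil (x i / L)
  rw [add_div] at h1
  rcases le_total 0 (⌈(x i + s) / L⌉ - 2 + 1 - ⌈x i / L⌉) with h | h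
  · have : (((⌈(x i + s) / L⌉ - 2 + 1 - ⌈x i / L⌉).toNat : ℤ) : ℝ) =
        ((⌈(x i + s) / L⌉ - 2 + 1 - ⌈x i / L⌉ : ℤ) : ℝ) := by rw [Int.toNat_of_nonneg h]
    rw [Int.cast_natCast] at this
    rw [this]
    push_cast
    rw [add_div]
    linarith
  · rw [Int.toNat_of_nonpos h]
    simp only [Nat.cast_zero]
    positivity

lemma le_card_innerBlocks {L : ℕ} (x : Fin d → ℝ) {s : ℝ} (hs : 2 ≤ s / L) :
    (s / L - 2) ^ d ≤ ((innerBlocks L x s).card : ℝ) := by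
  rw [innerBlocks, Pi.card_Icc, Nat.cast_prod]
  refine le_of_eq_of_le ((Finset.prod_const (s / (L : ℝ) - 2)).trans (by simp)).symm
    (Finset.prod_le_prod (fun _ _ ↦ by linarith) fun i _ ↦ ?_)
  rw [Int.card_Icc]
  have h1 := Int.le_ceil ((x i + s) / L)
  have h2 := Int.ceil_lt_add_one (x i / L)
  have h3 : ((⌈(x i + s) / L⌉ - 2 + 1 - ⌈x i / L⌉ : ℤ) : ℝ) ≤
      (((⌈(x i + s) / L⌉ - 2 + 1 - ⌈x i / L⌉).toNat : ℤ) : ℝ) := by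
    exact_mod_cast Int.self_le_toNat _
  rw [Int.cast_natCast] at h3
  refine le_trans ?_ h3
  push_cast
  rw [add_div] at h1 ⊢
  linarith

/-- The cells of a block whose distance from the complement of the block is at least `R`. -/
def deepCells (L R : ℕ) (b : Cell d) : Finset (Cell d) :=
  Finset.Icc (fun i ↦ L * b i + R) fun i ↦ L * b i + L - 1 - R

lemma deepCells_subset {L R : ℕ} (b : Cell d) : deepCells L R b ⊆ blockCells L b := by
  intro c hc
  simp only [deepCells, blockCells, Finset.mem_Icc, Pi.le_def] at *
  exact ⟨fun i ↦ by have := hc.1 i; omega, fun i ↦ by have := hc.2 i; omega⟩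

lemma card_deepCells {L R : ℕ} (h : 2 * R ≤ L) (b : Cell d) :
    (deepCells L R b).card = (L - 2 * R) ^ d := by
  rw [deepCells, Pi.card_Icc]
  refine (Finset.prod_congr rfl fun i _ ↦ ?_).trans ((Finset.prod_const (L - 2 * R)).trans (by simp))
  rw [Int.card_Icc]
  omega

lemma boxRegion_subset_shiftRegion {L R : ℕ} (hL : 0 < L) {b k : Cell d}
    (hk : k ∈ deepCells L R b) : boxRegion d R ⊆ shiftRegion k (blockRegion L b) := by
  intro z hz
  refine (mem_blockCells hL).1 ?_
  have hz' := mem_cellBox.1 (show z.1 ∈ cellBox d R from hz)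
  simp only [deepCells, blockCells, Finset.mem_Icc, Pi.le_def, Pi.add_apply] at *
  refine ⟨fun i ↦ ?_, fun i ↦ ?_⟩
  · have := abs_le.1 (hz' i); have := hk.1 i; omega
  · have := abs_le.1 (hz' i); have := hk.2 i; omega

end Cubes

/-! ### Approximation by blocks and passage to large cubes. -/

section CLT

variable {d : ℕ} {A : Type*} [MeasurableSpace A] {α : ℕ}
  {φ : (j : ℕ) → (Fin (j + 1) → (Fin d → ℝ) × A) → unitInterval} {p : ℕ}
  {γ : ℝ≥0} {Θ : Measure A} [IsProbabilityMeasure Θ]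

lemma finite_cells_shiftRegion {E : Region d} (hE : (cells E).Finite) (k : Cell d) :
    (cells (shiftRegion k E)).Finite := by
  refine (hE.image fun c ↦ c - k).subset ?_
  rintro _ ⟨⟨c, x⟩, hx, rfl⟩
  exact ⟨c + k, ⟨_, hx, rfl⟩, by simp⟩

lemma measurableSet_shiftRegion {E : Region d} (hE : MeasurableSet E) (k : Cell d) :
    MeasurableSet (shiftRegion k E) := hE.preimage (by fun_prop)

lemma lintegral_diffIn_sub_le (hα : 1 ≤ α) {E E' : Region d} (hE : (cells E).Finite)
    (hE' : (cells E').Finite) :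
    ∫⁻ ω, ‖diffIn α φ p E none (cnt ω) (field ω) - diffIn α φ p E' none (cnt ω) (field ω)‖ₑ ^ 2
      ∂configLaw d γ Θ ≤
    4 * ∫⁻ ω, (1 + joinedTotal φ (cnt ω) (field ω)) ^ (2 * (p + 1)) ∂configLaw d γ Θ := by
  rw [← lintegral_const_mul' _ _ (by finiteness)]
  refine lintegral_mono fun ω ↦ ?_
  dsimp only
  rw [mul_comm 2 (p + 1), pow_mul, show (4 : ℝ≥0∞) = 2 ^ 2 by norm_num, ← mul_pow]
  gcongr
  refine enorm_sub_le.trans ?_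
  rw [two_mul]
  exact add_le_add (enorm_diffIn_le hα hE) (enorm_diffIn_le hα hE')

/-- A cell at depth `R` inside an inner block contributes at most `C₀ * ε` by uniform stabilization,
any other cell at most `C₀`. The number of the latter is the number of all cells minus that of the
deep ones. -/
lemma exists_variance_sub_blocks_le (hφ : IsConnection α φ) (hα : 1 ≤ α)
    (hm : ∫⁻ a, mixing γ Θ φ a ^ (2 * (p + 1)) ∂Θ < ∞) :
    ∃ C : ℝ, 0 ≤ C ∧ ∀ ε > 0, ∃ R : ℕ, ∀ L : ℕ, 0 < L → 2 * R ≤ L → ∀ (x : Fin d → ℝ) (s : ℝ), 0 < s →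
      2 ≤ s / L →
      Var[(fun ω ↦ bettiIn α φ p (regionOf (cube x s)) (cnt ω) (field ω)) -
        fun ω ↦ ∑ b ∈ innerBlocks L x s, blockVar γ Θ α φ p L b ω; configLaw d γ Θ] ≤
      C * (ε * (s + 2) ^ d + ((s + 2) ^ d - (s / L - 2) ^ d * ((L : ℝ) - 2 * R) ^ d)) := by
  classical
  set M := 4 * ∫⁻ ω, (1 + joinedTotal φ (cnt ω) (field ω)) ^ (2 * (p + 1)) ∂configLaw d γ Θ with hM
  have hMt : M ≠ ∞ :=
    ENNReal.mul_ne_top (by finiteness) (lintegral_joinedTotal_lt_top γ Θ hφ hα hm).ne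
  -- The summand `1` makes `C₀` positive, so that `C₀ * ε` is an admissible accuracy.
  set C₀ : ℝ≥0 := M.toNNReal + 1 with hC₀
  have hC₀M : M ≤ C₀ := by
    rw [hC₀, ENNReal.coe_add, ENNReal.coe_toNNReal hMt]
    exact le_self_add
  refine ⟨2 * (γ * Real.exp γ) * C₀, by positivity, fun ε hε ↦ ?_⟩
  lift ε to ℝ≥0 using hε.le
  have hε' : (0 : ℝ≥0) < ε := hε
  have hC₀pos : 0 < C₀ := by rw [hC₀]; positivity
  obtain ⟨R, hR⟩ := exists_lintegral_diffIn_sub_le (p := p) γ Θ hφ hα hm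
    (ε := ((C₀ * ε : ℝ≥0) : ℝ≥0∞)) (by exact_mod_cast mul_pos hC₀pos hε')
  refine ⟨R, fun L hL hRL x s hs hsL ↦ ?_⟩
  set B := innerBlocks L x s
  set T := outerCells x s
  set Dp := B.biUnion (deepCells L R) with hDp
  have hDT : Dp ⊆ T := by
    intro k hk
    obtain ⟨b, hb, hkb⟩ := Finset.mem_biUnion.1 hk
    exact blockCells_subset_outerCells hL hb (deepCells_subset b hkb)
  have hDcard : Dp.card = B.card * (L - 2 * R) ^ d := by
    rw [hDp, Finset.card_biUnion, Finset.sum_congr rfl fun b _ ↦ card_deepCells hRL b,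
      Finset.sum_const, smul_eq_mul]
    intro b _ b' _ hbb
    rw [Function.onFun, Finset.disjoint_left]
    intro c hc hc'
    exact hbb (((mem_blockCells hL).1 (deepCells_subset b hc)).symm.trans
      ((mem_blockCells hL).1 (deepCells_subset b' hc')))
  have hE := measurableSet_regionOf (measurableSet_cube x s)
  have hEc : (cells (regionOf (cube x s))).Finite :=
    (Finset.finite_toSet T).subset (cells_regionOf_cube x s)
  have hmain := variance_sub_blocks_le (p := p) γ Θ hφ hα hm hL hE (cells_regionOf_cube x s) (B := B)
    (fun b hb ↦ blockCells_subset_outerCells hL hb) (c := fun k ↦ if k ∈ Dp then C₀ * ε else C₀) ?_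
  · refine hmain.trans ?_
    rw [mul_assoc _ (C₀ : ℝ)]
    refine mul_le_mul_of_nonneg_left ?_ (by positivity)
    have e1 : ∑ k ∈ T, (((if k ∈ Dp then C₀ * ε else C₀ : ℝ≥0)) : ℝ) =
        C₀ * (Dp.card * ε + (T.card - Dp.card)) := by
      rw [← Finset.sum_sdiff hDT, Finset.sum_congr rfl (g := fun _ ↦ (C₀ : ℝ)),
        Finset.sum_congr (s₁ := Dp) rfl (g := fun _ ↦ (C₀ * ε : ℝ)), Finset.sum_const,
        Finset.sum_const, Finset.card_sdiff_of_subset hDT, nsmul_eq_mul, nsmul_eq_mul,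
        Nat.cast_sub (Finset.card_le_card hDT)]
      · ring
      · intro k hk
        rw [if_pos hk]; push_cast; rfl
      · intro k hk
        rw [if_neg (Finset.mem_sdiff.1 hk).2]
    rw [e1]
    refine mul_le_mul_of_nonneg_left ?_ C₀.2
    have h1 : (T.card : ℝ) ≤ (s + 2) ^ d := card_outerCells_le x hs.le
    have h2 : (Dp.card : ℝ) ≤ T.card := by exact_mod_cast Finset.card_le_card hDT
    have h3 : (s / L - 2) ^ d * ((L : ℝ) - 2 * R) ^ d ≤ Dp.card := by
      rw [hDcard]
      push_cast [Nat.cast_sub hRL]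
      refine mul_le_mul_of_nonneg_right (le_card_innerBlocks x hsL) (pow_nonneg ?_ _)
      have : ((2 * R : ℕ) : ℝ) ≤ L := by exact_mod_cast hRL
      push_cast at this
      linarith
    have h4 : (Dp.card : ℝ) * ε ≤ ε * (s + 2) ^ d := by
      rw [mul_comm]
      exact mul_le_mul_of_nonneg_left (h2.trans h1) ε.2
    linarith
  · intro k _
    set Bk : Region d := if blockOf L k ∈ B then blockRegion L (blockOf L k) else ∅ with hBk
    have hBm : MeasurableSet Bk := by
      rw [hBk]; split_ifs
      exacts [measurableSet_blockRegion _ _, MeasurableSet.empty]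
    have hBc : (cells Bk).Finite := by
      rw [hBk]; split_ifs
      exacts [finite_cells_blockRegion hL _, by simp [cells]]
    have key : ∫⁻ ω, ‖diffIn α φ p (shiftRegion k (regionOf (cube x s))) none (cnt ω) (field ω) -
        diffIn α φ p (shiftRegion k Bk) none (cnt ω) (field ω)‖ₑ ^ 2 ∂configLaw d γ Θ ≤
        ((if k ∈ Dp then C₀ * ε else C₀ : ℝ≥0) : ℝ≥0∞) := by
      split_ifs with hk
      · obtain ⟨b, hb, hkb⟩ := Finset.mem_biUnion.1 hk
        have hbk : blockOf L k = b := (mem_blockCells hL).1 (deepCells_subset b hkb)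
        have hBkb : Bk = blockRegion L b := by rw [hBk, hbk, if_pos hb]
        have h1 := boxRegion_subset_shiftRegion hL hkb
        rw [hBkb]
        refine hR _ _ (measurableSet_shiftRegion hE k)
          (measurableSet_shiftRegion (measurableSet_blockRegion L b) k)
          (finite_cells_shiftRegion hEc k)
          (finite_cells_shiftRegion (finite_cells_blockRegion hL b) k) (h1.trans ?_) h1
        exact fun z hz ↦ blockRegion_subset_regionOf hL hb hz
      · exact (lintegral_diffIn_sub_le hα (finite_cells_shiftRegion hEc k)
          (finite_cells_shiftRegion hBc k)).trans hC₀M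
    convert key

/-- Cubes, given by the lower corner and the side length. -/
abbrev CubeData (d : ℕ) : Type := {c : (Fin d → ℝ) × ℝ // 0 < c.2}

/-- The filter of large cubes. -/
def largeCubes (d : ℕ) : Filter (CubeData d) := comap (fun c ↦ c.1.2) atTop

instance : (largeCubes d).NeBot := by
  refine comap_neBot fun t ht ↦ ?_
  obtain ⟨s, hs⟩ := mem_atTop_sets.1 ht
  exact ⟨⟨(0, max s 1), by positivity⟩, hs _ (le_max_left _ _)⟩

lemma tendsto_card_innerBlocks {L : ℕ} (hL : 0 < L) :
    Tendsto (fun c : CubeData d ↦ ((innerBlocks L c.1.1 c.1.2).card : ℝ) / c.1.2 ^ d) (largeCubes d)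
      (𝓝 (((L : ℝ)⁻¹) ^ d)) := by
  have hL' : (0 : ℝ) < L := by exact_mod_cast hL
  have hs : Tendsto (fun c : CubeData d ↦ c.1.2) (largeCubes d) atTop := tendsto_comap
  have h1 : Tendsto (fun s : ℝ ↦ ((L : ℝ)⁻¹ - 2 * s⁻¹) ^ d) atTop (𝓝 (((L : ℝ)⁻¹ - 2 * 0) ^ d)) :=
    (tendsto_const_nhds.sub (tendsto_inv_atTop_zero.const_mul 2)).pow d
  rw [mul_zero, sub_zero] at h1
  refine tendsto_of_tendsto_of_tendsto_of_le_of_le' (h1.comp hs) tendsto_const_nhds ?_ ?_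
  · filter_upwards [hs.eventually_ge_atTop (2 * L)] with c hc
    have hc0 := c.2
    rw [Function.comp_apply, le_div_iff₀ (by positivity), ← mul_pow]
    refine le_trans (le_of_eq ?_) (le_card_innerBlocks c.1.1 ?_)
    · congr 1
      field_simp
    · rwa [le_div_iff₀ hL']
  · refine .of_forall fun c ↦ ?_
    have hc0 := c.2
    rw [div_le_iff₀ (by positivity), ← mul_pow]
    refine (card_innerBlocks_le hL c.1.1 hc0.le).trans (le_of_eq ?_)
    rw [inv_mul_eq_div]

/-- Constants are chosen in this order: the accuracy `ε`, the radius `R` of stabilization, a block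
length `L` for which the layers of width `R` are negligible, and then the side length of the cube
tends to infinity. The approximating sums run over the inner blocks. -/
theorem exists_clt_bettiIn (hd : 1 ≤ d) (hφ : IsConnection α φ) (hα : 1 ≤ α)
    (hm : ∫⁻ a, mixing γ Θ φ a ^ (2 * (p + 1)) ∂Θ < ∞) :
    ∃ v : ℝ≥0, Tendsto (fun c : CubeData d ↦
        Var[fun ω ↦ bettiIn α φ p (regionOf (cube c.1.1 c.1.2)) (cnt ω) (field ω); configLaw d γ Θ] /
          c.1.2 ^ d) (largeCubes d) (𝓝 v) ∧
      ∀ t : ℝ, Tendsto (fun c : CubeData d ↦ charFun ((configLaw d γ Θ).map fun ω ↦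
        (bettiIn α φ p (regionOf (cube c.1.1 c.1.2)) (cnt ω) (field ω) -
          ∫ ω', bettiIn α φ p (regionOf (cube c.1.1 c.1.2)) (cnt ω') (field ω') ∂configLaw d γ Θ) /
            √(c.1.2 ^ d)) t) (largeCubes d)
        (𝓝 (Complex.exp (-(v * t ^ 2 / 2 : ℝ)))) := by
  have hs : Tendsto (fun c : CubeData d ↦ c.1.2) (largeCubes d) atTop := tendsto_comap
  refine exists_clt_of_approx (vol := fun c : CubeData d ↦ c.1.2 ^ d) (fun c ↦ pow_pos c.2 d)
    (fun c ↦ memLp_bettiIn γ Θ hφ hα hm (measurableSet_regionOf (measurableSet_cube _ _))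
      ((Finset.finite_toSet _).subset (cells_regionOf_cube _ _))) fun η hη ↦ ?_
  obtain ⟨C, hC, hCε⟩ := exists_variance_sub_blocks_le (d := d) (p := p) hφ hα hm
  obtain ⟨R, hR⟩ := hCε (η / (2 * (C + 1))) (by positivity)
  set ε := η / (2 * (C + 1)) with hε
  have hCεη : C * ε < η := by
    rw [hε, mul_div_assoc', div_lt_iff₀ (by positivity)]
    nlinarith
  obtain ⟨L, hL, hRL, hlim⟩ : ∃ L : ℕ, 0 < L ∧ 2 * R ≤ L ∧
      C * (ε + (1 - (1 - 2 * R * (L : ℝ)⁻¹) ^ d)) < η := by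
    have h1 : Tendsto (fun L : ℕ ↦ C * (ε + (1 - (1 - 2 * R * (L : ℝ)⁻¹) ^ d))) atTop
        (𝓝 (C * (ε + (1 - (1 - 2 * R * 0) ^ d)))) :=
      (tendsto_const_nhds.add (tendsto_const_nhds.sub ((tendsto_const_nhds.sub
        (tendsto_inv_atTop_nhds_zero_nat.const_mul _)).pow d))).const_mul C
    rw [mul_zero, sub_zero, one_pow, sub_self, add_zero] at h1
    obtain ⟨L, h2, h3, h4⟩ := ((eventually_ge_atTop 1).and ((eventually_ge_atTop (2 * R)).and
      (h1.eventually (gt_mem_nhds hCεη)))).exists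
    exact ⟨L, h2, h3, h4⟩
  have hL' : (0 : ℝ) < L := by exact_mod_cast hL
  have hmeas : Measurable (blockVar γ Θ α φ p L 0) := measurable_blockVar hφ hL 0
  have hsum0 (B : Finset (Cell d)) :
      ∫ ω, ∑ b ∈ B, blockVar γ Θ α φ p L b ω ∂configLaw d γ Θ = 0 := by
    rw [integral_finsetSum _ fun b _ ↦ (memLp_blockVar hφ hα hm hL b).integrable one_le_two]
    exact Finset.sum_eq_zero fun b _ ↦ integral_blockVar hφ hα hm hL b
  refine ⟨fun c ω ↦ ∑ b ∈ innerBlocks L c.1.1 c.1.2, blockVar γ Θ α φ p L b ω,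
    fun c ↦ (innerBlocks L c.1.1 c.1.2).card, ((L : ℝ)⁻¹) ^ d,
    (configLaw d γ Θ).map (blockVar γ Θ α φ p L 0), by positivity,
    Measure.isProbabilityMeasure_map hmeas.aemeasurable, ?_, ?_,
    fun c ↦ memLp_sum_blockVar hφ hα hm hL _, ?_, tendsto_card_innerBlocks hL, ?_, fun c ↦ ?_,
    fun c t ↦ ?_⟩
  · exact (memLp_map_measure_iff aestronglyMeasurable_id hmeas.aemeasurable).2
      (memLp_blockVar hφ hα hm hL 0)
  · rw [integral_map hmeas.aemeasurable (f := fun x ↦ x) aestronglyMeasurable_id]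
    exact integral_blockVar hφ hα hm hL 0
  · have h1 : Tendsto (fun c : CubeData d ↦ c.1.2 / L - 2) (largeCubes d) atTop :=
      tendsto_atTop_add_const_right _ _ (hs.atTop_div_const hL')
    rw [← tendsto_natCast_atTop_iff (R := ℝ)]
    refine tendsto_atTop_mono' _ ?_ h1
    filter_upwards [h1.eventually_ge_atTop 1] with c hc
    refine le_trans ?_ (le_card_innerBlocks c.1.1 (by linarith))
    -- The dimension has to be positive here; otherwise the number of blocks would not grow.
    exact le_self_pow₀ hc (by omega)
  · have h2 : Tendsto (fun s : ℝ ↦ C * (ε * (1 + 2 * s⁻¹) ^ d + ((1 + 2 * s⁻¹) ^ d -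
        ((L : ℝ)⁻¹ - 2 * s⁻¹) ^ d * ((L : ℝ) - 2 * R) ^ d))) atTop
        (𝓝 (C * (ε * (1 + 2 * 0) ^ d + ((1 + 2 * 0) ^ d -
          ((L : ℝ)⁻¹ - 2 * 0) ^ d * ((L : ℝ) - 2 * R) ^ d)))) := by
      have h3 : Tendsto (fun s : ℝ ↦ (1 + 2 * s⁻¹) ^ d) atTop (𝓝 ((1 + 2 * 0) ^ d)) :=
        (tendsto_const_nhds.add (tendsto_inv_atTop_zero.const_mul 2)).pow d
      have h4 : Tendsto (fun s : ℝ ↦ ((L : ℝ)⁻¹ - 2 * s⁻¹) ^ d) atTop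
          (𝓝 (((L : ℝ)⁻¹ - 2 * 0) ^ d)) :=
        (tendsto_const_nhds.sub (tendsto_inv_atTop_zero.const_mul 2)).pow d
      exact ((h3.const_mul ε).add (h3.sub (h4.mul_const _))).const_mul C
    have e0 : C * (ε * (1 + 2 * 0) ^ d + ((1 + 2 * 0) ^ d -
          ((L : ℝ)⁻¹ - 2 * 0) ^ d * ((L : ℝ) - 2 * R) ^ d)) =
        C * (ε + (1 - (1 - 2 * R * (L : ℝ)⁻¹) ^ d)) := by
      rw [mul_zero, add_zero, sub_zero, one_pow, mul_one, ← mul_pow]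
      congr 4
      field_simp
    rw [e0] at h2
    filter_upwards [(h2.comp hs).eventually (gt_mem_nhds hlim),
      hs.eventually_ge_atTop (2 * L)] with c hc hc2
    have hc0 := c.2
    refine (hR L hL hRL c.1.1 c.1.2 c.2 (by rwa [le_div_iff₀ hL'])).trans ?_
    have hsd : (0 : ℝ) < c.1.2 ^ d := by positivity
    calc _ = C * (ε * (1 + 2 * c.1.2⁻¹) ^ d + ((1 + 2 * c.1.2⁻¹) ^ d -
          ((L : ℝ)⁻¹ - 2 * c.1.2⁻¹) ^ d * ((L : ℝ) - 2 * R) ^ d)) * c.1.2 ^ d := by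
          have a1 : (c.1.2 + 2) ^ d = (1 + 2 * c.1.2⁻¹) ^ d * c.1.2 ^ d := by
            rw [← mul_pow]; congr 1; field_simp
          have a2 : (c.1.2 / L - 2) ^ d = ((L : ℝ)⁻¹ - 2 * c.1.2⁻¹) ^ d * c.1.2 ^ d := by
            rw [← mul_pow]; congr 1; field_simp
          rw [a1, a2]
          ring
      _ ≤ η * c.1.2 ^ d := by gcongr; exact hc.le
  · rw [variance_id_map hmeas.aemeasurable]
    exact variance_sum_blockVar hφ hα hm hL _
  · simp only [hsum0, sub_zero]
    exact charFun_sum_blockVar hφ hL _ t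

end CLT

/-! ### Positivity of the asymptotic variance -/

section Positivity

variable {d : ℕ} {A : Type*} [MeasurableSpace A] {α : ℕ}
  {φ : (j : ℕ) → (Fin (j + 1) → (Fin d → ℝ) × A) → unitInterval} {p : ℕ}
  {γ : ℝ≥0} {Θ : Measure A} [IsProbabilityMeasure Θ]

open Classical in
/-- Indicates that there are `n` points in the cell `k`. -/
def cntInd (k : Cell d) (n : ℕ) (ω : Config d A) : ℝ := if cnt ω k = n then 1 else 0

omit [MeasurableSpace A] in
lemma cntInd_eq (k : Cell d) (n : ℕ) (ω : Config d A) :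
    cntInd k n ω = (if (ω (.inl k)).1 = n then 1 else 0) := by
  unfold cntInd cnt
  congr

lemma measurable_natInd (n : ℕ) :
    Measurable fun z : ℕ × Datum d A ↦ (if z.1 = n then 1 else 0 : ℝ) :=
  (measurable_of_countable fun m : ℕ ↦ (if m = n then 1 else 0 : ℝ)).comp measurable_fst

lemma measurable_cntInd (k : Cell d) (n : ℕ) : Measurable (cntInd (A := A) k n) := by
  have : cntInd (A := A) k n = fun ω ↦ (if (ω (.inl k)).1 = n then 1 else 0 : ℝ) :=
    funext fun ω ↦ cntInd_eq k n ω
  rw [this]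
  exact (measurable_natInd n).comp (measurable_pi_apply _)

lemma integral_natInd (n : ℕ) :
    ∫ z, (if z.1 = n then 1 else 0 : ℝ) ∂siteLaw d γ Θ = (poissonMeasure γ).real {n} := by
  have h : ∀ m : ℕ, (if m = n then 1 else 0 : ℝ) = ({n} : Set ℕ).indicator 1 m := fun m ↦ by
    simp [indicator_apply]
  rw [siteLaw, integral_fun_fst (fun m : ℕ ↦ (if m = n then 1 else 0 : ℝ))]
  simp only [h]
  rw [integral_indicator_one (measurableSet_singleton n)]
  simp

lemma poissonMeasure_real_pos (hγ : 0 < γ) (n : ℕ) : 0 < (poissonMeasure γ).real {n} := by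
  rw [Measure.real, poissonMeasure_singleton, ENNReal.toReal_ofReal (by positivity)]
  have : (0 : ℝ) < γ := hγ
  positivity

lemma integral_cntInd_mul {X : Config d A → ℝ} {k : Cell d} (n : ℕ)
    (hX : AEStronglyMeasurable X (configLaw d γ Θ)) (hXk : DependsOn X {Sum.inl k}ᶜ) :
    ∫ ω, cntInd k n ω * X ω ∂configLaw d γ Θ =
      (poissonMeasure γ).real {n} * ∫ ω, X ω ∂configLaw d γ Θ := by
  simp only [cntInd_eq]
  rw [configLaw, integral_mul_of_dependsOn (siteLaw d γ Θ) hX hXk (measurable_natInd n),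
    integral_natInd]

/-- The effect of the next point in the cell `k` on the Betti numbers of two regions. -/
lemma integral_cntInd_mul_diffIn (hφ : IsConnection α φ) {E E' : Region d} (hE : MeasurableSet E)
    (hEc : (cells E).Finite) (hE' : MeasurableSet E') (hEc' : (cells E').Finite) (k : Cell d)
    (n : ℕ) :
    ∫ ω, cntInd k n ω * (diffIn α φ p E (some (k, n)) (cnt ω) (field ω) *
        diffIn α φ p E' (some (k, n)) (cnt ω) (field ω)) ∂configLaw d γ Θ =
      ∫ ω, cntInd 0 n ω * (diffIn α φ p (shiftRegion k E) none (cnt ω) (field ω) *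
        diffIn α φ p (shiftRegion k E') none (cnt ω) (field ω)) ∂configLaw d γ Θ := by
  have hmp := measurePreserving_relabelled (d := d) (A := A) γ Θ k n
  have hd {E : Region d} (hE : MeasurableSet E) (hEc : (cells E).Finite) :
      Measurable fun ω : Config d A ↦ diffIn α φ p (shiftRegion k E) none (cnt ω) (field ω) :=
    measurable_diffIn hφ (measurableSet_shiftRegion hE k) (finite_cells_shiftRegion hEc k)
      measurable_cnt measurable_field none
  conv_rhs => rw [← hmp.map_eq]
  rw [integral_map hmp.measurable.aemeasurable]
  · refine integral_congr_ae (.of_forall fun ω ↦ ?_)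
    have : cnt (relabelled k n ω) 0 = cnt ω k := by simp [cnt, relabelled, relabelIdx]
    simp only [cntInd, this]
    split_ifs with h
    · rw [diffIn_relabelled hφ h, diffIn_relabelled hφ h]
    · simp
  · exact ((measurable_cntInd 0 n).mul ((hd hE hEc).mul (hd hE' hEc'))).aestronglyMeasurable

omit [MeasurableSpace A] in
lemma dependsOn_update_cnt {β : Type*} (F : (Cell d → ℕ) → Field d A → β) (k : Cell d) (n : ℕ) :
    DependsOn (fun ω : Config d A ↦ F (Function.update (cnt ω) k n) (field ω)) {Sum.inl k}ᶜ := by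
  intro ω ω' hω
  have e1 : field ω = field ω' := by
    ext1 ρ; rw [field, field, hω _ (by simp)]
  have e2 : Function.update (cnt ω) k n = Function.update (cnt ω') k n := by
    ext c
    obtain rfl | hc := eq_or_ne c k
    · simp
    · rw [Function.update_of_ne hc, Function.update_of_ne hc, cnt, cnt, hω _ (by simpa using hc)]
  simp only [e1, e2]

lemma measurable_update_cnt (k : Cell d) (n : ℕ) :
    Measurable fun ω : Config d A ↦ Function.update (cnt ω) k n :=
  (measurable_update_left (a := k) (x := n)).comp measurable_cnt

omit [MeasurableSpace A] in
lemma cntInd_mul_update (F : (Cell d → ℕ) → Field d A → ℝ) (k : Cell d) (n : ℕ) (ω : Config d A) :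
    cntInd k n ω * F (Function.update (cnt ω) k n) (field ω) =
      cntInd k n ω * F (cnt ω) (field ω) := by
  unfold cntInd
  split_ifs with h
  · rw [← h, Function.update_eq_self]
  · simp

/-- A variable that does not depend on the number of points in the cell `k` is square integrable if
it is so on the event that there are `n` points in `k`. -/
lemma memLp_two_of_cntInd_mul (hγ : 0 < γ) {X : Config d A → ℝ} {k : Cell d} {n : ℕ}
    (hX : Measurable X) (hXk : DependsOn X {Sum.inl k}ᶜ)
    (h : MemLp (fun ω ↦ cntInd k n ω * X ω) 2 (configLaw d γ Θ)) : MemLp X 2 (configLaw d γ Θ) := by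
  rw [memLp_two_iff_lintegral hX.aestronglyMeasurable]
  rw [memLp_two_iff_lintegral h.aestronglyMeasurable] at h
  have e : ∀ ω, ‖cntInd k n ω * X ω‖ₑ ^ 2 = (if (ω (.inl k)).1 = n then 1 else 0) * ‖X ω‖ₑ ^ 2 := by
    intro ω
    rw [cntInd_eq]
    split_ifs <;> simp
  have hm : Measurable fun z : ℕ × Datum d A ↦ (if z.1 = n then 1 else 0 : ℝ≥0∞) :=
    (measurable_of_countable fun m : ℕ ↦ (if m = n then 1 else 0 : ℝ≥0∞)).comp measurable_fst
  simp only [e] at h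
  rw [configLaw, lintegral_mul_of_dependsOn (siteLaw d γ Θ) (X := fun ω ↦ ‖X ω‖ₑ ^ 2)
    (hX.enorm.pow_const 2) (fun ω ω' hω ↦ by simp only [hXk hω]) hm,
    lintegral_siteLaw_fst γ Θ (f := fun m ↦ if m = n then 1 else 0)] at h
  have h0 : ∫⁻ m, (if m = n then 1 else 0 : ℝ≥0∞) ∂poissonMeasure γ ≠ 0 := by
    have e2 : ∀ m : ℕ, (if m = n then 1 else 0 : ℝ≥0∞) = ({n} : Set ℕ).indicator 1 m := fun m ↦ by
      simp [indicator_apply]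
    simp only [e2]
    rw [lintegral_indicator_one (measurableSet_singleton n)]
    intro h0
    have := poissonMeasure_real_pos hγ n
    rw [Measure.real, h0] at this
    simp at this
  by_contra hcon
  rw [not_lt, top_le_iff] at hcon
  rw [show (Measure.infinitePi fun _ ↦ siteLaw d γ Θ) = configLaw d γ Θ from rfl, hcon,
    ENNReal.mul_top h0] at h
  exact lt_irrefl _ h

/-- The centre of a block of side length `2 R + 1`. -/
def blockCentre (R : ℕ) (b : Cell d) : Cell d := fun i ↦ (2 * R + 1 : ℕ) * b i + R

lemma blockCentre_mem (R : ℕ) (b : Cell d) : blockCentre R b ∈ deepCells (2 * R + 1) R b := by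
  simp only [deepCells, Finset.mem_Icc, Pi.le_def, blockCentre]
  exact ⟨fun i ↦ le_rfl, fun i ↦ by push_cast; omega⟩

lemma blockOf_blockCentre (R : ℕ) (b : Cell d) : blockOf (2 * R + 1) (blockCentre R b) = b :=
  (mem_blockCells (by omega)).1 (deepCells_subset b (blockCentre_mem R b))

/-- The test function has one summand for the central cell `k` of each inner block: `a` compares `n
+ 1` with `n` points in `k`, and the weight `Y` is the effect of the next point on the block. Its
covariance with the Betti number of the window is the mean of `Y` times the effect of the same point
on the window. By stabilization the two effects almost agree, so every block contributes at least a
fixed positive amount, and the Cauchy-Schwarz inequality applies. -/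
theorem pos_of_integral_sq_diffIn_ge (hφ : IsConnection α φ) (hα : 1 ≤ α) (hγ : 0 < γ)
    (hm : ∫⁻ a, mixing γ Θ φ a ^ (2 * (p + 1)) ∂Θ < ∞) {δ : ℝ} (hδ : 0 < δ) {n R₀ : ℕ}
    (hlow : ∀ E : Region d, MeasurableSet E → (cells E).Finite → boxRegion d R₀ ⊆ E →
      δ ≤ ∫ ω, cntInd 0 n ω * diffIn α φ p E none (cnt ω) (field ω) ^ 2 ∂configLaw d γ Θ)
    {v : ℝ} (hv : Tendsto (fun c : CubeData d ↦
        Var[fun ω ↦ bettiIn α φ p (regionOf (cube c.1.1 c.1.2)) (cnt ω) (field ω); configLaw d γ Θ] /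
          c.1.2 ^ d) (largeCubes d) (𝓝 v)) : 0 < v := by
  classical
  have hdm {E : Region d} (hE : MeasurableSet E) (hEc : (cells E).Finite) (l : Label d) :
      Measurable fun ω : Config d A ↦ diffIn α φ p E l (cnt ω) (field ω) :=
    measurable_diffIn hφ hE hEc measurable_cnt measurable_field l
  have hfin := lintegral_joinedTotal_lt_top γ Θ hφ hα hm
  have hdL {E : Region d} (hE : MeasurableSet E) (hEc : (cells E).Finite) :
      MemLp (fun ω : Config d A ↦ diffIn α φ p E none (cnt ω) (field ω)) 2 (configLaw d γ Θ) := by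
    rw [memLp_two_iff_lintegral (hdm hE hEc none).aestronglyMeasurable]
    exact (lintegral_sq_diffIn_le γ Θ hα hEc).trans_lt hfin
  set M : ℝ := (∫⁻ ω, (1 + joinedTotal φ (cnt ω) (field ω)) ^ (2 * (p + 1)) ∂configLaw d γ Θ).toReal
    with hM
  have hind (k : Cell d) (n : ℕ) (ω : Config d A) : 0 ≤ cntInd k n ω ∧ cntInd k n ω ≤ 1 := by
    unfold cntInd; split_ifs <;> simp
  have hindL {X : Config d A → ℝ} (hX : MemLp X 2 (configLaw d γ Θ)) (k : Cell d) (n : ℕ) :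
      MemLp (fun ω ↦ cntInd k n ω * X ω) 2 (configLaw d γ Θ) := by
    refine hX.mono ((measurable_cntInd k n).aestronglyMeasurable.mul hX.aestronglyMeasurable)
      (.of_forall fun ω ↦ ?_)
    rw [norm_mul, Real.norm_of_nonneg (hind k n ω).1]
    exact mul_le_of_le_one_left (norm_nonneg _) (hind k n ω).2
  have hdM {E : Region d} (hE : MeasurableSet E) (hEc : (cells E).Finite) :
      ∫ ω, diffIn α φ p E none (cnt ω) (field ω) ^ 2 ∂configLaw d γ Θ ≤ M := by
    rw [integral_eq_lintegral_of_nonneg_ae (.of_forall fun _ ↦ sq_nonneg _)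
      (((hdm hE hEc none).pow_const 2).aestronglyMeasurable)]
    refine ENNReal.toReal_mono hfin.ne ?_
    simp only [← enorm_sq_eq]
    exact lintegral_sq_diffIn_le γ Θ hα hEc
  obtain ⟨R₁, hR₁⟩ := exists_lintegral_diffIn_sub_le (p := p) γ Θ hφ hα hm
    (ε := ENNReal.ofReal (δ / 2)) (by positivity)
  set R := max R₀ R₁ with hR
  have hbox {R' : ℕ} (h : R' ≤ R) : boxRegion d R' ⊆ boxRegion d R := fun x hx ↦ cellBox_mono h hx
  set L := 2 * R + 1 with hLd
  have hL : 0 < L := by omega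
  set π₀ := (poissonMeasure γ).real {n} with hπ₀
  set π₁ := (poissonMeasure γ).real {n + 1} with hπ₁
  have hp0 : 0 < π₀ := poissonMeasure_real_pos hγ n
  have hp1 : 0 < π₁ := poissonMeasure_real_pos hγ (n + 1)
  -- the test function
  set a : ℕ × Datum d A → ℝ := fun z ↦
    (if z.1 = n + 1 then 1 else 0) / π₁ - (if z.1 = n then 1 else 0) / π₀ with ha
  have ham : Measurable a := ((measurable_natInd _).div_const _).sub ((measurable_natInd _).div_const _)
  set K := π₁⁻¹ + π₀⁻¹ with hK
  have haK (z) : |a z| ≤ K := by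
    refine (abs_sub _ _).trans (add_le_add ?_ ?_)
    · rw [abs_of_nonneg (by positivity)]
      split_ifs
      · simp
      · simpa using hp1.le
    · rw [abs_of_nonneg (by positivity)]
      split_ifs
      · simp
      · simpa using hp0.le
  have hni (n) : Integrable (fun z : ℕ × Datum d A ↦ (if z.1 = n then 1 else 0 : ℝ)) (siteLaw d γ Θ) := by
    refine Integrable.of_bound (measurable_natInd n).aestronglyMeasurable 1 (.of_forall fun z ↦ ?_)
    split_ifs <;> simp
  have ha0 : ∫ z, a z ∂siteLaw d γ Θ = 0 := by
    simp only [ha]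
    rw [integral_sub ((hni _).div_const _) ((hni _).div_const _), integral_div, integral_div,
      integral_natInd, integral_natInd, div_self hp1.ne', div_self hp0.ne', sub_self]
  -- the local contributions
  set Y : Idx d → Config d A → ℝ := fun i ω ↦ match i with
    | .inl k => diffIn α φ p (blockRegion L (blockOf L k)) (some (k, n)) (Function.update (cnt ω) k n)
        (field ω)
    | .inr _ => 0 with hY
  have hYm (k) : Measurable (Y (.inl k)) := measurable_diffIn hφ (measurableSet_blockRegion L _)
    (finite_cells_blockRegion hL _) (measurable_update_cnt k n) measurable_field _
  have hYd (k) : DependsOn (Y (.inl k)) {Sum.inl k}ᶜ := dependsOn_update_cnt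
    (fun N q ↦ diffIn α φ p (blockRegion L (blockOf L k)) (some (k, n)) N q) k n
  have hYint (k) (X : Config d A → ℝ) : ∫ ω, cntInd k n ω * (Y (.inl k) ω * X ω) ∂configLaw d γ Θ =
      ∫ ω, cntInd k n ω * (diffIn α φ p (blockRegion L (blockOf L k)) (some (k, n)) (cnt ω) (field ω) *
        X ω) ∂configLaw d γ Θ := by
    refine integral_congr_ae (.of_forall fun ω ↦ ?_)
    have := cntInd_mul_update (fun N q ↦
      diffIn α φ p (blockRegion L (blockOf L k)) (some (k, n)) N q) k n ω
    simp only [hY, ← mul_assoc]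
    rw [← this]
  have hYL (k) : MemLp (Y (.inl k)) 2 (configLaw d γ Θ) := by
    refine memLp_two_of_cntInd_mul (n := n) hγ (hYm k) (hYd k) ?_
    have hmp := measurePreserving_relabelled (d := d) (A := A) γ Θ k n
    have h1 := hindL (hdL (measurableSet_shiftRegion (measurableSet_blockRegion L (blockOf L k)) k)
      (finite_cells_shiftRegion (finite_cells_blockRegion hL (blockOf L k)) k)) 0 n
    refine (memLp_congr_ae (.of_forall fun ω ↦ ?_)).1 (h1.comp_measurePreserving hmp)
    have : cnt (relabelled k n ω) 0 = cnt ω k := by simp [cnt, relabelled, relabelIdx]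
    have h2 := cntInd_mul_update (fun N q ↦
      diffIn α φ p (blockRegion L (blockOf L k)) (some (k, n)) N q) k n ω
    simp only [hY, Function.comp_apply]
    rw [h2]
    simp only [cntInd, this]
    split_ifs with h
    · rw [diffIn_relabelled hφ h]
    · simp
  have hYsq (k) : ∫ ω, Y (.inl k) ω ^ 2 ∂configLaw d γ Θ ≤ M / π₀ := by
    rw [le_div_iff₀' hp0, ← integral_cntInd_mul n (k := k) ((hYm k).pow_const 2).aestronglyMeasurable
      (fun ω ω' h ↦ by simp only [hYd k h])]
    have e1 : ∀ ω, cntInd k n ω * Y (.inl k) ω ^ 2 = cntInd k n ω * (Y (.inl k) ω * Y (.inl k) ω) :=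
      fun ω ↦ by ring
    simp only [e1]
    have e2 : ∫ ω, cntInd k n ω * (Y (.inl k) ω * Y (.inl k) ω) ∂configLaw d γ Θ =
        ∫ ω, cntInd k n ω * (diffIn α φ p (blockRegion L (blockOf L k)) (some (k, n)) (cnt ω) (field ω) *
          diffIn α φ p (blockRegion L (blockOf L k)) (some (k, n)) (cnt ω) (field ω))
            ∂configLaw d γ Θ := by
      rw [hYint k (Y (.inl k))]
      simp only [mul_comm (diffIn _ _ _ _ _ _ _) (Y _ _)]
      exact hYint k _
    rw [e2, integral_cntInd_mul_diffIn hφ (measurableSet_blockRegion L _) (finite_cells_blockRegion hL _)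
      (measurableSet_blockRegion L _) (finite_cells_blockRegion hL _)]
    have hD := hdL (measurableSet_shiftRegion (measurableSet_blockRegion L (blockOf L k)) k)
      (finite_cells_shiftRegion (finite_cells_blockRegion hL (blockOf L k)) k)
    refine le_trans ?_ (hdM (measurableSet_shiftRegion (measurableSet_blockRegion L (blockOf L k)) k)
      (finite_cells_shiftRegion (finite_cells_blockRegion hL (blockOf L k)) k))
    refine integral_mono_of_nonneg (.of_forall fun ω ↦ mul_nonneg (hind 0 n ω).1 (mul_self_nonneg _))
      hD.integrable_sq (.of_forall fun ω ↦ ?_)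
    dsimp only
    rw [← sq]
    exact mul_le_of_le_one_left (sq_nonneg _) (hind 0 n ω).2
  -- the lower bound for one cube
  have hcube (c : CubeData d) : (innerBlocks L c.1.1 c.1.2).card * (δ / 4 / π₀) ^ 2 ≤
      Var[fun ω ↦ bettiIn α φ p (regionOf (cube c.1.1 c.1.2)) (cnt ω) (field ω); configLaw d γ Θ] *
        (K ^ 2 * (M / π₀)) := by
    set E := regionOf (cube c.1.1 c.1.2) with hEdef
    set B := innerBlocks L c.1.1 c.1.2
    have hE : MeasurableSet E := measurableSet_regionOf (measurableSet_cube _ _)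
    have hEc : (cells E).Finite := (Finset.finite_toSet _).subset (cells_regionOf_cube _ _)
    set f : Config d A → ℝ := fun ω ↦ bettiIn α φ p E (cnt ω) (field ω) with hf
    have hfL : MemLp f 2 (configLaw d γ Θ) := memLp_bettiIn γ Θ hφ hα hm hE hEc
    have hinj : Function.Injective fun b : Cell d ↦ (Sum.inl (blockCentre R b) : Idx d) := by
      intro b b' h
      have := congrArg (blockOf L) (Sum.inl.inj h)
      rwa [blockOf_blockCentre, blockOf_blockCentre] at this
    set T : Finset (Idx d) := B.image fun b ↦ Sum.inl (blockCentre R b) with hT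
    have hTY : ∀ i ∈ T, MemLp (Y i) 2 (configLaw d γ Θ) := by
      intro i hi
      obtain ⟨b, hb, rfl⟩ := Finset.mem_image.1 hi
      exact hYL _
    -- `Y` uses the counts of a single block, with that of the central cell replaced by `n`; the
    -- other central cells lie in other blocks.
    have hTd : ∀ i ∈ T, DependsOn (Y i) (T : Set (Idx d))ᶜ := by
      intro i hi ω ω' hω
      obtain ⟨b, hb, rfl⟩ := Finset.mem_image.1 hi
      have hq : field ω = field ω' := by
        ext1 ρ
        rw [field, field, hω (.inr ρ)]
        simp [hT]
      have hbo : blockOf L (blockCentre R b) = b := blockOf_blockCentre R b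
      simp only [hY, hbo, hq]
      refine diffIn_congr hφ (cells_blockRegion_subset hL b) (fun k hk ↦ ?_)
        (deepCells_subset b (blockCentre_mem R b)) n fun _ _ _ ↦ rfl
      obtain rfl | hne := eq_or_ne k (blockCentre R b)
      · simp
      · rw [Function.update_of_ne hne, Function.update_of_ne hne, cnt, cnt, hω (.inl k)]
        simp only [hT, Finset.coe_image, mem_compl_iff, mem_image, Finset.mem_coe, Sum.inl.injEq,
          not_exists, not_and]
        rintro b' - rfl
        have hk' := (mem_blockCells hL).1 hk
        rw [blockOf_blockCentre] at hk'
        exact hne (by rw [hk'])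
    have hmain := sq_sum_integral_le_variance_mul (siteLaw d γ Θ) T (f := f) hfL (Y := Y) hTY hTd ham haK ha0
    have hterm : ∀ b ∈ B, δ / 4 / π₀ ≤ ∫ ω, a (ω (.inl (blockCentre R b))) *
        Y (.inl (blockCentre R b)) ω * f ω ∂configLaw d γ Θ := by
      intro b hb
      set k := blockCentre R b with hk
      have hbk : blockOf L k = b := blockOf_blockCentre R b
      set fm : ℕ → Config d A → ℝ := fun m ω ↦ bettiIn α φ p E (Function.update (cnt ω) k m) (field ω)
        with hfm
      have hfmm (m) : Measurable (fm m) :=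
        measurable_bettiIn hφ hE hEc (measurable_update_cnt k m) measurable_field
      have hfmd (m) : DependsOn (fm m) {Sum.inl k}ᶜ :=
        dependsOn_update_cnt (fun N q ↦ bettiIn α φ p E N q) k m
      have hfme (m) (ω) : cntInd k m ω * fm m ω = cntInd k m ω * f ω :=
        cntInd_mul_update (fun N q ↦ bettiIn α φ p E N q) k m ω
      have hfmL (m) : MemLp (fm m) 2 (configLaw d γ Θ) := by
        refine memLp_two_of_cntInd_mul (n := m) hγ (hfmm m) (hfmd m) ?_
        simp only [hfme]
        exact hindL hfL k m
      have hYf (m) : Integrable (fun ω ↦ Y (.inl k) ω * fm m ω) (configLaw d γ Θ) :=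
        integrable_mul_of_memLp_two (hYL k) (hfmL m)
      have hYfd (m) : DependsOn (fun ω ↦ Y (.inl k) ω * fm m ω) {Sum.inl k}ᶜ := fun ω ω' h ↦ by
        simp only [hYd k h, hfmd m h]
      -- The indicators in `a` are divided by their probabilities, so integrating out the count
      -- replaces it by `n + 1` and by `n`.
      have e1 : ∫ ω, a (ω (.inl k)) * Y (.inl k) ω * f ω ∂configLaw d γ Θ =
          ∫ ω, (Y (.inl k) ω * fm (n + 1) ω - Y (.inl k) ω * fm n ω) ∂configLaw d γ Θ := by
        have e2 : ∀ ω : Config d A, a (ω (.inl k)) * Y (.inl k) ω * f ω =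
            π₁⁻¹ * (cntInd k (n + 1) ω * (Y (.inl k) ω * fm (n + 1) ω)) -
              π₀⁻¹ * (cntInd k n ω * (Y (.inl k) ω * fm n ω)) := by
          intro ω
          have h1 := hfme (n + 1) ω
          have h2 := hfme n ω
          have h3 : a (ω (.inl k)) = cntInd k (n + 1) ω / π₁ - cntInd k n ω / π₀ := by
            rw [cntInd_eq, cntInd_eq]
          rw [h3]
          calc _ = π₁⁻¹ * Y (.inl k) ω * (cntInd k (n + 1) ω * f ω) -
                π₀⁻¹ * Y (.inl k) ω * (cntInd k n ω * f ω) := by ring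
            _ = _ := by rw [← h1, ← h2]; ring
        have hi (m) : Integrable (fun ω ↦ cntInd k m ω * (Y (.inl k) ω * fm m ω)) (configLaw d γ Θ) := by
          refine (hYf m).mono ((measurable_cntInd k m).aestronglyMeasurable.mul
            (hYf m).aestronglyMeasurable) (.of_forall fun ω ↦ ?_)
          rw [norm_mul, Real.norm_of_nonneg (hind k m ω).1]
          exact mul_le_of_le_one_left (norm_nonneg _) (hind k m ω).2
        simp only [e2]
        rw [integral_sub ((hi _).const_mul _) ((hi _).const_mul _), integral_const_mul,
          integral_const_mul, integral_cntInd_mul _ (hYf _).aestronglyMeasurable (hYfd _),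
          integral_cntInd_mul _ (hYf _).aestronglyMeasurable (hYfd _), ← hπ₀, ← hπ₁,
          inv_mul_cancel_left₀ hp1.ne', inv_mul_cancel_left₀ hp0.ne', integral_sub (hYf _) (hYf _)]
      set g : Config d A → ℝ := fun ω ↦
        diffIn α φ p E (some (k, n)) (Function.update (cnt ω) k n) (field ω) with hg
      have hgm : Measurable g :=
        measurable_diffIn hφ hE hEc (measurable_update_cnt k n) measurable_field _
      have hgd : DependsOn g {Sum.inl k}ᶜ :=
        dependsOn_update_cnt (fun N q ↦ diffIn α φ p E (some (k, n)) N q) k n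
      have e3 : ∀ ω, Y (.inl k) ω * fm (n + 1) ω - Y (.inl k) ω * fm n ω = Y (.inl k) ω * g ω := by
        intro ω
        rw [← mul_sub]
        congr 1
        exact bettiIn_update_succ k n
      rw [e1]
      simp only [e3]
      have hYg : Measurable fun ω ↦ Y (.inl k) ω * g ω := (hYm k).mul hgm
      have hYgd : DependsOn (fun ω ↦ Y (.inl k) ω * g ω) {Sum.inl k}ᶜ := fun ω ω' h ↦ by
        simp only [hYd k h, hgd h]
      rw [div_le_iff₀' hp0, ← integral_cntInd_mul n (k := k) hYg.aestronglyMeasurable hYgd, hYint k g]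
      have e4 : ∀ ω, cntInd k n ω * (diffIn α φ p (blockRegion L (blockOf L k)) (some (k, n)) (cnt ω)
          (field ω) * g ω) = cntInd k n ω * (diffIn α φ p (blockRegion L (blockOf L k)) (some (k, n))
            (cnt ω) (field ω) * diffIn α φ p E (some (k, n)) (cnt ω) (field ω)) := by
        intro ω
        have := cntInd_mul_update (fun N q ↦ diffIn α φ p E (some (k, n)) N q) k n ω
        simp only [hg]
        rw [mul_left_comm, this, mul_left_comm]
      simp only [e4]
      rw [integral_cntInd_mul_diffIn hφ (measurableSet_blockRegion L _)
        (finite_cells_blockRegion hL _) hE hEc, hbk]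
      have hs1 : boxRegion d R ⊆ shiftRegion k (blockRegion L b) :=
        boxRegion_subset_shiftRegion hL (blockCentre_mem R b)
      have hs2 : boxRegion d R ⊆ shiftRegion k E :=
        hs1.trans fun z hz ↦ blockRegion_subset_regionOf hL hb hz
      have hm1 := measurableSet_shiftRegion (measurableSet_blockRegion L b) k
      have hc1 := finite_cells_shiftRegion (finite_cells_blockRegion hL b) k
      have hm2 := measurableSet_shiftRegion hE k
      have hc2 := finite_cells_shiftRegion hEc k
      set x : Config d A → ℝ := fun ω ↦
        diffIn α φ p (shiftRegion k (blockRegion L b)) none (cnt ω) (field ω) with hx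
      set y : Config d A → ℝ := fun ω ↦
        diffIn α φ p (shiftRegion k E) none (cnt ω) (field ω) with hy
      have hxL : MemLp x 2 (configLaw d γ Θ) := hdL hm1 hc1
      have hyL : MemLp y 2 (configLaw d γ Θ) := hdL hm2 hc2
      have h1 : δ ≤ ∫ ω, cntInd 0 n ω * x ω ^ 2 ∂configLaw d γ Θ :=
        hlow _ hm1 hc1 ((hbox (le_max_left _ _)).trans hs1)
      have hxyL : MemLp (fun ω ↦ x ω - y ω) 2 (configLaw d γ Θ) := hxL.sub hyL
      have h2 : ∫ ω, (x ω - y ω) ^ 2 ∂configLaw d γ Θ ≤ δ / 2 := by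
        rw [integral_eq_lintegral_of_nonneg_ae (.of_forall fun _ ↦ sq_nonneg _)
          hxyL.integrable_sq.aestronglyMeasurable]
        refine ENNReal.toReal_le_of_le_ofReal (by positivity) ?_
        simp only [← enorm_sq_eq]
        exact hR₁ _ _ hm1 hm2 hc1 hc2 ((hbox (le_max_right _ _)).trans hs1)
          ((hbox (le_max_right _ _)).trans hs2)
      have hbd {X : Config d A → ℝ} (hX : Integrable X (configLaw d γ Θ)) :
          Integrable (fun ω ↦ cntInd 0 n ω * X ω) (configLaw d γ Θ) := by
        refine hX.mono ((measurable_cntInd 0 n).aestronglyMeasurable.mul hX.aestronglyMeasurable)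
          (.of_forall fun ω ↦ ?_)
        rw [norm_mul, Real.norm_of_nonneg (hind 0 n ω).1]
        exact mul_le_of_le_one_left (norm_nonneg _) (hind 0 n ω).2
      -- This rests on `2 * x * y ≥ x ^ 2 - (x - y) ^ 2`. With the bounds `δ` and `δ / 2` it yields
      -- `δ / 4`.
      have h3 : ∫ ω, (cntInd 0 n ω * x ω ^ 2 - (x ω - y ω) ^ 2) / 2 ∂configLaw d γ Θ ≤
          ∫ ω, cntInd 0 n ω * (x ω * y ω) ∂configLaw d γ Θ := by
        refine integral_mono (((hbd hxL.integrable_sq).sub hxyL.integrable_sq).div_const 2)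
          (hbd (integrable_mul_of_memLp_two hxL hyL)) fun ω ↦ ?_
        dsimp only
        have h4 := hind 0 n ω
        have h5 : cntInd 0 n ω * (x ω - y ω) ^ 2 ≤ (x ω - y ω) ^ 2 :=
          mul_le_of_le_one_left (sq_nonneg _) h4.2
        have h6 : 0 ≤ cntInd 0 n ω * y ω ^ 2 := mul_nonneg h4.1 (sq_nonneg _)
        nlinarith
      rw [integral_div, integral_sub (hbd hxL.integrable_sq) hxyL.integrable_sq] at h3
      linarith
    change (∑ i ∈ T, ∫ ω, a (ω i) * Y i ω * f ω ∂configLaw d γ Θ) ^ 2 ≤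
      variance f (configLaw d γ Θ) * (K ^ 2 * ∑ i ∈ T, ∫ ω, Y i ω ^ 2 ∂configLaw d γ Θ) at hmain
    rw [hT, Finset.sum_image fun _ _ _ _ h ↦ hinj h, Finset.sum_image fun _ _ _ _ h ↦ hinj h] at hmain
    have h1 : B.card * (δ / 4 / π₀) ≤ ∑ b ∈ B, ∫ ω, a (ω (.inl (blockCentre R b))) *
        Y (.inl (blockCentre R b)) ω * f ω ∂configLaw d γ Θ := by
      rw [← nsmul_eq_mul]
      exact Finset.card_nsmul_le_sum _ _ _ hterm
    have h2 : ∑ b ∈ B, ∫ ω, Y (.inl (blockCentre R b)) ω ^ 2 ∂configLaw d γ Θ ≤ B.card * (M / π₀) := by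
      rw [← nsmul_eq_mul]
      exact Finset.sum_le_card_nsmul _ _ _ fun b _ ↦ hYsq _
    have h0 : 0 ≤ Var[f; configLaw d γ Θ] := variance_nonneg _ _
    have h3 : (B.card * (δ / 4 / π₀)) ^ 2 ≤ Var[f; configLaw d γ Θ] * (K ^ 2 * (B.card * (M / π₀))) := by
      refine (pow_le_pow_left₀ (by positivity) h1 2).trans (hmain.trans ?_)
      gcongr
    rcases Nat.eq_zero_or_pos B.card with hB0 | hB0
    · rw [hB0, Nat.cast_zero, zero_mul]
      have : 0 ≤ M := ENNReal.toReal_nonneg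
      positivity
    · have hBpos : (0 : ℝ) < B.card := by exact_mod_cast hB0
      have : (B.card : ℝ) * (B.card * (δ / 4 / π₀) ^ 2) ≤
          B.card * (Var[f; configLaw d γ Θ] * (K ^ 2 * (M / π₀))) := by nlinarith
      exact le_of_mul_le_mul_left this hBpos
  have hlim1 : Tendsto (fun c : CubeData d ↦ ((innerBlocks L c.1.1 c.1.2).card : ℝ) / c.1.2 ^ d *
      (δ / 4 / π₀) ^ 2) (largeCubes d) (𝓝 (((L : ℝ)⁻¹) ^ d * (δ / 4 / π₀) ^ 2)) :=
    (tendsto_card_innerBlocks hL).mul_const _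
  have hlim2 := hv.mul_const (K ^ 2 * (M / π₀))
  have hle := le_of_tendsto_of_tendsto' hlim1 hlim2 fun c ↦ by
    have hs : (0 : ℝ) < c.1.2 ^ d := pow_pos c.2 d
    rw [div_mul_eq_mul_div, div_mul_eq_mul_div]
    exact div_le_div_of_nonneg_right (hcube c) hs.le
  have hpos : 0 < ((L : ℝ)⁻¹) ^ d * (δ / 4 / π₀) ^ 2 := by
    have : (0 : ℝ) < L := by exact_mod_cast hL
    positivity
  have hMnn : 0 ≤ K ^ 2 * (M / π₀) := by
    have : 0 ≤ M := ENNReal.toReal_nonneg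
    positivity
  by_contra hcon
  have := mul_nonpos_of_nonpos_of_nonneg (not_lt.1 hcon) hMnn
  linarith

end Positivity

/-! ### Counting measures -/

section Counting

variable {X : Type*} [MeasurableSpace X]

lemma natCast_ne_zero_one_le {r : ℝ≥0∞} (h : ∃ n : ℕ∞, r = n) (hr : r < 1) : r = 0 := by
  obtain ⟨n, rfl⟩ := h
  have : n < 1 := by exact_mod_cast hr
  rw [Order.lt_one_iff] at this
  simp [this]

/-- Transported to the real line, a measure without atoms gives every point a neighbourhood of
measure less than one, hence zero by integrality; then the whole measure vanishes. -/
lemma exists_atom [StandardBorelSpace X] {η : Measure X} [IsFiniteMeasure η]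
    (h : ∀ s, MeasurableSet s → ∃ n : ℕ∞, η s = n) (h0 : η ≠ 0) : ∃ x, η {x} ≠ 0 := by
  by_contra! hx
  apply h0
  obtain ⟨f, hf⟩ := exists_measurableEmbedding_real X
  have h1 : η.map f univ = 0 := by
    refine measure_null_of_locally_null _ fun y _ ↦ ?_
    have hy : η.map f {y} = 0 := by
      rw [hf.map_apply]
      by_cases hy : ∃ x, f x = y
      · obtain ⟨x, rfl⟩ := hy
        rw [← image_singleton, preimage_image_eq _ hf.injective, hx]
      · have : f ⁻¹' {y} = ∅ := by
          ext x
          simpa using fun h ↦ hy ⟨x, h⟩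
        rw [this, measure_empty]
    obtain ⟨u, hu, huo, hu1⟩ := ({y} : Set ℝ).exists_isOpen_lt_of_lt (μ := η.map f) 1
      (by rw [hy]; exact one_pos)
    refine ⟨u, mem_nhdsWithin_of_mem_nhds (huo.mem_nhds (hu rfl)), ?_⟩
    rw [hf.map_apply] at hu1 ⊢
    exact natCast_ne_zero_one_le (h _ (hf.measurable huo.measurableSet)) hu1
  rwa [hf.map_apply, preimage_univ, Measure.measure_univ_eq_zero] at h1

/-- Induction on a bound for the total mass: an atom is split off with its full multiplicity, which
is at least one. -/
lemma exists_sum_dirac [StandardBorelSpace X] (n : ℕ) : ∀ (η : Measure X),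
    (∀ s, MeasurableSet s → ∃ n : ℕ∞, η s = n) → η univ ≤ n →
    ∃ l : List X, η = (l.map Measure.dirac).sum := by
  induction n with
  | zero =>
    intro η _ h
    exact ⟨[], by simpa using h⟩
  | succ n ih =>
    intro η hη h
    have : IsFiniteMeasure η := ⟨h.trans_lt (by simp)⟩
    by_cases h0 : η = 0
    · exact ⟨[], by simpa using h0⟩
    obtain ⟨x, hx⟩ := exists_atom hη h0
    obtain ⟨k, hk⟩ := hη {x} (measurableSet_singleton x)
    have hkt : k ≠ ⊤ := by
      rintro rfl
      exact measure_ne_top η {x} (by simp at hk)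
    lift k to ℕ using hkt
    have hk1 : 1 ≤ k := by
      rcases Nat.eq_zero_or_pos k with rfl | h
      · exact absurd (hk.trans (by simp)) hx
      · exact h
    obtain ⟨l, hl⟩ := ih (η.restrict {x}ᶜ) (fun s hs ↦ by
      rw [Measure.restrict_apply hs]
      exact hη _ (hs.inter (measurableSet_singleton x).compl)) (by
      rw [Measure.restrict_apply .univ, univ_inter]
      have h1 := measure_add_measure_compl (μ := η) (measurableSet_singleton x)
      have h2 : (1 : ℝ≥0∞) ≤ η {x} := by
        rw [hk]
        exact_mod_cast hk1
      have h3 : η {x}ᶜ + 1 ≤ n + 1 := by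
        calc η {x}ᶜ + 1 ≤ η {x}ᶜ + η {x} := by gcongr
          _ = η univ := by rw [add_comm, h1]
          _ ≤ _ := by simpa using h
      exact (ENNReal.add_le_add_iff_right ENNReal.one_ne_top).1 h3)
    refine ⟨List.replicate k x ++ l, ?_⟩
    rw [List.map_append, List.sum_append, ← hl, List.map_replicate, List.sum_replicate]
    conv_lhs => rw [← Measure.restrict_add_restrict_compl (μ := η) (measurableSet_singleton x)]
    congr 1
    rw [Measure.restrict_singleton, hk]
    ext s hs
    simp

variable {ι : Type*}

lemma measure_eq_tsum_inter [Countable ι] {K : ι → Set X} (hK : ∀ c, MeasurableSet (K c))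
    (hKd : Pairwise fun c c' ↦ Disjoint (K c) (K c')) (hKu : ⋃ c, K c = univ) (η : Measure X)
    {s : Set X} (hs : MeasurableSet s) : η s = ∑' c, η (s ∩ K c) := by
  rw [← measure_iUnion (fun c c' h ↦ (hKd h).mono inter_subset_right inter_subset_right)
    fun c ↦ hs.inter (hK c), ← inter_iUnion, hKu, inter_univ]

/-- The law of a random measure is determined by the joint laws of its values on disjoint sets which
are contained in members of a given countable partition. -/
theorem map_eq_of_disjoint {Ω Ω' : Type*} [MeasurableSpace Ω] [MeasurableSpace Ω'] {P : Measure Ω}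
    {P' : Measure Ω'} [IsProbabilityMeasure P] [IsProbabilityMeasure P'] {Φ : Ω → Measure X}
    {Φ' : Ω' → Measure X} (hΦ : Measurable Φ) (hΦ' : Measurable Φ') [Countable ι] [Nonempty ι]
    {K : ι → Set X} (hK : ∀ c, MeasurableSet (K c))
    (hKd : Pairwise fun c c' ↦ Disjoint (K c) (K c')) (hKu : ⋃ c, K c = univ)
    (h : ∀ (m : ℕ) (s : Fin m → Set X), (∀ i, MeasurableSet (s i)) →
      Pairwise (fun i j ↦ Disjoint (s i) (s j)) → (∀ i, ∃ c, s i ⊆ K c) →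
      P.map (fun ω i ↦ Φ ω (s i)) = P'.map (fun ω i ↦ Φ' ω (s i))) :
    P.map Φ = P'.map Φ' := by
  classical
  let J := {s : Set X // MeasurableSet s ∧ ∃ c, s ⊆ K c}
  let ev : Measure X → J → ℝ≥0∞ := fun η s ↦ η s.1
  have hev : Measurable ev := measurable_pi_lambda _ fun s ↦ Measure.measurable_coe s.2.1
  -- By countable additivity the evaluations on sets inside one member of the partition determine
  -- all others, so they generate the σ-algebra.
  have hle : @Measurable _ _ (MeasurableSpace.comap ev inferInstance) _ (id : Measure X → Measure X) := by
    refine @Measure.measurable_of_measurable_coe _ _ _ (MeasurableSpace.comap ev inferInstance) id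
      fun s hs ↦ ?_
    simp only [id, measure_eq_tsum_inter hK hKd hKu _ hs]
    refine Measurable.ennreal_tsum fun c ↦ ?_
    exact (measurable_pi_apply (⟨s ∩ K c, hs.inter (hK c), c, inter_subset_right⟩ : J)).comp
      (comap_measurable ev)
  have hmain : P.map (ev ∘ Φ) = P'.map (ev ∘ Φ') := by
    have := Measure.isProbabilityMeasure_map (μ := P) (hev.comp hΦ).aemeasurable
    have hfin (I : Finset J) : P.map (fun ω ↦ I.restrict (ev (Φ ω))) =
        P'.map (fun ω ↦ I.restrict (ev (Φ' ω))) := by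
      -- The atoms of the algebra generated by finitely many sets. The atom outside all of them is
      -- dropped, since it need not lie in a member of the partition and is not needed to recover
      -- the values.
      let at' : Finset I → Set X := fun T ↦ if T.Nonempty then {x | ∀ i : I, x ∈ i.1.1 ↔ i ∈ T} else ∅
      have hat (T) : MeasurableSet (at' T) := by
        simp only [at']
        split_ifs
        · rw [show {x | ∀ i : I, x ∈ i.1.1 ↔ i ∈ T} = ⋂ i : I, {x | x ∈ i.1.1 ↔ i ∈ T} by
            ext; simp]
          refine MeasurableSet.iInter fun i ↦ ?_
          by_cases hi : i ∈ T
          · simp only [hi, iff_true]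
            exact i.1.2.1
          · simp only [hi, iff_false]
            exact i.1.2.1.compl
        · exact .empty
      have hatd : Pairwise fun T T' ↦ Disjoint (at' T) (at' T') := by
        intro T T' hT
        rw [Set.disjoint_left]
        intro x hx hx'
        simp only [at'] at hx hx'
        split_ifs at hx hx'
        · exact hT (Finset.ext fun i ↦ (hx i).symm.trans (hx' i))
        all_goals simp_all
      have hatc (T) : ∃ c, at' T ⊆ K c ∨ at' T = ∅ := by
        simp only [at']
        split_ifs with hT
        · obtain ⟨i, hi⟩ := hT
          obtain ⟨c, hc⟩ := i.1.2.2
          exact ⟨c, Or.inl fun x hx ↦ hc ((hx i).2 hi)⟩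
        · exact ⟨Classical.arbitrary ι, Or.inr rfl⟩
      have hval (η : Measure X) (i : I) : η i.1.1 = ∑ T : Finset I, if i ∈ T then η (at' T) else 0 := by
        rw [← Finset.sum_filter, ← measure_biUnion_finset (fun T _ T' _ hT ↦ hatd hT) fun T _ ↦ hat T]
        congr 1
        ext x
        simp only [Finset.mem_filter, Finset.mem_univ, true_and, mem_iUnion, exists_prop]
        constructor
        · intro hx
          have hmem : i ∈ Finset.univ.filter fun j : I ↦ x ∈ j.1.1 := by simpa using hx
          refine ⟨_, hmem, ?_⟩
          simp only [at']
          rw [if_pos ⟨i, hmem⟩]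
          simp
        · rintro ⟨T, hi, hx⟩
          simp only [at'] at hx
          rw [if_pos ⟨i, hi⟩] at hx
          exact (hx i).2 hi
      let eq := Fintype.equivFin (Finset I)
      have h1 := h _ (fun i ↦ at' (eq.symm i)) (fun i ↦ hat _)
        (fun i j hij ↦ hatd (eq.symm.injective.ne hij)) (fun i ↦ by
          obtain ⟨c, hc | hc⟩ := hatc (eq.symm i)
          · exact ⟨c, hc⟩
          · exact ⟨c, by simp [hc]⟩)
      let g : (Fin (Fintype.card (Finset I)) → ℝ≥0∞) → I → ℝ≥0∞ := fun v i ↦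
        ∑ T : Finset I, if i ∈ T then v (eq T) else 0
      have hg : Measurable g := by
        refine measurable_pi_lambda _ fun i ↦ Finset.measurable_sum _ fun T _ ↦ ?_
        split_ifs <;> fun_prop
      have h2 := congrArg (Measure.map g) h1
      have hm (i) : Measurable fun ω ↦ Φ ω (at' (eq.symm i)) := (Measure.measurable_coe (hat _)).comp hΦ
      have hm' (i) : Measurable fun ω ↦ Φ' ω (at' (eq.symm i)) := (Measure.measurable_coe (hat _)).comp hΦ'
      rw [Measure.map_map hg (measurable_pi_lambda _ hm), Measure.map_map hg (measurable_pi_lambda _ hm')] at h2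
      convert h2 using 2
      · ext ω i
        simp [g, Finset.restrict, ev, hval (Φ ω) i]
      · ext ω i
        simp [g, Finset.restrict, ev, hval (Φ' ω) i]
    have hl := isProjectiveLimit_map (P := P) (X := fun s ω ↦ ev (Φ ω) s) (hev.comp hΦ).aemeasurable
    have hl' := isProjectiveLimit_map (P := P') (X := fun s ω ↦ ev (Φ' ω) s) (hev.comp hΦ').aemeasurable
    simp_rw [hfin] at hl
    have (I : Finset J) : IsFiniteMeasure (P'.map fun ω ↦ I.restrict (ev (Φ' ω))) := inferInstance
    exact hl.unique hl'
  refine Measure.ext fun B hB ↦ ?_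
  obtain ⟨B', hB', hBB⟩ := hle hB
  obtain rfl : ev ⁻¹' B' = B := hBB
  rw [← Measure.map_apply hev hB', ← Measure.map_apply hev hB', Measure.map_map hev hΦ,
    Measure.map_map hev hΦ', hmain]

end Counting

/-- Locally finite counting measures as a space. -/
abbrev PointMeasure (d : ℕ) (B : Type*) [MeasurableSpace B] : Type _ :=
  {η : Measure ((Fin d → ℝ) × B) // IsLocallyFiniteCounting η}

/-! ### Countable separation of the space of counting measures. -/

section PointMeasure

variable {d : ℕ} {B : Type*} [MeasurableSpace B]

lemma countablySeparated_of_injective {Y Z : Type*} [MeasurableSpace Y] [MeasurableSpace Z]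
    [MeasurableSpace.CountablySeparated Z] {g : Y → Z} (hg : Measurable g) (hi : Function.Injective g) :
    MeasurableSpace.CountablySeparated Y := by
  obtain ⟨S, hS, hSm, h⟩ := (MeasurableSpace.hasCountableSeparatingOn_of_countablySeparated (α := Z)).1
  refine ⟨⟨(fun s ↦ g ⁻¹' s) '' S, hS.image _, ?_, fun x _ y _ hxy ↦ hi ?_⟩⟩
  · rintro _ ⟨s, hs, rfl⟩
    exact hg (hSm s hs)
  · exact h _ (mem_univ _) _ (mem_univ _) fun s hs ↦ hxy _ (mem_image_of_mem _ hs)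

/-- A locally finite measure is determined by countably many values: those on rational half-lines of
an embedding into `ℝ`, cut off by balls. Countable separation later allows measurability to be
tested along a surjection. -/
instance [StandardBorelSpace B] : MeasurableSpace.CountablySeparated (PointMeasure d B) := by
  obtain ⟨f, hf⟩ := exists_measurableEmbedding_real ((Fin d → ℝ) × B)
  let K : ℕ → Set ((Fin d → ℝ) × B) := fun n ↦ Metric.closedBall 0 n ×ˢ univ
  have hK (n) : MeasurableSet (K n) := measurableSet_closedBall.prod .univ
  let T : Option ℚ → Set ((Fin d → ℝ) × B) := fun o ↦ o.elim univ fun q ↦ f ⁻¹' Iic (q : ℝ)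
  have hT (o) : MeasurableSet (T o) := by
    cases o
    exacts [.univ, hf.measurable measurableSet_Iic]
  refine countablySeparated_of_injective
    (g := fun (η : PointMeasure d B) (i : Option ℚ × ℕ) ↦ η.1 (T i.1 ∩ K i.2)) ?_ ?_
  · exact measurable_pi_lambda _ fun i ↦
      (Measure.measurable_coe ((hT _).inter (hK _))).comp measurable_subtype_coe
  · intro η η' h
    apply Subtype.ext
    refine Measure.ext_of_iUnion_eq_univ (s := K) ?_ fun n ↦ ?_
    · refine eq_univ_of_forall fun x ↦ mem_iUnion.2 ?_
      obtain ⟨n, hn⟩ := exists_nat_ge ‖x.1‖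
      exact ⟨n, by simpa [K] using hn⟩
    · have hfin : IsFiniteMeasure (η.1.restrict (K n)) :=
        ⟨by rw [Measure.restrict_apply_univ]
            exact η.2.2 _ measurableSet_closedBall Metric.isBounded_closedBall⟩
      have hmap : (η.1.restrict (K n)).map f = (η'.1.restrict (K n)).map f := by
        refine ext_of_generate_finite _
          (BorelSpace.measurable_eq.trans Real.borel_eq_generateFrom_Iic_rat)
          Real.isPiSystem_Iic_rat (fun s hs ↦ ?_) ?_
        · obtain ⟨q, rfl⟩ := mem_iUnion.1 hs
          rw [hf.map_apply, hf.map_apply, Measure.restrict_apply (hf.measurable measurableSet_Iic),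
            Measure.restrict_apply (hf.measurable measurableSet_Iic)]
          exact congrFun h (some q, n)
        · rw [hf.map_apply, hf.map_apply, preimage_univ, Measure.restrict_apply .univ,
            Measure.restrict_apply .univ]
          exact congrFun h (none, n)
      rw [← hf.comap_map (η.1.restrict (K n)), hmap, hf.comap_map]

end PointMeasure

/-! ### Independent points scattered over cells -/

section Scatter

variable {d : ℕ} {X : Type*} [MeasurableSpace X]

/-- The counting measure of the points `z (c, j)` with `j < N c`. -/
def scatter (N : Cell d → ℕ) (z : Cell d × ℕ → X) : Measure X :=
  Measure.sum fun k : {k : Cell d × ℕ // k.2 < N k.1} ↦ Measure.dirac (z k)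

variable {N : Cell d → ℕ} {z : Cell d × ℕ → X} {s : Set X}

open Classical in
lemma scatter_apply' (hs : MeasurableSet s) :
    scatter N z s = ∑' k : Cell d × ℕ, if k.2 < N k.1 ∧ z k ∈ s then 1 else 0 := by
  rw [scatter, Measure.sum_apply _ hs]
  simp only [Measure.dirac_apply' _ hs]
  refine (tsum_subtype {k : Cell d × ℕ | k.2 < N k.1} fun k ↦ s.indicator 1 (z k)).trans ?_
  congr 1
  ext k
  by_cases h1 : k.2 < N k.1 <;> by_cases h2 : z k ∈ s <;> simp [h1, h2, indicator]

lemma scatter_apply (hs : MeasurableSet s) :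
    scatter N z s = ({k | k.2 < N k.1 ∧ z k ∈ s}.encard : ℝ≥0∞) := by
  classical
  rw [scatter_apply' hs, ← ENNReal.tsum_set_one,
    tsum_subtype {k : Cell d × ℕ | k.2 < N k.1 ∧ z k ∈ s} fun _ ↦ (1 : ℝ≥0∞)]
  congr 1
  ext k
  simp [indicator]

lemma measurable_scatter {Ω : Type*} [MeasurableSpace Ω] {M : Ω → Cell d → ℕ}
    {y : Ω → Cell d × ℕ → X} (hM : Measurable M) (hy : Measurable y) :
    Measurable fun ω ↦ scatter (M ω) (y ω) := by
  classical
  refine Measure.measurable_of_measurable_coe _ fun s hs ↦ ?_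
  simp only [scatter_apply' hs]
  refine Measurable.tsum fun k ↦ Measurable.ite ?_ measurable_const measurable_const
  refine MeasurableSet.inter (s₁ := {ω | k.2 < M ω k.1}) ?_ ?_
  · exact measurableSet_lt measurable_const ((measurable_pi_apply k.1).comp hM)
  · exact hs.preimage ((measurable_pi_apply k).comp hy)

open Classical in
lemma scatter_eq_sum (hs : MeasurableSet s) {C : Finset (Cell d)}
    (hC : ∀ c ∉ C, ∀ j, z (c, j) ∉ s) :
    scatter N z s = ((∑ c ∈ C, ∑ j ∈ Finset.range (N c), if z (c, j) ∈ s then 1 else 0 : ℕ) : ℝ≥0∞) := by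
  rw [scatter_apply' hs, tsum_eq_sum (s := (C.sigma fun c ↦ Finset.range (N c)).map
    (Equiv.sigmaEquivProd _ _).toEmbedding), Finset.sum_map, Finset.sum_sigma]
  · push_cast
    refine Finset.sum_congr rfl fun c _ ↦ Finset.sum_congr rfl fun j hj ↦ ?_
    have := Finset.mem_range.1 hj
    simp [this]
  · rintro ⟨c, j⟩ h
    refine if_neg fun h' ↦ h ?_
    refine Finset.mem_map.2 ⟨⟨c, j⟩, Finset.mem_sigma.2 ⟨?_, Finset.mem_range.2 h'.1⟩, rfl⟩
    by_contra hc
    exact hC c hc j h'.2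

lemma integral_prod_infinitePi {ι Z : Type*} [MeasurableSpace Z] (ζ : Measure Z)
    [IsProbabilityMeasure ζ] (I : Finset ι) {g : ι → Z → ℂ} (hg : ∀ i, Measurable (g i)) :
    ∫ ω, ∏ i ∈ I, g i (ω i) ∂(Measure.infinitePi fun _ : ι ↦ ζ) = ∏ i ∈ I, ∫ x, g i x ∂ζ := by
  have hm : Measurable fun y : I → Z ↦ ∏ i : I, g i (y i) :=
    Finset.measurable_prod _ fun i _ ↦ (hg i).comp (measurable_pi_apply i)
  have h := integral_restrict_infinitePi (μ := fun _ : ι ↦ ζ) (s := I) hm.aestronglyMeasurable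
  rw [integral_fintype_prod_eq_prod (fun i : I ↦ g i), Finset.prod_coe_sort I fun i ↦ ∫ x, g i x ∂ζ] at h
  rw [← h]
  congr 1
  ext ω
  exact (Finset.prod_coe_sort I fun i ↦ g i (ω i)).symm

lemma integral_pow_poissonMeasure (γ : ℝ≥0) (w : ℂ) :
    ∫ n, w ^ n ∂poissonMeasure γ = Complex.exp (γ * (w - 1)) := by
  rw [integral_poissonMeasure]
  calc ∑' n : ℕ, (Real.exp (-γ) * γ ^ n / n.factorial : ℝ) • w ^ n
      = ∑' n : ℕ, (Real.exp (-γ) : ℂ) * ((γ * w) ^ n / n.factorial) := by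
        congr with n
        rw [Complex.real_smul]
        push_cast
        ring
    _ = (Real.exp (-γ) : ℂ) * Complex.exp (γ * w) := by
        rw [tsum_mul_left, (NormedSpace.expSeries_div_hasSum_exp ((γ : ℂ) * w)).tsum_eq,
          Complex.exp_eq_exp_ℂ]
    _ = _ := by
        rw [Complex.ofReal_exp, ← Complex.exp_add]
        push_cast
        ring_nf

variable {Z : Type*} [MeasurableSpace Z] (γ : ℝ≥0) (ζ : Measure Z) [IsProbabilityMeasure ζ]

/-- The joint law of Poisson numbers of points for all cells and independent seeds. -/
def seedLaw (d : ℕ) (γ : ℝ≥0) (ζ : Measure Z) [IsProbabilityMeasure ζ] :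
    Measure ((Cell d → ℕ) × (Label d → Z)) :=
  (Measure.infinitePi fun _ ↦ poissonMeasure γ).prod (Measure.infinitePi fun _ ↦ ζ)

instance : IsProbabilityMeasure (seedLaw d γ ζ) := by
  unfold seedLaw; infer_instance

/-- For fixed counts the seeds integrate to powers; the generating function of the Poisson law then
gives the exponential. -/
lemma integral_seedLaw_prod (C : Finset (Cell d)) {f : Cell d → Z → ℂ} (hf : ∀ c, Measurable (f c))
    (hf1 : ∀ c x, ‖f c x‖ ≤ 1) :
    ∫ p, ∏ c ∈ C, ∏ j ∈ Finset.range (p.1 c), f c (p.2 (some (c, j))) ∂seedLaw d γ ζ =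
      Complex.exp (γ * ∑ c ∈ C, (∫ x, f c x ∂ζ - 1)) := by
  classical
  have hmeas : Measurable fun p : (Cell d → ℕ) × (Label d → Z) ↦
      ∏ c ∈ C, ∏ j ∈ Finset.range (p.1 c), f c (p.2 (some (c, j))) := by
    refine Finset.measurable_prod _ fun c _ ↦ ?_
    have h1 : Measurable fun x : (Label d → Z) × ℕ ↦ ∏ j ∈ Finset.range x.2, f c (x.1 (some (c, j))) :=
      measurable_from_prod_countable_left fun n ↦ Finset.measurable_prod (Finset.range n) fun j _ ↦
        (hf c).comp (measurable_pi_apply (some (c, j)))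
    exact h1.comp (measurable_snd.prodMk ((measurable_pi_apply c).comp measurable_fst))
  rw [seedLaw, integral_prod]
  · have h1 (N : Cell d → ℕ) : ∫ s, ∏ c ∈ C, ∏ j ∈ Finset.range (N c), f c (s (some (c, j)))
        ∂(Measure.infinitePi fun _ : Label d ↦ ζ) = ∏ c ∈ C, (∫ x, f c x ∂ζ) ^ N c := by
      have h2 := integral_prod_infinitePi ζ ((C.sigma fun c ↦ Finset.range (N c)).image
        fun k ↦ (some (k.1, k.2) : Label d)) (g := fun l x ↦ l.elim 1 fun k ↦ f k.1 x)
        (by rintro (_ | k); exacts [measurable_const, hf k.1])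
      have hinj : InjOn (fun k : (_ : Cell d) × ℕ ↦ (some (k.1, k.2) : Label d))
          (C.sigma fun c ↦ Finset.range (N c)) := by
        rintro ⟨c, j⟩ _ ⟨c', j'⟩ _ h
        simpa using h
      rw [Finset.prod_image hinj, Finset.prod_sigma] at h2
      simp only [Option.elim_some, Finset.prod_const, Finset.card_range] at h2
      rw [← h2]
      congr 1
      ext s
      rw [Finset.prod_image hinj, Finset.prod_sigma]
      rfl
    simp only [h1]
    rw [integral_prod_infinitePi (poissonMeasure γ) C (g := fun c n ↦ (∫ x, f c x ∂ζ) ^ n)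
      fun c ↦ measurable_from_top]
    simp only [integral_pow_poissonMeasure]
    rw [← Complex.exp_sum, Finset.mul_sum]
  · refine Integrable.of_bound hmeas.aestronglyMeasurable 1 (.of_forall fun p ↦ ?_)
    rw [norm_prod]
    refine Finset.prod_le_one (fun _ _ ↦ norm_nonneg _) fun c _ ↦ ?_
    rw [norm_prod]
    exact Finset.prod_le_one (fun _ _ ↦ norm_nonneg _) fun j _ ↦ hf1 _ _

open Classical in
-- Poisson numbers of independently placed points have independent Poisson counts on disjoint sets.
-- The joint characteristic function factorizes because a point lies in at most one of the sets.
theorem map_scatter_seedLaw {place : Cell d → Z → X} (hp : ∀ c, Measurable (place c)) {m : ℕ}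
    {t : Fin m → Set X} (ht : ∀ i, MeasurableSet (t i))
    (htd : Pairwise fun i j ↦ Disjoint (t i) (t j)) (C : Finset (Cell d))
    (hC : ∀ c ∉ C, ∀ x i, place c x ∉ t i) :
    (seedLaw d γ ζ).map (fun p i ↦ scatter p.1 (fun k ↦ place k.1 (p.2 (some k))) (t i)) =
      Measure.pi fun i ↦ (poissonMeasure (γ * ∑ c ∈ C, (ζ (place c ⁻¹' t i)).toNNReal)).map
        fun n : ℕ ↦ (n : ℝ≥0∞) := by
  set r : Fin m → ℝ≥0 := fun i ↦ γ * ∑ c ∈ C, (ζ (place c ⁻¹' t i)).toNNReal with hr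
  let I : Cell d → Fin m → Z → ℝ := fun c i x ↦ if place c x ∈ t i then 1 else 0
  have hI (c i) : Measurable (I c i) :=
    Measurable.ite ((hp c) (ht i)) measurable_const measurable_const
  let R : (Cell d → ℕ) × (Label d → Z) → Fin m → ℝ := fun p i ↦
    ∑ c ∈ C, ∑ j ∈ Finset.range (p.1 c), I c i (p.2 (some (c, j)))
  have hRm : Measurable R := by
    refine measurable_pi_lambda _ fun i ↦ Finset.measurable_sum _ fun c _ ↦ ?_
    have h1 : Measurable fun x : (Label d → Z) × ℕ ↦
        ∑ j ∈ Finset.range x.2, I c i (x.1 (some (c, j))) :=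
      measurable_from_prod_countable_left fun n ↦ Finset.measurable_sum (Finset.range n) fun j _ ↦
        (hI c i).comp (measurable_pi_apply (some (c, j)))
    exact h1.comp (measurable_snd.prodMk ((measurable_pi_apply c).comp measurable_fst))
  have hval (p : (Cell d → ℕ) × (Label d → Z)) (i) :
      scatter p.1 (fun k ↦ place k.1 (p.2 (some k))) (t i) = ENNReal.ofReal (R p i) := by
    rw [scatter_eq_sum (ht i) (C := C) fun c hc j ↦ hC c hc _ i, ← ENNReal.ofReal_natCast]
    congr 1
    simp only [R, I]
    push_cast
    rfl
  have hlaw : (seedLaw d γ ζ).map R = Measure.pi fun i ↦ (poissonMeasure (r i)).map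
      fun n : ℕ ↦ (n : ℝ) := by
    have hpr (i) : IsProbabilityMeasure ((poissonMeasure (r i)).map fun n : ℕ ↦ (n : ℝ)) :=
      Measure.isProbabilityMeasure_map (by fun_prop)
    rw [← charFun_eq_pi_iff]
    intro θ
    rw [Measure.map_map (by fun_prop) hRm, charFun_apply,
      integral_map ((WithLp.measurable_toLp 2 _).comp hRm).aemeasurable (by fun_prop)]
    let f : Cell d → Z → ℂ := fun c x ↦ Complex.exp ((∑ i, θ i * I c i x : ℝ) * Complex.I)
    have hf (c) : Measurable (f c) := by fun_prop
    have e1 (p : (Cell d → ℕ) × (Label d → Z)) :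
        Complex.exp ((inner ℝ ((WithLp.toLp 2 ∘ R) p) θ : ℝ) * Complex.I) =
          ∏ c ∈ C, ∏ j ∈ Finset.range (p.1 c), f c (p.2 (some (c, j))) := by
      have e0 : (inner ℝ ((WithLp.toLp 2 ∘ R) p) θ : ℝ) =
          ∑ c ∈ C, ∑ j ∈ Finset.range (p.1 c), ∑ i, θ i * I c i (p.2 (some (c, j))) := by
        simp only [PiLp.inner_apply, Function.comp, R, RCLike.inner_apply, conj_trivial,
          Finset.mul_sum]
        rw [Finset.sum_comm]
        refine Finset.sum_congr rfl fun c _ ↦ ?_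
        rw [Finset.sum_comm]
      simp only [f, ← Complex.exp_sum, ← Finset.sum_mul]
      rw [e0]
      congr 2
      push_cast
      rfl
    simp only [e1]
    rw [integral_seedLaw_prod γ ζ C hf fun c x ↦ (Complex.norm_exp_ofReal_mul_I _).le]
    have e2 (c : Cell d) : ∫ x, f c x ∂ζ - 1 =
        ∑ i, (ζ (place c ⁻¹' t i)).toNNReal * (Complex.exp (θ i * Complex.I) - 1) := by
      -- At most one of the indicators is nonzero, so the exponential of their combination is affine
      -- in them.
      have e3 (x : Z) : f c x = 1 + ∑ i, (place c ⁻¹' t i).indicator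
          (fun _ ↦ Complex.exp (θ i * Complex.I) - 1) x := by
        simp only [f, I]
        by_cases hx : ∃ i, place c x ∈ t i
        · obtain ⟨i, hi⟩ := hx
          have hne (i') (h : i' ≠ i) : place c x ∉ t i' := fun h' ↦
            Set.disjoint_left.1 (htd h) h' hi
          rw [Finset.sum_eq_single i (fun i' _ h ↦ by simp [hne i' h]) (by simp),
            Finset.sum_eq_single i (fun i' _ h ↦ by simp [hne i' h]) (by simp)]
          simp [hi]
        · push Not at hx
          simp [hx]
      simp only [e3]
      rw [integral_add (integrable_const _) (integrable_finsetSum _ fun i _ ↦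
        (integrable_const _).indicator (hp c (ht i))), integral_finsetSum _ fun i _ ↦
        (integrable_const _).indicator (hp c (ht i))]
      simp only [integral_const, probReal_univ, one_smul, add_sub_cancel_left]
      refine Finset.sum_congr rfl fun i _ ↦ ?_
      rw [integral_indicator_const _ (hp c (ht i))]
      rfl
    simp only [e2, charFun_map_cast_poissonMeasure]
    rw [← Complex.exp_sum]
    congr 1
    rw [Finset.sum_comm, Finset.mul_sum]
    refine Finset.sum_congr rfl fun i _ ↦ ?_
    rw [← Finset.sum_mul, hr]
    push_cast
    ring
  have hof (i) : IsProbabilityMeasure (((poissonMeasure (r i)).map fun n : ℕ ↦ (n : ℝ)).map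
      ENNReal.ofReal) :=
    have := Measure.isProbabilityMeasure_map (μ := poissonMeasure (r i)) (f := fun n : ℕ ↦ (n : ℝ))
      (by fun_prop)
    Measure.isProbabilityMeasure_map (by fun_prop)
  have h := congrArg (Measure.map fun v i ↦ ENNReal.ofReal (v i)) hlaw
  rw [Measure.map_map (by fun_prop) hRm, Measure.pi_map_pi (f := fun _ ↦ ENNReal.ofReal)
    fun _ ↦ by fun_prop] at h
  simp only [hval]
  refine h.trans ?_
  congr 1
  ext1 i
  rw [Measure.map_map (by fun_prop) (by fun_prop)]
  congr 1
  ext n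
  simp

end Scatter

/-! ### A construction of the Poisson process -/

section Cloud

/-- A relative position, a mark in `A`, a time and the variables of a point. -/
abbrev Seed (d : ℕ) (A : Type*) (α : ℕ) : Type _ :=
  ((Fin d → unitInterval) × A) × unitInterval × Marks α

instance (α : ℕ) : IsProbabilityMeasure (marksLaw α) := by
  unfold marksLaw; infer_instance

variable {d : ℕ} {A : Type*} [MeasurableSpace A] {α : ℕ}

/-- The law of a seed. -/
def seedBase (d : ℕ) (α : ℕ) (Θ : Measure A) : Measure (Seed d A α) :=
  ((volume : Measure (Fin d → unitInterval)).prod Θ).prod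
    ((volume : Measure unitInterval).prod (marksLaw α))

instance (Θ : Measure A) [IsProbabilityMeasure Θ] : IsProbabilityMeasure (seedBase d α Θ) := by
  unfold seedBase; infer_instance

/-- The point with the seed `s` in the cell `c`, where cells are translated by `-x`. -/
def place (x : Fin d → unitInterval) (c : Cell d) (s : Seed d A α) : Point d A α :=
  (fun i ↦ c i + s.1.1 i - x i, s.1.2, s.2.1, s.2.2)

lemma measurable_place {Ω : Type*} [MeasurableSpace Ω] {x : Ω → Fin d → unitInterval}
    {s : Ω → Seed d A α} (hx : Measurable x) (c : Cell d) (hs : Measurable s) :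
    Measurable fun ω ↦ place (x ω) c (s ω) := by
  unfold place
  refine Measurable.prodMk (measurable_pi_lambda _ fun i ↦ ?_) (by fun_prop)
  have h1 : Measurable fun ω ↦ ((s ω).1.1 i : ℝ) := measurable_subtype_coe.comp (by fun_prop)
  have h2 : Measurable fun ω ↦ (x ω i : ℝ) := measurable_subtype_coe.comp (by fun_prop)
  fun_prop

/-- The counting measure of the points with given seeds. -/
def cloud (x : Fin d → unitInterval) (N : Cell d → ℕ) (s : Label d → Seed d A α) :
    Measure (Point d A α) :=
  scatter N fun k ↦ place x k.1 (s (some k))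

lemma measurable_cloud {Ω : Type*} [MeasurableSpace Ω] {x : Ω → Fin d → unitInterval}
    {N : Ω → Cell d → ℕ} {s : Ω → Label d → Seed d A α} (hx : Measurable x) (hN : Measurable N)
    (hs : Measurable s) : Measurable fun ω ↦ cloud (x ω) (N ω) (s ω) :=
  measurable_scatter hN (measurable_pi_lambda _ fun k ↦ measurable_place hx _ (by fun_prop))

omit [MeasurableSpace A] in
lemma exists_cells_of_isBounded {W : Set (Fin d → ℝ)} (hW : Bornology.IsBounded W) :
    ∃ C : Finset (Cell d), ∀ c ∉ C, ∀ (x : Fin d → unitInterval) (s : Seed d A α),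
      (place x c s).1 ∉ W := by
  obtain ⟨r, hr⟩ := hW.subset_closedBall 0
  refine ⟨Finset.Icc (fun _ ↦ -(⌈r⌉ + 1)) fun _ ↦ ⌈r⌉ + 1, fun c hc x s h ↦ hc ?_⟩
  have hy := hr h
  rw [mem_closedBall_zero_iff] at hy
  rw [Finset.mem_Icc, Pi.le_def, Pi.le_def, ← forall_and]
  intro i
  have h1 := abs_le.1 ((norm_le_pi_norm (place x c s).1 i).trans hy)
  simp only [place] at h1
  have h2 := (s.1.1 i).2
  have h3 := (x i).2
  have h4 := Int.le_ceil r
  have h5 : (-(⌈r⌉ + 1) : ℝ) ≤ c i := by linarith [h1.1, h2.2, h3.1]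
  have h6 : (c i : ℝ) ≤ ⌈r⌉ + 1 := by linarith [h1.2, h2.1, h3.2]
  exact ⟨by exact_mod_cast h5, by exact_mod_cast h6⟩

lemma isLocallyFiniteCounting_cloud (x : Fin d → unitInterval) (N : Cell d → ℕ)
    (s : Label d → Seed d A α) : IsLocallyFiniteCounting (cloud x N s) := by
  refine ⟨fun t ht ↦ ⟨_, scatter_apply ht⟩, fun W hW hb ↦ ?_⟩
  obtain ⟨C, hC⟩ := exists_cells_of_isBounded (A := A) (α := α) hb
  rw [cloud, scatter_apply (hW.prod .univ), ENat.toENNReal_lt_top, encard_lt_top_iff]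
  refine (C.finite_toSet.biUnion fun c _ ↦ (finite_lt_nat (N c)).image fun j ↦ (c, j)).subset ?_
  rintro ⟨c, j⟩ ⟨h1, h2⟩
  refine mem_biUnion (x := c) ?_ ⟨j, h1, rfl⟩
  by_contra hc
  exact hC c hc x _ h2.1

lemma lintegral_intensity (γ : ℝ≥0) (Θ : Measure A) [IsProbabilityMeasure Θ]
    (x : Fin d → unitInterval) {f : Point d A α → ℝ≥0∞} (hf : Measurable f) :
    ∫⁻ q, f q ∂intensity d α γ Θ = γ * ∑' c : Cell d, ∫⁻ s, f (place x c s) ∂seedBase d α Θ := by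
  have hg : Measurable fun y : Fin d → ℝ ↦ ∫⁻ b, f (y, b) ∂Θ.prod (volume.prod (marksLaw α)) :=
    hf.lintegral_prod_right'
  rw [intensity, lintegral_prod _ hf.aemeasurable, lintegral_smul_measure,
    ← lintegral_sub_right_eq_self _ (fun i ↦ (x i : ℝ)), lintegral_eq_tsum_cells]
  · rw [ENNReal.smul_def, smul_eq_mul]
    congr 2
    ext c
    have hfp : Measurable fun s : Seed d A α ↦ f (place x c s) :=
      hf.comp (measurable_place measurable_const c measurable_id)
    rw [seedBase, lintegral_prod _ hfp.aemeasurable, lintegral_prod]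
    · congr 1
      ext ξ
      rw [lintegral_prod]
      · rfl
      · exact (hf.comp measurable_prodMk_left).aemeasurable
    · exact hfp.lintegral_prod_right'.aemeasurable
  · exact hg.comp (measurable_id.sub_const _)

/-- Both sides have independent Poisson counts with the same means on disjoint sets. Testing only
sets inside unit cubes keeps the number of cells involved finite, and the shift `x` does not matter
since the intensity is translation invariant. -/
theorem map_eq_map_cloud {Ω : Type*} [MeasurableSpace Ω] {P : Measure Ω} [IsProbabilityMeasure P]
    {γ : ℝ≥0} {Θ : Measure A} [IsProbabilityMeasure Θ] {Ψ : Ω → Measure (Point d A α)}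
    (hΨ : IsPoissonProcess Ψ (intensity d α γ Θ) P) (x : Fin d → unitInterval) :
    P.map Ψ = (seedLaw d γ (seedBase d α Θ)).map fun p ↦ cloud x p.1 p.2 := by
  have hfl : Measurable fun y : Fin d → ℝ ↦ fun i ↦ ⌊y i⌋ := by fun_prop
  refine map_eq_of_disjoint (ι := Cell d) (K := fun c ↦ {q | (fun i ↦ ⌊q.1 i⌋) = c}) hΨ.measurable
    (measurable_cloud measurable_const measurable_fst measurable_snd)
    (fun c ↦ (hfl.comp measurable_fst) (measurableSet_singleton c)) ?_ ?_ ?_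
  · intro c c' hc
    rw [Set.disjoint_left]
    intro q hq hq'
    exact hc (Eq.trans (Eq.symm hq) hq')
  · exact eq_univ_of_forall fun q ↦ mem_iUnion.2 ⟨_, rfl⟩
  · intro m t ht htd htc
    have hbc : ∀ i, ∃ C : Finset (Cell d), ∀ c ∉ C, ∀ s : Seed d A α, place x c s ∉ t i := by
      intro i
      obtain ⟨c, hc⟩ := htc i
      have hb : Bornology.IsBounded {y : Fin d → ℝ | (fun i ↦ ⌊y i⌋) = c} := by
        refine (Metric.isBounded_Icc (fun i ↦ (c i : ℝ)) fun i ↦ (c i : ℝ) + 1).subset fun y hy ↦ ?_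
        have hy' (i) : ⌊y i⌋ = c i := congrFun hy i
        refine ⟨fun i ↦ ?_, fun i ↦ ?_⟩
        · simp only [← hy']; exact Int.floor_le _
        · simp only [← hy']; exact (Int.lt_floor_add_one _).le
      obtain ⟨C, hC⟩ := exists_cells_of_isBounded (A := A) (α := α) hb
      exact ⟨C, fun c' hc' s hs ↦ hC c' hc' x s (hc hs)⟩
    choose C hC using hbc
    have hC' : ∀ c ∉ Finset.univ.biUnion C, ∀ (s : Seed d A α) (i), place x c s ∉ t i :=
      fun c hc s i ↦ hC i c (fun h ↦ hc (Finset.mem_biUnion.2 ⟨i, Finset.mem_univ _, h⟩)) s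
    have hμ (i) : intensity d α γ Θ (t i) = (γ * ∑ c ∈ Finset.univ.biUnion C,
        (seedBase d α Θ (place x c ⁻¹' t i)).toNNReal : ℝ≥0) := by
      rw [← lintegral_indicator_one (ht i), lintegral_intensity γ Θ x (measurable_one.indicator (ht i)),
        tsum_eq_sum (s := Finset.univ.biUnion C)]
      · push_cast
        congr 1
        refine Finset.sum_congr rfl fun c _ ↦ ?_
        have hpm : MeasurableSet (place x c ⁻¹' t i : Set (Seed d A α)) :=
          (measurable_place measurable_const c measurable_id) (ht i)
        rw [ENNReal.coe_toNNReal (measure_ne_top _ _), ← lintegral_indicator_one hpm]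
        rfl
      · intro c hc
        simp [indicator, hC' c hc]
    have hmi (i) : AEMeasurable (fun ω ↦ Ψ ω (t i)) P :=
      ((Measure.measurable_coe (ht i)).comp hΨ.measurable).aemeasurable
    rw [(iIndepFun_iff_map_fun_eq_pi_map hmi).1 (hΨ.indep m t ht htd)]
    refine Eq.trans ?_ (map_scatter_seedLaw γ (seedBase d α Θ)
      (fun c ↦ measurable_place measurable_const c measurable_id) ht htd _ hC').symm
    congr 1
    ext1 i
    rw [hΨ.poisson _ (ht i) (by rw [hμ]; exact ENNReal.coe_ne_top), hμ, ENNReal.toNNReal_coe]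
    rfl

lemma exists_sum_range_dirac {X : Type*} [MeasurableSpace X] [StandardBorelSpace X] [Nonempty X]
    {η : Measure X} [IsFiniteMeasure η] (h : ∀ s, MeasurableSet s → ∃ n : ℕ∞, η s = n) :
    ∃ (n : ℕ) (y : ℕ → X), η = ∑ j ∈ Finset.range n, Measure.dirac (y j) := by
  obtain ⟨n, hn⟩ := exists_nat_gt (η univ).toReal
  obtain ⟨l, hl⟩ := exists_sum_dirac n η h (by
    rw [← ENNReal.ofReal_toReal (measure_ne_top η univ), ← ENNReal.ofReal_natCast]
    exact ENNReal.ofReal_le_ofReal hn.le)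
  refine ⟨l.length, fun j ↦ l.getD j (Classical.arbitrary X), ?_⟩
  rw [hl, ← Fin.sum_univ_fun_getElem, Finset.sum_range]
  refine Finset.sum_congr rfl fun i _ ↦ ?_
  simp

/-- In each shifted cell the measure is a finite sum of unit masses, and fractional parts recover
the relative positions. The seed of the additional point is left free, as the cloud does not use it.
-/
theorem exists_cloud_eq [StandardBorelSpace A] [Nonempty A] (x : Fin d → unitInterval)
    {η : Measure (Point d A α)} (hη : IsLocallyFiniteCounting η) :
    ∃ (N : Cell d → ℕ) (s : Cell d × ℕ → Seed d A α), ∀ s' : Label d → Seed d A α,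
      (∀ k, s' (some k) = s k) → cloud x N s' = η := by
  let K : Cell d → Set (Point d A α) := fun c ↦ {q | (fun i ↦ ⌊q.1 i + x i⌋) = c}
  have hfl : Measurable fun q : Point d A α ↦ fun i ↦ ⌊q.1 i + x i⌋ := by fun_prop
  have hK (c) : MeasurableSet (K c) := hfl (measurableSet_singleton c)
  have hKf (c) : η (K c) < ∞ := by
    refine (measure_mono ?_).trans_lt (hη.2 (Icc (fun i ↦ (c i : ℝ) - x i) fun i ↦ c i + 1 - x i)
      measurableSet_Icc (Metric.isBounded_Icc _ _))
    intro q hq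
    have hq' (i) : ⌊q.1 i + x i⌋ = c i := congrFun hq i
    refine ⟨⟨fun i ↦ ?_, fun i ↦ ?_⟩, trivial⟩
    · have := Int.floor_le (q.1 i + x i)
      rw [hq'] at this
      simp only
      linarith
    · have := Int.lt_floor_add_one (q.1 i + x i)
      rw [hq'] at this
      simp only
      linarith
  have hex (c) : ∃ (n : ℕ) (y : ℕ → Point d A α),
      η.restrict (K c) = ∑ j ∈ Finset.range n, Measure.dirac (y j) := by
    have : IsFiniteMeasure (η.restrict (K c)) := ⟨by simpa using hKf c⟩
    refine exists_sum_range_dirac fun s hs ↦ ?_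
    rw [Measure.restrict_apply hs]
    exact hη.1 _ (hs.inter (hK c))
  choose N y hy using hex
  have hmem (c j) (hj : j < N c) : y c j ∈ K c := by
    by_contra h
    have h1 : η.restrict (K c) (K c)ᶜ = 0 := by simp [hK c]
    rw [hy, Measure.finsetSum_apply, Finset.sum_eq_zero_iff] at h1
    have := h1 j (Finset.mem_range.2 hj)
    rw [Measure.dirac_apply' _ (hK c).compl, indicator_of_mem h] at this
    exact one_ne_zero this
  let s : Cell d × ℕ → Seed d A α := fun k ↦
    ((fun i ↦ ⟨Int.fract ((y k.1 k.2).1 i + x i), Int.fract_nonneg _, (Int.fract_lt_one _).le⟩,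
      (y k.1 k.2).2.1), (y k.1 k.2).2.2)
  have hs (c j) (hj : j < N c) : place x c (s (c, j)) = y c j := by
    have h := hmem c j hj
    refine Prod.ext (funext fun i ↦ ?_) rfl
    have h' : ⌊(y c j).1 i + x i⌋ = c i := congrFun h i
    simp only [place, s, ← h', Int.floor_add_fract, add_sub_cancel_right]
  refine ⟨N, s, fun s' hs' ↦ Measure.ext fun B hB ↦ ?_⟩
  classical
  rw [cloud, scatter_apply' hB, ENNReal.summable.tsum_prod' fun _ ↦ ENNReal.summable, measure_eq_tsum_inter hK ?_ ?_ η hB]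
  · congr 1
    ext c
    rw [← Measure.restrict_apply hB, hy, Measure.finsetSum_apply, tsum_eq_sum (s := Finset.range (N c))]
    · refine Finset.sum_congr rfl fun j hj ↦ ?_
      have hj' := Finset.mem_range.1 hj
      rw [hs' (c, j), hs c j hj', Measure.dirac_apply' _ hB]
      simp [hj', indicator]
    · intro j hj
      rw [Finset.mem_range] at hj
      simp [hj]
  · intro c c' hc
    rw [Set.disjoint_left]
    intro q hq hq'
    exact hc (Eq.trans (Eq.symm hq) hq')
  · exact eq_univ_of_forall fun q ↦ mem_iUnion.2 ⟨_, rfl⟩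

end Cloud

/-! ### Selecting coordinates at random indices -/

section Selection

lemma measurePreserving_prod_comm_middle {X₁ X₂ X₃ X₄ : Type*} [MeasurableSpace X₁]
    [MeasurableSpace X₂] [MeasurableSpace X₃] [MeasurableSpace X₄] (μ₁ : Measure X₁)
    (μ₂ : Measure X₂) (μ₃ : Measure X₃) (μ₄ : Measure X₄) [SFinite μ₁] [SFinite μ₂] [SFinite μ₃]
    [SFinite μ₄] :
    MeasurePreserving (fun p : (X₁ × X₂) × X₃ × X₄ ↦ ((p.1.1, p.2.1), (p.1.2, p.2.2)))
      ((μ₁.prod μ₂).prod (μ₃.prod μ₄)) ((μ₁.prod μ₃).prod (μ₂.prod μ₄)) := by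
  have h1 := measurePreserving_prodAssoc μ₁ μ₂ (μ₃.prod μ₄)
  have h2 := (MeasurePreserving.id μ₁).prod ((measurePreserving_prodAssoc μ₂ μ₃ μ₄).symm)
  have h3 := (MeasurePreserving.id μ₁).prod ((Measure.measurePreserving_swap (μ := μ₂) (ν := μ₃)).prod
    (MeasurePreserving.id μ₄))
  have h4 := (MeasurePreserving.id μ₁).prod (measurePreserving_prodAssoc μ₃ μ₂ μ₄)
  have h5 := (measurePreserving_prodAssoc μ₁ μ₃ (μ₂.prod μ₄)).symm
  exact h5.comp (h4.comp (h3.comp (h2.comp h1)))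

/-- Given `b`, distinct members of an independent identically distributed family are chosen without
looking at their values. This is why decision variables read off from the marks of the points have
the law required by the model. -/
lemma measurePreserving_select {B I J Z : Type*} [MeasurableSpace B] [MeasurableSpace Z]
    [Countable J] (μ : Measure B) [SFinite μ] (ζ : Measure Z) [IsProbabilityMeasure ζ]
    {ι : B → I → J} (hι : ∀ b, Function.Injective (ι b))
    (hm : ∀ i j, MeasurableSet {b | ι b i = j}) :
    MeasurePreserving (fun p : B × (J → Z) ↦ (p.1, fun i ↦ p.2 (ι p.1 i)))
      (μ.prod (Measure.infinitePi fun _ ↦ ζ)) (μ.prod (Measure.infinitePi fun _ ↦ ζ)) := by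
  have hmeas : Measurable fun p : B × (J → Z) ↦ (p.1, fun i ↦ p.2 (ι p.1 i)) := by
    refine measurable_fst.prodMk (measurable_pi_lambda _ fun i S hS ↦ ?_)
    have : (fun p : B × (J → Z) ↦ p.2 (ι p.1 i)) ⁻¹' S =
        ⋃ j, {p | ι p.1 i = j} ∩ {p | p.2 j ∈ S} := by
      ext p
      simp
    rw [this]
    refine .iUnion fun j ↦ ((hm i j).preimage measurable_fst).inter ?_
    exact ((measurable_pi_apply j).comp measurable_snd) hS
  refine ⟨hmeas, Measure.ext fun S hS ↦ ?_⟩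
  rw [Measure.map_apply hmeas hS, Measure.prod_apply (hmeas hS), Measure.prod_apply hS]
  congr 1
  ext b
  rw [← Measure.map_infinitePi_infinitePi_of_inj (P := fun _ : J ↦ ζ) (hι b),
    Measure.map_apply (by fun_prop) (measurable_prodMk_left hS)]
  rfl

lemma measurable_ncard {Ω K : Type*} [MeasurableSpace Ω] [Countable K] {S : Ω → Set K}
    (hS : ∀ k, MeasurableSet {ω | k ∈ S ω}) : Measurable fun ω ↦ (S ω).ncard := by
  classical
  have h : (fun ω ↦ (S ω).ncard) = fun ω ↦
      ⌊(∑' k, if k ∈ S ω then (1 : ℝ≥0∞) else 0).toReal⌋₊ := by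
    ext ω
    have h1 : (∑' k, if k ∈ S ω then (1 : ℝ≥0∞) else 0) = (S ω).encard := by
      rw [← ENNReal.tsum_set_one, tsum_subtype (S ω) fun _ ↦ (1 : ℝ≥0∞)]
      congr 1
    rw [h1]
    rcases (S ω).finite_or_infinite with hf | hi
    · rw [← hf.cast_ncard_eq]
      simp
    -- For an infinite set both conventions give `0`.
    · simp [hi.encard_eq, hi.ncard]
  rw [h]
  refine Nat.measurable_floor.comp (ENNReal.measurable_toReal.comp (Measurable.tsum fun k ↦ ?_))
  exact Measurable.ite (hS k) measurable_const measurable_const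

lemma infinitePi_prod_map_zip {ι X Y : Type*} [MeasurableSpace X] [MeasurableSpace Y]
    (μ : Measure X) (ν : Measure Y) [IsProbabilityMeasure μ] [IsProbabilityMeasure ν] :
    MeasurePreserving (fun p : (ι → X) × (ι → Y) ↦ fun i ↦ (p.1 i, p.2 i))
      ((Measure.infinitePi fun _ ↦ μ).prod (Measure.infinitePi fun _ ↦ ν))
      (Measure.infinitePi fun _ ↦ μ.prod ν) := by
  refine ⟨by fun_prop, ?_⟩
  rw [← infinitePi_map_prodSplit, Measure.map_map (by fun_prop) (by fun_prop)]
  exact Measure.map_id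

lemma measurePreserving_prodSplit {ι X Y : Type*} [MeasurableSpace X] [MeasurableSpace Y]
    (μ : Measure X) (ν : Measure Y) [IsProbabilityMeasure μ] [IsProbabilityMeasure ν] :
    MeasurePreserving (fun ω : ι → X × Y ↦ (fun i ↦ (ω i).1, fun i ↦ (ω i).2))
      (Measure.infinitePi fun _ ↦ μ.prod ν)
      ((Measure.infinitePi fun _ ↦ μ).prod (Measure.infinitePi fun _ ↦ ν)) :=
  ⟨by fun_prop, infinitePi_map_prodSplit (fun _ ↦ μ) fun _ ↦ ν⟩

lemma measurePreserving_infinitePi_map {ι X Y : Type*} [MeasurableSpace X] [MeasurableSpace Y]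
    {μ : Measure X} {ν : Measure Y} [IsProbabilityMeasure μ] [IsProbabilityMeasure ν] {f : X → Y}
    (hf : MeasurePreserving f μ ν) :
    MeasurePreserving (fun (ω : ι → X) i ↦ f (ω i)) (Measure.infinitePi fun _ ↦ μ)
      (Measure.infinitePi fun _ ↦ ν) := by
  refine ⟨measurable_pi_lambda _ fun i ↦ hf.measurable.comp (measurable_pi_apply i), ?_⟩
  rw [Measure.infinitePi_map_pi _ fun _ ↦ hf.measurable]
  simp only [hf.map_eq]

end Selection

/-! ### The marks of all labels as one family of uniform variables. -/

section Flat

/-- Indices for the uniform variables in `Marks α`. -/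
abbrev MarkIdx (α : ℕ) : Type := (j : Icc 1 α) × (Fin (j : ℕ) → ℕ × ℕ)

lemma measurePreserving_flatMarks (ι : Type*) (α : ℕ) :
    MeasurePreserving (fun (m : ι → Marks α) (k : ι × MarkIdx α) ↦ m k.1 k.2.1 k.2.2)
      (Measure.infinitePi fun _ ↦ marksLaw α)
      (Measure.infinitePi fun _ ↦ (volume : Measure unitInterval)) := by
  have h1 : MeasurePreserving (fun (m : Marks α) (k : MarkIdx α) ↦ m k.1 k.2) (marksLaw α)
      (Measure.infinitePi fun _ ↦ (volume : Measure unitInterval)) := by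
    refine ⟨by fun_prop, ?_⟩
    rw [marksLaw, ← Measure.infinitePi_eq_pi]
    exact Measure.infinitePi_map_piCurry_symm (ι := Icc 1 α) (κ := fun j ↦ Fin (j : ℕ) → ℕ × ℕ)
      (X := fun _ _ ↦ unitInterval) (fun _ _ ↦ volume)
  have h2 : MeasurePreserving (fun (m : ι → MarkIdx α → unitInterval) (k : ι × MarkIdx α) ↦ m k.1 k.2)
      (Measure.infinitePi fun _ ↦ Measure.infinitePi fun _ ↦ (volume : Measure unitInterval))
      (Measure.infinitePi fun _ ↦ (volume : Measure unitInterval)) := by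
    refine ⟨by fun_prop, ?_⟩
    exact Measure.infinitePi_map_curry_symm (ι := ι) (κ := MarkIdx α)
      (X := unitInterval) (fun _ _ ↦ volume)
  exact h2.comp (measurePreserving_infinitePi_map h1)

end Flat

/-! ### Configurations of the model from the points of the Poisson process -/

section Code

variable {d : ℕ} {A : Type*} {α : ℕ}

/-- The labels of the points that are present, including the additional point. -/
def alive (N : Cell d → ℕ) : Set (Label d) := {l | ∀ k, l = some k → k.2 < N k.1}

/-- The time of a label. -/
def clock (τ : Label d → unitInterval) : Label d → unitInterval
  | none => 1
  | some k => τ (some k)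

/-- The position of a label. -/
def spot (x : Fin d → unitInterval) (r : Label d → (Fin d → unitInterval) × A) :
    Label d → Fin d → ℝ
  | none => 0
  | some k => fun i ↦ k.1 i + (r (some k)).1 i - x i

/-- The coordinates of a label. -/
def rank (e : ℕ ≃ (Fin d → ℤ)) (x : Fin d → unitInterval) (N : Cell d → ℕ)
    (r : Label d → (Fin d → unitInterval) × A) (τ : Label d → unitInterval) (l : Label d) : ℕ × ℕ :=
  (cubeIndex e (spot x r l), {k : Cell d × ℕ | k.2 < N k.1 ∧
    cubeIndex e (spot x r (some k)) = cubeIndex e (spot x r l) ∧ clock τ (some k) ≤ clock τ l}.ncard)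

open Classical in
/-- An enumeration of `ρ` by increasing times. -/
def IsSorted (N : Cell d → ℕ) (τ : Label d → unitInterval) (ρ : Finset (Label d)) {j : ℕ}
    (z : Fin (j + 1) → Label d) : Prop :=
  StrictMono (fun i ↦ clock τ (z i)) ∧ Finset.univ.image z = ρ ∧ ∀ i, z i ∈ alive N

open Classical in
/-- The index of the uniform variable that decides about `ρ`. -/
def ruleIdx (α : ℕ) (e : ℕ ≃ (Fin d → ℤ)) (x : Fin d → unitInterval) (N : Cell d → ℕ)
    (r : Label d → (Fin d → unitInterval) × A) (τ : Label d → unitInterval) (ρ : Finset (Label d)) :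
    Idx d ⊕ Label d × MarkIdx α :=
  if h : InjOn (clock τ) (alive N) ∧ ∃ (j : Icc 1 α) (z : Fin ((j : ℕ) + 1) → Label d), IsSorted N τ ρ z
  then .inr (h.2.choose_spec.choose (Fin.last _), ⟨h.2.choose, fun i ↦
    rank e x N r τ (h.2.choose_spec.choose i.castSucc)⟩)
  else .inl (.inr ρ)

variable {e : ℕ ≃ (Fin d → ℤ)} {x : Fin d → unitInterval} {N : Cell d → ℕ}
  {r : Label d → (Fin d → unitInterval) × A} {τ : Label d → unitInterval} {ρ : Finset (Label d)}

lemma IsSorted.injective {j : ℕ} {z : Fin (j + 1) → Label d} (hz : IsSorted N τ ρ z) :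
    Function.Injective z := fun _ _ h ↦ hz.1.injective (by simp only [h])

lemma IsSorted.card {j : ℕ} {z : Fin (j + 1) → Label d} (hz : IsSorted N τ ρ z) : ρ.card = j + 1 := by
  classical
  rw [← hz.2.1, Finset.card_image_of_injective _ hz.injective, Finset.card_univ, Fintype.card_fin]

lemma IsSorted.unique (hI : InjOn (clock τ) (alive N)) {j : ℕ} {z z' : Fin (j + 1) → Label d}
    (hz : IsSorted N τ ρ z) (hz' : IsSorted N τ ρ z') : z = z' := by
  classical
  have h : (fun i ↦ clock τ (z i)) = fun i ↦ clock τ (z' i) := by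
    refine (hz.1.range_inj hz'.1).1 ?_
    have h1 : range z = range z' := by
      have := congrArg (fun s : Finset (Label d) ↦ (s : Set (Label d))) (hz.2.1.trans hz'.2.1.symm)
      simpa using this
    rw [← Function.comp_def, ← Function.comp_def, range_comp, range_comp, h1]
  ext1 i
  exact hI (hz.2.2 i) (hz'.2.2 i) (congrFun h i)

/-- For distinct times the increasing enumeration of `ρ` is unique, so the arbitrary choice in
`ruleIdx` has no effect. -/
lemma ruleIdx_of_isSorted (hI : InjOn (clock τ) (alive N)) (j : Icc 1 α)
    {z : Fin ((j : ℕ) + 1) → Label d} (hz : IsSorted N τ ρ z) :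
    ruleIdx α e x N r τ ρ =
      .inr (z (Fin.last _), ⟨j, fun i ↦ rank e x N r τ (z i.castSucc)⟩) := by
  have h : InjOn (clock τ) (alive N) ∧ ∃ (j : Icc 1 α) (z : Fin ((j : ℕ) + 1) → Label d),
    IsSorted N τ ρ z := ⟨hI, j, z, hz⟩
  rw [ruleIdx, dif_pos h]
  have h1 := h.2.choose_spec.choose_spec
  generalize h.2.choose_spec.choose = z' at h1
  generalize h.2.choose = j' at *
  obtain rfl : j' = j := Subtype.ext (by have := h1.card; have := hz.card; omega)
  rw [h1.unique hI hz]

lemma ruleIdx_cases (α : ℕ) (e : ℕ ≃ (Fin d → ℤ)) (x : Fin d → unitInterval) (N : Cell d → ℕ)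
    (r : Label d → (Fin d → unitInterval) × A) (τ : Label d → unitInterval)
    (ρ : Finset (Label d)) :
    (∃ (j : Icc 1 α) (z : Fin ((j : ℕ) + 1) → Label d), (InjOn (clock τ) (alive N) ∧ IsSorted N τ ρ z) ∧
      ruleIdx α e x N r τ ρ =
        .inr (z (Fin.last _), ⟨j, fun i ↦ rank e x N r τ (z i.castSucc)⟩)) ∨
    (∀ (j : Icc 1 α) (z : Fin ((j : ℕ) + 1) → Label d),
      ¬ (InjOn (clock τ) (alive N) ∧ IsSorted N τ ρ z)) ∧ ruleIdx α e x N r τ ρ = .inl (.inr ρ) := by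
  by_cases h : InjOn (clock τ) (alive N) ∧
      ∃ (j : Icc 1 α) (z : Fin ((j : ℕ) + 1) → Label d), IsSorted N τ ρ z
  · obtain ⟨hI, j, z, hz⟩ := h
    exact Or.inl ⟨j, z, ⟨hI, hz⟩, ruleIdx_of_isSorted hI j hz⟩
  · refine Or.inr ⟨fun j z hz ↦ h ⟨hz.1, j, z, hz.2⟩, ?_⟩
    rw [ruleIdx, dif_neg h]

lemma finite_cubeIndex_eq (e : ℕ ≃ (Fin d → ℤ)) (x : Fin d → unitInterval) (N : Cell d → ℕ)
    (r : Label d → (Fin d → unitInterval) × A) (n : ℕ) :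
    {k : Cell d × ℕ | k.2 < N k.1 ∧ cubeIndex e (spot x r (some k)) = n}.Finite := by
  have hb : Bornology.IsBounded {y : Fin d → ℝ | cubeIndex e y = n} := by
    refine (Metric.isBounded_Icc (fun i ↦ (e n i : ℝ)) fun i ↦ (e n i : ℝ) + 1).subset fun y hy ↦ ?_
    have hy' (i) : ⌊y i⌋ = e n i := by
      have : e.symm (fun i ↦ ⌊y i⌋) = n := hy
      rw [Equiv.symm_apply_eq] at this
      exact congrFun this i
    refine ⟨fun i ↦ ?_, fun i ↦ ?_⟩
    · simp only [← hy']; exact Int.floor_le _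
    · simp only [← hy']; exact (Int.lt_floor_add_one _).le
  obtain ⟨C, hC⟩ := exists_cells_of_isBounded (A := A) (α := 0) hb
  refine (C.finite_toSet.biUnion fun c _ ↦ (finite_lt_nat (N c)).image fun j ↦ (c, j)).subset ?_
  rintro ⟨c, j⟩ ⟨h1, h2⟩
  refine mem_biUnion (x := c) ?_ ⟨j, h1, rfl⟩
  by_contra hc
  exact hC c hc x (r (some (c, j)), 0, fun _ _ ↦ 0) h2

/-- Distinct points in a configuration with distinct times have distinct coordinates. -/
lemma rank_injOn (e : ℕ ≃ (Fin d → ℤ)) (x : Fin d → unitInterval)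
    (r : Label d → (Fin d → unitInterval) × A)
    (hI : InjOn (clock τ) (alive N)) {k k' : Cell d × ℕ}
    (hk : some k ∈ alive N) (hk' : some k' ∈ alive N)
    (h : rank e x N r τ (some k) = rank e x N r τ (some k')) : k = k' := by
  by_contra hne
  have hτ : clock τ (some k) ≠ clock τ (some k') := fun h ↦ hne (Option.some.inj (hI hk hk' h))
  wlog hlt : clock τ (some k) < clock τ (some k') generalizing k k'
  · exact this hk' hk h.symm (Ne.symm hne) hτ.symm (lt_of_le_of_ne (not_lt.1 hlt) hτ.symm)
  have h1 : cubeIndex e (spot x r (some k)) = cubeIndex e (spot x r (some k')) :=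
    congrArg Prod.fst h
  -- Two points of the same cube with different times have different ranks, because the later one is
  -- counted only in its own rank. Finiteness is needed, as infinite sets have `ncard` zero.
  refine (ncard_lt_ncard ((ssubset_iff_of_subset fun k'' hk'' ↦ ?_).2 ⟨k', ?_, ?_⟩) ?_).ne
    (congrArg Prod.snd h)
  · exact ⟨hk''.1, hk''.2.1.trans h1, hk''.2.2.trans hlt.le⟩
  · exact ⟨hk' k' rfl, rfl, le_rfl⟩
  · exact fun h' ↦ not_le.2 hlt h'.2.2
  · exact (finite_cubeIndex_eq e x N r _).subset fun k'' hk'' ↦ ⟨hk''.1, hk''.2.1⟩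

/-- The additional point has the largest possible time `1` and can only come last. Hence its own
coordinates never serve as an index. -/
lemma IsSorted.castSucc_ne_none {j : ℕ} {z : Fin (j + 1) → Label d} (hz : IsSorted N τ ρ z)
    (i : Fin j) : z i.castSucc ≠ none := by
  intro h
  have h1 := hz.1 (Fin.castSucc_lt_last i)
  simp only [h] at h1
  exact not_lt.2 (unitInterval.le_one _) h1

/-- The last point and the coordinates of the earlier ones determine the whole set. Sets to which
the rule does not apply keep their own indices in the other summand. -/
lemma ruleIdx_injective : Function.Injective (ruleIdx α e x N r τ) := by
  classical
  intro ρ ρ' h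
  obtain ⟨j, z, ⟨hI, hz⟩, e1⟩ | ⟨-, e1⟩ := ruleIdx_cases α e x N r τ ρ <;>
  obtain ⟨j', z', ⟨hI', hz'⟩, e2⟩ | ⟨-, e2⟩ := ruleIdx_cases α e x N r τ ρ' <;>
  rw [e1, e2] at h
  · simp only [Sum.inr.injEq, Prod.mk.injEq] at h
    obtain ⟨h1, h2⟩ := h
    obtain rfl : j = j' := congrArg Sigma.fst h2
    have h3 := eq_of_heq (Sigma.mk.inj_iff.1 h2).2
    have h4 : z = z' := by
      ext1 i
      induction i using Fin.lastCases with
      | last => exact h1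
      | cast i =>
        obtain ⟨k, hk⟩ := Option.ne_none_iff_exists'.1 (hz.castSucc_ne_none i)
        obtain ⟨k', hk'⟩ := Option.ne_none_iff_exists'.1 (hz'.castSucc_ne_none i)
        have h5 := congrFun h3 i
        simp only [hk, hk'] at h5
        rw [hk, hk', rank_injOn e x r hI (hk ▸ hz.2.2 _) (hk' ▸ hz'.2.2 _) h5]
    rw [← hz.2.1, ← hz'.2.1, h4]
  · cases h
  · cases h
  · exact Sum.inr.inj (Sum.inl.inj h)

section Measurable

variable [MeasurableSpace A] {Ω : Type*} [MeasurableSpace Ω] {x : Ω → Fin d → unitInterval}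
  {N : Ω → Cell d → ℕ} {r : Ω → Label d → (Fin d → unitInterval) × A} {τ : Ω → Label d → unitInterval}

omit [MeasurableSpace A] in
lemma measurableSet_mem_alive (hN : Measurable N) (l : Label d) :
    MeasurableSet {ω | l ∈ alive (N ω)} := by
  rcases l with _ | k
  · simp [alive]
  · have : {ω | some k ∈ alive (N ω)} = {ω | k.2 < N ω k.1} := by
      ext ω
      refine ⟨fun h ↦ h k rfl, fun h k' hk' ↦ ?_⟩
      cases hk'
      exact h
    rw [this]
    exact measurableSet_lt measurable_const ((measurable_pi_apply _).comp hN)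

omit [MeasurableSpace A] in
lemma measurable_clock (hτ : Measurable τ) (l : Label d) : Measurable fun ω ↦ clock (τ ω) l := by
  rcases l with _ | k
  · exact measurable_const
  · exact (measurable_pi_apply (some k)).comp hτ

lemma measurable_spot (hx : Measurable x) (hr : Measurable r) (l : Label d) :
    Measurable fun ω ↦ spot (x ω) (r ω) l := by
  rcases l with _ | k
  · exact measurable_const
  · refine measurable_pi_lambda _ fun i ↦ ?_
    have h1 : Measurable fun ω ↦ ((r ω (some k)).1 i : ℝ) := measurable_subtype_coe.comp (by fun_prop)
    have h2 : Measurable fun ω ↦ (x ω i : ℝ) := measurable_subtype_coe.comp (by fun_prop)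
    simp only [spot]
    fun_prop

omit [MeasurableSpace A] in
lemma measurable_cubeIndex (e : ℕ ≃ (Fin d → ℤ)) : Measurable (cubeIndex e) := by
  have h : Measurable fun y : Fin d → ℝ ↦ fun i ↦ ⌊y i⌋ := by fun_prop
  exact (measurable_of_countable e.symm).comp h

lemma measurable_rank (e : ℕ ≃ (Fin d → ℤ)) (hx : Measurable x) (hN : Measurable N)
    (hr : Measurable r) (hτ : Measurable τ) (l : Label d) :
    Measurable fun ω ↦ rank e (x ω) (N ω) (r ω) (τ ω) l := by
  have hc (l) : Measurable fun ω ↦ cubeIndex e (spot (x ω) (r ω) l) :=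
    (measurable_cubeIndex e).comp (measurable_spot hx hr l)
  refine (hc l).prodMk (measurable_ncard fun k ↦ ?_)
  refine MeasurableSet.inter (s₁ := {ω | k.2 < N ω k.1}) ?_ (MeasurableSet.inter ?_ ?_)
  · exact measurableSet_lt measurable_const ((measurable_pi_apply _).comp hN)
  · exact measurableSet_eq_fun (hc _) (hc _)
  · exact measurableSet_le (f := fun ω ↦ clock (τ ω) (some k)) (g := fun ω ↦ clock (τ ω) l)
      (measurable_clock hτ _) (measurable_clock hτ _)

omit [MeasurableSpace A] in
lemma measurableSet_injOn_alive {β : Type*} [MeasurableSpace β] [MeasurableSingletonClass β]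
    [MeasurableSpace.SeparatesPoints β] [MeasurableEq β] {f : Ω → Label d → β}
    (hN : Measurable N) (hf : ∀ l, Measurable fun ω ↦ f ω l) :
    MeasurableSet {ω | InjOn (f ω) (alive (N ω))} := by
  have : {ω | InjOn (f ω) (alive (N ω))} = ⋂ l : Label d, ⋂ l' : {l' : Label d // l ≠ l'},
      ({ω | l ∈ alive (N ω)} ∩ ({ω | l'.1 ∈ alive (N ω)} ∩ {ω | f ω l = f ω l'.1}))ᶜ := by
    ext ω
    simp only [mem_ofPred_eq, mem_iInter, mem_compl_iff, mem_inter_iff, not_and, Subtype.forall]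
    constructor
    · exact fun h l l' hl h1 h2 h3 ↦ hl (h h1 h2 h3)
    · intro h l h1 l' h2 h3
      by_contra hne
      exact h l l' hne h1 h2 h3
  rw [this]
  exact .iInter fun l ↦ .iInter fun l' ↦ ((measurableSet_mem_alive hN l).inter
    ((measurableSet_mem_alive hN l').inter (measurableSet_eq_fun (hf l) (hf l')))).compl

omit [MeasurableSpace A] in
lemma measurableSet_isSorted (hN : Measurable N) (hτ : Measurable τ) (ρ : Finset (Label d)) {j : ℕ}
    (z : Fin (j + 1) → Label d) : MeasurableSet {ω | IsSorted (N ω) (τ ω) ρ z} := by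
  classical
  refine MeasurableSet.inter (s₁ := {ω | StrictMono fun i ↦ clock (τ ω) (z i)}) ?_
    (MeasurableSet.inter (.const _) ?_)
  · have : {ω | StrictMono fun i ↦ clock (τ ω) (z i)} =
        ⋂ i, ⋂ i', ⋂ _ : i < i', {ω | clock (τ ω) (z i) < clock (τ ω) (z i')} := by
      ext ω
      simp only [mem_ofPred_eq, mem_iInter]
      exact ⟨fun h i i' hi ↦ h hi, fun h i i' hi ↦ h i i' hi⟩
    rw [this]
    exact .iInter fun i ↦ .iInter fun i' ↦ .iInter fun _ ↦
      measurableSet_lt (measurable_clock hτ _) (measurable_clock hτ _)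
  · have : {ω | ∀ i, z i ∈ alive (N ω)} = ⋂ i, {ω | z i ∈ alive (N ω)} := by
      ext ω
      simp only [mem_ofPred_eq, mem_iInter]
    have h2 : MeasurableSet {ω | ∀ i, z i ∈ alive (N ω)} := by
      rw [this]
      exact .iInter fun i ↦ measurableSet_mem_alive hN _
    exact h2

lemma measurableSet_ruleIdx_eq (e : ℕ ≃ (Fin d → ℤ)) (hx : Measurable x) (hN : Measurable N)
    (hr : Measurable r) (hτ : Measurable τ) (ρ : Finset (Label d)) (ξ : Idx d ⊕ Label d × MarkIdx α) :
    MeasurableSet {ω | ruleIdx α e (x ω) (N ω) (r ω) (τ ω) ρ = ξ} := by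
  let nice (j : Icc 1 α) (z : Fin ((j : ℕ) + 1) → Label d) : Set Ω :=
    {ω | InjOn (clock (τ ω)) (alive (N ω)) ∧ IsSorted (N ω) (τ ω) ρ z}
  have hnice (j z) : MeasurableSet (nice j z) :=
    (measurableSet_injOn_alive hN (measurable_clock hτ)).inter (measurableSet_isSorted hN hτ ρ z)
  have : {ω | ruleIdx α e (x ω) (N ω) (r ω) (τ ω) ρ = ξ} =
      (⋃ (j : Icc 1 α) (z : Fin ((j : ℕ) + 1) → Label d), nice j z ∩
        {ω | (.inr (z (Fin.last _), ⟨j, fun i ↦ rank e (x ω) (N ω) (r ω) (τ ω) (z i.castSucc)⟩) :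
          Idx d ⊕ Label d × MarkIdx α) = ξ}) ∪
      ((⋂ (j : Icc 1 α) (z : Fin ((j : ℕ) + 1) → Label d), (nice j z)ᶜ) ∩
        {_ω | (.inl (.inr ρ) : Idx d ⊕ Label d × MarkIdx α) = ξ}) := by
    ext ω
    simp only [mem_union, mem_iUnion, mem_inter_iff, mem_iInter, mem_compl_iff, mem_ofPred_eq, nice]
    obtain ⟨j, z, hn, e1⟩ | ⟨hn, e1⟩ := ruleIdx_cases α e (x ω) (N ω) (r ω) (τ ω) ρ
    · constructor
      · exact fun h ↦ Or.inl ⟨j, z, hn, e1.symm.trans h⟩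
      · rintro (⟨j', z', hn', e2⟩ | ⟨h, -⟩)
        · rw [ruleIdx_of_isSorted hn'.1 j' hn'.2]
          exact e2
        · exact absurd hn (h j z)
    · constructor
      · exact fun h ↦ Or.inr ⟨hn, e1.symm.trans h⟩
      · rintro (⟨j', z', hn', e2⟩ | ⟨-, h⟩)
        · exact absurd hn' (hn j' z')
        · exact e1.trans h
  rw [this]
  refine (MeasurableSet.iUnion fun j ↦ .iUnion fun z ↦ (hnice j z).inter ?_).union
    ((MeasurableSet.iInter fun j ↦ .iInter fun z ↦ (hnice j z).compl).inter (.const _))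
  have h1 : Measurable fun ω (i : Fin (j : ℕ)) ↦ rank e (x ω) (N ω) (r ω) (τ ω) (z i.castSucc) :=
    measurable_pi_lambda _ fun i ↦ measurable_rank e hx hN hr hτ _
  exact h1 (Set.to_countable {κ : Fin (j : ℕ) → ℕ × ℕ |
    (.inr (z (Fin.last _), ⟨j, κ⟩) : Idx d ⊕ Label d × MarkIdx α) = ξ}).measurableSet

end Measurable

end Code

/-! ### The joint construction of the model and the Poisson process -/

section Joint

variable {d : ℕ} {A : Type*} [MeasurableSpace A] {α : ℕ}

/-- A configuration of the model with times and uniform variables for all labels. -/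
abbrev Ext (d : ℕ) (A : Type*) (α : ℕ) : Type _ :=
  Config d A × (Label d → unitInterval × Marks α)

/-- The law of an extended configuration. -/
def extLaw (d : ℕ) (α : ℕ) (γ : ℝ≥0) (Θ : Measure A) [IsProbabilityMeasure Θ] :
    Measure (Ext d A α) :=
  (configLaw d γ Θ).prod (Measure.infinitePi fun _ ↦ (volume : Measure unitInterval).prod (marksLaw α))

/-- The relative positions and marks of all labels. -/
def bases (ω : Config d A) (l : Label d) : (Fin d → unitInterval) × A := (field ω {l}).1

/-- The seeds of all labels. -/
def seeds (ω : Ext d A α) (l : Label d) : Seed d A α := (bases ω.1 l, ω.2 l)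

/-- The times of all labels. -/
def times (ω : Ext d A α) (l : Label d) : unitInterval := (ω.2 l).1

/-- All uniform variables. -/
def uniforms (ω : Ext d A α) : Idx d ⊕ Label d × MarkIdx α → unitInterval
  | .inl i => (ω.1 i).2.2
  | .inr k => (ω.2 k.1).2 k.2.1 k.2.2

/-- The index of the uniform variable for a coordinate. -/
def fullIdx (α : ℕ) (e : ℕ ≃ (Fin d → ℤ)) (x : Fin d → unitInterval) (N : Cell d → ℕ)
    (r : Label d → (Fin d → unitInterval) × A) (τ : Label d → unitInterval) :
    Idx d → Idx d ⊕ Label d × MarkIdx α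
  | .inl c => .inl (.inl c)
  | .inr ρ => ruleIdx α e x N r τ ρ

/-- The configuration of the model in which the decision variables are those of the points. -/
def code (e : ℕ ≃ (Fin d → ℤ)) (χ : (Label d → (Fin d → unitInterval) × A) → Fin d → unitInterval)
    (ω : Ext d A α) : Config d A := fun i ↦
  ((ω.1 i).1, ((ω.1 i).2.1, uniforms ω
    (fullIdx α e (χ (bases ω.1)) (cnt ω.1) (bases ω.1) (times ω) i)))

omit [MeasurableSpace A] in
lemma fullIdx_injective (e : ℕ ≃ (Fin d → ℤ)) (x : Fin d → unitInterval) (N : Cell d → ℕ)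
    (r : Label d → (Fin d → unitInterval) × A) (τ : Label d → unitInterval) :
    Function.Injective (fullIdx α e x N r τ) := by
  have h0 (c : Cell d) (ρ : Finset (Label d)) : ruleIdx α e x N r τ ρ ≠ .inl (.inl c) := by
    obtain ⟨j, z, -, h⟩ | ⟨-, h⟩ := ruleIdx_cases α e x N r τ ρ <;> rw [h] <;> simp
  rintro (c | ρ) (c' | ρ') h
  · simpa [fullIdx] using h
  · exact absurd h.symm (h0 c ρ')
  · exact absurd h (h0 c' ρ)
  · rw [ruleIdx_injective h]

variable (γ : ℝ≥0) (Θ : Measure A) [IsProbabilityMeasure Θ]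

/-- The law of the relative position and the mark of a point. -/
abbrev baseLaw (d : ℕ) (Θ : Measure A) : Measure ((Fin d → unitInterval) × A) := volume.prod Θ

lemma measurePreserving_splitConfig :
    MeasurePreserving (fun ω : Config d A ↦ (fun i ↦ ((ω i).1, (ω i).2.1), fun i ↦ (ω i).2.2))
      (configLaw d γ Θ)
      ((Measure.infinitePi fun _ ↦ (poissonMeasure γ).prod (baseLaw d Θ)).prod
        (Measure.infinitePi fun _ ↦ volume)) :=
  (measurePreserving_prodSplit _ _).comp (measurePreserving_infinitePi_map
    (measurePreserving_prodAssoc (poissonMeasure γ) (baseLaw d Θ)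
      (volume : Measure unitInterval)).symm)

lemma measurePreserving_joinConfig :
    MeasurePreserving (fun (p : (Idx d → ℕ × ((Fin d → unitInterval) × A)) × (Idx d → unitInterval))
        i ↦ ((p.1 i).1, ((p.1 i).2, p.2 i)))
      ((Measure.infinitePi fun _ ↦ (poissonMeasure γ).prod (baseLaw d Θ)).prod
        (Measure.infinitePi fun _ ↦ volume)) (configLaw d γ Θ) :=
  (measurePreserving_infinitePi_map (measurePreserving_prodAssoc (poissonMeasure γ) (baseLaw d Θ)
      (volume : Measure unitInterval))).comp (infinitePi_prod_map_zip _ _)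

lemma measurePreserving_sumElim {ι κ Z : Type*} [MeasurableSpace Z] (ζ : Measure Z)
    [IsProbabilityMeasure ζ] :
    MeasurePreserving (fun (p : (ι → Z) × (κ → Z)) i ↦ Sum.elim p.1 p.2 i)
      ((Measure.infinitePi fun _ ↦ ζ).prod (Measure.infinitePi fun _ ↦ ζ))
      (Measure.infinitePi fun _ ↦ ζ) := by
  refine ⟨measurable_pi_lambda _ fun i ↦ ?_, prod_map_sumElim_infinitePi fun _ ↦ ζ⟩
  cases i <;> simp only [Sum.elim_inl, Sum.elim_inr] <;> fun_prop

/-- The selected indices, including the shift `χ`, are functions of counts, positions, marks and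
times, and the uniform variables are independent of all these. So `measurePreserving_select`
applies; everything else rearranges product measures. -/
theorem measurePreserving_code (e : ℕ ≃ (Fin d → ℤ))
    {χ : (Label d → (Fin d → unitInterval) × A) → Fin d → unitInterval} (hχ : Measurable χ) :
    MeasurePreserving (code e χ) (extLaw d α γ Θ) (configLaw d γ Θ) := by
  have h1 := (measurePreserving_splitConfig (d := d) γ Θ).prod
    (((MeasurePreserving.id _).prod (measurePreserving_flatMarks (Label d) α)).comp
      (measurePreserving_prodSplit (ι := Label d) (volume : Measure unitInterval) (marksLaw α)))
  have h2 := measurePreserving_prod_comm_middle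
    (Measure.infinitePi fun _ : Idx d ↦ (poissonMeasure γ).prod (baseLaw d Θ))
    (Measure.infinitePi fun _ : Idx d ↦ (volume : Measure unitInterval))
    (Measure.infinitePi fun _ : Label d ↦ (volume : Measure unitInterval))
    (Measure.infinitePi fun _ : Label d × MarkIdx α ↦ (volume : Measure unitInterval))
  have h3 := (MeasurePreserving.id (((Measure.infinitePi fun _ : Idx d ↦
    (poissonMeasure γ).prod (baseLaw d Θ)).prod
      (Measure.infinitePi fun _ : Label d ↦ (volume : Measure unitInterval))))).prod
    (measurePreserving_sumElim (ι := Idx d) (κ := Label d × MarkIdx α)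
      (volume : Measure unitInterval))
  let N : (Idx d → ℕ × ((Fin d → unitInterval) × A)) × (Label d → unitInterval) → Cell d → ℕ :=
    fun b c ↦ (b.1 (.inl c)).1
  let r : (Idx d → ℕ × ((Fin d → unitInterval) × A)) × (Label d → unitInterval) →
      Label d → (Fin d → unitInterval) × A := fun b l ↦ (b.1 (.inr {l})).2
  have hN : Measurable N := by fun_prop
  have hr : Measurable r := by fun_prop
  have h4 := measurePreserving_select (I := Idx d) ((Measure.infinitePi fun _ : Idx d ↦
    (poissonMeasure γ).prod (baseLaw d Θ)).prod
      (Measure.infinitePi fun _ : Label d ↦ (volume : Measure unitInterval)))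
    (volume : Measure unitInterval)
    (ι := fun b ↦ fullIdx α e (χ (r b)) (N b) (r b) b.2)
    (fun b ↦ fullIdx_injective e _ _ _ _) (by
      rintro (c | ρ) ξ
      · exact MeasurableSet.const ((.inl (.inl c) : Idx d ⊕ Label d × MarkIdx α) = ξ)
      · exact measurableSet_ruleIdx_eq e (hχ.comp hr) hN hr measurable_snd ρ ξ)
  have h5 := (measurePreserving_fst (μ := Measure.infinitePi fun _ : Idx d ↦
      (poissonMeasure γ).prod (baseLaw d Θ))
      (ν := Measure.infinitePi fun _ : Label d ↦ (volume : Measure unitInterval))).prod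
    (MeasurePreserving.id (Measure.infinitePi fun _ : Idx d ↦ (volume : Measure unitInterval)))
  have h6 := measurePreserving_joinConfig (d := d) γ Θ
  have h7 := h6.comp (h5.comp (h4.comp (h3.comp (h2.comp h1))))
  refine cast (congrArg (MeasurePreserving · (extLaw d α γ Θ) (configLaw d γ Θ)) ?_) h7
  funext ω i
  symm
  simp only [code, Function.comp, Prod.map]
  refine Prod.ext rfl (Prod.ext rfl ?_)
  generalize hk : fullIdx α e (χ (bases ω.1)) (cnt ω.1) (bases ω.1) (times ω) i = k
  have hk' : fullIdx α e (χ (r (fun i ↦ ((ω.1 i).1, (ω.1 i).2.1), fun l ↦ (ω.2 l).1)))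
    (N (fun i ↦ ((ω.1 i).1, (ω.1 i).2.1), fun l ↦ (ω.2 l).1))
    (r (fun i ↦ ((ω.1 i).1, (ω.1 i).2.1), fun l ↦ (ω.2 l).1)) (fun l ↦ (ω.2 l).1) i = k := hk
  simp only [id]
  erw [hk']
  cases k <;> rfl

theorem measurePreserving_seeds :
    MeasurePreserving (fun ω : Ext d A α ↦ (cnt ω.1, seeds ω)) (extLaw d α γ Θ)
      (seedLaw d γ (seedBase d α Θ)) := by
  have h1 : MeasurePreserving
      (fun ω : Config d A ↦ ((fun c : Cell d ↦ ω (.inl c)), fun ρ : Finset (Label d) ↦ ω (.inr ρ)))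
      (configLaw d γ Θ) ((Measure.infinitePi fun _ ↦ siteLaw d γ Θ).prod
        (Measure.infinitePi fun _ ↦ siteLaw d γ Θ)) :=
    ⟨by fun_prop, infinitePi_map_sumSplit fun _ ↦ siteLaw d γ Θ⟩
  have h2 : MeasurePreserving (fun (ω : Cell d → ℕ × Datum d A) c ↦ (ω c).1)
      (Measure.infinitePi fun _ ↦ siteLaw d γ Θ) (Measure.infinitePi fun _ ↦ poissonMeasure γ) :=
    measurePreserving_infinitePi_map measurePreserving_fst
  have h3 : MeasurePreserving (fun (ω : Finset (Label d) → ℕ × Datum d A) l ↦ ω {l})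
      (Measure.infinitePi fun _ ↦ siteLaw d γ Θ) (Measure.infinitePi fun _ ↦ siteLaw d γ Θ) :=
    ⟨by fun_prop, Measure.map_infinitePi_infinitePi_of_inj (P := fun _ ↦ siteLaw d γ Θ)
      (Finset.singleton_injective)⟩
  have h4 : MeasurePreserving (fun (ω : Label d → ℕ × Datum d A) c ↦ (ω c).2.1)
      (Measure.infinitePi fun _ ↦ siteLaw d γ Θ) (Measure.infinitePi fun _ ↦ baseLaw d Θ) :=
    measurePreserving_infinitePi_map ((measurePreserving_fst).comp measurePreserving_snd)
  have h5 := ((h2.prod (h4.comp h3)).comp h1).prod (MeasurePreserving.id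
    (Measure.infinitePi fun _ : Label d ↦ (volume : Measure unitInterval).prod (marksLaw α)))
  have h6 := measurePreserving_prodAssoc (Measure.infinitePi fun _ : Cell d ↦ poissonMeasure γ)
    (Measure.infinitePi fun _ : Label d ↦ baseLaw d Θ)
    (Measure.infinitePi fun _ : Label d ↦ (volume : Measure unitInterval).prod (marksLaw α))
  have h7 := (MeasurePreserving.id (Measure.infinitePi fun _ : Cell d ↦ poissonMeasure γ)).prod
    (infinitePi_prod_map_zip (ι := Label d) (baseLaw d Θ)
      ((volume : Measure unitInterval).prod (marksLaw α)))
  exact h7.comp (h6.comp h5)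

end Joint

/-! ### The complex of the Poisson process as a complex on labels -/

section Identify

variable {d : ℕ} {A : Type*} {α : ℕ}

/-- The point with a given label. -/
def node (x : Fin d → unitInterval) (s : Label d → Seed d A α) : Label d → Point d A α
  | none => (0, (s none).1.2, 1, (s none).2.2)
  | some k => place x k.1 (s (some k))

/-- All points have distinct times and distinct positions. -/
def Separated (x : Fin d → unitInterval) (N : Cell d → ℕ) (s : Label d → Seed d A α) : Prop :=
  InjOn (clock fun l ↦ (s l).2.1) (alive N) ∧ InjOn (spot x fun l ↦ (s l).1) (alive N)

variable {e : ℕ ≃ (Fin d → ℤ)} {x : Fin d → unitInterval} {N : Cell d → ℕ}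
  {s : Label d → Seed d A α} {S : Set (Label d)}

lemma time_node (l : Label d) : time (node x s l) = clock (fun l ↦ (s l).2.1) l := by
  cases l <;> rfl

lemma node_fst (l : Label d) : (node x s l).1 = spot x (fun l ↦ (s l).1) l := by
  cases l <;> rfl

lemma mark_node (l : Label d) : mark (node x s l) = (s l).2.2 := by
  cases l <;> rfl

lemma loc_node (l : Label d) : loc (node x s l) = (spot x (fun l ↦ (s l).1) l, (s l).1.2) := by
  cases l <;> rfl

lemma none_mem_alive : none ∈ alive N := fun _ h ↦ by cases h

lemma some_mem_alive {k : Cell d × ℕ} : some k ∈ alive N ↔ k.2 < N k.1 :=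
  ⟨fun h ↦ h k rfl, fun h k' hk' ↦ by cases hk'; exact h⟩

lemma Separated.loc_injOn (h : Separated x N s) : InjOn (fun l ↦ loc (node x s l)) (alive N) := by
  intro l hl l' hl' he
  refine h.2 hl hl' ?_
  simp only [loc_node] at he
  exact congrArg Prod.fst he

variable [MeasurableSpace A]

/-- The additional point is later than all others and does not enter their ranks. So the coordinates
are the same whether or not `ψ` contains it. -/
lemma coords_node (hI : InjOn (clock fun l ↦ (s l).2.1) (alive N))
    (hsp : InjOn (spot x fun l ↦ (s l).1) (alive N)) (hS : S ⊆ alive N)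
    (hS' : ∀ k, some k ∈ alive N → some k ∈ S) {ψ : Measure (Point d A α)}
    (hψ : points ψ = node x s '' S) {k : Cell d × ℕ} (hk : some k ∈ alive N) :
    coords e ψ (node x s (some k)) =
      rank e x N (fun l ↦ (s l).1) (fun l ↦ (s l).2.1) (some k) := by
  rw [coords, rank, node_fst]
  congr 1
  rw [← InjOn.ncard_image (f := fun k ↦ node x s (some k))]
  · congr 1
    ext q
    simp only [mem_ofPred_eq, mem_image, hψ, time_node]
    constructor
    · rintro ⟨⟨l, hl, rfl⟩, h1, h2⟩
      rcases l with _ | k'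
      · rw [time_node] at h2
        have h3 : clock (fun l ↦ (s l).2.1) (some k) = clock (fun l ↦ (s l).2.1) none :=
          le_antisymm (unitInterval.le_one _) h2
        cases hI hk none_mem_alive h3
      · rw [time_node] at h2
        rw [node_fst] at h1
        exact ⟨k', ⟨some_mem_alive.1 (hS hl), h1, h2⟩, rfl⟩
    · rintro ⟨k', ⟨h0, h1, h2⟩, rfl⟩
      rw [node_fst, time_node]
      exact ⟨⟨_, hS' _ (some_mem_alive.2 h0), rfl⟩, h1, h2⟩
  · intro k' hk' k'' hk'' h
    have h1 := hsp (some_mem_alive.2 hk'.1) (some_mem_alive.2 hk''.1)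
      (by simpa only [node_fst] using congrArg Prod.fst h)
    exact Option.some.inj h1

variable {χ : (Label d → (Fin d → unitInterval) × A) → Fin d → unitInterval} {ω : Ext d A α}
  {φ : (j : ℕ) → (Fin (j + 1) → (Fin d → ℝ) × A) → unitInterval}

omit [MeasurableSpace A] in
lemma code_unif {ρ : Finset (Label d)} (hx : χ (bases ω.1) = x) (h : Separated x (cnt ω.1) (seeds ω))
    (j : Icc 1 α) {z : Fin ((j : ℕ) + 1) → Label d} (hz : IsSorted (cnt ω.1) (times ω) ρ z) :
    (field (code e χ ω) ρ).2 = mark (node x (seeds ω) (z (Fin.last _))) j fun i ↦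
      rank e x (cnt ω.1) (bases ω.1) (times ω) (z i.castSucc) := by
  have h1 := ruleIdx_of_isSorted (e := e) (x := x) (r := bases ω.1) h.1 j hz
  have h2 : (field (code e χ ω) ρ).2 = uniforms ω
    (ruleIdx α e (χ (bases ω.1)) (cnt ω.1) (bases ω.1) (times ω) ρ) := rfl
  rw [h2, hx, mark_node]
  exact congrArg (uniforms ω) h1

/-- The acceptance rules for a set of points and for the set of the labels agree. -/
lemma spans_image_iff (hφ : IsConnection α φ) (hx : χ (bases ω.1) = x)
    (h : Separated x (cnt ω.1) (seeds ω)) (hS : S ⊆ alive (cnt ω.1))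
    (hS' : ∀ k, some k ∈ alive (cnt ω.1) → some k ∈ S) (hn : none ∈ S → (bases ω.1 none).1 = x)
    {ψ : Measure (Point d A α)} (hψ : points ψ = node x (seeds ω) '' S) {σ : Finset (Label d)}
    (hσ : (σ : Set (Label d)) ⊆ S) [DecidableEq (Point d A α)] :
    Spans φ e ψ (σ.image (node x (seeds ω))) ↔
      σ ∈ (labelComplex α φ (field (code e χ ω))).faces := by
  classical
  have hinj : InjOn (node x (seeds ω)) (alive (cnt ω.1)) :=
    fun l hl l' hl' he ↦ h.loc_injOn hl hl' (congrArg loc he)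
  -- Positions in the model and in the point process differ by the shift `x`. For the additional
  -- label this requires its relative position to be `x`, as it has to land at the origin.
  have hvtx (j : ℕ) (hj : j ∈ Icc 1 α) (z : Fin (j + 1) → Label d) (hz : ∀ i, z i ∈ σ) :
      φ j (fun i ↦ vtx (field (code e χ ω)) (z i)) = φ j fun i ↦ loc (node x (seeds ω) (z i)) := by
    rw [← hφ.translation j hj (fun i ↦ (x i : ℝ)) fun i ↦ loc (node x (seeds ω) (z i))]
    congr 1
    ext1 i
    rw [loc_node]
    have hS1 := hσ (hz i)
    generalize z i = l at hS1
    refine Prod.ext (funext fun m ↦ ?_) rfl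
    rcases l with _ | k
    · have h1 : rel (field (code e χ ω)) none = x := hn hS1
      simp only [vtx, cellOf, h1, spot]
      simp
    · have h1 : rel (field (code e χ ω)) (some k) = (bases ω.1 (some k)).1 := rfl
      simp only [vtx, cellOf, h1, spot, Pi.add_apply]
      simp [seeds]
  have hkey (j : Icc 1 α) (z : Fin ((j : ℕ) + 1) → Label d) (hz : ∀ i, z i ∈ σ)
      (hm : StrictMono fun i ↦ clock (times ω) (z i)) :
      mark (node x (seeds ω) (z (Fin.last j))) j
        (fun i ↦ coords e ψ (node x (seeds ω) (z i.castSucc))) =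
      (field (code e χ ω) (Finset.univ.image z)).2 := by
    have hs : IsSorted (cnt ω.1) (times ω) (Finset.univ.image z) z :=
      ⟨hm, by congr!, fun i ↦ hS (hσ (hz i))⟩
    rw [code_unif hx h j hs]
    congr 1
    ext1 i
    obtain ⟨k, hk⟩ := Option.ne_none_iff_exists'.1 (hs.castSucc_ne_none i)
    rw [hk, coords_node h.1 h.2 hS hS' hψ (hk ▸ hs.2.2 _)]
    rfl
  have hcard : (σ.image (node x (seeds ω))).card = σ.card :=
    Finset.card_image_of_injOn (hinj.mono (hσ.trans hS))
  rw [Spans, hcard, Finset.image_nonempty]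
  simp only [labelComplex, markComplex, mem_ofPred_eq]
  refine and_congr_right fun _ ↦ ⟨fun hsp ↦ ⟨hsp.2.1, fun j hj z hz hzσ ↦ ?_⟩, fun hsp ↦
    ⟨?_, hsp.1, fun j z hz hm ↦ ?_⟩⟩
  -- The model tests all injective enumerations, the rule of the process only those by increasing
  -- time. Sorting and the symmetry of `φ` reduce the former to the latter.
  · let f : Fin (j + 1) → unitInterval := fun i ↦ clock (times ω) (z i)
    have hf : Function.Injective f := fun i i' he ↦ hz (h.1 (hS (hσ (hzσ i))) (hS (hσ (hzσ i'))) he)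
    have hm : StrictMono (f ∘ Tuple.sort f) :=
      (Tuple.monotone_sort f).strictMono_of_injective (hf.comp (Tuple.sort f).injective)
    have h1 := hsp.2.2 ⟨j, hj⟩ (fun i ↦ node x (seeds ω) (z (Tuple.sort f i)))
      (fun i ↦ Finset.mem_image_of_mem _ (hzσ _)) (by simp only [time_node]; exact hm)
    have h2 := hkey ⟨j, hj⟩ (fun i ↦ z (Tuple.sort f i)) (fun i ↦ hzσ _) hm
    have h3 : Finset.univ.image (fun i ↦ z (Tuple.sort f i)) = Finset.univ.image z := by
      ext l
      simp only [Finset.mem_image, Finset.mem_univ, true_and]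
      exact (Tuple.sort f).surjective.exists (p := fun i ↦ z i = l) |>.symm
    have h4 := hφ.symmetric j hj (Tuple.sort f) fun i ↦ loc (node x (seeds ω) (z i))
    rw [hvtx j hj z hzσ, ← h4]
    refine le_trans (le_of_eq ?_) (h1.trans (le_of_eq rfl))
    refine Eq.trans ?_ h2.symm
    rw [h3]
    congr!
  · rw [Finset.coe_image, hψ]
    exact image_mono hσ
  · choose z' hz' hzz using fun i ↦ Finset.mem_image.1 (hz i)
    obtain rfl : (fun i ↦ node x (seeds ω) (z' i)) = z := funext hzz
    have hm' : StrictMono fun i ↦ clock (times ω) (z' i) := by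
      simp only [time_node] at hm
      exact hm
    have h1 := hsp.2 j j.2 z' (fun i i' he ↦ hm'.injective (by simp only [he])) hz'
    rw [hvtx j j.2 z' hz'] at h1
    refine le_trans (le_of_eq ?_) h1
    rw [hkey j z' hz' hm']
    congr!

/-- In a separated configuration the locations of the present labels are distinct, so this is the
invariance of Betti numbers under injective maps of vertices. `S` contains the additional label or
not, according to whether the additional point belongs to `ψ`. -/
lemma betti_complexIn (hφ : IsConnection α φ) (hx : χ (bases ω.1) = x)
    (h : Separated x (cnt ω.1) (seeds ω)) (hS : S ⊆ alive (cnt ω.1))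
    (hS' : ∀ k, some k ∈ alive (cnt ω.1) → some k ∈ S) (hn : none ∈ S → (bases ω.1 none).1 = x)
    {ψ : Measure (Point d A α)} (hψ : points ψ = node x (seeds ω) '' S) (W : Set (Fin d → ℝ))
    (p : ℕ) : betti p (complexIn φ e ψ W) = betti p (restrict (labelComplex α φ
      (field (code e χ ω))) {l | l ∈ S ∧ spot x (bases ω.1) l ∈ W}) := by
  classical
  rw [← betti_map (f := fun l ↦ loc (node x (seeds ω) l)) (V := alive (cnt ω.1)) h.loc_injOn
    (fun σ hσ l hl ↦ hS (hσ.2 hl).1)]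
  congr 1
  apply PreAbstractSimplicialComplex.ext
  ext τ
  simp only [complexIn, restrict, complex, PreAbstractSimplicialComplex.map, mem_ofPred_eq,
    mem_image]
  constructor
  · rintro ⟨⟨T, hT, rfl⟩, hW⟩
    have hT2 : (T : Set (Point d A α)) ⊆ node x (seeds ω) '' S := hψ ▸ hT.2.1
    obtain ⟨σ, hσ, rfl⟩ := Finset.subset_set_image_iff.1 hT2
    have hT' : Spans φ e ψ (σ.image (node x (seeds ω))) := by convert hT
    refine ⟨σ, ⟨(spans_image_iff hφ hx h hS hS' hn hψ hσ).1 hT', fun l hl ↦ ⟨hσ hl, ?_⟩⟩, ?_⟩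
    · have := hW (Finset.mem_coe.2 (Finset.mem_image_of_mem _ (Finset.mem_image_of_mem _ hl)))
      rw [loc_node] at this
      exact this.1
    · ext v
      simp
  · rintro ⟨σ, ⟨hσ, hW⟩, rfl⟩
    have hσS : (σ : Set (Label d)) ⊆ S := fun l hl ↦ (hW hl).1
    refine ⟨⟨σ.image (node x (seeds ω)), ?_, ?_⟩, ?_⟩
    · exact (spans_image_iff hφ hx h hS hS' hn hψ hσS).2 hσ
    · ext v
      simp
    · intro v hv
      obtain ⟨l, hl, rfl⟩ := by simpa only [Finset.coe_image, mem_image] using hv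
      rw [loc_node]
      exact ⟨(hW hl).2, mem_univ _⟩

variable [MeasurableSingletonClass A]

lemma points_cloud : points (cloud x N s) = node x s '' {l | l ∈ alive N ∧ l ≠ none} := by
  ext q
  rw [points, mem_ofPred_eq, cloud, scatter_apply (measurableSet_singleton q)]
  simp only [ne_eq, ENat.toENNReal_eq_zero, encard_eq_zero, mem_singleton_iff, mem_image,
    mem_ofPred_eq]
  rw [← ne_eq, ← nonempty_iff_ne_empty]
  constructor
  · rintro ⟨k, h1, h2⟩
    exact ⟨some k, ⟨some_mem_alive.2 h1, by simp⟩, h2⟩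
  · rintro ⟨_ | k, ⟨h1, h3⟩, h2⟩
    · exact absurd rfl h3
    · exact ⟨k, some_mem_alive.1 h1, h2⟩

lemma points_add_dirac : points (cloud x N s + Measure.dirac (node x s none)) =
    node x s '' alive N := by
  have h1 : points (cloud x N s + Measure.dirac (node x s none)) =
      points (cloud x N s) ∪ {node x s none} := by
    ext q
    by_cases hq : q = node x s none
    · simp [points, hq]
    · have : node x s none ∉ ({q} : Set _) := fun h ↦ hq (mem_singleton_iff.1 h).symm
      rw [points, points, mem_union, mem_ofPred_eq, mem_ofPred_eq, Measure.add_apply,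
        Measure.dirac_apply' _ (measurableSet_singleton q), indicator_of_notMem this, add_zero,
        mem_singleton_iff, or_iff_left hq]
  rw [h1, points_cloud, ← image_singleton, ← image_union]
  congr 1
  ext l
  rcases l with _ | k <;> simp [none_mem_alive]

/-- The region of the model that belongs to a set when all positions are shifted by `-x`. -/
def regionAt (x : Fin d → unitInterval) (W : Set (Fin d → ℝ)) : Region d :=
  {c | (fun i ↦ (c.1 i : ℝ) + c.2 i - x i) ∈ W}

lemma betti_complexIn_cloud (hφ : IsConnection α φ) (hx : χ (bases ω.1) = x)
    (h : Separated x (cnt ω.1) (seeds ω)) (W : Set (Fin d → ℝ)) (p : ℕ) :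
    betti p (complexIn φ e (cloud x (cnt ω.1) (seeds ω)) W) =
      bettiIn α φ p (regionAt x W) (cnt ω.1) (field (code e χ ω)) := by
  rw [betti_complexIn (S := {l | l ∈ alive (cnt ω.1) ∧ l ≠ none}) hφ hx h (fun l hl ↦ hl.1) (fun k hk ↦ ⟨hk, by simp⟩) (fun h ↦ absurd rfl h.2)
    points_cloud, bettiIn]
  congr 2
  ext l
  rcases l with _ | ⟨c, j⟩
  · simp [none_notMem_verts]
  · rw [some_mem_verts, mem_ofPred_eq, mem_ofPred_eq, some_mem_alive]
    simp only [ne_eq, reduceCtorEq, not_false_eq_true, and_true]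
    rfl

/-- Both complexes in the difference operator belong to the configuration with the additional point.
Taking the origin out of the window removes exactly the label `none`, since no other point lies
there. -/
lemma diffOp_cloud (hφ : IsConnection α φ) (hx : χ (bases ω.1) = x) (hx' : (bases ω.1 none).1 = x)
    (h : Separated x (cnt ω.1) (seeds ω)) (W : Set (Fin d → ℝ)) (p : ℕ) :
    diffOp φ e (betti p) (node x (seeds ω) none) (cloud x (cnt ω.1) (seeds ω)) W =
      diffIn α φ p (regionAt x W) none (cnt ω.1) (field (code e χ ω)) := by
  have h0 : (cellOf (none : Label d), rel (field (code e χ ω)) none) ∈ regionAt x W ↔ 0 ∈ W := by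
    have h1 : rel (field (code e χ ω)) none = x := hx'
    have h2 : (fun i ↦ (((0 : Cell d) i : ℤ) : ℝ) + x i - x i) = 0 := by ext i; simp
    rw [h1, regionAt, mem_ofPred_eq]
    exact iff_of_eq (congrArg (· ∈ W) h2)
  rw [diffOp, betti_complexIn hφ hx h subset_rfl (fun _ ↦ id) (fun _ ↦ hx') points_add_dirac,
    betti_complexIn hφ hx h subset_rfl (fun _ ↦ id) (fun _ ↦ hx') points_add_dirac, diffIn]
  have h3 : {l | l ∈ alive (cnt ω.1) ∧ spot x (bases ω.1) l ∈ W \ {(node x (seeds ω) none).1}} =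
      verts (regionAt x W) (cnt ω.1) (field (code e χ ω)) := by
    ext l
    rcases l with _ | ⟨c, j⟩
    · rw [mem_ofPred_eq]
      exact iff_of_false (fun h ↦ h.2.2 rfl) none_notMem_verts
    · rw [some_mem_verts, mem_ofPred_eq, some_mem_alive]
      refine and_congr_right fun hj ↦ ⟨fun h' ↦ h'.1, fun h' ↦ ⟨h', fun h4 ↦ ?_⟩⟩
      cases h.2 (some_mem_alive.2 hj) none_mem_alive h4
  rw [h3]
  split_ifs with h4
  · rw [bettiDiff]
    congr 3
    ext l
    rcases l with _ | ⟨c, j⟩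
    · simp only [mem_ofPred_eq, mem_insert_iff, true_or, iff_true]
      exact ⟨none_mem_alive, h0.1 h4⟩
    · simp only [mem_ofPred_eq, mem_insert_iff, reduceCtorEq, false_or]
      rw [some_mem_verts, some_mem_alive]
      rfl
  · rw [sub_eq_zero]
    congr 2
    rw [← h3]
    ext l
    rw [mem_ofPred_eq, mem_ofPred_eq]
    refine and_congr_right fun hl ↦ ⟨fun h' ↦ ⟨h', fun h5 ↦ ?_⟩, fun h' ↦ h'.1⟩
    rw [h5] at h'
    exact h4 (h0.2 h')

end Identify

/-! ### Separated configurations -/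

section Simple

variable {d : ℕ} {A : Type*} [MeasurableSpace A] {α : ℕ}

/-- Counting measures whose points have distinct times and distinct positions, such that no point
has time `1` or lies at the origin. -/
def IsSimple (η : Measure (Point d A α)) : Prop :=
  (∀ q, η {q} ≤ 1) ∧ InjOn time (points η) ∧ InjOn Prod.fst (points η) ∧
    ∀ q ∈ points η, time q ≠ 1 ∧ q.1 ≠ 0

variable {x : Fin d → unitInterval} {N : Cell d → ℕ} {s : Label d → Seed d A α}

/-- Passes from a property of the labelling to one of the counting measure alone, which makes sense
for the process itself. The bound on the masses of singletons excludes two labels with the same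
point. -/
lemma isSimple_cloud_iff [MeasurableSingletonClass A] :
    IsSimple (cloud x N s) ↔ Separated x N s := by
  have hp {k : Cell d × ℕ} (hk : some k ∈ alive N) : node x s (some k) ∈ points (cloud x N s) := by
    rw [points_cloud]
    exact ⟨some k, ⟨hk, by simp⟩, rfl⟩
  constructor
  · rintro ⟨h1, h2, h3, h4⟩
    have hinj {k k' : Cell d × ℕ} (hk : some k ∈ alive N) (hk' : some k' ∈ alive N)
        (h : node x s (some k) = node x s (some k')) : some k = some k' := by
      have h5 := h1 (node x s (some k))
      rw [cloud, scatter_apply (measurableSet_singleton _), ← ENat.toENNReal_one,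
        ENat.toENNReal_le, encard_le_one_iff] at h5
      rw [h5 k k' ⟨some_mem_alive.1 hk, rfl⟩ ⟨some_mem_alive.1 hk', h.symm⟩]
    constructor
    · rintro (_ | k) hk (_ | k') hk' h
      · rfl
      · rw [← time_node (x := x), ← time_node (x := x)] at h
        exact absurd h.symm (h4 _ (hp hk')).1
      · rw [← time_node (x := x), ← time_node (x := x)] at h
        exact absurd h (h4 _ (hp hk)).1
      · rw [← time_node (x := x), ← time_node (x := x)] at h
        exact hinj hk hk' (h2 (hp hk) (hp hk') h)
    · rintro (_ | k) hk (_ | k') hk' h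
      · rfl
      · rw [← node_fst, ← node_fst] at h
        exact absurd h.symm (h4 _ (hp hk')).2
      · rw [← node_fst, ← node_fst] at h
        exact absurd h (h4 _ (hp hk)).2
      · rw [← node_fst, ← node_fst] at h
        exact hinj hk hk' (h3 (hp hk) (hp hk') h)
  · intro h
    refine ⟨fun q ↦ ?_, ?_, ?_, ?_⟩
    · rw [cloud, scatter_apply (measurableSet_singleton _), ← ENat.toENNReal_one,
        ENat.toENNReal_le, encard_le_one_iff]
      intro k k' hk hk'
      refine Option.some.inj (h.2 (some_mem_alive.2 hk.1) (some_mem_alive.2 hk'.1) ?_)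
      rw [← node_fst, ← node_fst]
      exact congrArg Prod.fst (hk.2.trans hk'.2.symm)
    all_goals rw [points_cloud]
    · rintro _ ⟨l, hl, rfl⟩ _ ⟨l', hl', rfl⟩ he
      rw [time_node, time_node] at he
      rw [h.1 hl.1 hl'.1 he]
    · rintro _ ⟨l, hl, rfl⟩ _ ⟨l', hl', rfl⟩ he
      rw [node_fst, node_fst] at he
      rw [h.2 hl.1 hl'.1 he]
    · rintro _ ⟨l, hl, rfl⟩
      rw [time_node, node_fst]
      exact ⟨fun he ↦ hl.2 (h.1 hl.1 none_mem_alive he), fun he ↦ hl.2 (h.2 hl.1 none_mem_alive he)⟩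

lemma measurableSet_separated {Ω : Type*} [MeasurableSpace Ω] {x : Ω → Fin d → unitInterval}
    {N : Ω → Cell d → ℕ} {s : Ω → Label d → Seed d A α} (hx : Measurable x) (hN : Measurable N)
    (hs : Measurable s) : MeasurableSet {ω | Separated (x ω) (N ω) (s ω)} :=
  (measurableSet_injOn_alive hN (measurable_clock (by fun_prop))).inter
    (measurableSet_injOn_alive hN (measurable_spot hx (by fun_prop)))

lemma infinitePi_eq_zero_of_update {ι Z : Type*} [MeasurableSpace Z] [DecidableEq ι]
    (ζ : Measure Z) [IsProbabilityMeasure ζ] {D : Set (ι → Z)} (hD : MeasurableSet D) (i : ι)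
    (h : ∀ s : ι → Z, ζ {z | Function.update s i z ∈ D} = 0) :
    Measure.infinitePi (fun _ ↦ ζ) D = 0 := by
  rw [← lintegral_indicator_one hD,
    lintegral_eq_update ζ (measurable_one.indicator hD) i, lintegral_eq_zero_iff']
  · refine Eventually.of_forall fun s ↦ ?_
    have h1 : (fun z ↦ D.indicator (1 : (ι → Z) → ℝ≥0∞) (Function.update s i z)) =
        {z | Function.update s i z ∈ D}.indicator 1 := rfl
    have h2 : MeasurableSet {z | Function.update s i z ∈ D} := measurable_update s hD
    change ∫⁻ z, D.indicator (1 : (ι → Z) → ℝ≥0∞) (Function.update s i z) ∂ζ = 0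
    rw [h1, lintegral_indicator_one h2, h s]
  · have : Measurable fun p : (ι → Z) × Z ↦
      D.indicator (1 : (ι → Z) → ℝ≥0∞) (Function.update p.1 i p.2) :=
      (measurable_one.indicator hD).comp measurable_update'
    exact this.lintegral_prod_right'.aemeasurable

lemma seedBase_time (Θ : Measure A) [IsProbabilityMeasure Θ] (c : unitInterval) :
    seedBase d α Θ {z | z.2.1 = c} = 0 := by
  have h := measurePreserving_fst (μ := (volume : Measure unitInterval)) (ν := marksLaw α) |>.comp
    (measurePreserving_snd (μ := (volume : Measure (Fin d → unitInterval)).prod Θ)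
      (ν := (volume : Measure unitInterval).prod (marksLaw α)))
  have h1 := h.measure_preimage (measurableSet_singleton c).nullMeasurableSet
  rw [measure_singleton] at h1
  exact h1

lemma seedBase_rel (Θ : Measure A) [IsProbabilityMeasure Θ] (i : Fin d) (a b : ℝ) :
    seedBase d α Θ {z | a + z.1.1 i = b} = 0 := by
  have h := (measurePreserving_eval (fun _ : Fin d ↦ (volume : Measure unitInterval)) i).comp
    ((measurePreserving_fst (μ := (volume : Measure (Fin d → unitInterval))) (ν := Θ)).comp
    (measurePreserving_fst (μ := (volume : Measure (Fin d → unitInterval)).prod Θ)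
      (ν := (volume : Measure unitInterval).prod (marksLaw α))))
  have h0 : ({t : unitInterval | a + t = b}).Subsingleton := fun t ht t' ht' ↦
    Subtype.ext (add_left_cancel (ht.trans ht'.symm))
  have h1 := h.measure_preimage h0.measurableSet.nullMeasurableSet
  rw [h0.measure_zero] at h1
  exact h1

/-- Almost all configurations are separated. -/
lemma ae_separated (hd : 1 ≤ d) (γ : ℝ≥0) (Θ : Measure A) [IsProbabilityMeasure Θ]
    (x : Fin d → unitInterval) :
    ∀ᵐ p ∂seedLaw d γ (seedBase d α Θ), Separated x p.1 p.2 := by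
  classical
  suffices h : ∀ᵐ s ∂Measure.infinitePi fun _ : Label d ↦ seedBase d α Θ, ∀ l l', l ≠ l' →
      clock (fun l ↦ (s l).2.1) l ≠ clock (fun l ↦ (s l).2.1) l' ∧
      spot x (fun l ↦ (s l).1) l ≠ spot x (fun l ↦ (s l).1) l' by
    have h' := (measurePreserving_snd (μ := Measure.infinitePi fun _ : Cell d ↦ poissonMeasure γ)
      (ν := Measure.infinitePi fun _ : Label d ↦ seedBase d α Θ)).quasiMeasurePreserving.ae h
    filter_upwards [h'] with p hp
    refine ⟨fun l _ l' _ he ↦ ?_, fun l _ l' _ he ↦ ?_⟩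
    · by_contra hne
      exact (hp l l' hne).1 he
    · by_contra hne
      exact (hp l l' hne).2 he
  have key (k : Cell d × ℕ) (l : Label d) (hl : l ≠ some k) :
      ∀ᵐ s ∂Measure.infinitePi fun _ : Label d ↦ seedBase d α Θ,
      clock (fun l ↦ (s l).2.1) (some k) ≠ clock (fun l ↦ (s l).2.1) l ∧
      spot x (fun l ↦ (s l).1) (some k) ≠ spot x (fun l ↦ (s l).1) l := by
    have hcl (l : Label d) : Measurable fun s : Label d → Seed d A α ↦ clock (fun l ↦ (s l).2.1) l :=
      measurable_clock (by fun_prop) l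
    have hsp (l : Label d) : Measurable fun s : Label d → Seed d A α ↦ spot x (fun l ↦ (s l).1) l :=
      measurable_spot measurable_const (by fun_prop) l
    rw [eventually_and]
    constructor
    · refine measure_eq_zero_iff_ae_notMem.1 (infinitePi_eq_zero_of_update (seedBase d α Θ)
        (D := {s | clock (fun l ↦ (s l).2.1) (some k) = clock (fun l ↦ (s l).2.1) l})
        (measurableSet_eq_fun (hcl _) (hcl _)) (some k) fun s ↦ ?_)
      refine measure_mono_null (fun z hz ↦ ?_) (seedBase_time Θ (clock (fun l ↦ (s l).2.1) l))
      have h1 : clock (fun l ↦ (Function.update s (some k) z l).2.1) l =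
          clock (fun l ↦ (s l).2.1) l := by
        rcases l with _ | k'
        · rfl
        · simp [clock, Function.update_of_ne hl]
      have h2 : clock (fun l ↦ (Function.update s (some k) z l).2.1) (some k) = z.2.1 := by
        simp [clock]
      exact h2.symm.trans (hz.trans h1)
    · refine measure_eq_zero_iff_ae_notMem.1 (infinitePi_eq_zero_of_update (seedBase d α Θ)
        (D := {s | spot x (fun l ↦ (s l).1) (some k) = spot x (fun l ↦ (s l).1) l})
        (measurableSet_eq_fun (hsp _) (hsp _)) (some k) fun s ↦ ?_)
      -- One coordinate suffices to distinguish positions; it exists because the dimension is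
      -- positive.
      let i : Fin d := ⟨0, hd⟩
      refine measure_mono_null (fun z hz ↦ ?_) (seedBase_rel Θ i (k.1 i)
        (spot x (fun l ↦ (s l).1) l i + x i))
      have h1 : spot x (fun l ↦ (Function.update s (some k) z l).1) l =
          spot x (fun l ↦ (s l).1) l := by
        rcases l with _ | k'
        · rfl
        · simp [spot, Function.update_of_ne hl]
      have h2 : spot x (fun l ↦ (Function.update s (some k) z l).1) (some k) i =
          k.1 i + z.1.1 i - x i := by
        simp [spot]
      have h3 := congrFun (show _ = _ from hz) i
      rw [h2, h1] at h3
      exact (sub_eq_iff_eq_add.1 h3)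
  have h1 (l l' : Label d) (hl : l ≠ l') : ∀ᵐ s ∂Measure.infinitePi fun _ : Label d ↦ seedBase d α Θ,
      clock (fun l ↦ (s l).2.1) l ≠ clock (fun l ↦ (s l).2.1) l' ∧
      spot x (fun l ↦ (s l).1) l ≠ spot x (fun l ↦ (s l).1) l' := by
    rcases l with _ | k
    · rcases l' with _ | k'
      · exact absurd rfl hl
      · filter_upwards [key k' none hl] with s hs
        exact ⟨hs.1.symm, hs.2.symm⟩
    · exact key k l' hl.symm
  simp only [ae_all_iff]
  exact fun l l' hl ↦ h1 l l' hl

end Simple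

/-! ### Transfer of laws -/

section Transfer

variable {d : ℕ} {A : Type*} [MeasurableSpace A] {α : ℕ}

/-- The points of a configuration as an element of the space of counting measures. -/
def cloudPoint (x : Fin d → unitInterval) (N : Cell d → ℕ) (s : Label d → Seed d A α) :
    PointMeasure d (A × unitInterval × Marks α) :=
  ⟨cloud x N s, isLocallyFiniteCounting_cloud x N s⟩

lemma measurable_cloudPoint {Ω : Type*} [MeasurableSpace Ω] {x : Ω → Fin d → unitInterval}
    {N : Ω → Cell d → ℕ} {s : Ω → Label d → Seed d A α} (hx : Measurable x) (hN : Measurable N)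
    (hs : Measurable s) : Measurable fun ω ↦ cloudPoint (x ω) (N ω) (s ω) :=
  (measurable_cloud hx hN hs).subtype_mk

omit [MeasurableSpace A] in
lemma exists_ext (N : Cell d → ℕ) (s : Label d → Seed d A α) :
    ∃ ω : Ext d A α, cnt ω.1 = N ∧ seeds ω = s := by
  classical
  refine ⟨(fun
    | .inl c => (N c, ((s none).1, 0))
    | .inr ρ => (0, ((if h : ∃ l, ρ = {l} then (s h.choose).1 else (s none).1), 0)),
    fun l ↦ (s l).2), rfl, ?_⟩
  ext1 l
  have h : ∃ l', ({l} : Finset (Label d)) = {l'} := ⟨l, rfl⟩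
  refine Prod.ext ?_ rfl
  change (if h : ∃ l', ({l} : Finset (Label d)) = {l'} then (s h.choose).1 else (s none).1) = (s l).1
  rw [dif_pos h, ← Finset.singleton_injective h.choose_spec]

lemma cloudPoint_congr {x : Fin d → unitInterval} {N : Cell d → ℕ} {s s' : Label d → Seed d A α}
    (h : ∀ k, s' (some k) = s (some k)) : cloudPoint x N s' = cloudPoint x N s := by
  simp only [cloudPoint, cloud, h]

lemma exists_ext_cloudPoint [StandardBorelSpace A] (x : Fin d → unitInterval)
    (η : PointMeasure d (A × unitInterval × Marks α)) (a : A) (u : Marks α) :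
    ∃ ω : Ext d A α, cloudPoint x (cnt ω.1) (seeds ω) = η ∧ (bases ω.1 none).2 = a ∧
      (ω.2 none).2 = u := by
  have : Nonempty A := ⟨a⟩
  obtain ⟨N, s, hs⟩ := exists_cloud_eq x η.2
  let t : Label d → Seed d A α
    | none => ((x, a), 0, u)
    | some k => s k
  obtain ⟨ω, h1, h2⟩ := exists_ext N t
  have h3 : ((bases ω.1 none, ω.2 none) : Seed d A α) = ((x, a), 0, u) := congrFun h2 none
  refine ⟨ω, Subtype.ext ?_, (congrArg (fun z : Seed d A α ↦ z.1.2) h3 :),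
    (congrArg (fun z : Seed d A α ↦ z.2.2) h3 :)⟩
  rw [h1, h2]
  exact hs t fun k ↦ rfl

lemma map_subtype_mk_eq {Ω Ω' Y : Type*} [MeasurableSpace Ω] [MeasurableSpace Ω'] [MeasurableSpace Y]
    {S : Set Y} {P : Measure Ω} {Q : Measure Ω'} {f : Ω → S} {g : Ω' → S} (hf : Measurable f)
    (hg : Measurable g) (h : P.map (fun ω ↦ (f ω : Y)) = Q.map fun ω ↦ (g ω : Y)) :
    P.map f = Q.map g := by
  refine Measure.ext fun t ht ↦ ?_
  obtain ⟨T, hT, rfl⟩ := ht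
  have h1 := DFunLike.congr_fun h T
  rw [Measure.map_apply hf.subtype_val hT, Measure.map_apply hg.subtype_val hT] at h1
  rw [Measure.map_apply hf (measurable_subtype_coe hT), Measure.map_apply hg (measurable_subtype_coe hT)]
  exact h1

lemma measurable_seeds : Measurable fun ω : Ext d A α ↦ seeds ω := by
  unfold seeds bases field; fun_prop

lemma measurable_cnt_fst : Measurable fun ω : Ext d A α ↦ cnt ω.1 := by
  unfold cnt; fun_prop

lemma measurable_bases_fst : Measurable fun ω : Ext d A α ↦ bases ω.1 := by
  unfold bases field; fun_prop

variable {Ω : Type*} [MeasurableSpace Ω] {P : Measure Ω} [IsProbabilityMeasure P] {γ : ℝ≥0}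
  {Θ : Measure A} [IsProbabilityMeasure Θ] {Ψ : Ω → Measure (Point d A α)}

/-- The law of the Poisson process as the law of the points of a configuration. -/
lemma map_process_eq (hΨ : IsPoissonProcess Ψ (intensity d α γ Θ) P) (x : Fin d → unitInterval) :
    P.map (fun ω ↦ (⟨Ψ ω, hΨ.counting ω⟩ : PointMeasure d (A × unitInterval × Marks α))) =
      (seedLaw d γ (seedBase d α Θ)).map fun p ↦ cloudPoint x p.1 p.2 :=
  map_subtype_mk_eq hΨ.measurable.subtype_mk
    (measurable_cloudPoint measurable_const measurable_fst measurable_snd) (map_eq_map_cloud hΨ x)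

lemma map_process_eq_extLaw (hΨ : IsPoissonProcess Ψ (intensity d α γ Θ) P)
    (x : Fin d → unitInterval) :
    P.map (fun ω ↦ (⟨Ψ ω, hΨ.counting ω⟩ : PointMeasure d (A × unitInterval × Marks α))) =
      (extLaw d α γ Θ).map fun ω ↦ cloudPoint x (cnt ω.1) (seeds ω) := by
  rw [map_process_eq hΨ x, ← (measurePreserving_seeds γ Θ).map_eq, Measure.map_map
    (measurable_cloudPoint measurable_const measurable_fst measurable_snd)
    (measurePreserving_seeds γ Θ).measurable]
  rfl

/-- The joint law of the Poisson process and the marks of the additional point. -/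
lemma map_process_prod_eq (hΨ : IsPoissonProcess Ψ (intensity d α γ Θ) P)
    {V : Ω → A} (hV : Measurable V) (hVΘ : P.map V = Θ)
    {U : Ω → Marks α} (hU : Measurable U) (hUQ : P.map U = marksLaw α)
    (hVU : IndepFun V U P) (hVUΨ : IndepFun (fun ω ↦ (V ω, U ω)) Ψ P) :
    P.map (fun ω ↦ ((V ω, U ω),
      (⟨Ψ ω, hΨ.counting ω⟩ : PointMeasure d (A × unitInterval × Marks α)))) =
      (extLaw d α γ Θ).map fun ω ↦ (((bases ω.1 none).2, (ω.2 none).2),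
        cloudPoint (bases ω.1 none).1 (cnt ω.1) (seeds ω)) := by
  classical
  have hVU' : P.map (fun ω ↦ (V ω, U ω)) = Θ.prod (marksLaw α) := by
    rw [(indepFun_iff_map_prod_eq_prod_map_map hV.aemeasurable hU.aemeasurable).1 hVU, hVΘ, hUQ]
  have hΨm : Measurable fun ω ↦
      (⟨Ψ ω, hΨ.counting ω⟩ : PointMeasure d (A × unitInterval × Marks α)) :=
    hΨ.measurable.subtype_mk
  have hind : IndepFun (fun ω ↦ (V ω, U ω))
      (fun ω ↦ (⟨Ψ ω, hΨ.counting ω⟩ : PointMeasure d (A × unitInterval × Marks α))) P := by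
    rw [indepFun_iff_measure_inter_preimage_eq_mul] at hVUΨ ⊢
    rintro s _ hs ⟨T, hT, rfl⟩
    exact hVUΨ s T hs hT
  rw [(indepFun_iff_map_prod_eq_prod_map_map (hV.prodMk hU).aemeasurable
    hΨm.aemeasurable).1 hind, hVU']
  have hpost : Measurable fun z : Seed d A α ↦ (z.1.2, z.2.2) := by fun_prop
  have h1 : MeasurePreserving (fun z : Seed d A α ↦ (z.1.2, z.2.2)) (seedBase d α Θ)
      (Θ.prod (marksLaw α)) :=
    (measurePreserving_snd (μ := (volume : Measure (Fin d → unitInterval))) (ν := Θ)).prod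
      (measurePreserving_snd (μ := (volume : Measure unitInterval)) (ν := marksLaw α))
  let G : Seed d A α → (Cell d → ℕ) × (Label d → Seed d A α) →
      PointMeasure d (A × unitInterval × Marks α) := fun z p ↦ cloudPoint z.1.1 p.1 p.2
  have hG : Measurable (Function.uncurry G) :=
    measurable_cloudPoint (x := fun y : Seed d A α × (Cell d → ℕ) × (Label d → Seed d A α) ↦ y.1.1.1)
      (by fun_prop) (by fun_prop) (by fun_prop)
  -- The law of the cloud is the same for every shift. Hence the shift may be the random relative
  -- position of the additional point, and the cloud stays independent of the marks of that point.
  have h2 := h1.skew_product (μc := seedLaw d γ (seedBase d α Θ)) hG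
    (Eventually.of_forall fun z ↦ (map_process_eq hΨ z.1.1).symm)
  have h3 : MeasurePreserving (fun q : (Cell d → ℕ) × (Label d → Seed d A α) × Seed d A α ↦
      (q.2.2, (q.1, q.2.1))) ((Measure.infinitePi fun _ : Cell d ↦ poissonMeasure γ).prod
        ((Measure.infinitePi fun _ : Label d ↦ seedBase d α Θ).prod (seedBase d α Θ)))
      ((seedBase d α Θ).prod (seedLaw d γ (seedBase d α Θ))) :=
    (Measure.measurePreserving_swap).comp (measurePreserving_prodAssoc _ _ _).symm
  -- Resampling the seed of the additional label changes neither the law of the seeds nor, for a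
  -- given shift, the cloud.
  have h4 := (MeasurePreserving.id (Measure.infinitePi fun _ : Cell d ↦ poissonMeasure γ)).prod
    (measurePreserving_update (seedBase d α Θ) (none : Label d))
  have h5 : Measurable fun p : (Cell d → ℕ) × (Label d → Seed d A α) ↦
      ((((p.2 none).1.2, (p.2 none).2.2), cloudPoint (p.2 none).1.1 p.1 p.2) :
        (A × Marks α) × PointMeasure d (A × unitInterval × Marks α)) :=
    Measurable.prodMk (by fun_prop) (measurable_cloudPoint (by fun_prop) (by fun_prop) (by fun_prop))
  have h6 : (extLaw d α γ Θ).map (fun ω ↦ (((bases ω.1 none).2, (ω.2 none).2),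
        cloudPoint (bases ω.1 none).1 (cnt ω.1) (seeds ω))) = (seedLaw d γ (seedBase d α Θ)).map
      fun p ↦ (((p.2 none).1.2, (p.2 none).2.2), cloudPoint (p.2 none).1.1 p.1 p.2) := by
    rw [← (measurePreserving_seeds γ Θ).map_eq, Measure.map_map h5
      (measurePreserving_seeds γ Θ).measurable]
    rfl
  rw [h6, seedLaw, ← h4.map_eq, Measure.map_map h5 h4.measurable, ← (h2.comp h3).map_eq]
  congr 1

end Transfer

/-! ### Identities in law between the complex of the Poisson process and the model. -/

section Transfer

variable {d : ℕ} {A : Type*} [MeasurableSpace A] {α : ℕ}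
  {φ : (j : ℕ) → (Fin (j + 1) → (Fin d → ℝ) × A) → unitInterval} {e : ℕ ≃ (Fin d → ℤ)}

lemma identDistrib_of_map_eq {Ω Ω' Y β : Type*} [MeasurableSpace Ω] [MeasurableSpace Ω']
    [MeasurableSpace Y] [MeasurableSpace β] {P : Measure Ω} {Q : Measure Ω'} {f : Ω → Y} {g : Ω' → Y}
    (hf : Measurable f) (hg : Measurable g) (h : P.map f = Q.map g) {F : Y → β} (hF : Measurable F)
    {a : Ω → β} {b : Ω' → β} (ha : a =ᵐ[P] F ∘ f) (hb : b =ᵐ[Q] F ∘ g) : IdentDistrib a b P Q where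
  aemeasurable_fst := (hF.comp hf).aemeasurable.congr ha.symm
  aemeasurable_snd := (hF.comp hg).aemeasurable.congr hb.symm
  map_eq := by
    rw [Measure.map_congr ha, Measure.map_congr hb, ← Measure.map_map hF hf, h,
      Measure.map_map hF hg]

instance [StandardBorelSpace A] : StandardBorelSpace (Ext d A α) := by
  have h1 : StandardBorelSpace unitInterval := inferInstance
  have h2 : StandardBorelSpace (Datum d A) := inferInstance
  have h3 : StandardBorelSpace (Config d A) := inferInstance
  have h4 : StandardBorelSpace (Marks α) := inferInstance
  infer_instance

/-- Every counting measure is the cloud of an extended configuration, and a function on a countably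
separated space is measurable if it is so after composition with a measurable surjection from a
standard Borel space. Functionals of counting measures need no direct analysis. -/
lemma measurable_of_comp_cloudPoint [StandardBorelSpace A] [Nonempty A] {β : Type*}
    [MeasurableSpace β] {F : PointMeasure d (A × unitInterval × Marks α) → β}
    (h : Measurable fun ω : Ext d A α ↦ F (cloudPoint 0 (cnt ω.1) (seeds ω))) : Measurable F := by
  refine (Measurable.measurable_comp_iff_of_surjective (X := Ext d A α)
    (f := fun ω ↦ cloudPoint 0 (cnt ω.1) (seeds ω))
    (measurable_cloudPoint measurable_const measurable_cnt_fst measurable_seeds) fun η ↦ ?_).1 h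
  obtain ⟨ω, hω, -⟩ := exists_ext_cloudPoint 0 η (Classical.arbitrary A) fun _ _ ↦ 0
  exact ⟨ω, hω⟩

lemma countablySeparated_prod {X Y : Type*} [MeasurableSpace X] [MeasurableSpace Y] [MeasurableSpace.CountablySeparated X]
    [MeasurableSpace.CountablySeparated Y] : MeasurableSpace.CountablySeparated (X × Y) := by
  obtain ⟨S, hS, hSm, h⟩ := (MeasurableSpace.hasCountableSeparatingOn_of_countablySeparated (α := X)).1
  obtain ⟨T, hT, hTm, h'⟩ :=
    (MeasurableSpace.hasCountableSeparatingOn_of_countablySeparated (α := Y)).1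
  refine ⟨⟨(fun s ↦ Prod.fst ⁻¹' s) '' S ∪ (fun s ↦ Prod.snd ⁻¹' s) '' T,
    (hS.image _).union (hT.image _), ?_, fun x _ y _ hxy ↦ Prod.ext ?_ ?_⟩⟩
  · rintro _ (⟨s, hs, rfl⟩ | ⟨s, hs, rfl⟩)
    exacts [measurable_fst (hSm s hs), measurable_snd (hTm s hs)]
  · exact h _ (mem_univ _) _ (mem_univ _) fun s hs ↦ hxy _ (Or.inl (mem_image_of_mem _ hs))
  · exact h' _ (mem_univ _) _ (mem_univ _) fun s hs ↦ hxy _ (Or.inr (mem_image_of_mem _ hs))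

lemma measurable_of_comp_mark_cloudPoint [StandardBorelSpace A] {β : Type*}
    [MeasurableSpace β] {F : (A × Marks α) × PointMeasure d (A × unitInterval × Marks α) → β}
    (h : Measurable fun ω : Ext d A α ↦ F (((bases ω.1 none).2, (ω.2 none).2),
      cloudPoint 0 (cnt ω.1) (seeds ω))) : Measurable F := by
  have h1 : StandardBorelSpace (Marks α) := inferInstance
  have h2 : StandardBorelSpace (A × Marks α) := inferInstance
  have h3 : MeasurableSpace.CountablySeparated (PointMeasure d (A × unitInterval × Marks α)) :=
    inferInstance
  have h4 := countablySeparated_prod (X := A × Marks α)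
    (Y := PointMeasure d (A × unitInterval × Marks α))
  refine (Measurable.measurable_comp_iff_of_surjective (X := Ext d A α)
    (f := fun ω ↦ (((bases ω.1 none).2, (ω.2 none).2), cloudPoint 0 (cnt ω.1) (seeds ω)))
    (Measurable.prodMk ?_
      (measurable_cloudPoint measurable_const measurable_cnt_fst measurable_seeds)) ?_).1 h
  · have := measurable_bases_fst (d := d) (A := A) (α := α)
    fun_prop
  · rintro ⟨⟨a, u⟩, η⟩
    obtain ⟨ω, h1, h2, h3⟩ := exists_ext_cloudPoint 0 η a u
    exact ⟨ω, by simp only [h1, h2, h3]⟩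

lemma measurableSet_isSimple [StandardBorelSpace A] [Nonempty A] :
    MeasurableSet {η : PointMeasure d (A × unitInterval × Marks α) | IsSimple η.1} := by
  have h : Measurable fun η : PointMeasure d (A × unitInterval × Marks α) ↦ IsSimple η.1 := by
    refine measurable_of_comp_cloudPoint (measurableSet_setOfPred.1 ?_)
    have h1 := measurableSet_separated (Ω := Ext d A α) (x := fun _ ↦ 0) measurable_const
      measurable_cnt_fst measurable_seeds
    simpa only [cloudPoint, isSimple_cloud_iff] using h1
  exact measurableSet_setOfPred.2 h

variable {Ω : Type*} [MeasurableSpace Ω] {P : Measure Ω} [IsProbabilityMeasure P] {γ : ℝ≥0}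
  {Θ : Measure A} [IsProbabilityMeasure Θ] {Ψ : Ω → Measure (Point d A α)}

lemma ae_separated_extLaw (hd : 1 ≤ d) :
    ∀ᵐ ω ∂extLaw d α γ Θ, Separated 0 (cnt ω.1) (seeds ω) :=
  (measurePreserving_seeds γ Θ).quasiMeasurePreserving.ae (ae_separated hd γ Θ 0)

variable [StandardBorelSpace A]

lemma ae_isSimple (hd : 1 ≤ d) (hΨ : IsPoissonProcess Ψ (intensity d α γ Θ) P) :
    ∀ᵐ ω ∂P, IsSimple (Ψ ω) := by
  have : Nonempty A := nonempty_of_isProbabilityMeasure Θ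
  have h1 := map_process_eq_extLaw hΨ 0
  have h2 := ae_map_iff (μ := P) (f := fun ω ↦ (⟨Ψ ω, hΨ.counting ω⟩ :
    PointMeasure d (A × unitInterval × Marks α))) hΨ.measurable.subtype_mk.aemeasurable
    (measurableSet_isSimple (d := d) (A := A) (α := α))
  refine h2.1 ?_
  rw [h1, ae_map_iff (measurable_cloudPoint measurable_const measurable_cnt_fst
    measurable_seeds).aemeasurable measurableSet_isSimple]
  filter_upwards [ae_separated_extLaw hd] with ω hω
  exact isSimple_cloud_iff.2 hω

open Classical in
/-- The Betti number of the complex of the Poisson process has the law of the Betti number of the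
complex of the model. -/
theorem identDistrib_betti (hd : 1 ≤ d) (hφ : IsConnection α φ)
    (hΨ : IsPoissonProcess Ψ (intensity d α γ Θ) P) {W : Set (Fin d → ℝ)} (hW : MeasurableSet W)
    (hWc : (cells (regionOf W)).Finite) (p : ℕ) :
    IdentDistrib (fun ω ↦ betti p (complexIn φ e (Ψ ω) W))
      (fun ω ↦ bettiIn α φ p (regionOf W) (cnt ω) (field ω)) P (configLaw d γ Θ) := by
  have : Nonempty A := nonempty_of_isProbabilityMeasure Θ
  have hreg : regionAt 0 W = regionOf W := by
    ext z; simp [regionAt, regionOf]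
  have hcode := measurePreserving_code (α := α) γ Θ e (χ := fun _ ↦ 0) measurable_const
  have hbm := measurable_bettiIn (p := p) hφ (measurableSet_regionOf hW) hWc
    (measurable_cnt (d := d) (A := A)) measurable_field
  -- The complex is identified with that of the model only for simple measures, so `F` is set to
  -- zero elsewhere; this affects a null set.
  let F : PointMeasure d (A × unitInterval × Marks α) → ℝ := fun η ↦
    if IsSimple η.1 then betti p (complexIn φ e η.1 W) else 0
  have hF' (ω : Ext d A α) : F (cloudPoint 0 (cnt ω.1) (seeds ω)) =
      if Separated 0 (cnt ω.1) (seeds ω) then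
        bettiIn α φ p (regionOf W) (cnt (code e (fun _ ↦ 0) ω)) (field (code e (fun _ ↦ 0) ω))
      else 0 := by
    simp only [F, cloudPoint, isSimple_cloud_iff]
    refine if_ctx_congr Iff.rfl (fun h ↦ ?_) fun _ ↦ rfl
    rw [betti_complexIn_cloud (χ := fun _ ↦ 0) hφ rfl h, hreg]
    rfl
  have hF : Measurable F := by
    refine measurable_of_comp_cloudPoint ?_
    simp only [hF']
    exact Measurable.ite (measurableSet_separated measurable_const measurable_cnt_fst
      measurable_seeds) (hbm.comp hcode.measurable) measurable_const
  refine (identDistrib_of_map_eq (Q := extLaw d α γ Θ) (b := fun ω ↦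
    bettiIn α φ p (regionOf W) (cnt (code e (fun _ ↦ 0) ω)) (field (code e (fun _ ↦ 0) ω)))
    hΨ.measurable.subtype_mk (measurable_cloudPoint measurable_const
    measurable_cnt_fst measurable_seeds) (map_process_eq_extLaw hΨ 0) hF ?_ ?_).trans ?_
  · filter_upwards [ae_isSimple hd hΨ] with ω hω
    exact (if_pos hω).symm
  · filter_upwards [ae_separated_extLaw hd] with ω hω
    simp only [Function.comp, hF', if_pos hω]
  · refine ⟨(hbm.comp hcode.measurable).aemeasurable, hbm.aemeasurable, ?_⟩
    have h1 := Measure.map_map (μ := extLaw d α γ Θ) hbm hcode.measurable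
    rw [hcode.map_eq] at h1
    exact h1.symm

/-- The origin shift of the model. -/
abbrev originShift (r : Label d → (Fin d → unitInterval) × A) : Fin d → unitInterval := (r none).1

omit [StandardBorelSpace A] in
lemma measurable_originShift : Measurable (originShift (d := d) (A := A)) := by
  unfold originShift; fun_prop

open Classical in
/-- The sequence of the differences at the origin has the law of the sequence of the differences
in the model. -/
theorem identDistrib_originDiff (hd : 1 ≤ d) (hφ : IsConnection α φ)
    (hΨ : IsPoissonProcess Ψ (intensity d α γ Θ) P)
    {V : Ω → A} (hV : Measurable V) (hVΘ : P.map V = Θ)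
    {U : Ω → Marks α} (hU : Measurable U) (hUQ : P.map U = marksLaw α)
    (hVU : IndepFun V U P) (hVUΨ : IndepFun (fun ω ↦ (V ω, U ω)) Ψ P)
    {W : ℕ → Set (Fin d → ℝ)} (hW : ∀ n, MeasurableSet (W n))
    (hWc : ∀ n, (cells (regionOf (W n))).Finite) (p : ℕ) :
    IdentDistrib (fun ω n ↦ originDiff φ e Ψ V U (betti p) (W n) ω)
      (fun (ω : Ext d A α) n ↦ diffIn α φ p (regionAt (bases ω.1 none).1 (W n)) none
        (cnt (code e originShift ω)) (field (code e originShift ω))) P (extLaw d α γ Θ) := by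
  have : Nonempty A := nonempty_of_isProbabilityMeasure Θ
  have hreg (n) : regionAt 0 (W n) = regionOf (W n) := by
    ext z; simp [regionAt, regionOf]
  let F : (A × Marks α) × PointMeasure d (A × unitInterval × Marks α) → ℕ → ℝ := fun y n ↦
    if IsSimple y.2.1 then diffOp φ e (betti p) (0, y.1.1, 1, y.1.2) y.2.1 (W n) else 0
  -- For measurability the clouds are taken with shift `0`, whereas `diffOp_cloud` requires the
  -- relative position of the additional point to equal the shift. Resetting this position to `0`
  -- leaves the points and the marks unchanged.
  let reset : Ext d A α → Ext d A α := fun ω ↦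
    (Function.update ω.1 (.inr {none}) ((ω.1 (.inr {none})).1,
      ((0, (ω.1 (.inr {none})).2.1.2), (ω.1 (.inr {none})).2.2)), ω.2)
  have hresetm : Measurable reset := by
    have h1 : Measurable fun ω : Ext d A α ↦ ((ω.1, ((ω.1 (.inr {none})).1,
      ((0, (ω.1 (.inr {none})).2.1.2), (ω.1 (.inr {none})).2.2))) :
        Config d A × (ℕ × Datum d A)) := by fun_prop
    exact (measurable_update'.comp h1).prodMk measurable_snd
  have hreset (ω : Ext d A α) : cnt (reset ω).1 = cnt ω.1 ∧ bases (reset ω).1 none =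
      (0, (bases ω.1 none).2) ∧ (reset ω).2 = ω.2 ∧
      ∀ k, seeds (reset ω) (some k) = seeds ω (some k) := by
    refine ⟨?_, ?_, rfl, fun k ↦ ?_⟩
    · ext c
      simp [cnt, reset]
    · simp [bases, field, reset]
    · simp [seeds, bases, field, reset]
  have hF' (ω : Ext d A α) (n : ℕ) : F (((bases ω.1 none).2, (ω.2 none).2),
      cloudPoint 0 (cnt ω.1) (seeds ω)) n =
      if Separated 0 (cnt (reset ω).1) (seeds (reset ω)) then
        diffIn α φ p (regionOf (W n)) none (cnt (code e (fun _ ↦ 0) (reset ω)))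
          (field (code e (fun _ ↦ 0) (reset ω))) else 0 := by
    obtain ⟨h1, h2, h3, h4⟩ := hreset ω
    have h5 : cloudPoint 0 (cnt ω.1) (seeds ω) = cloudPoint 0 (cnt (reset ω).1) (seeds (reset ω)) := by
      rw [h1, cloudPoint_congr h4]
    rw [h5, ← h3]
    have h6 : (bases ω.1 none).2 = (bases (reset ω).1 none).2 := by rw [h2]
    rw [h6]
    simp only [F, cloudPoint, isSimple_cloud_iff]
    refine if_ctx_congr Iff.rfl (fun h ↦ ?_) fun _ ↦ rfl
    have h7 := diffOp_cloud (e := e) (χ := fun _ ↦ 0) hφ rfl (by rw [h2]) h (W n) p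
    rw [hreg] at h7
    exact h7
  have hF : Measurable F := by
    refine measurable_of_comp_mark_cloudPoint (measurable_pi_lambda _ fun n ↦ ?_)
    simp only [hF']
    have hcode := measurePreserving_code (α := α) γ Θ e (χ := fun _ ↦ 0) measurable_const
    have hdm := measurable_diffIn (p := p) hφ (measurableSet_regionOf (hW n)) (hWc n)
      (measurable_cnt (d := d) (A := A)) measurable_field none
    exact Measurable.ite (measurableSet_separated measurable_const
      (measurable_cnt_fst.comp hresetm) (measurable_seeds.comp hresetm))
      ((hdm.comp hcode.measurable).comp hresetm) measurable_const
  have hb := measurable_bases_fst (d := d) (A := A) (α := α)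
  have hg : Measurable fun ω : Ext d A α ↦ (((bases ω.1 none).2, (ω.2 none).2),
      cloudPoint (bases ω.1 none).1 (cnt ω.1) (seeds ω)) :=
    Measurable.prodMk (by fun_prop) (measurable_cloudPoint (by fun_prop) measurable_cnt_fst
      measurable_seeds)
  have hf : Measurable fun ω ↦ ((V ω, U ω),
      (⟨Ψ ω, hΨ.counting ω⟩ : PointMeasure d (A × unitInterval × Marks α))) :=
    (hV.prodMk hU).prodMk hΨ.measurable.subtype_mk
  have hmap := map_process_prod_eq hΨ hV hVΘ hU hUQ hVU hVUΨ
  have hsimple : ∀ᵐ ω ∂extLaw d α γ Θ, Separated (bases ω.1 none).1 (cnt ω.1) (seeds ω) := by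
    have hS : MeasurableSet {y : (A × Marks α) × PointMeasure d (A × unitInterval × Marks α) |
      IsSimple y.2.1} := measurable_snd measurableSet_isSimple
    have h1 := (ae_map_iff (μ := P) hf.aemeasurable hS).2 (ae_isSimple hd hΨ)
    rw [hmap, ae_map_iff hg.aemeasurable hS] at h1
    filter_upwards [h1] with ω hω
    exact isSimple_cloud_iff.1 hω
  -- The equality of laws is joint in `n`, so almost sure statements about whole sequences can be
  -- transferred.
  refine identDistrib_of_map_eq hf hg hmap hF ?_ ?_
  · filter_upwards [ae_isSimple hd hΨ] with ω hω
    ext1 n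
    exact (if_pos hω).symm
  · filter_upwards [hsimple] with ω hω
    ext1 n
    refine Eq.trans ?_ (if_pos (isSimple_cloud_iff.2 hω)).symm
    exact (diffOp_cloud (χ := originShift) hφ rfl rfl hω (W n) p).symm

end Transfer

/-! ### Cubes -/

section Cubes

variable {d : ℕ}

lemma IsCube.exists_data {W : Set (Fin d → ℝ)} (hW : IsCube W) :
    ∃ c : CubeData d, W = cube c.1.1 c.1.2 := by
  obtain ⟨x, s, hs, rfl⟩ := hW
  exact ⟨⟨(x, s), hs⟩, rfl⟩

lemma regionAt_cube (x : Fin d → unitInterval) (y : Fin d → ℝ) (s : ℝ) :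
    regionAt x (cube y s) = regionOf (cube (fun i ↦ y i + x i) s) := by
  ext z
  simp only [regionAt, regionOf, cube, mem_ofPred_eq]
  refine forall_congr' fun i ↦ and_congr ?_ ?_ <;> constructor <;> intro h <;> linarith

lemma finite_cells_regionAt (x : Fin d → unitInterval) {W : Set (Fin d → ℝ)} (hW : IsCube W) :
    (cells (regionAt x W)).Finite := by
  obtain ⟨c, rfl⟩ := hW.exists_data
  rw [regionAt_cube]
  exact (Finset.finite_toSet _).subset (cells_regionOf_cube _ _)

lemma finite_cells_regionOf {W : Set (Fin d → ℝ)} (hW : IsCube W) :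
    (cells (regionOf W)).Finite := by
  obtain ⟨c, rfl⟩ := hW.exists_data
  exact (Finset.finite_toSet _).subset (cells_regionOf_cube _ _)

lemma IsCube.measurableSet {W : Set (Fin d → ℝ)} (hW : IsCube W) : MeasurableSet W := by
  obtain ⟨c, rfl⟩ := hW.exists_data
  exact measurableSet_cube _ _

lemma CubesTendTo.exists_boxRegion_subset {W : ℕ → Set (Fin d → ℝ)} (hW : CubesTendTo W) (R : ℕ) :
    ∃ N, ∀ n ≥ N, ∀ x : Fin d → unitInterval, boxRegion d R ⊆ regionAt x (W n) := by
  obtain ⟨N, hN⟩ := hW.2 (Icc (fun _ ↦ -((R : ℝ) + 1)) fun _ ↦ (R : ℝ) + 1) (Metric.isBounded_Icc _ _)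
  refine ⟨N, fun n hn x z hz ↦ hN n hn ?_⟩
  have h1 (i) : |(z.1 i : ℝ)| ≤ R := by exact_mod_cast mem_cellBox.1 hz i
  have h2 (i) := abs_le.1 (h1 i)
  refine ⟨fun i ↦ ?_, fun i ↦ ?_⟩ <;> have h3 := h2 i <;> have h4 := (z.2 i).2.1 <;>
    have h5 := (z.2 i).2.2 <;> have h6 := (x i).2.1 <;> have h7 := (x i).2.2 <;> dsimp only <;>
    linarith

lemma CubesTendTo.exists_data (hd : 1 ≤ d) {W : ℕ → Set (Fin d → ℝ)} (hW : CubesTendTo W) :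
    ∃ c : ℕ → CubeData d, (∀ n, W n = cube (c n).1.1 (c n).1.2) ∧ Tendsto c atTop (largeCubes d) := by
  choose c hc using fun n ↦ (hW.1 n).exists_data
  refine ⟨c, hc, tendsto_comap_iff.2 (tendsto_atTop.2 fun R ↦ ?_)⟩
  obtain ⟨N, hN⟩ := hW.2 (Icc (fun _ ↦ 0) fun _ ↦ |R|) (Metric.isBounded_Icc _ _)
  filter_upwards [eventually_ge_atTop N] with n hn
  have h0 : (fun _ ↦ 0 : Fin d → ℝ) ∈ W n := hN n hn ⟨fun _ ↦ le_rfl, fun _ ↦ abs_nonneg _⟩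
  have h1 : (fun _ ↦ |R| : Fin d → ℝ) ∈ W n := hN n hn ⟨fun _ ↦ abs_nonneg _, fun _ ↦ le_rfl⟩
  rw [hc n] at h0 h1
  have h2 := (h0 ⟨0, hd⟩).1
  have h3 := (h1 ⟨0, hd⟩).2
  have h4 := le_abs_self R
  simp only [Function.comp]
  linarith

lemma exists_cubesTendTo (d : ℕ) : ∃ W : ℕ → Set (Fin d → ℝ), CubesTendTo W := by
  refine ⟨fun n ↦ cube (fun _ ↦ -((n : ℝ) + 1)) (2 * (n + 1)),
    fun n ↦ ⟨_, _, by positivity, rfl⟩, fun B hB ↦ ?_⟩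
  obtain ⟨r, hr⟩ := hB.subset_closedBall 0
  obtain ⟨N, hN⟩ := exists_nat_ge r
  refine ⟨N, fun n hn y hy i ↦ ?_⟩
  have h1 : ‖y‖ ≤ r := mem_closedBall_zero_iff.1 (hr hy)
  have h2 := abs_le.1 ((norm_le_pi_norm y i).trans (h1.trans hN))
  have h3 : (N : ℝ) ≤ n := by exact_mod_cast hn
  constructor <;> linarith

/-- Eventual constancy along an interleaved sequence forces the same limit for both sequences of
cubes. -/
lemma CubesTendTo.interleave {W W' : ℕ → Set (Fin d → ℝ)} (hW : CubesTendTo W)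
    (hW' : CubesTendTo W') : CubesTendTo fun n ↦ if Even n then W (n / 2) else W' (n / 2) := by
  refine ⟨fun n ↦ ?_, fun B hB ↦ ?_⟩
  · dsimp only
    split_ifs
    exacts [hW.1 _, hW'.1 _]
  · obtain ⟨N, hN⟩ := hW.2 B hB
    obtain ⟨N', hN'⟩ := hW'.2 B hB
    refine ⟨2 * (N + N'), fun n hn ↦ ?_⟩
    dsimp only
    split_ifs
    exacts [hN _ (by omega), hN' _ (by omega)]

end Cubes

/-! ### Stabilization -/

section Stabilization

variable {d : ℕ} {A : Type*} [MeasurableSpace A] {α : ℕ}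
  {φ : (j : ℕ) → (Fin (j + 1) → (Fin d → ℝ) × A) → unitInterval} {e : ℕ ≃ (Fin d → ℤ)}
  {γ : ℝ≥0} {Θ : Measure A} [IsProbabilityMeasure Θ] {p : ℕ}

lemma ae_joinedTotal_lt_top (hφ : IsConnection α φ) (hα : 1 ≤ α) {m : ℕ} (hm0 : m ≠ 0)
    (hm : ∫⁻ a, mixing γ Θ φ a ^ m ∂Θ < ∞) :
    ∀ᵐ ω ∂configLaw d γ Θ, joinedTotal φ (cnt ω) (field ω) < ∞ := by
  have hae : ∀ᵐ ω ∂configLaw d γ Θ, (1 + joinedTotal φ (cnt ω) (field ω)) ^ m < ∞ :=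
    ae_lt_top (((measurable_joinedTotal hφ hα).const_add 1).pow_const _)
      (lintegral_joinedTotal_lt_top γ Θ hφ hα hm).ne
  filter_upwards [hae] with ω hω
  rcases ENNReal.pow_lt_top_iff.1 hω with h | h
  · exact (ENNReal.add_lt_top.1 h).2
  · exact absurd h hm0

/-- The difference at the origin in the model. -/
def modelDiff (α : ℕ) (φ : (j : ℕ) → (Fin (j + 1) → (Fin d → ℝ) × A) → unitInterval) (p : ℕ)
    (e : ℕ ≃ (Fin d → ℤ)) (W : Set (Fin d → ℝ)) (ω : Ext d A α) : ℝ :=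
  diffIn α φ p (regionAt (bases ω.1 none).1 W) none (cnt (code e originShift ω))
    (field (code e originShift ω))

lemma ae_joinedTotal_code (hφ : IsConnection α φ) (hα : 1 ≤ α) {m : ℕ} (hm0 : m ≠ 0)
    (hm : ∫⁻ a, mixing γ Θ φ a ^ m ∂Θ < ∞) : ∀ᵐ ω ∂extLaw d α γ Θ,
      joinedTotal φ (cnt (code e originShift ω)) (field (code e originShift ω)) < ∞ :=
  (measurePreserving_code γ Θ e measurable_originShift).quasiMeasurePreserving.ae
    (ae_joinedTotal_lt_top hφ hα hm0 hm)

omit [MeasurableSpace A] in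
lemma exists_modelDiff_eq (hα : 1 ≤ α) {W : ℕ → Set (Fin d → ℝ)} (hW : CubesTendTo W)
    {ω : Ext d A α}
    (h : joinedTotal φ (cnt (code e originShift ω)) (field (code e originShift ω)) < ∞) :
    ∃ R, (∀ E : Region d, (cells E).Finite → boxRegion d R ⊆ E → diffIn α φ p E none
        (cnt (code e originShift ω)) (field (code e originShift ω)) =
      diffIn α φ p (boxRegion d R) none (cnt (code e originShift ω))
        (field (code e originShift ω))) ∧
      ∃ N, ∀ n ≥ N, modelDiff α φ p e (W n) ω = diffIn α φ p (boxRegion d R) none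
        (cnt (code e originShift ω)) (field (code e originShift ω)) := by
  obtain ⟨R, hR⟩ := exists_diffIn_stable hα h p
  obtain ⟨N, hN⟩ := hW.exists_boxRegion_subset R
  exact ⟨R, hR, N, fun n hn ↦ hR _ (finite_cells_regionAt _ (hW.1 n)) (hN n hn _)⟩

lemma lintegral_modelDiff_le (hφ : IsConnection α φ) (hα : 1 ≤ α) {W : Set (Fin d → ℝ)} (hW : IsCube W)
    (m : ℕ) : ∫⁻ ω, ‖modelDiff α φ p e W ω‖ₑ ^ m ∂extLaw d α γ Θ ≤
      ∫⁻ ω, (1 + joinedTotal φ (cnt ω) (field ω)) ^ (m * (p + 1)) ∂configLaw d γ Θ := by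
  rw [← (measurePreserving_code (α := α) γ Θ e measurable_originShift).lintegral_comp
    (((measurable_joinedTotal hφ hα).const_add 1).pow_const _)]
  refine lintegral_mono fun ω ↦ ?_
  dsimp only
  rw [mul_comm m, pow_mul]
  gcongr
  exact enorm_diffIn_le hα (finite_cells_regionAt _ hW)

omit [MeasurableSpace A] in
-- Betti numbers are integers, so a nonzero effect cannot be small.
lemma one_le_diffIn_sq {E : Region d} {l : Label d} {N : Cell d → ℕ} {q : Field d A}
    (h : diffIn α φ p E l N q ≠ 0) : 1 ≤ diffIn α φ p E l N q ^ 2 := by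
  obtain ⟨z, hz⟩ : ∃ z : ℤ, diffIn α φ p E l N q = z := by
    rw [diffIn]
    split_ifs
    · rw [bettiDiff, betti, betti]
      exact ⟨(_ - _) - (_ - _), by push_cast; rfl⟩
    · exact ⟨0, by simp⟩
  rw [hz] at h ⊢
  have h1 : z ≠ 0 := by exact_mod_cast h
  have h2 : 1 ≤ z ^ 2 := by
    have := sq_pos_of_ne_zero h1
    omega
  exact_mod_cast h2

/-- A lower bound for the second moments of the differences at the origin if these do not tend
to zero. -/
lemma exists_lower_bound (hφ : IsConnection α φ) (hα : 1 ≤ α)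
    (hm : ∫⁻ a, mixing γ Θ φ a ^ (2 * (p + 1)) ∂Θ < ∞)
    {W : ℕ → Set (Fin d → ℝ)} (hW : CubesTendTo W)
    (hpos : extLaw d α γ Θ {ω | ∃ N, ∀ n ≥ N, modelDiff α φ p e (W n) ω ≠ 0} ≠ 0) :
    ∃ δ : ℝ, 0 < δ ∧ ∃ n R : ℕ, ∀ E : Region d, MeasurableSet E → (cells E).Finite →
      boxRegion d R ⊆ E →
      δ ≤ ∫ ω, cntInd 0 n ω * diffIn α φ p E none (cnt ω) (field ω) ^ 2 ∂configLaw d γ Θ := by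
  classical
  -- `k.1` fixes the number of points in the cell `0`, and `k.2` is a radius beyond which the effect
  -- is constant and nonzero. Up to a null set, these countably many events cover the event in
  -- `hpos`, so one of them is not null.
  let B : ℕ × ℕ → Set (Config d A) := fun k ↦ {ω | cnt ω 0 = k.1 ∧
    diffIn α φ p (boxRegion d k.2) none (cnt ω) (field ω) ≠ 0 ∧
    ∀ E : Region d, (cells E).Finite → boxRegion d k.2 ⊆ E →
      diffIn α φ p E none (cnt ω) (field ω) = diffIn α φ p (boxRegion d k.2) none (cnt ω) (field ω)}
  have hcode := measurePreserving_code (α := α) γ Θ e measurable_originShift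
  obtain ⟨k, hk⟩ : ∃ k, configLaw d γ Θ (B k) ≠ 0 := by
    by_contra! h0
    refine hpos ?_
    have h1 : extLaw d α γ Θ (⋃ k, code e originShift ⁻¹' B k) = 0 := by
      refine measure_iUnion_null fun k ↦ le_antisymm ?_ zero_le
      -- The events `B k` quantify over all regions. This inequality holds for arbitrary sets, so
      -- their measurability is not required.
      refine (Measure.le_map_apply hcode.measurable.aemeasurable _).trans ?_
      rw [hcode.map_eq, h0 k]
    refine measure_mono_null_ae ?_ h1
    filter_upwards [ae_joinedTotal_code (e := e) hφ hα (by omega) hm] with ω hω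
    rintro ⟨N, hN⟩
    obtain ⟨R, hR, N', hN'⟩ := exists_modelDiff_eq (p := p) hα hW hω
    refine mem_iUnion.2 ⟨(cnt (code e originShift ω) 0, R), rfl, ?_, hR⟩
    rw [← hN' (max N N') (le_max_right _ _)]
    exact hN _ (le_max_left _ _)
  refine ⟨(configLaw d γ Θ).real (B k), ENNReal.toReal_pos hk (measure_ne_top _ _), k.1, k.2,
    fun E hE hEc hbox ↦ ?_⟩
  have hdm := measurable_diffIn (p := p) hφ hE hEc (measurable_cnt (d := d) (A := A))
    measurable_field none
  have hdL : MemLp (fun ω : Config d A ↦ diffIn α φ p E none (cnt ω) (field ω)) 2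
      (configLaw d γ Θ) := by
    rw [memLp_two_iff_lintegral hdm.aestronglyMeasurable]
    exact (lintegral_sq_diffIn_le γ Θ hα hEc).trans_lt (lintegral_joinedTotal_lt_top γ Θ hφ hα hm)
  have hind (ω : Config d A) : 0 ≤ cntInd 0 k.1 ω ∧ cntInd 0 k.1 ω ≤ 1 := by
    unfold cntInd; split_ifs <;> simp
  have hint : Integrable (fun ω ↦ cntInd 0 k.1 ω * diffIn α φ p E none (cnt ω) (field ω) ^ 2)
      (configLaw d γ Θ) := by
    refine hdL.integrable_sq.mono' ((measurable_cntInd 0 k.1).mul (hdm.pow_const 2)).aestronglyMeasurable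
      (Eventually.of_forall fun ω ↦ ?_)
    rw [Real.norm_of_nonneg (mul_nonneg (hind ω).1 (sq_nonneg _))]
    exact mul_le_of_le_one_left (sq_nonneg _) (hind ω).2
  have h1 := mul_meas_ge_le_integral_of_nonneg
    (Eventually.of_forall fun ω ↦ mul_nonneg (hind ω).1 (sq_nonneg _)) hint 1
  rw [one_mul] at h1
  refine le_trans (measureReal_mono ?_) h1
  rintro ω ⟨h2, h3, h4⟩
  have h5 := one_le_diffIn_sq h3
  rw [← h4 E hEc hbox] at h5
  simpa [cntInd, h2] using h5

end Stabilization

/-! ### Weak stabilization, moment condition and central limit theorem for Betti numbers. -/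

section Main

variable {d : ℕ} {A Ω : Type*} [MeasurableSpace A] [StandardBorelSpace A] [MeasurableSpace Ω] {α : ℕ}
  {φ : (j : ℕ) → (Fin (j + 1) → (Fin d → ℝ) × A) → unitInterval} {e : ℕ ≃ (Fin d → ℤ)}
  {γ : ℝ≥0} {Θ : Measure A} [IsProbabilityMeasure Θ] {p : ℕ}
  {P : Measure Ω} [IsProbabilityMeasure P] {Ψ : Ω → Measure (Point d A α)}
  {V : Ω → A} {U : Ω → Marks α}

omit [MeasurableSpace A] [StandardBorelSpace A] in
lemma translationInvariant_betti (p : ℕ) :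
    TranslationInvariant (d := d) (A := A) (betti p) := by
  intro K _ t
  have hinj : InjOn (fun v : (Fin d → ℝ) × A ↦ (v.1 + t, v.2)) univ := by
    intro v _ w _ h
    have h1 : v.1 + t = w.1 + t ∧ v.2 = w.2 := Prod.mk.inj h
    exact Prod.ext (add_right_cancel h1.1) h1.2
  have h := betti_map (K := K) hinj (fun _ _ ↦ subset_univ _) p
  convert h

lemma measurableSet_eventually_const : MeasurableSet {a : ℕ → ℝ | ∃ N, ∀ n ≥ N, a n = a N} := by
  have : {a : ℕ → ℝ | ∃ N, ∀ n ≥ N, a n = a N} = ⋃ N, ⋂ n, ⋂ _ : n ≥ N, {a | a n = a N} := by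
    ext a; simp
  rw [this]
  exact .iUnion fun N ↦ .iInter fun n ↦ .iInter fun _ ↦
    measurableSet_eq_fun (measurable_pi_apply n) (measurable_pi_apply N)

lemma measurableSet_eventually_ne_zero : MeasurableSet {a : ℕ → ℝ | ∃ N, ∀ n ≥ N, a n ≠ 0} := by
  have : {a : ℕ → ℝ | ∃ N, ∀ n ≥ N, a n ≠ 0} = ⋃ N, ⋂ n, ⋂ _ : n ≥ N, {a | a n = 0}ᶜ := by
    ext a; simp
  rw [this]
  exact .iUnion fun N ↦ .iInter fun n ↦ .iInter fun _ ↦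
    (measurableSet_eq_fun (measurable_pi_apply n) measurable_const).compl

omit [IsProbabilityMeasure P] in
lemma aemeasurable_of_identDistrib {Ω' : Type*} [MeasurableSpace Ω'] {Q : Measure Ω'} {D : ℕ → Ω → ℝ}
    {D' : ℕ → Ω' → ℝ} (h : IdentDistrib (fun ω n ↦ D n ω) (fun ω n ↦ D' n ω) P Q) (n : ℕ) :
    AEMeasurable (D n) P :=
  (measurable_pi_apply n).comp_aemeasurable h.aemeasurable_fst

omit [StandardBorelSpace A] [IsProbabilityMeasure P] in
lemma ae_eventually_const (hα : 1 ≤ α) (hφ : IsConnection α φ) {m : ℕ} (hm0 : m ≠ 0)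
    (hm : ∫⁻ a, mixing γ Θ φ a ^ m ∂Θ < ∞) {W : ℕ → Set (Fin d → ℝ)} (hW : CubesTendTo W)
    {D : ℕ → Ω → ℝ} (h : IdentDistrib (fun ω n ↦ D n ω)
      (fun ω n ↦ modelDiff α φ p e (W n) ω) P (extLaw d α γ Θ)) :
    ∀ᵐ ω ∂P, ∃ c N, ∀ n ≥ N, D n ω = c := by
  have h1 := h.symm.ae_snd measurableSet_eventually_const (by
    filter_upwards [ae_joinedTotal_code (e := e) hφ hα hm0 hm] with ω hω
    obtain ⟨R, -, N, hN⟩ := exists_modelDiff_eq (p := p) hα hW hω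
    exact ⟨N, fun n hn ↦ (hN n hn).trans (hN N le_rfl).symm⟩)
  filter_upwards [h1] with ω ⟨N, hN⟩
  exact ⟨_, N, hN⟩

omit [StandardBorelSpace A] in
/-- The Betti numbers are weakly stabilizing. -/
theorem weaklyStabilizing_betti (hα : 1 ≤ α) (hφ : IsConnection α φ) {m : ℕ} (hm0 : m ≠ 0)
    (hm : ∫⁻ a, mixing γ Θ φ a ^ m ∂Θ < ∞)
    (hident : ∀ W : ℕ → Set (Fin d → ℝ), (∀ n, IsCube (W n)) →
      IdentDistrib (fun ω n ↦ originDiff φ e Ψ V U (betti p) (W n) ω)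
        (fun ω n ↦ modelDiff α φ p e (W n) ω) P (extLaw d α γ Θ)) :
    WeaklyStabilizing φ e Ψ V U P (betti p) := by
  refine ⟨translationInvariant_betti p, ?_⟩
  -- `Z` is the almost sure limit along one reference sequence of cubes; any other sequence is
  -- compared with it by interleaving.
  obtain ⟨W₀, hW₀⟩ := exists_cubesTendTo d
  obtain ⟨Z, hZ, hZlim⟩ := measurable_limit_of_tendsto_metrizable_ae (μ := P) (L := atTop)
    (f := fun n ↦ originDiff φ e Ψ V U (betti p) (W₀ n))
    (aemeasurable_of_identDistrib (hident W₀ hW₀.1)) (by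
      filter_upwards [ae_eventually_const hα hφ hm0 hm hW₀ (hident W₀ hW₀.1)] with ω ⟨c, N, hc⟩
      exact ⟨c, tendsto_const_nhds.congr' (eventually_atTop.2 ⟨N, fun n hn ↦ (hc n hn).symm⟩)⟩)
  refine ⟨Z, hZ, fun W hW ↦ ?_⟩
  have hmeas := aemeasurable_of_identDistrib (hident W hW.1)
  refine ⟨hmeas, tendstoInMeasure_of_tendsto_ae (fun n ↦ (hmeas n).aestronglyMeasurable) ?_⟩
  have hWW := hW.interleave hW₀
  filter_upwards [hZlim, ae_eventually_const hα hφ hm0 hm hWW (hident _ hWW.1)]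
    with ω h1 ⟨c, N, hc⟩
  have h2 : ∀ n ≥ N, originDiff φ e Ψ V U (betti p) (W n) ω = c := fun n hn ↦ by
    have := hc (2 * n) (by omega)
    rwa [if_pos (even_two_mul n), Nat.mul_div_cancel_left n two_pos] at this
  have h3 : ∀ n ≥ N, originDiff φ e Ψ V U (betti p) (W₀ n) ω = c := fun n hn ↦ by
    have := hc (2 * n + 1) (by omega)
    rwa [if_neg (by simp), show (2 * n + 1) / 2 = n by omega] at this
  have h4 : Z ω = c := tendsto_nhds_unique h1
    (tendsto_const_nhds.congr' (eventually_atTop.2 ⟨N, fun n hn ↦ (h3 n hn).symm⟩))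
  rw [h4]
  exact tendsto_const_nhds.congr' (eventually_atTop.2 ⟨N, fun n hn ↦ (h2 n hn).symm⟩)

omit [StandardBorelSpace A] [IsProbabilityMeasure P] in
/-- The Betti numbers satisfy the moment condition. -/
theorem momentCondition_betti (hα : 1 ≤ α) (hφ : IsConnection α φ)
    (hm : ∫⁻ a, mixing γ Θ φ a ^ (3 * (p + 1)) ∂Θ < ∞)
    (hident : ∀ W : ℕ → Set (Fin d → ℝ), (∀ n, IsCube (W n)) →
      IdentDistrib (fun ω n ↦ originDiff φ e Ψ V U (betti p) (W n) ω)
        (fun ω n ↦ modelDiff α φ p e (W n) ω) P (extLaw d α γ Θ)) :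
    MomentCondition φ e Ψ V U P (betti p) := by
  -- With `ε = 1`, third moments of a difference bounded by a power `p + 1` of the degree account
  -- for the order `3 * (p + 1)`.
  refine ⟨1, one_pos, fun W hW _ ↦ aemeasurable_of_identDistrib (hident (fun _ ↦ W) fun _ ↦ hW) 0,
    lt_of_le_of_lt ?_ (lintegral_joinedTotal_lt_top γ Θ hφ hα hm)⟩
  refine iSup_le fun W ↦ iSup_le fun hW ↦ iSup_le fun _ ↦ ?_
  refine le_trans (le_of_eq ?_) (lintegral_modelDiff_le (p := p) (e := e) hφ hα hW 3)
  have h1 := (hident (fun _ ↦ W) fun _ ↦ hW).comp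
    (u := fun a : ℕ → ℝ ↦ ‖a 0‖ₑ ^ 3) (by fun_prop)
  refine Eq.trans ?_ h1.lintegral_eq
  refine lintegral_congr fun ω ↦ ?_
  rw [show (2 + 1 : ℝ) = (3 : ℕ) by norm_num, ENNReal.rpow_natCast]
  rfl

/-- The Betti numbers satisfy the central limit theorem. -/
theorem satisfiesCLT_betti (hd : 1 ≤ d) (hα : 1 ≤ α) (hγ : 0 < γ) (hφ : IsConnection α φ)
    (hm : ∫⁻ a, mixing γ Θ φ a ^ (2 * (p + 1)) ∂Θ < ∞)
    (hΨ : IsPoissonProcess Ψ (intensity d α γ Θ) P)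
    (hident : ∀ W : ℕ → Set (Fin d → ℝ), (∀ n, IsCube (W n)) →
      IdentDistrib (fun ω n ↦ originDiff φ e Ψ V U (betti p) (W n) ω)
        (fun ω n ↦ modelDiff α φ p e (W n) ω) P (extLaw d α γ Θ)) :
    SatisfiesCLT φ e Ψ V U P (betti p) := by
  have hlaw {W : Set (Fin d → ℝ)} (hW : IsCube W) := identDistrib_betti (e := e) hd hφ hΨ
    hW.measurableSet (finite_cells_regionOf hW) p
  refine ⟨fun W hW ↦ (hlaw hW).memLp_iff.2 (memLp_bettiIn γ Θ hφ hα hm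
    (measurableSet_regionOf hW.measurableSet) (finite_cells_regionOf hW)), ?_⟩
  obtain ⟨v, hv, hvc⟩ := exists_clt_bettiIn (γ := γ) (p := p) hd hφ hα hm
  refine ⟨v, fun W hW ↦ ?_, fun Z hZ hZ0 ↦ ?_⟩
  · obtain ⟨c, hc, hcl⟩ := hW.exists_data hd
    have hvol (n) : volume.real (W n) = (c n).1.2 ^ d := by
      rw [hc n, volume_real_cube _ (c n).2.le]
    constructor
    · refine (hv.comp hcl).congr fun n ↦ ?_
      rw [hvol, (hlaw (hW.1 n)).variance_eq, hc n]
      rfl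
    · have hX (n) := ((hlaw (hW.1 n)).sub_const
        (∫ ω', betti p (complexIn φ e (Ψ ω') (W n)) ∂P)).div_const (√(volume.real (W n)))
      refine ⟨fun n ↦ (hX n).aemeasurable_fst, aemeasurable_id,
        ProbabilityMeasure.tendsto_iff_tendsto_charFun.2 fun t ↦ ?_⟩
      simp only [ProbabilityMeasure.coe_mk, Measure.map_id, charFun_gaussianReal]
      have hlim : Complex.exp (t * (0 : ℝ) * Complex.I - (v : ℝ) * t ^ 2 / 2) =
          Complex.exp (-(v * t ^ 2 / 2 : ℝ)) := by
        push_cast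
        congr 1
        ring
      rw [hlim]
      refine ((hvc t).comp hcl).congr fun n ↦ ?_
      rw [(hX n).map_eq, (hlaw (hW.1 n)).integral_eq, hvol n, hc n]
      rfl
  -- Any associated variable agrees almost surely with the eventual value along one sequence of
  -- cubes. If it is not almost surely zero, then neither are the eventual differences in the model.
  · obtain ⟨W, hW⟩ := exists_cubesTendTo d
    have h1 := hident W hW.1
    have hmeas := aemeasurable_of_identDistrib h1
    have hm0 : 2 * (p + 1) ≠ 0 := by omega
    have hev := ae_eventually_const hα hφ hm0 hm hW h1
    obtain ⟨L, hL, hLlim⟩ := measurable_limit_of_tendsto_metrizable_ae (μ := P) (L := atTop)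
      (f := fun n ↦ originDiff φ e Ψ V U (betti p) (W n)) hmeas (by
        filter_upwards [hev] with ω ⟨c, N, hc⟩
        exact ⟨c, tendsto_const_nhds.congr' (eventually_atTop.2 ⟨N, fun n hn ↦ (hc n hn).symm⟩)⟩)
    have hZL := tendstoInMeasure_ae_unique (hZ.2 W hW).2 (tendstoInMeasure_of_tendsto_ae
      (fun n ↦ (hmeas n).aestronglyMeasurable) hLlim)
    have hpos : extLaw d α γ Θ {ω | ∃ N, ∀ n ≥ N, modelDiff α φ p e (W n) ω ≠ 0} ≠ 0 := by
      have h2 := h1.measure_mem_eq measurableSet_eventually_ne_zero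
      refine fun h0 ↦ hZ0.ne' (measure_mono_null_ae ?_ (h2.trans h0))
      filter_upwards [hZL, hLlim, hev] with ω h3 h4 ⟨c, N, hc⟩ h5
      have h6 : L ω = c := tendsto_nhds_unique h4
        (tendsto_const_nhds.congr' (eventually_atTop.2 ⟨N, fun n hn ↦ (hc n hn).symm⟩))
      refine ⟨N, fun n hn h7 ↦ h5 ?_⟩
      rw [h3, h6, ← hc n hn]
      exact h7
    obtain ⟨δ, hδ, n, R, hlow⟩ := exists_lower_bound hφ hα hm hW hpos
    have := pos_of_integral_sq_diffIn_ge hφ hα hγ hm hδ hlow hv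
    exact_mod_cast this

end Main

end RCM

end

theorem mainTheorem3 {A Ω : Type*} [MeasurableSpace A] [StandardBorelSpace A] [MeasurableSpace Ω]
    (P : Measure Ω) [IsProbabilityMeasure P] (d α : ℕ) (hd : 1 ≤ d) (hα : 1 ≤ α)
    (γ : ℝ≥0) (hγ : 0 < γ) (Θ : Measure A) [IsProbabilityMeasure Θ]
    (φ : (j : ℕ) → (Fin (j + 1) → (Fin d → ℝ) × A) → unitInterval) (hφ : IsConnection α φ)
    (e : ℕ ≃ (Fin d → ℤ)) (he : e 0 = 0)
    (Ψ : Ω → Measure (Point d A α)) (hΨ : IsPoissonProcess Ψ (intensity d α γ Θ) P)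
    (V : Ω → A) (hV : Measurable V) (hVΘ : P.map V = Θ)
    (U : Ω → Marks α) (hU : Measurable U) (hUQ : P.map U = marksLaw α)
    (hVU : IndepFun V U P) (hVUΨ : IndepFun (fun ω ↦ (V ω, U ω)) Ψ P)
    (p : ℕ) (hp : ∫⁻ ω, mixing γ Θ φ (V ω) ^ (3 * (p + 1)) ∂P < ∞) :
    WeaklyStabilizing φ e Ψ V U P (betti p) ∧
      MomentCondition φ e Ψ V U P (betti p) ∧
      SatisfiesCLT φ e Ψ V U P (betti p) := by
  have hm : ∫⁻ a, mixing γ Θ φ a ^ (3 * (p + 1)) ∂Θ < ∞ := by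
    have h := lintegral_map (μ := P) ((measurable_mixing γ Θ hφ hα).pow_const (3 * (p + 1))) hV
    rw [hVΘ] at h
    exact h.trans_lt hp
  -- The central limit theorem needs only second moments of the differences, hence the lower order;
  -- a lower power is at most one plus the higher power.
  have hm2 : ∫⁻ a, mixing γ Θ φ a ^ (2 * (p + 1)) ∂Θ < ∞ := by
    refine lt_of_le_of_lt (lintegral_mono (g := fun a ↦ 1 + mixing γ Θ φ a ^ (3 * (p + 1)))
      fun a ↦ ?_) (by
        rw [lintegral_add_left measurable_const]
        exact ENNReal.add_lt_top.2 ⟨by simp, hm⟩)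
    rcases le_total (mixing γ Θ φ a) 1 with h | h
    · exact (pow_le_one₀ zero_le h).trans le_self_add
    · exact (pow_le_pow_right₀ h (by omega)).trans le_add_self
  have hident (W : ℕ → Set (Fin d → ℝ)) (hW : ∀ n, IsCube (W n)) :
      ProbabilityTheory.IdentDistrib (fun ω n ↦ originDiff φ e Ψ V U (betti p) (W n) ω)
        (fun ω n ↦ modelDiff α φ p e (W n) ω) P (extLaw d α γ Θ) :=
    identDistrib_originDiff hd hφ hΨ hV hVΘ hU hUQ hVU hVUΨ (fun n ↦ (hW n).measurableSet)
      (fun n ↦ finite_cells_regionOf (hW n)) p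
  exact ⟨weaklyStabilizing_betti hα hφ (by omega) hm hident,
    momentCondition_betti hα hφ hm hident, satisfiesCLT_betti hd hα hγ hφ hm2 hΨ hident⟩
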